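/- **Setting.** All objects below form a sequence with $n\to\infty$ and $p\to\infty$; $N\ge 0$ is arbitrary. We observe $n$ i.i.d. labelled pairs $({\bf X}_i,Y_i)$ with $Y=f({\bf X})+\epsilon$, ${\bf X}\in\mathbb R^p$, and, independently, $N$ i.i.d. unlabelled copies ${\bf X}_{n+1},\dots,{\bf X}_{n+N}$ of ${\bf X}$. Here $\epsilon$ is independent of ${\bf X}$, $E\epsilon=0$, $E\epsilon^2=\sigma^2$, $E{\bf X}=0$, $E f({\bf X})=0$. Let $\theta^*=\arg\min_\theta E\{f({\bf X})-{\bf X}^T\theta\}^2$, $\eta=f({\bf X})-{\bf X}^T\theta^*$, $\Sigma=E({\bf X}{\bf X}^T)$, $\Omega=\Sigma^{-1}$; let $m:\mathbb R^p\to\mathbb R$ be measurable, $\mu=E\{{\bf X}m({\bf X})\}$, ${\bf T}_1={\bf X}(Y-{\bf X}^T\theta^*)$, ${\bf T}_2={\bf X}m({\bf X})-\mu$, $\mathbb B=\{E({\bf T}_2{\bf T}_2^T)\}^{-1}E\{{\bf X}{\bf X}^Tm({\bf X})(Y-{\bf X}^T\theta^*)\}$, ${\bf E}={\bf T}_1-\mathbb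 B^T{\bf T}_2$ and, for a fixed $\psi\in\mathbb R$, $$\Gamma_\psi=E({\bf T}_1{\bf T}_1^T)-\tfrac{N(2\psi-\psi^2)}{n+N}\{E({\bf T}_2{\bf T}_1^T)\}^T\{E({\bf T}_2{\bf T}_2^T)\}^{-1}E({\bf T}_2{\bf T}_1^T).$$ **Estimators.** Split the labelled indices into $D_1^*,D_2^*$ of sizes $n_1,n_2$ and the unlabelled ones into $U_1,U_2$ of sizes $N_1,N_2$, with $|n_1-n_2|\le1$, $|N_1-N_2|\le 1$; put $D_j=D_j^*\cup U_j$. Let $\widehat m^{-j}$ be computed from the labelled data outside $D_j^*$, and $\widehat\mu^j=n_j^{-1}\sum_{i\in D_j^*}{\bf X}_i\widehat m^{-j}({\bf X}_i)$. * $\widehat\theta_D$ minimizes $\|\theta\|_1$ subject to $\|n^{-1}\sum_{i\le n}(Y_i-{\bf X}_i^T\theta){\bf X}_i\|_\infty\le\lambda_D$. * $\widehat\gamma_k$ minimizes $(n+N)^{-1}\sum_{i\le n+N}(X_{ik}-{\bf X}_{i,-k}^T\gamma)^2+2\lambda_k\|\gamma\|_1$; $\widehat\tau_k^2=(n+N)^{-1}\sum_i(X_{ik}-{\bf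 X}_{i,-k}^T\widehat\gamma_k)X_{ik}$; $\widehat\Omega$ has entries $\widehat\Omega_{kk}=\widehat\tau_k^{-2}$ and $\widehat\Omega_{kl}=-\widehat\gamma_{k,l}\widehat\tau_k^{-2}$ for $l\ne k$. * $\widehat{\mathbb B}^j_{\cdot k}$ minimizes $n_j^{-1}\sum_{i\in D_j^*}[X_{ik}(Y_i-{\bf X}_i^T\widehat\theta_D)-\beta^T\{{\bf X}_i\widehat m^{-j}({\bf X}_i)-\widehat\mu^j\}]^2+\widetilde\lambda\|\beta\|_1$, and $\widehat{\mathbb B}=(\widehat{\mathbb B}^1+\widehat{\mathbb B}^2)/2$. * $\widehat\xi=n^{-1}\sum_{i\le n}{\bf X}_iY_i-\frac\psi2\widehat{\mathbb B}^T\sum_{j=1}^2\{\widehat\mu^j-(n_j+N_j)^{-1}\sum_{i\in D_j}{\bf X}_i\widehat m^{-j}({\bf X}_i)\}$ and $\widehat\theta^d=\widehat\theta_D+\widehat\Omega(\widehat\xi-\widehat\Sigma_n\widehat\theta_D)$ with $\widehat\Sigma_n=n^{-1}\sum_{i\le n}{\bf X}_i{\bf X}_i^T$. * $\widehat\Gamma_\psi=\widehat{\mathbb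 M}_1-\frac{N(2\psi-\psi^2)}{n+N}\widehat{\mathbb B}^T\widehat{\mathbb M}_2$, with $\widehat{\mathbb M}_1=n^{-1}\sum_{i\le n}(Y_i-{\bf X}_i^T\widehat\theta_D)^2{\bf X}_i{\bf X}_i^T$ and $\widehat{\mathbb M}_2=\frac12\sum_{j=1}^2n_j^{-1}\sum_{i\in D_j^*}(Y_i-{\bf X}_i^T\widehat\theta_D)\widehat m^{-j}({\bf X}_i){\bf X}_i{\bf X}_i^T$. Any solutions of the minimization problems may be taken. **Assumptions.** Let $c_0,\delta>0$ and $C,C_m$ be constants. (1) $\Sigma^{-1/2}{\bf X}$ is sub-Gaussian, $\|u^T\Sigma^{-1/2}{\bf X}\|_{L^q}\le C\sqrt q$ for $\|u\|_2=1$, $q\ge1$; $\Lambda_{\min}(\Sigma)\ge c_0$; $\max_j\Sigma_{jj}\le C$; $\|{\bf X}\|_\infty\le K_1$ almost surely. (2) $E\eta^2\le\Phi^2$ with $0\le\Phi\le C$; $E|\epsilon|^{2+\delta},E|\eta|^{2+\delta},E\epsilon^4,E\eta^4\le C$. (3) $\|\theta^*\|_0\le s$ with $s\ge1$ and $s\log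 p\le Cn$. (4) $\Lambda_{\min}(E({\bf T}_2{\bf T}_2^T))\ge c_0$; $E(E_j^2)\le C$ for all $j$; $|m({\bf X})|\le C$ almost surely. (5) $\max_k\|\mathbb B_{\cdot k}\|_0\le s_B$ with $s_B\ge1$, $\max_k\|\mathbb B_{\cdot k}\|_1\le L_B$; $\max_k\|\Omega_{k\cdot}\|_0\le s_\Omega$, $\max_k\|\Omega_{k\cdot}\|_1\le L_\Omega$. (6) $c_n\ge0$ is deterministic, $s_BK_1^2(c_n+\sqrt{\log p/n})\to0$ and $(K_1L_\Omega)^2s_\Omega\sqrt{\log p/(n+N)}\to0$. (7) For a number $\varepsilon_0\ge0$, $\limsup P(\max_j\|\widehat m^{-j}-m\|_{L_2(P_{\bf X})}>C_mc_n)\le\varepsilon_0$. (If $\|\widehat m^{-j}-m\|_{L_2(P_{\bf X})}=O_p(c_n)$, this holds for every $\varepsilon_0>0$ with a suitable $C_m$.) (8) $Rem\to0$, where $Rem=K_1(s_B+s_B^{1/2}L_B)(\sqrt{\log p/n}+c_n)+K_1^2\sqrt{ss_B\log p/n}+K_1L_B\sqrt{s\log p/n}$. **Claim.** There is a constant $C_0>0$,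 depending only on $c_0,C,C_m,\delta$, such that the following holds for all constants $A$ and $C_B\ge C_0$, if $C_0r_D\le\lambda_D\le Ar_D$ with $r_D=K_1\sqrt{(\sigma^2+\Phi^2)\log p/n}$, if $C_0r_N\le\lambda_k\le Ar_N$ for all $k$ with $r_N=K_1L_\Omega\sqrt{\log p/(n+N)}$, and if $\widetilde\lambda$ minimizes $$s_B\lambda+\lambda^{-1}\Big\{K_1L_B\Big(c_n+\sqrt{\tfrac{\log p}n}\Big)+K_1^2\sqrt{\tfrac{s(\sigma^2+\Phi^2)\log p}{n}}\Big\}^2\quad\text{over }\lambda\ge C_BK_1\Big(c_n+\sqrt{\tfrac{\log p}n}\Big).$$ Let $v\ne0$ be a deterministic vector in $\mathbb R^p$ (which may change along the sequence) and let $$R_1=K_1L_\Omega^2s_\Omega\sqrt{\tfrac{\log p}{n+N}}\,\|\Gamma_\psi\|_{\max},\quad R_2=K_1^3L_\Omega^2\sqrt{\tfrac{s\log p}n},\quad R_3=\tfrac{NK_1^2L_\Omega^2}{n+N}Rem.$$ (a) For every $\varepsilon>\varepsilon_0$ there is a constant $M$ such that, for all large indices of the sequence, $$P\big(|v^T\widehat\Omega\widehat\Gamma_\psi\widehat\Omega^Tv-v^T\Omega\Gamma_\psi\Omega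 v|>M\|v\|_1^2(R_1+R_2+R_3)\big)\le\varepsilon.$$ For $\varepsilon_0=0$ this says that the error is $O_p\{\|v\|_1^2(R_1+R_2+R_3)\}$. (b) Suppose in addition that $v^T\Omega\Gamma_\psi\Omega v\ge c_1\|v\|_2^2$ for a constant $c_1>0$, that $\|v\|_1^2(R_1+R_2+R_3)/\|v\|_2^2\to0$, that $$\Big(\frac{\|v\|_1L_\Omega K_1}{\|v\|_2}\Big)^{2+\delta}\frac1{n^{\delta/2}}\Big(1+\frac{L_B^{2+\delta}N}{n+N}\Big)\to0,$$ and that $n^{1/2}\bar\delta_n/\|v\|_2\to0$, where $$\bar\delta_n=\|v\|_1L_\Omega K_1^2\sqrt{\tfrac{\log p}n}\Big[\{(\sigma^2+\Phi^2)^{1/2}+L_B\}s_\Omega\sqrt{\tfrac{\log p}{n+N}}+(s_B+s_B^{1/2}L_B)\Big(\sqrt{\tfrac{\log p}n}+c_n\Big)+K_1(s\vee s_B)(\sigma^2+\Phi^2)^{1/2}\sqrt{\tfrac{\log p}n}\Big].$$ Then for every $t\in\mathbb R$, with $\Phi_{\mathcal N}$ the standard normal distribution function, $$\limsup\Big|P\Big(\frac{n^{1/2}v^T(\widehat\theta^d-\theta^*)}{(v^T\widehat\Omega\widehat\Gamma_\psi\widehat\Omega^Tv)^{1/2}}\le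 t\Big)-\Phi_{\mathcal N}(t)\Big|\le\varepsilon_0.$$ For $\varepsilon_0=0$ this says that the studentized statistic converges in distribution to $\mathcal N(0,1)$. -/

import Mathlib

open MeasureTheory ProbabilityTheory Filter Topology Matrix

noncomputable section

namespace SemiSup

/-! ### Norms -/

def l1 {p : ℕ} (u : Fin p → ℝ) : ℝ := ∑ i, |u i|

def l2 {p : ℕ} (u : Fin p → ℝ) : ℝ := √(∑ i, u i ^ 2)

/-- The number of non-zero coordinates. -/
def l0 {p : ℕ} (u : Fin p → ℝ) : ℕ := (Function.support u).ncard

/-- The largest absolute value of an entry. -/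
def maxNorm {p : ℕ} (A : Matrix (Fin p) (Fin p) ℝ) : ℝ := ⨆ ij : Fin p × Fin p, |A ij.1 ij.2|

/-! ### Population quantities -/

/-- A labelled observation `(X, Y)`. -/
abbrev Obs (p : ℕ) : Type := (Fin p → ℝ) × ℝ

/-- The model `Y = f(X) + ε` with `X ∼ PX` and `ε ∼ Pε` independent, `E X = 0`, `E f(X) = 0`,
`E ε = 0`, the working function `m`, and the vector `θ` of coefficients of the `L²`-projection of
`f(X)` onto the linear span of the coordinates of `X`. -/
structure Model (p : ℕ) where
  PX : Measure (Fin p → ℝ)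
  Pε : Measure ℝ
  f : (Fin p → ℝ) → ℝ
  m : (Fin p → ℝ) → ℝ
  θ : Fin p → ℝ
  probX : IsProbabilityMeasure PX
  probε : IsProbabilityMeasure Pε
  measurable_f : Measurable f
  measurable_m : Measurable m
  memLp_X : ∀ j, MemLp (fun x : Fin p → ℝ => x j) 2 PX
  memLp_f : MemLp f 2 PX
  memLp_ε : MemLp (fun e : ℝ => e) 2 Pε
  mean_X : ∀ j, ∫ x, x j ∂PX = 0
  mean_f : ∫ x, f x ∂PX = 0
  mean_ε : ∫ e, e ∂Pε = 0
  isMinOn_θ : IsMinOn (fun t : Fin p → ℝ => ∫ x, (f x - x ⬝ᵥ t) ^ 2 ∂PX) Set.univ θ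

namespace Model

variable {p : ℕ} (M : Model p)

/-- The law of `(X, Y)`. -/
def PXY : Measure (Obs p) := (M.PX.prod M.Pε).map fun z => (z.1, M.f z.1 + z.2)

/-- `σ² = E ε²`. -/
def noiseVar : ℝ := ∫ e, e ^ 2 ∂M.Pε

/-- `η(x) = f(x) - xᵀθ`. -/
def eta (x : Fin p → ℝ) : ℝ := M.f x - x ⬝ᵥ M.θ

/-- `Σ = E(X Xᵀ)`, which is the covariance matrix since `E X = 0`. -/
def Sigma : Matrix (Fin p) (Fin p) ℝ := Matrix.of fun i j => ∫ x, x i * x j ∂M.PX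

/-- The precision matrix `Ω = Σ⁻¹`. -/
def Omega : Matrix (Fin p) (Fin p) ℝ := M.Sigma⁻¹

/-- `μ = E{X m(X)}`. -/
def mu : Fin p → ℝ := fun j => ∫ x, x j * M.m x ∂M.PX

/-- `T₁ = X (Y - Xᵀθ)`. -/
def T1 (z : Obs p) : Fin p → ℝ := fun j => z.1 j * (z.2 - z.1 ⬝ᵥ M.θ)

/-- `T₂ = X m(X) - μ`. -/
def T2 (x : Fin p → ℝ) : Fin p → ℝ := fun j => x j * M.m x - M.mu j

/-- `E(T₁ T₁ᵀ)`. -/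
def M1 : Matrix (Fin p) (Fin p) ℝ := Matrix.of fun i j => ∫ z, M.T1 z i * M.T1 z j ∂M.PXY

/-- `E(T₂ T₁ᵀ)`. -/
def M2 : Matrix (Fin p) (Fin p) ℝ := Matrix.of fun i j => ∫ z, M.T2 z.1 i * M.T1 z j ∂M.PXY

/-- `E(T₂ T₂ᵀ)`. -/
def M3 : Matrix (Fin p) (Fin p) ℝ := Matrix.of fun i j => ∫ x, M.T2 x i * M.T2 x j ∂M.PX

/-- `B = {E(T₂ T₂ᵀ)}⁻¹ E{X Xᵀ m(X) (Y - Xᵀθ)}`. -/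
def B : Matrix (Fin p) (Fin p) ℝ :=
  M.M3⁻¹ * Matrix.of fun i j => ∫ z, z.1 i * z.1 j * M.m z.1 * (z.2 - z.1 ⬝ᵥ M.θ) ∂M.PXY

/-- The error vector `E = X (Y - Xᵀθ) - Bᵀ{X m(X) - μ}` of the working regression. -/
def workErr (z : Obs p) : Fin p → ℝ := M.T1 z - M.Bᵀ *ᵥ M.T2 z.1

/-- `Γ_ψ`. -/
def Gam (ψ : ℝ) (n N : ℕ) : Matrix (Fin p) (Fin p) ℝ :=
  M.M1 - ((N : ℝ) * (2 * ψ - ψ ^ 2) / ((n : ℝ) + N)) • (M.M2ᵀ * M.M3⁻¹ * M.M2)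

/-- The asymptotic variance `vᵀ Ω Γ_ψ Ω v`. -/
def asympVar (ψ : ℝ) (n N : ℕ) (v : Fin p → ℝ) : ℝ :=
  v ⬝ᵥ ((M.Omega * M.Gam ψ n N * M.Omega) *ᵥ v)

end Model

/-! ### Sample, cross-fitting and estimators -/

/-- `n` labelled observations and `N` unlabelled ones. -/
abbrev Sample (n N p : ℕ) : Type := (Fin n → Obs p) × (Fin N → Fin p → ℝ)

/-- The law of `n` i.i.d. labelled and, independently, `N` i.i.d. unlabelled observations. -/
def Model.law {p : ℕ} (M : Model p) (n N : ℕ) : Measure (Sample n N p) :=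
  (Measure.pi fun _ => M.PXY).prod (Measure.pi fun _ => M.PX)

/-- A partition of the labelled and of the unlabelled indices into two halves (up to rounding), and
for each fold `j` a learner `m̂⁻ʲ` trained on the labelled observations outside the fold `j`. -/
structure CrossFit (n N p : ℕ) where
  foldL : Fin n → Fin 2
  foldU : Fin N → Fin 2
  balancedL : ∀ j j' : Fin 2, (Finset.univ.filter fun i => foldL i = j).card
    ≤ (Finset.univ.filter fun i => foldL i = j').card + 1
  balancedU : ∀ j j' : Fin 2, (Finset.univ.filter fun i => foldU i = j).card
    ≤ (Finset.univ.filter fun i => foldU i = j').card + 1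
  mhat : (j : Fin 2) → ({i : Fin n // foldL i ≠ j} → Obs p) → (Fin p → ℝ) → ℝ
  measurable_mhat : ∀ j, Measurable (Function.uncurry (mhat j))

section Estimators

variable {n N p : ℕ}

/-- All `n + N` covariate vectors. -/
def allX (ω : Sample n N p) : Fin n ⊕ Fin N → Fin p → ℝ := Sum.elim (fun i => (ω.1 i).1) ω.2

/-- The constraint of the Dantzig selector. -/
def DantzigFeasible (ω : Sample n N p) (lam : ℝ) (t : Fin p → ℝ) : Prop :=
  ∀ j, |(n : ℝ)⁻¹ * ∑ i, ((ω.1 i).2 - (ω.1 i).1 ⬝ᵥ t) * (ω.1 i).1 j| ≤ lam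

def IsDantzig (ω : Sample n N p) (lam : ℝ) (t : Fin p → ℝ) : Prop :=
  DantzigFeasible ω lam t ∧ ∀ t', DantzigFeasible ω lam t' → l1 t ≤ l1 t'

/-- `g` is a node-wise lasso coefficient vector for the `k`-th covariate; vectors indexed by the
coordinates other than `k` are represented by vectors whose `k`-th coordinate is `0`. -/
def IsNodewise (ω : Sample n N p) (k : Fin p) (lam : ℝ) (g : Fin p → ℝ) : Prop :=
  g k = 0 ∧ IsMinOn (fun g' : Fin p → ℝ =>
    ((n : ℝ) + N)⁻¹ * ∑ i, (allX ω i k - allX ω i ⬝ᵥ g') ^ 2 + 2 * lam * l1 g')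
    {g' | g' k = 0} g

/-- `τ̂ₖ²`. -/
def tauSq (ω : Sample n N p) (g : Fin p → Fin p → ℝ) (k : Fin p) : ℝ :=
  ((n : ℝ) + N)⁻¹ * ∑ i, (allX ω i k - allX ω i ⬝ᵥ g k) * allX ω i k

/-- The node-wise lasso estimator `Ω̂ = T̂⁻² Ĉ`. -/
def omegaHat (ω : Sample n N p) (g : Fin p → Fin p → ℝ) : Matrix (Fin p) (Fin p) ℝ :=
  Matrix.of fun k j => (if j = k then 1 else - g k j) / tauSq ω g k

/-- `Σ̂ₙ`. -/
def sigmaHat (ω : Sample n N p) : Matrix (Fin p) (Fin p) ℝ :=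
  Matrix.of fun k l => (n : ℝ)⁻¹ * ∑ i, (ω.1 i).1 k * (ω.1 i).1 l

namespace CrossFit

variable (D : CrossFit n N p)

/-- The labelled indices of the fold `j`. -/
def L (j : Fin 2) : Finset (Fin n) := Finset.univ.filter fun i => D.foldL i = j

/-- The unlabelled indices of the fold `j`. -/
def U (j : Fin 2) : Finset (Fin N) := Finset.univ.filter fun i => D.foldU i = j

/-- The function `m̂⁻ʲ` obtained from the sample `ω`. -/
def mAt (ω : Sample n N p) (j : Fin 2) (x : Fin p → ℝ) : ℝ := D.mhat j (fun i => ω.1 i.1) x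

/-- `μ̂ʲ`, the mean of `X m̂⁻ʲ(X)` over the labelled data of the fold `j`. -/
def muL (ω : Sample n N p) (j : Fin 2) : Fin p → ℝ := fun k =>
  ((D.L j).card : ℝ)⁻¹ * ∑ i ∈ D.L j, (ω.1 i).1 k * D.mAt ω j (ω.1 i).1

/-- The mean of `X m̂⁻ʲ(X)` over the labelled and unlabelled data of the fold `j`. -/
def muLU (ω : Sample n N p) (j : Fin 2) : Fin p → ℝ := fun k =>
  (((D.L j).card : ℝ) + (D.U j).card)⁻¹ *
    (∑ i ∈ D.L j, (ω.1 i).1 k * D.mAt ω j (ω.1 i).1 + ∑ i ∈ D.U j, ω.2 i k * D.mAt ω j (ω.2 i))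

/-- `b` is a lasso estimate of the `k`-th column of `B` from the fold `j`, given the initial
estimate `t` of `θ`. -/
def IsLassoB (ω : Sample n N p) (t : Fin p → ℝ) (lam : ℝ) (j : Fin 2) (k : Fin p)
    (b : Fin p → ℝ) : Prop :=
  IsMinOn (fun b' : Fin p → ℝ => ((D.L j).card : ℝ)⁻¹ * ∑ i ∈ D.L j,
      ((ω.1 i).1 k * ((ω.1 i).2 - (ω.1 i).1 ⬝ᵥ t)
        - ∑ l, b' l * ((ω.1 i).1 l * D.mAt ω j (ω.1 i).1 - D.muL ω j l)) ^ 2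
    + lam * l1 b') Set.univ b

end CrossFit

/-- The solutions of the three optimization problems: the Dantzig selector `θ̂_D`, the node-wise
lasso vectors `γ̂ₖ`, and the columns `B̂ʲ_{·k}`. -/
structure Fit (p : ℕ) where
  θD : Fin p → ℝ
  γ : Fin p → Fin p → ℝ
  b : Fin 2 → Fin p → Fin p → ℝ

/-- `F` solves the optimization problems on the sample `ω` with tuning parameters `lamD`, `lamN`
and `lamB`. -/
structure IsFit (D : CrossFit n N p) (ω : Sample n N p) (lamD : ℝ) (lamN : Fin p → ℝ) (lamB : ℝ)
    (F : Fit p) : Prop where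
  dantzig : IsDantzig ω lamD F.θD
  nodewise : ∀ k, IsNodewise ω k (lamN k) (F.γ k)
  lassoB : ∀ j k, D.IsLassoB ω F.θD lamB j k (F.b j k)

namespace Fit

/-- `B̂ = (B̂¹ + B̂²) / 2`. -/
def Bhat (F : Fit p) : Matrix (Fin p) (Fin p) ℝ :=
  Matrix.of fun l k => (F.b 0 k l + F.b 1 k l) / 2

variable (D : CrossFit n N p) (ω : Sample n N p) (F : Fit p) (ψ : ℝ)

/-- `ξ̂_{S,ψ}`. -/
def xiHat : Fin p → ℝ :=
  (fun k => (n : ℝ)⁻¹ * ∑ i, (ω.1 i).1 k * (ω.1 i).2)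
    - (ψ / 2) • (F.Bhatᵀ *ᵥ ∑ j, (D.muL ω j - D.muLU ω j))

/-- The estimator `θ̂ᵈ_{S,ψ} = θ̂_D + Ω̂ (ξ̂_{S,ψ} - Σ̂ₙ θ̂_D)`. -/
def thetaHat : Fin p → ℝ :=
  F.θD + omegaHat ω F.γ *ᵥ (F.xiHat D ω ψ - sigmaHat ω *ᵥ F.θD)

/-- `M̂₁`. -/
def M1hat : Matrix (Fin p) (Fin p) ℝ := Matrix.of fun k l =>
  (n : ℝ)⁻¹ * ∑ i, ((ω.1 i).2 - (ω.1 i).1 ⬝ᵥ F.θD) ^ 2 * ((ω.1 i).1 k * (ω.1 i).1 l)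

/-- `M̂₂ʲ`. -/
def M2hatFold (j : Fin 2) : Matrix (Fin p) (Fin p) ℝ := Matrix.of fun k l =>
  ((D.L j).card : ℝ)⁻¹ * ∑ i ∈ D.L j,
    ((ω.1 i).2 - (ω.1 i).1 ⬝ᵥ F.θD) * D.mAt ω j (ω.1 i).1 * ((ω.1 i).1 k * (ω.1 i).1 l)

/-- `M̂₂ = (M̂₂¹ + M̂₂²) / 2`. -/
def M2hat : Matrix (Fin p) (Fin p) ℝ :=
  (1 / 2 : ℝ) • (F.M2hatFold D ω 0 + F.M2hatFold D ω 1)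

/-- `Γ̂_ψ`. -/
def GamHat : Matrix (Fin p) (Fin p) ℝ :=
  F.M1hat ω - ((N : ℝ) * (2 * ψ - ψ ^ 2) / ((n : ℝ) + N)) • (F.Bhatᵀ * F.M2hat D ω)

/-- The plug-in variance `vᵀ Ω̂ Γ̂_ψ Ω̂ᵀ v` (the node-wise lasso matrix `Ω̂` is not symmetric). -/
def varHat (v : Fin p → ℝ) : ℝ :=
  v ⬝ᵥ ((omegaHat ω F.γ * F.GamHat D ω ψ * (omegaHat ω F.γ)ᵀ) *ᵥ v)

/-- The studentized statistic for `vᵀ θ`. -/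
def studentized (θ v : Fin p → ℝ) : ℝ :=
  √(n : ℝ) * (v ⬝ᵥ (F.thetaHat D ω ψ - θ)) / √(F.varHat D ω ψ v)

end Fit

end Estimators

/-! ### Assumptions at one stage of the asymptotics -/

/-- The sparsity levels and size parameters: `θ` is `s`-sparse, the columns of `B` are `sB`-sparse
with `ℓ¹`-norm at most `LB`, the rows of `Ω` are `sΩ`-sparse with `ℓ¹`-norm at most `LΩ`, the
covariates are bounded by `K`, `E η² ≤ Φ²`, and `c` is the rate of `m̂⁻ʲ`. -/
structure Params where
  s : ℕ
  sB : ℕ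
  sΩ : ℕ
  K : ℝ
  LB : ℝ
  LΩ : ℝ
  Φ : ℝ
  c : ℝ

/-- The distributional assumptions, with `c₀` the constant in all lower bounds and `C` the constant
in all upper bounds. -/
structure Assumptions {p : ℕ} (c₀ C δ : ℝ) (M : Model p) (n : ℕ) (P : Params) : Prop where
  /-- `Σ^{-1/2} X` is a sub-Gaussian vector: `‖uᵀ Σ^{-1/2} X‖_{L^q} ≤ C √q` for all unit vectors
  `u` and all `q ≥ 1`. -/
  subGaussian : ∃ R : Matrix (Fin p) (Fin p) ℝ, R.PosDef ∧ R * R = M.Sigma⁻¹ ∧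
    ∀ u : Fin p → ℝ, l2 u = 1 → ∀ q : ℝ, 1 ≤ q →
      eLpNorm (fun x => u ⬝ᵥ (R *ᵥ x)) (ENNReal.ofReal q) M.PX ≤ ENNReal.ofReal (C * √q)
  eig_Sigma : ∀ u : Fin p → ℝ, c₀ * l2 u ^ 2 ≤ u ⬝ᵥ (M.Sigma *ᵥ u)
  diag_Sigma : ∀ j, M.Sigma j j ≤ C
  bounded_X : ∀ᵐ x ∂M.PX, ∀ j, |x j| ≤ P.K
  Φ_nonneg : 0 ≤ P.Φ
  Φ_le : P.Φ ≤ C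
  eta_sq : ∫⁻ x, ENNReal.ofReal (M.eta x ^ 2) ∂M.PX ≤ ENNReal.ofReal (P.Φ ^ 2)
  one_le_s : 1 ≤ P.s
  sparse_θ : l0 M.θ ≤ P.s
  s_log_le : (P.s : ℝ) * Real.log p ≤ C * n
  eig_M3 : ∀ u : Fin p → ℝ, c₀ * l2 u ^ 2 ≤ u ⬝ᵥ (M.M3 *ᵥ u)
  workErr_sq : ∀ j, ∫⁻ z, ENNReal.ofReal (M.workErr z j ^ 2) ∂M.PXY ≤ ENNReal.ofReal C
  bounded_m : ∀ᵐ x ∂M.PX, |M.m x| ≤ C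
  c_nonneg : 0 ≤ P.c
  one_le_sB : 1 ≤ P.sB
  sparse_B : ∀ k, l0 (fun l => M.B l k) ≤ P.sB
  l1_B : ∀ k, l1 (fun l => M.B l k) ≤ P.LB
  sparse_Omega : ∀ k, l0 (M.Omega k) ≤ P.sΩ
  l1_Omega : ∀ k, l1 (M.Omega k) ≤ P.LΩ
  moment_ε : ∫⁻ e, ENNReal.ofReal (|e| ^ (2 + δ)) ∂M.Pε ≤ ENNReal.ofReal C
  moment_η : ∫⁻ x, ENNReal.ofReal (|M.eta x| ^ (2 + δ)) ∂M.PX ≤ ENNReal.ofReal C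
  fourth_ε : ∫⁻ e, ENNReal.ofReal (e ^ 4) ∂M.Pε ≤ ENNReal.ofReal C
  fourth_η : ∫⁻ x, ENNReal.ofReal (M.eta x ^ 4) ∂M.PX ≤ ENNReal.ofReal C

/-! ### Rates -/

/-- `√(log p / n)`. -/
def rt (p n : ℕ) : ℝ := √(Real.log p / n)

/-- `λ_D ≍ K √((σ² + Φ²) log p / n)`. -/
def rateD {p : ℕ} (M : Model p) (n : ℕ) (P : Params) : ℝ :=
  P.K * √((M.noiseVar + P.Φ ^ 2) * Real.log p / n)

/-- `λₖ ≍ K LΩ √(log p / (n + N))`. -/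
def rateN (p n N : ℕ) (P : Params) : ℝ := P.K * P.LΩ * rt p (n + N)

/-- `lam` is the tuning parameter `λ̃_opt`: it minimizes `sB λ + λ⁻¹ t²` over all
`λ ≥ CB K (c + √(log p / n))`, where
`t = K LB (c + √(log p / n)) + K² √(s (σ² + Φ²) log p / n)`. -/
def IsLamOpt {p : ℕ} (CB : ℝ) (M : Model p) (n : ℕ) (P : Params) (lam : ℝ) : Prop :=
  CB * P.K * (P.c + rt p n) ≤ lam ∧
  IsMinOn (fun x : ℝ => P.sB * x + x⁻¹ * (P.K * P.LB * (P.c + rt p n)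
      + P.K ^ 2 * √(P.s * (M.noiseVar + P.Φ ^ 2) * Real.log p / n)) ^ 2)
    (Set.Ici (CB * P.K * (P.c + rt p n))) lam

/-- `Rem`. -/
def Rem (p n : ℕ) (P : Params) : ℝ :=
  P.K * (P.sB + √P.sB * P.LB) * (rt p n + P.c)
    + P.K ^ 2 * √(P.s * P.sB * Real.log p / n) + P.K * P.LB * √(P.s * Real.log p / n)

/-- `‖v‖₁² (R₁ + R₂ + R₃)`. -/
def varRate {p : ℕ} (M : Model p) (ψ : ℝ) (n N : ℕ) (P : Params) (v : Fin p → ℝ) : ℝ :=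
  l1 v ^ 2 *
    (P.K * P.LΩ ^ 2 * P.sΩ * rt p (n + N) * maxNorm (M.Gam ψ n N)
      + P.K ^ 3 * P.LΩ ^ 2 * √(P.s * Real.log p / n)
      + (N : ℝ) * P.K ^ 2 * P.LΩ ^ 2 / ((n : ℝ) + N) * Rem p n P)

/-- The order `δ̄` of the remainder in the linear expansion of `vᵀ (θ̂ᵈ_{S,ψ} - θ)`. -/
def expRate {p : ℕ} (M : Model p) (n N : ℕ) (P : Params) (v : Fin p → ℝ) : ℝ :=
  l1 v * P.LΩ * P.K ^ 2 * rt p n *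
    ((√(M.noiseVar + P.Φ ^ 2) + P.LB) * P.sΩ * rt p (n + N)
      + (P.sB + √P.sB * P.LB) * (rt p n + P.c)
      + P.K * max (P.s : ℝ) P.sB * √(M.noiseVar + P.Φ ^ 2) * rt p n)

/-- The quantity in the Lyapunov condition. -/
def lyap {p : ℕ} (δ : ℝ) (n N : ℕ) (P : Params) (v : Fin p → ℝ) : ℝ :=
  (l1 v * P.LΩ * P.K / l2 v) ^ (2 + δ) * (1 / (n : ℝ) ^ (δ / 2))
    * (1 + P.LB ^ (2 + δ) * N / ((n : ℝ) + N))

end SemiSup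

end

open MeasureTheory ProbabilityTheory Filter Topology Matrix

noncomputable section

namespace SemiSup

/-! ### Averages -/

/-- The average of `g` over the finite set `s`. -/
def avg {ι : Type*} (s : Finset ι) (g : ι → ℝ) : ℝ := (s.card : ℝ)⁻¹ * ∑ i ∈ s, g i

section Avg

variable {ι : Type*} {s : Finset ι}

lemma avg_add (f g : ι → ℝ) : avg s (fun i => f i + g i) = avg s f + avg s g := by
  simp only [avg, Finset.sum_add_distrib, mul_add]

lemma avg_sub (f g : ι → ℝ) : avg s (fun i => f i - g i) = avg s f - avg s g := by
  simp only [avg, Finset.sum_sub_distrib, mul_sub]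

lemma avg_const_mul (c : ℝ) (g : ι → ℝ) : avg s (fun i => c * g i) = c * avg s g := by
  simp only [avg, ← Finset.mul_sum]; ring

lemma avg_mul_const (c : ℝ) (g : ι → ℝ) : avg s (fun i => g i * c) = avg s g * c := by
  simp only [avg, ← Finset.sum_mul]; ring

lemma avg_neg (g : ι → ℝ) : avg s (fun i => -g i) = -avg s g := by
  simp only [avg, Finset.sum_neg_distrib]; ring

lemma avg_const (hs : s.Nonempty) (c : ℝ) : avg s (fun _ => c) = c := by
  have : (s.card : ℝ) ≠ 0 := by exact_mod_cast hs.card_pos.ne'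
  simp [avg, this]

lemma avg_congr {f g : ι → ℝ} (h : ∀ i ∈ s, f i = g i) : avg s f = avg s g := by
  simp only [avg, Finset.sum_congr rfl h]

lemma avg_mono {f g : ι → ℝ} (h : ∀ i ∈ s, f i ≤ g i) : avg s f ≤ avg s g :=
  mul_le_mul_of_nonneg_left (Finset.sum_le_sum h) (by positivity)

lemma avg_nonneg {g : ι → ℝ} (h : ∀ i ∈ s, 0 ≤ g i) : 0 ≤ avg s g :=
  mul_nonneg (by positivity) (Finset.sum_nonneg h)

lemma abs_avg_le (g : ι → ℝ) : |avg s g| ≤ avg s fun i => |g i| := by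
  simp only [avg, abs_mul, abs_of_nonneg (show (0 : ℝ) ≤ (s.card : ℝ)⁻¹ by positivity)]
  exact mul_le_mul_of_nonneg_left (Finset.abs_sum_le_sum_abs _ _) (by positivity)

lemma avg_sum {κ : Type*} (t : Finset κ) (g : κ → ι → ℝ) :
    avg s (fun i => ∑ a ∈ t, g a i) = ∑ a ∈ t, avg s (g a) := by
  simp only [avg, ← Finset.mul_sum]; rw [Finset.sum_comm]

lemma avg_mul_sq_le (f g : ι → ℝ) :
    avg s (fun i => f i * g i) ^ 2 ≤ avg s (fun i => f i ^ 2) * avg s (fun i => g i ^ 2) := by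
  have := Finset.sum_mul_sq_le_sq_mul_sq s f g
  simp only [avg]
  calc _ = ((s.card : ℝ)⁻¹) ^ 2 * (∑ i ∈ s, f i * g i) ^ 2 := by ring
    _ ≤ ((s.card : ℝ)⁻¹) ^ 2 * ((∑ i ∈ s, f i ^ 2) * ∑ i ∈ s, g i ^ 2) := by gcongr
    _ = _ := by ring

lemma abs_avg_mul_le (f g : ι → ℝ) :
    |avg s (fun i => f i * g i)| ≤ √(avg s fun i => f i ^ 2) * √(avg s fun i => g i ^ 2) := by
  rw [← Real.sqrt_mul (avg_nonneg fun i _ => sq_nonneg _)]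
  exact Real.abs_le_sqrt (avg_mul_sq_le f g)

lemma avg_abs_le_sqrt (hs : s.Nonempty) (f : ι → ℝ) :
    avg s (fun i => |f i|) ≤ √(avg s fun i => f i ^ 2) := by
  have := abs_avg_mul_le (s := s) (fun i => |f i|) (fun _ => 1)
  simp only [mul_one, sq_abs, one_pow, avg_const hs, Real.sqrt_one] at this
  exact (le_abs_self _).trans this

lemma avg_subset_le {t : Finset ι} {g : ι → ℝ} (hst : s ⊆ t) (h : ∀ i ∈ t, 0 ≤ g i) {c : ℝ}
    (hs : s.Nonempty) (hc : (t.card : ℝ) ≤ c * s.card) : avg s g ≤ c * avg t g := by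
  have hs' : (0 : ℝ) < s.card := by exact_mod_cast hs.card_pos
  have ht' : (0 : ℝ) < t.card := by exact_mod_cast (hs.mono hst).card_pos
  have h1 : ∑ i ∈ s, g i ≤ ∑ i ∈ t, g i :=
    Finset.sum_le_sum_of_subset_of_nonneg hst fun i hi _ => h i hi
  have h2 : 0 ≤ ∑ i ∈ t, g i := Finset.sum_nonneg h
  have h3 : (s.card : ℝ)⁻¹ ≤ c * (t.card : ℝ)⁻¹ := by
    rw [inv_le_iff_one_le_mul₀ hs', mul_assoc, mul_comm _ (s.card : ℝ), ← mul_assoc,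
      ← div_eq_mul_inv, le_div_iff₀ ht']
    linarith
  simp only [avg]
  calc _ ≤ (s.card : ℝ)⁻¹ * ∑ i ∈ t, g i := by gcongr
    _ ≤ (c * (t.card : ℝ)⁻¹) * ∑ i ∈ t, g i := by gcongr
    _ = _ := by ring

end Avg

/-! ### Concentration of averages of independent observations -/

/-- The variables `Z i` are independent with law `μ`. -/
structure IsIID {Ω α ι : Type*} [MeasurableSpace Ω] [MeasurableSpace α] (P : Measure Ω)
    (μ : Measure α) (Z : ι → Ω → α) : Prop where
  measurable : ∀ i, Measurable (Z i)
  map_eq : ∀ i, P.map (Z i) = μ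
  indep : iIndepFun Z P

section Concentration

variable {Ω α ι : Type*} [MeasurableSpace Ω] [MeasurableSpace α] {P : Measure Ω} {μ : Measure α}
  {Z : ι → Ω → α} {s : Finset ι}

namespace IsIID

lemma integral_comp (h : IsIID P μ Z) (i : ι) {g : α → ℝ} (hg : Measurable g) :
    ∫ ω, g (Z i ω) ∂P = ∫ x, g x ∂μ := by
  rw [← h.map_eq i, integral_map (h.measurable i).aemeasurable hg.aestronglyMeasurable]

lemma integrable_comp (h : IsIID P μ Z) (i : ι) {g : α → ℝ} (hg : Integrable g μ) :
    Integrable (fun ω => g (Z i ω)) P := by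
  rw [← h.map_eq i] at hg
  exact hg.comp_measurable (h.measurable i)

lemma ae_comp (h : IsIID P μ Z) (i : ι) {q : α → Prop} (hq : ∀ᵐ x ∂μ, q x) :
    ∀ᵐ ω ∂P, q (Z i ω) := by
  rw [← h.map_eq i] at hq
  exact ae_of_ae_map (h.measurable i).aemeasurable hq

lemma ae_forall (h : IsIID P μ Z) (s : Finset ι) {q : α → Prop} (hq : ∀ᵐ x ∂μ, q x) :
    ∀ᵐ ω ∂P, ∀ i ∈ s, q (Z i ω) :=
  (ae_ball_iff s.countable_toSet).2 fun i _ => h.ae_comp i hq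

lemma indep_comp (h : IsIID P μ Z) {g : α → ℝ} (hg : Measurable g) :
    iIndepFun (fun i ω => g (Z i ω)) P :=
  h.indep.comp (fun _ => g) fun _ => hg

/-- Chernoff bound for the sum of independent identically distributed variables. -/
lemma chernoff [IsProbabilityMeasure P] (h : IsIID P μ Z) {g : α → ℝ} (hg : Measurable g)
    (hint : Integrable (fun x => Real.exp (g x)) μ) {a : ℝ}
    (ha : ∫ x, Real.exp (g x) ∂μ ≤ Real.exp a) (u : ℝ) :
    P.real {ω | u ≤ ∑ i ∈ s, g (Z i ω)} ≤ Real.exp (s.card * a - u) := by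
  have hm : ∀ i, Measurable fun ω => g (Z i ω) := fun i => hg.comp (h.measurable i)
  have hI : ∀ i ∈ s, Integrable (fun ω => Real.exp (1 * g (Z i ω))) P := fun i _ => by
    simpa using h.integrable_comp i hint
  have h1 := measure_ge_le_exp_mul_mgf (X := ∑ i ∈ s, fun ω => g (Z i ω)) (μ := P) (t := 1) u
    zero_le_one ((h.indep_comp hg).integrable_exp_mul_sum hm hI)
  rw [(h.indep_comp hg).mgf_sum hm] at h1
  have h2 : ∏ i ∈ s, mgf (fun ω => g (Z i ω)) P 1 ≤ ∏ _i ∈ s, Real.exp a := by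
    refine Finset.prod_le_prod (fun i _ => mgf_nonneg) fun i _ => ?_
    simp only [mgf, one_mul]
    rw [h.integral_comp i (g := fun x => Real.exp (g x)) hg.exp]
    exact ha
  rw [Finset.prod_const, ← Real.exp_nat_mul] at h2
  simp only [Finset.sum_apply] at h1
  refine h1.trans ?_
  calc Real.exp (-1 * u) * _ ≤ Real.exp (-1 * u) * Real.exp (s.card * a) := by gcongr
    _ = _ := by rw [← Real.exp_add]; ring_nf

lemma integral_avg (h : IsIID P μ Z) {g : α → ℝ} (hg : Measurable g) (hint : Integrable g μ)
    (hs : s.Nonempty) : ∫ ω, avg s (fun i => g (Z i ω)) ∂P = ∫ x, g x ∂μ := by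
  unfold avg
  rw [integral_const_mul, integral_finsetSum _ fun i _ => h.integrable_comp i hint]
  simp only [h.integral_comp _ hg, Finset.sum_const, nsmul_eq_mul]
  have : (s.card : ℝ) ≠ 0 := by exact_mod_cast hs.card_pos.ne'
  field_simp

lemma integrable_avg (h : IsIID P μ Z) {g : α → ℝ} (hint : Integrable g μ) :
    Integrable (fun ω => avg s (fun i => g (Z i ω))) P := by
  unfold avg
  exact (integrable_finsetSum _ fun i _ => h.integrable_comp i hint).const_mul _

/-- Markov's inequality for an average. -/
lemma markov_avg (h : IsIID P μ Z) {g : α → ℝ} (hg : Measurable g) (hint : Integrable g μ)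
    (hg0 : ∀ x, 0 ≤ g x) (hs : s.Nonempty) {t : ℝ} (ht : 0 < t) :
    P.real {ω | t ≤ avg s fun i => g (Z i ω)} ≤ (∫ x, g x ∂μ) / t := by
  rw [le_div_iff₀' ht, ← h.integral_avg hg hint hs]
  exact mul_meas_ge_le_integral_of_nonneg
    (ae_of_all _ fun ω => avg_nonneg fun i _ => hg0 _) (h.integrable_avg hint) t

/-- Chebyshev's inequality for an average. -/
lemma chebyshev_avg [IsProbabilityMeasure P] [IsProbabilityMeasure μ] (h : IsIID P μ Z) {g : α → ℝ} (hg : Measurable g) (hg2 : MemLp g 2 μ)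
    (hs : s.Nonempty) {t : ℝ} (ht : 0 < t) :
    P.real {ω | t ≤ avg s (fun i => g (Z i ω)) - ∫ x, g x ∂μ}
      ≤ (∫ x, g x ^ 2 ∂μ) / (s.card * t ^ 2) := by
  have hm : (0 : ℝ) < s.card := by exact_mod_cast hs.card_pos
  have hL : ∀ i, MemLp (fun ω => g (Z i ω)) 2 P := fun i =>
    (by rw [h.map_eq]; exact hg2 : MemLp g 2 (P.map (Z i))).comp_of_map
      (h.measurable i).aemeasurable
  have hvar : variance (∑ i ∈ s, fun ω => g (Z i ω)) P ≤ s.card * ∫ x, g x ^ 2 ∂μ := by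
    rw [IndepFun.variance_sum (fun i _ => hL i)
      fun i _ j _ hij => (h.indep_comp hg).indepFun hij]
    calc _ ≤ ∑ i ∈ s, ∫ x, g x ^ 2 ∂μ := by
          refine Finset.sum_le_sum fun i _ => ?_
          refine (variance_le_expectation_sq (hL i).aestronglyMeasurable).trans_eq ?_
          exact h.integral_comp i (g := fun x => g x ^ 2) (hg.pow_const 2)
      _ = _ := by simp
  have hS : MemLp (∑ i ∈ s, fun ω => g (Z i ω)) 2 P := memLp_finsetSum' s fun i _ => hL i
  have hE : ∫ ω, (∑ i ∈ s, fun ω => g (Z i ω)) ω ∂P = s.card * ∫ x, g x ∂μ := by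
    simp only [Finset.sum_apply]
    rw [integral_finsetSum _ fun i _ => h.integrable_comp i (hg2.integrable one_le_two)]
    simp [h.integral_comp _ hg]
  have hc := meas_ge_le_variance_div_sq hS (c := s.card * t) (by positivity)
  have h1 : P.real {ω | t ≤ avg s (fun i => g (Z i ω)) - ∫ x, g x ∂μ}
      ≤ variance (∑ i ∈ s, fun ω => g (Z i ω)) P / (s.card * t) ^ 2 := by
    refine ENNReal.toReal_le_of_le_ofReal (div_nonneg (variance_nonneg _ _) (by positivity)) ?_
    refine (measure_mono fun ω hω => ?_).trans hc
    simp only [Set.mem_ofPred_eq] at hω ⊢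
    rw [hE]
    refine le_trans ?_ (le_abs_self _)
    simp only [Finset.sum_apply]
    simp only [avg] at hω
    have := mul_le_mul_of_nonneg_left hω hm.le
    rw [mul_sub, ← mul_assoc, mul_inv_cancel₀ hm.ne', one_mul] at this
    exact this
  refine h1.trans ?_
  calc _ ≤ (s.card * ∫ x, g x ^ 2 ∂μ) / (s.card * t) ^ 2 := by gcongr
    _ = _ := by field_simp

/-- A one-sided exponential inequality of Bernstein type. -/
lemma bernstein_avg [IsProbabilityMeasure P] [IsProbabilityMeasure μ] (h : IsIID P μ Z) {g : α → ℝ} (hg : Measurable g)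
    {b V lam t : ℝ}
    (hb : ∀ᵐ x ∂μ, |g x| ≤ b) (hV : ∫ x, g x ^ 2 ∂μ ≤ V) (hlam : 0 < lam) (hlb : lam * b ≤ 1)
    (hs : s.Nonempty) :
    P.real {ω | t ≤ avg s (fun i => g (Z i ω)) - ∫ x, g x ∂μ}
      ≤ Real.exp (s.card * (lam ^ 2 * V - lam * t)) := by
  have hm : (0 : ℝ) < s.card := by exact_mod_cast hs.card_pos
  have hbd : ∀ᵐ x ∂μ, ‖g x‖ ≤ b := hb
  have hgi : Integrable g μ := .of_bound hg.aestronglyMeasurable b hbd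
  have hg2i : Integrable (fun x => g x ^ 2) μ := by
    refine .of_bound (hg.pow_const 2).aestronglyMeasurable (b ^ 2) ?_
    filter_upwards [hb] with x hx
    rw [Real.norm_eq_abs, abs_pow]
    exact pow_le_pow_left₀ (abs_nonneg _) hx 2
  have hexp : ∀ᵐ x ∂μ, Real.exp (lam * g x) ≤ 1 + lam * g x + lam ^ 2 * g x ^ 2 := by
    filter_upwards [hb] with x hx
    have h1 : |lam * g x| ≤ 1 := by
      rw [abs_mul, abs_of_pos hlam]
      exact (mul_le_mul_of_nonneg_left hx hlam.le).trans hlb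
    have := (abs_le.1 (Real.abs_exp_sub_one_sub_id_le h1)).2
    nlinarith
  have hint : Integrable (fun x => Real.exp (lam * g x)) μ := by
    refine .of_bound (hg.const_mul _).exp.aestronglyMeasurable (Real.exp (lam * b)) ?_
    filter_upwards [hb] with x hx
    rw [Real.norm_eq_abs, abs_of_pos (Real.exp_pos _)]
    gcongr
    exact (le_abs_self _).trans hx
  have hmgf : ∫ x, Real.exp (lam * g x) ∂μ
      ≤ Real.exp (lam * ∫ x, g x ∂μ + lam ^ 2 * V) := by
    have e1 : ∫ x, Real.exp (lam * g x) ∂μ ≤ ∫ x, (1 + lam * g x + lam ^ 2 * g x ^ 2) ∂μ :=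
      integral_mono_ae hint (((integrable_const _).add (hgi.const_mul _)).add
        (hg2i.const_mul _)) hexp
    have i1 : Integrable (fun x => 1 + lam * g x) μ := (integrable_const _).add (hgi.const_mul _)
    rw [integral_add i1 (hg2i.const_mul _), integral_add (integrable_const _) (hgi.const_mul _), integral_const_mul,
      integral_const_mul] at e1
    simp only [integral_const, probReal_univ, smul_eq_mul, mul_one] at e1
    have e2 := Real.add_one_le_exp (lam * ∫ x, g x ∂μ + lam ^ 2 * V)
    nlinarith [sq_nonneg lam, mul_le_mul_of_nonneg_left hV (sq_nonneg lam)]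
  have := h.chernoff (s := s) (hg.const_mul lam) hint hmgf
    (s.card * lam * (t + ∫ x, g x ∂μ))
  refine le_trans (measureReal_mono fun ω hω => ?_) (this.trans_eq ?_)
  · simp only [Set.mem_ofPred_eq, avg, ← Finset.mul_sum] at hω ⊢
    have := mul_le_mul_of_nonneg_left hω (mul_pos hm hlam).le
    rw [mul_sub, show (s.card : ℝ) * lam * ((s.card : ℝ)⁻¹ * ∑ i ∈ s, g (Z i ω))
      = lam * ∑ i ∈ s, g (Z i ω) by field_simp] at this
    linarith
  · congr 1; ring

/-- Exponential inequality for the lower tail of an average of non-negative variables. -/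
lemma lower_tail_avg [IsProbabilityMeasure P] [IsProbabilityMeasure μ] (h : IsIID P μ Z) {g : α → ℝ} (hg : Measurable g) (hg0 : ∀ x, 0 ≤ g x)
    (hg2 : MemLp g 2 μ) {a : ℝ} (ha : 0 < a) (hW : ∫ x, g x ^ 2 ∂μ ≤ a * (∫ x, g x ∂μ) ^ 2)
    (hs : s.Nonempty) :
    P.real {ω | avg s (fun i => g (Z i ω)) < (∫ x, g x ∂μ) / 2}
      ≤ Real.exp (- (s.card / (8 * a))) := by
  have hm : (0 : ℝ) < s.card := by exact_mod_cast hs.card_pos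
  have hgi := hg2.integrable one_le_two
  have hg2i := hg2.integrable_sq
  set m1 := ∫ x, g x ∂μ with hm1
  have hm10 : 0 ≤ m1 := integral_nonneg hg0
  rcases hm10.eq_or_lt with h0 | hpos
  · have : {ω | avg s (fun i => g (Z i ω)) < m1 / 2} = ∅ := by
      ext ω
      simp only [Set.mem_ofPred_eq, Set.mem_empty_iff_false, iff_false, not_lt, ← h0]
      simpa using avg_nonneg fun i _ => hg0 _
    rw [this]; simp; positivity
  set lam := 1 / (2 * a * m1) with hlamdef
  have hlam : 0 < lam := by positivity
  have hexp : ∀ x, Real.exp (-lam * g x) ≤ 1 - lam * g x + lam ^ 2 / 2 * g x ^ 2 := fun x => by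
    have h1 : 0 ≤ lam * g x := mul_nonneg hlam.le (hg0 x)
    set y := lam * g x
    have h2 := Real.quadratic_le_exp_of_nonneg h1
    rw [show -lam * g x = -y by ring, Real.exp_neg, inv_le_iff_one_le_mul₀ (Real.exp_pos _)]
    have h3 : (0 : ℝ) ≤ 1 - y + y ^ 2 / 2 := by nlinarith [sq_nonneg (y - 1)]
    have : lam ^ 2 / 2 * g x ^ 2 = y ^ 2 / 2 := by simp only [y]; ring
    rw [this]
    nlinarith [mul_le_mul_of_nonneg_left h2 h3, sq_nonneg (y^2)]
  have hint : Integrable (fun x => Real.exp (-lam * g x)) μ := by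
    refine .of_bound (hg.const_mul _).exp.aestronglyMeasurable 1 (ae_of_all _ fun x => ?_)
    rw [Real.norm_eq_abs, abs_of_pos (Real.exp_pos _), Real.exp_le_one_iff]
    nlinarith [mul_nonneg hlam.le (hg0 x)]
  have hmgf : ∫ x, Real.exp (-lam * g x) ∂μ
      ≤ Real.exp (- lam * m1 + lam ^ 2 / 2 * (a * m1 ^ 2)) := by
    have e1 : ∫ x, Real.exp (-lam * g x) ∂μ ≤ ∫ x, (1 - lam * g x + lam ^ 2 / 2 * g x ^ 2) ∂μ :=
      integral_mono hint (((integrable_const _).sub (hgi.const_mul _)).add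
        (hg2i.const_mul _)) hexp
    have i1 : Integrable (fun x => 1 - lam * g x) μ := (integrable_const _).sub (hgi.const_mul _)
    rw [integral_add i1 (hg2i.const_mul _), integral_sub (integrable_const _) (hgi.const_mul _), integral_const_mul,
      integral_const_mul] at e1
    simp only [integral_const, probReal_univ, smul_eq_mul, mul_one] at e1
    have e2 := Real.add_one_le_exp (- lam * m1 + lam ^ 2 / 2 * (a * m1 ^ 2))
    nlinarith [sq_nonneg lam, mul_le_mul_of_nonneg_left hW (by positivity : 0 ≤ lam ^ 2 / 2)]
  have := h.chernoff (s := s) (hg.const_mul (-lam)) hint hmgf (-(s.card * lam * (m1 / 2)))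
  refine le_trans (measureReal_mono fun ω hω => ?_) (this.trans_eq ?_)
  · simp only [Set.mem_ofPred_eq, avg, ← Finset.mul_sum] at hω ⊢
    have := mul_le_mul_of_nonneg_left hω.le (mul_pos hm hlam).le
    rw [show (s.card : ℝ) * lam * ((s.card : ℝ)⁻¹ * ∑ i ∈ s, g (Z i ω))
      = lam * ∑ i ∈ s, g (Z i ω) by field_simp] at this
    linarith
  · congr 1
    rw [hlamdef]; field_simp; ring

end IsIID

end Concentration

/-! ### Maximal inequalities -/

lemma real_exists_le_card_mul {Ω κ : Type*} [MeasurableSpace Ω] {P : Measure Ω} [IsFiniteMeasure P]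
    [Fintype κ] {E : κ → Set Ω} {x : ℝ} (h : ∀ a, P.real (E a) ≤ x) :
    P.real {ω | ∃ a, ω ∈ E a} ≤ Fintype.card κ * x := by
  have h1 : {ω | ∃ a, ω ∈ E a} = ⋃ a, E a := by ext; simp
  rw [h1]
  calc _ ≤ ∑ a, P.real (E a) := measureReal_iUnion_fintype_le _
    _ ≤ ∑ _a : κ, x := Finset.sum_le_sum fun a _ => h a
    _ = _ := by simp

lemma integrable_of_abs_le_integrable {α : Type*} [MeasurableSpace α] {μ : Measure α}
    {f g : α → ℝ} (hg : Integrable g μ) (hf : Measurable f) (h : ∀ᵐ x ∂μ, |f x| ≤ g x) :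
    Integrable f μ := hg.mono' hf.aestronglyMeasurable h

namespace IsIID

variable {Ω α ι κ : Type*} [MeasurableSpace Ω] [MeasurableSpace α] {P : Measure Ω}
  {μ : Measure α} {Z : ι → Ω → α} {s : Finset ι} [Fintype κ]

/-- Uniform deviation of the averages of a finite family of bounded functions. -/
lemma bernstein_family [IsProbabilityMeasure P] [IsProbabilityMeasure μ] (h : IsIID P μ Z)
    {g : κ → α → ℝ} (hg : ∀ a, Measurable (g a)) {b V L : ℝ} (hb : ∀ a, ∀ᵐ x ∂μ, |g a x| ≤ b)
    (hV0 : 0 < V) (hL : 0 < L) (hV : ∀ a, ∫ x, g a x ^ 2 ∂μ ≤ V) (hs : s.Nonempty)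
    (hbV : b * √(L / (s.card * V)) ≤ 1) :
    P.real {ω | ∃ a, 5 * √(V * L / s.card) ≤ |avg s (fun i => g a (Z i ω)) - ∫ x, g a x ∂μ|}
      ≤ 2 * Fintype.card κ * Real.exp (-(4 * L)) := by
  have hm : (0 : ℝ) < s.card := by exact_mod_cast hs.card_pos
  set lam := √(L / (s.card * V)) with hlam
  have hlam0 : 0 < lam := Real.sqrt_pos.2 (by positivity)
  have hlt : lam * √(V * L / s.card) = L / s.card := by
    rw [hlam, ← Real.sqrt_mul (by positivity), show L / (s.card * V) * (V * L / s.card)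
      = (L / s.card) ^ 2 by field_simp, Real.sqrt_sq (by positivity)]
  have hl2 : lam ^ 2 * V = L / s.card := by
    rw [hlam, Real.sq_sqrt (by positivity)]; field_simp
  have hval : (s.card : ℝ) * (lam ^ 2 * V - lam * (5 * √(V * L / s.card))) = -(4 * L) := by
    rw [hl2, show lam * (5 * √(V * L / s.card)) = 5 * (lam * √(V * L / s.card)) by ring, hlt]
    field_simp; norm_num
  have := real_exists_le_card_mul (P := P) (x := 2 * Real.exp (-(4 * L)))
    (E := fun a => {ω | 5 * √(V * L / s.card) ≤ |avg s (fun i => g a (Z i ω)) - ∫ x, g a x ∂μ|})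
    fun a => by
      have h1 := h.bernstein_avg (s := s) (t := 5 * √(V * L / s.card)) (hg a) (hb a) (hV a)
        hlam0 (by linarith [mul_comm lam b]) hs
      have h2 := h.bernstein_avg (s := s) (g := fun x => - g a x) (t := 5 * √(V * L / s.card))
        (hg a).neg (by simpa using hb a) (by simpa using hV a) hlam0
        (by linarith [mul_comm lam b]) hs
      rw [hval] at h1 h2
      rw [two_mul]
      refine le_trans ?_ (add_le_add h1 h2)
      refine le_trans (measureReal_mono fun ω hω => ?_) (measureReal_union_le _ _)
      simp only [Set.mem_ofPred_eq, Set.mem_union] at hω ⊢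
      rcases le_abs.1 hω with h' | h'
      · exact Or.inl h'
      · right
        rw [avg_neg, integral_neg]; linarith
  refine this.trans_eq (by ring)

/-- Uniform deviation of the averages of a finite family of functions with an envelope `G`. -/
lemma envelope_family [IsProbabilityMeasure P] [IsProbabilityMeasure μ] (h : IsIID P μ Z)
    {g : κ → α → ℝ} (hg : ∀ a, Measurable (g a)) {G : α → ℝ} (hG : Measurable G)
    (hGi : Integrable G μ) (hgG : ∀ a, ∀ᵐ x ∂μ, |g a x| ≤ G x) {V L T : ℝ}
    (hV0 : 0 < V) (hL : 0 < L) (hgi : ∀ a, Integrable (fun x => g a x ^ 2) μ)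
    (hV : ∀ a, ∫ x, g a x ^ 2 ∂μ ≤ V) (hs : s.Nonempty) :
    P.real {ω | ∃ a, 5 * √(V * L / s.card) + T
        + ∫ x, {x | √(s.card * V / L) < G x}.indicator G x ∂μ
        ≤ |avg s (fun i => g a (Z i ω)) - ∫ x, g a x ∂μ|}
      ≤ 2 * Fintype.card κ * Real.exp (-(4 * L))
        + P.real {ω | T ≤ avg s fun i => {x | √(s.card * V / L) < G x}.indicator G (Z i ω)} := by
  have hm : (0 : ℝ) < s.card := by exact_mod_cast hs.card_pos
  set τ := √(s.card * V / L) with hτ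
  have hmS : MeasurableSet {x | τ < G x} := measurableSet_lt measurable_const hG
  set G2 := {x | τ < G x}.indicator G with hG2
  have hG2i : Integrable G2 μ := hGi.indicator hmS
  have hG2m : Measurable G2 := hG.indicator hmS
  set g1 : κ → α → ℝ := fun a => {x | τ < G x}ᶜ.indicator (g a) with hg1
  have hg1m : ∀ a, Measurable (g1 a) := fun a => (hg a).indicator hmS.compl
  have hb : ∀ a, ∀ᵐ x ∂μ, |g1 a x| ≤ τ := fun a => by
    filter_upwards [hgG a] with x hx
    simp only [hg1]
    by_cases hx' : τ < G x
    · rw [Set.indicator_of_notMem (by simpa using hx')]; simp [hτ]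
    · rw [Set.indicator_of_mem (by simpa using hx')]; exact hx.trans (not_lt.1 hx')
  have hg1V : ∀ a, ∫ x, g1 a x ^ 2 ∂μ ≤ V := fun a => by
    refine le_trans (integral_mono_of_nonneg (ae_of_all _ fun x => sq_nonneg _) (hgi a)
      (ae_of_all _ fun x => ?_)) (hV a)
    simp only [hg1]
    by_cases hx' : τ < G x
    · rw [Set.indicator_of_notMem (by simpa using hx')]; simpa using sq_nonneg _
    · rw [Set.indicator_of_mem (by simpa using hx')]
  have hd : ∀ a, ∀ᵐ x ∂μ, |g a x - g1 a x| ≤ G2 x := fun a => by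
    filter_upwards [hgG a] with x hx
    simp only [hg1, hG2]
    by_cases hx' : τ < G x
    · rw [Set.indicator_of_notMem (by simpa using hx'), Set.indicator_of_mem (by simpa using hx')]
      simpa using hx
    · rw [Set.indicator_of_mem (by simpa using hx'), Set.indicator_of_notMem (by simpa using hx')]
      simp
  have hbern := h.bernstein_family (s := s) hg1m hb hV0 hL hg1V hs (by
    rw [hτ, ← Real.sqrt_mul (by positivity), show (s.card : ℝ) * V / L * (L / (s.card * V)) = 1 by
      field_simp, Real.sqrt_one])
  refine le_trans ?_ (add_le_add hbern le_rfl)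
  refine le_trans ?_ (measureReal_union_le _ _)
  have hae : ∀ᵐ ω ∂P, ∀ i ∈ s, ∀ a, |g a (Z i ω) - g1 a (Z i ω)| ≤ G2 (Z i ω) :=
    h.ae_forall s (ae_all_iff.2 hd)
  refine ENNReal.toReal_mono (measure_ne_top _ _) (measure_mono_ae ?_)
  filter_upwards [hae] with ω hω
  rintro ⟨a, ha⟩
  by_contra hcon
  have hcon' : ¬ ((∃ a, 5 * √(V * L / s.card)
      ≤ |avg s (fun i => g1 a (Z i ω)) - ∫ x, g1 a x ∂μ|) ∨
      T ≤ avg s fun i => G2 (Z i ω)) := hcon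
  push Not at hcon'
  obtain ⟨h1, h2⟩ := hcon'
  have h1 := h1 a
  have e1 : |avg s (fun i => g a (Z i ω)) - avg s (fun i => g1 a (Z i ω))|
      ≤ avg s fun i => G2 (Z i ω) := by
    rw [← avg_sub]
    exact (abs_avg_le _).trans (avg_mono fun i hi => hω i hi a)
  have hga : Integrable (g a) μ := hGi.mono' (hg a).aestronglyMeasurable (hgG a)
  have hg1a : Integrable (g1 a) μ := hga.indicator hmS.compl
  have e2 : |∫ x, g a x ∂μ - ∫ x, g1 a x ∂μ| ≤ ∫ x, G2 x ∂μ := by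
    rw [← integral_sub hga hg1a]
    exact (abs_integral_le_integral_abs).trans
      (integral_mono_ae (hga.sub hg1a).abs hG2i (hd a))
  rw [abs_le] at e1 e2
  rw [abs_lt] at h1
  rcases le_abs.1 ha with h' | h' <;> linarith [e1.1, e1.2, e2.1, e2.2, h1.1, h1.2]

/-- Uniform deviation under a bound for the second moment of the envelope. -/
lemma envelope_sq_family [IsProbabilityMeasure P] [IsProbabilityMeasure μ] (h : IsIID P μ Z)
    {g : κ → α → ℝ} (hg : ∀ a, Measurable (g a)) {G : α → ℝ} (hG : Measurable G)
    (hG2 : MemLp G 2 μ) (hgG : ∀ a, ∀ᵐ x ∂μ, |g a x| ≤ G x) {V L : ℝ}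
    (hL : 0 < L) (hV : ∫ x, G x ^ 2 ∂μ ≤ V) (hs : s.Nonempty) :
    P.real {ω | ∃ a, 8 * √(V * L / s.card) < |avg s (fun i => g a (Z i ω)) - ∫ x, g a x ∂μ|}
      ≤ 2 * Fintype.card κ * Real.exp (-(4 * L)) + 1 / L := by
  have hm : (0 : ℝ) < s.card := by exact_mod_cast hs.card_pos
  have hGi := hG2.integrable one_le_two
  have hGsq := hG2.integrable_sq
  have hV0 : 0 ≤ V := (integral_nonneg fun x => sq_nonneg _).trans hV
  rcases hV0.eq_or_lt with h0 | hVpos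
  · have hG0 : G =ᵐ[μ] 0 := by
      have : ∫ x, G x ^ 2 ∂μ = 0 :=
        le_antisymm (hV.trans h0.symm.le) (integral_nonneg fun x => sq_nonneg _)
      rw [integral_eq_zero_iff_of_nonneg (fun x => sq_nonneg _) hGsq] at this
      filter_upwards [this] with x hx
      simpa using hx
    have hz : ∀ᵐ x ∂μ, ∀ a, g a x = 0 := by
      filter_upwards [hG0, ae_all_iff.2 hgG] with x hx h1 a
      have := h1 a
      rw [hx] at this
      simpa using this
    have : P.real {ω | ∃ a, 8 * √(V * L / s.card)
        < |avg s (fun i => g a (Z i ω)) - ∫ x, g a x ∂μ|} = 0 := by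
      rw [measureReal_eq_zero_iff]
      refine measure_mono_null (t := {ω | ¬ ∀ i ∈ s, ∀ a, g a (Z i ω) = 0}) ?_
        (h.ae_forall s hz)
      rintro ω ⟨a, ha⟩ hω
      rw [avg_congr (g := fun _ => 0) fun i hi => hω i hi a,
        integral_eq_zero_of_ae (by filter_upwards [hz] with x hx using hx a)] at ha
      simp only [avg, Finset.sum_const_zero, mul_zero, sub_zero, abs_zero] at ha
      exact absurd ha (not_lt.2 (by positivity))
    rw [this]; positivity
  set R := √(V * L / s.card) with hR
  have hRpos : 0 < R := Real.sqrt_pos.2 (by positivity)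
  set τ := √(s.card * V / L) with hτ
  have hτpos : 0 < τ := Real.sqrt_pos.2 (by positivity)
  have hτR : τ * R = V := by
    rw [hτ, hR, ← Real.sqrt_mul (by positivity), show (s.card : ℝ) * V / L * (V * L / s.card)
      = V ^ 2 by field_simp, Real.sqrt_sq hV0]
  have hmS : MeasurableSet {x | τ < G x} := measurableSet_lt measurable_const hG
  set G2 := {x | τ < G x}.indicator G with hG2def
  have hint : ∫ x, G2 x ∂μ ≤ R := by
    have : ∫ x, G2 x ∂μ ≤ ∫ x, G x ^ 2 / τ ∂μ := by
      refine integral_mono (hGi.indicator hmS) (hGsq.div_const _) fun x => ?_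
      simp only [hG2def]
      by_cases hx' : τ < G x
      · rw [Set.indicator_of_mem (by simpa using hx'), le_div_iff₀ hτpos, sq]
        exact mul_le_mul_of_nonneg_left hx'.le (hτpos.trans hx').le
      · rw [Set.indicator_of_notMem (by simpa using hx')]; positivity
    rw [integral_div] at this
    refine this.trans ?_
    rw [div_le_iff₀ hτpos, mul_comm, hτR]; exact hV
  have hg2 : ∀ a, ∀ᵐ x ∂μ, |g a x ^ 2| ≤ G x ^ 2 := fun a => by
    filter_upwards [hgG a] with x hx
    rw [abs_pow]; exact pow_le_pow_left₀ (abs_nonneg _) hx 2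
  have hgi : ∀ a, Integrable (fun x => g a x ^ 2) μ := fun a =>
    hGsq.mono' ((hg a).pow_const 2).aestronglyMeasurable (hg2 a)
  have hgV : ∀ a, ∫ x, g a x ^ 2 ∂μ ≤ V := fun a => by
    refine (integral_mono_ae (hgi a) hGsq ?_).trans hV
    filter_upwards [hg2 a] with x hx using (le_abs_self _).trans hx
  have henv := h.envelope_family (s := s) (T := 2 * R) hg hG hGi hgG hVpos hL hgi hgV hs
  rw [← hτ, ← hR] at henv
  have hch := h.chebyshev_avg (s := s) (g := G2) (hG.indicator hmS) (hG2.indicator hmS) hs hRpos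
  have hsq : ∫ x, G2 x ^ 2 ∂μ ≤ V := by
    refine le_trans (integral_mono_of_nonneg (ae_of_all _ fun x => sq_nonneg _) hGsq
      (ae_of_all _ fun x => ?_)) hV
    simp only [hG2def]
    by_cases hx' : τ < G x
    · rw [Set.indicator_of_mem (by simpa using hx')]
    · rw [Set.indicator_of_notMem (by simpa using hx')]; simpa using sq_nonneg _
  have hRsq : s.card * R ^ 2 = V * L := by
    rw [hR, Real.sq_sqrt (by positivity)]; field_simp
  have hch' : P.real {ω | 2 * R ≤ avg s fun i => G2 (Z i ω)} ≤ 1 / L := by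
    refine le_trans (measureReal_mono fun ω hω => ?_) (hch.trans ?_)
    · simp only [Set.mem_ofPred_eq] at hω ⊢; linarith
    · rw [hRsq, div_le_div_iff₀ (by positivity) hL]; nlinarith
  refine le_trans (measureReal_mono ?_) (henv.trans (add_le_add le_rfl hch'))
  rintro ω ⟨a, ha⟩
  exact ⟨a, by linarith⟩

/-- Uniform deviation when the tail of the envelope has a small mean. -/
lemma envelope_tail_family [IsProbabilityMeasure P] [IsProbabilityMeasure μ] (h : IsIID P μ Z)
    {g : κ → α → ℝ} (hg : ∀ a, Measurable (g a)) {G : α → ℝ} (hG : Measurable G)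
    (hG0 : ∀ x, 0 ≤ G x)
    (hGi : Integrable G μ) (hgG : ∀ a, ∀ᵐ x ∂μ, |g a x| ≤ G x) {V L z : ℝ}
    (hV0 : 0 < V) (hL : 0 < L) (hgi : ∀ a, Integrable (fun x => g a x ^ 2) μ)
    (hV : ∀ a, ∫ x, g a x ^ 2 ∂μ ≤ V) (hs : s.Nonempty) (hz1 : z ≤ 1)
    (hz : ∫ x, {x | √(s.card * V / L) < G x}.indicator G x ∂μ ≤ z * √(V * L / s.card)) :
    P.real {ω | ∃ a, 7 * √(V * L / s.card) < |avg s (fun i => g a (Z i ω)) - ∫ x, g a x ∂μ|}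
      ≤ 2 * Fintype.card κ * Real.exp (-(4 * L)) + z := by
  have hm : (0 : ℝ) < s.card := by exact_mod_cast hs.card_pos
  set R := √(V * L / s.card) with hR
  have hRpos : 0 < R := Real.sqrt_pos.2 (by positivity)
  have hmS : MeasurableSet {x | √(s.card * V / L) < G x} := measurableSet_lt measurable_const hG
  have henv := h.envelope_family (s := s) (T := R) hg hG hGi hgG hV0 hL hgi hV hs
  have hmk := h.markov_avg (s := s) (hG.indicator hmS) (hGi.indicator hmS)
    (fun x => Set.indicator_nonneg (fun x _ => hG0 x) x) hs hRpos
  refine le_trans (measureReal_mono ?_) (henv.trans (add_le_add le_rfl (hmk.trans ?_)))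
  · rintro ω ⟨a, ha⟩
    refine ⟨a, ?_⟩
    nlinarith
  · rwa [div_le_iff₀ hRpos]

end IsIID

/-! ### Lyapunov's central limit theorem for triangular arrays -/

lemma norm_cexp_sub_quadratic_le (y : ℝ) {ε δ : ℝ} (hε : 0 < ε) (hε1 : ε ≤ 1) (hδ : 0 < δ) :
    ‖Complex.exp (y * Complex.I) - (1 + y * Complex.I - y ^ 2 / 2)‖
      ≤ ε * y ^ 2 + 4 * ε ^ (-δ) * |y| ^ (2 + δ) := by
  have hpow : 0 ≤ ε ^ (-δ) * |y| ^ (2 + δ) := by positivity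
  have hlarge : ε < |y| → y ^ 2 ≤ ε ^ (-δ) * |y| ^ (2 + δ) := fun h => by
    have hy : 0 < |y| := hε.trans h
    rw [Real.rpow_add hy, Real.rpow_neg hε.le, Real.rpow_two, sq_abs, inv_mul_eq_div,
      le_div_iff₀ (by positivity)]
    exact mul_le_mul_of_nonneg_left (Real.rpow_le_rpow hε.le h.le hδ.le) (sq_nonneg _)
  have hny : ‖(y : ℂ) * Complex.I‖ = |y| := by simp
  rcases le_or_gt |y| 1 with h1 | h1
  · have hb := Complex.exp_bound (x := y * Complex.I) (by rw [hny]; exact h1) (n := 3) (by norm_num)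
    have hs : ∑ m ∈ Finset.range 3, ((y : ℂ) * Complex.I) ^ m / (m.factorial : ℂ)
        = 1 + y * Complex.I - y ^ 2 / 2 := by
      simp [Finset.sum_range_succ, Nat.factorial, mul_pow, Complex.I_sq]; ring
    rw [hs, hny] at hb
    have hb' : ‖Complex.exp (y * Complex.I) - (1 + y * Complex.I - y ^ 2 / 2)‖ ≤ |y| * y ^ 2 := by
      refine hb.trans ?_
      have : 0 ≤ |y| ^ 3 := by positivity
      rw [show |y| * y ^ 2 = |y| ^ 3 by rw [← sq_abs y]; ring]
      norm_num [Nat.factorial]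
      nlinarith
    refine hb'.trans ?_
    rcases le_or_gt |y| ε with h2 | h2
    · nlinarith [mul_le_mul_of_nonneg_right h2 (sq_nonneg y)]
    · nlinarith [mul_le_mul_of_nonneg_right h1 (sq_nonneg y), hlarge h2,
        mul_nonneg hε.le (sq_nonneg y)]
  · have h2 : ‖Complex.exp (y * Complex.I) - (1 + y * Complex.I - y ^ 2 / 2)‖
        ≤ 1 + (1 + |y| + y ^ 2 / 2) := by
      refine (norm_sub_le _ _).trans (add_le_add (Complex.norm_exp_ofReal_mul_I y).le ?_)
      refine (norm_sub_le _ _).trans (add_le_add ((norm_add_le _ _).trans ?_) ?_)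
      · rw [hny]; simp
      · simp
    have h3 : |y| ≤ y ^ 2 := by rw [← sq_abs]; nlinarith
    have h4 : 1 ≤ y ^ 2 := by rw [← sq_abs]; nlinarith
    nlinarith [hlarge (hε1.trans_lt h1), mul_nonneg hε.le (sq_nonneg y)]

lemma norm_prod_sub_prod_le {ι : Type*} (s : Finset ι) (a b : ι → ℂ) (ha : ∀ i, ‖a i‖ ≤ 1)
    (hb : ∀ i, ‖b i‖ ≤ 1) : ‖∏ i ∈ s, a i - ∏ i ∈ s, b i‖ ≤ ∑ i ∈ s, ‖a i - b i‖ := by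
  classical
  induction s using Finset.induction_on with
  | empty => simp
  | insert i s hi ih =>
    rw [Finset.prod_insert hi, Finset.prod_insert hi, Finset.sum_insert hi]
    have hA : ‖∏ i ∈ s, a i‖ ≤ 1 := by
      rw [norm_prod]; exact Finset.prod_le_one (fun i _ => norm_nonneg _) fun i _ => ha i
    calc ‖a i * ∏ i ∈ s, a i - b i * ∏ i ∈ s, b i‖
        = ‖(a i - b i) * ∏ i ∈ s, a i + b i * (∏ i ∈ s, a i - ∏ i ∈ s, b i)‖ := by
          congr 1; ring
      _ ≤ ‖a i - b i‖ * ‖∏ i ∈ s, a i‖ + ‖b i‖ * ‖∏ i ∈ s, a i - ∏ i ∈ s, b i‖ := by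
          refine (norm_add_le _ _).trans ?_; rw [norm_mul, norm_mul]
      _ ≤ ‖a i - b i‖ * 1 + 1 * ∑ i ∈ s, ‖a i - b i‖ := by
          gcongr
          exact hb i
      _ = _ := by ring

section CLT

variable {Ω : Type*} [MeasurableSpace Ω] {P : Measure Ω} [IsProbabilityMeasure P]

lemma norm_charFun_sub_quadratic_le {X : Ω → ℝ} (hX : Measurable X) (h2 : MemLp X 2 P)
    (h0 : ∫ ω, X ω ∂P = 0) {δ ε : ℝ} (hδ : 0 < δ) (hε : 0 < ε) (hε1 : ε ≤ 1)
    (hint : Integrable (fun ω => |X ω| ^ (2 + δ)) P) (t : ℝ) :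
    ‖charFun (P.map X) t - ((1 - t ^ 2 * (∫ ω, X ω ^ 2 ∂P) / 2 : ℝ) : ℂ)‖
      ≤ ε * t ^ 2 * ∫ ω, X ω ^ 2 ∂P
        + 4 * ε ^ (-δ) * |t| ^ (2 + δ) * ∫ ω, |X ω| ^ (2 + δ) ∂P := by
  have hXi := h2.integrable one_le_two
  have hX2 := h2.integrable_sq
  have hei : Integrable (fun ω => Complex.exp ((t * X ω : ℝ) * Complex.I)) P := by
    refine .of_bound (by fun_prop) 1 (ae_of_all _ fun ω => ?_)
    exact (Complex.norm_exp_ofReal_mul_I _).le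
  have hcf : charFun (P.map X) t = ∫ ω, Complex.exp ((t * X ω : ℝ) * Complex.I) ∂P := by
    rw [charFun_apply_real, integral_map hX.aemeasurable (by fun_prop)]
    simp
  have hq : Integrable (fun ω => (1 : ℂ) + ((t * X ω : ℝ) : ℂ) * Complex.I
      - ((t * X ω : ℝ) : ℂ) ^ 2 / 2) P := by
    refine ((integrable_const _).add (((hXi.const_mul t).ofReal).mul_const _)).sub ?_
    have : Integrable (fun ω => (((t * X ω) ^ 2 / 2 : ℝ) : ℂ)) P := by
      refine Integrable.ofReal ?_
      simp only [mul_pow]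
      exact (hX2.const_mul _).div_const _
    simpa using this
  have hqv : ∫ ω, ((1 : ℂ) + ((t * X ω : ℝ) : ℂ) * Complex.I
      - ((t * X ω : ℝ) : ℂ) ^ 2 / 2) ∂P 
      = ((1 - t ^ 2 * (∫ ω, X ω ^ 2 ∂P) / 2 : ℝ) : ℂ) := by
    have i1 : Integrable (fun ω => (1 : ℂ) + ((t * X ω : ℝ) : ℂ) * Complex.I) P :=
      (integrable_const _).add (((hXi.const_mul t).ofReal).mul_const _)
    have i2 : Integrable (fun ω => ((t * X ω : ℝ) : ℂ) ^ 2 / 2) P := by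
      have : Integrable (fun ω => (((t * X ω) ^ 2 / 2 : ℝ) : ℂ)) P := by
        refine Integrable.ofReal ?_
        simp only [mul_pow]
        exact (hX2.const_mul _).div_const _
      simpa using this
    rw [integral_sub i1 i2, integral_add (integrable_const _)
      (((hXi.const_mul t).ofReal).mul_const _), integral_mul_const, integral_complex_ofReal,
      integral_const_mul, h0]
    have : ∫ ω, ((t * X ω : ℝ) : ℂ) ^ 2 / 2 ∂P = ((∫ ω, t ^ 2 * X ω ^ 2 / 2 ∂P : ℝ) : ℂ) := by
      rw [← integral_complex_ofReal]
      congr 1; ext ω; push_cast; ring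
    rw [this, integral_div, integral_const_mul]
    simp
  rw [hcf, ← hqv, ← integral_sub hei hq]
  have hbi : Integrable (fun ω => ε * (t * X ω) ^ 2
      + 4 * ε ^ (-δ) * |t * X ω| ^ (2 + δ)) P := by
    simp only [mul_pow, abs_mul, Real.mul_rpow (abs_nonneg _) (abs_nonneg _)]
    exact ((hX2.const_mul _).const_mul _).add ((hint.const_mul _).const_mul _)
  refine (norm_integral_le_of_norm_le hbi (ae_of_all _ fun ω =>
    norm_cexp_sub_quadratic_le (t * X ω) hε hε1 hδ)).trans_eq ?_
  simp only [mul_pow, abs_mul, Real.mul_rpow (abs_nonneg _) (abs_nonneg _)]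
  rw [integral_add ((hX2.const_mul _).const_mul _) ((hint.const_mul _).const_mul _)]
  simp only [integral_const_mul]
  ring

lemma integral_sq_le_of_rpow {X : Ω → ℝ} (h2 : MemLp X 2 P) {δ ε : ℝ} (hδ : 0 < δ) (hε : 0 < ε)
    (hint : Integrable (fun ω => |X ω| ^ (2 + δ)) P) :
    ∫ ω, X ω ^ 2 ∂P ≤ ε ^ 2 + ε ^ (-δ) * ∫ ω, |X ω| ^ (2 + δ) ∂P := by
  have : ∫ ω, X ω ^ 2 ∂P ≤ ∫ ω, (ε ^ 2 + ε ^ (-δ) * |X ω| ^ (2 + δ)) ∂P := by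
    refine integral_mono h2.integrable_sq ((integrable_const _).add (hint.const_mul _)) fun ω => ?_
    rcases le_or_gt |X ω| ε with h | h
    · have : X ω ^ 2 ≤ ε ^ 2 := by rw [← sq_abs]; gcongr
      have h3 : 0 ≤ ε ^ (-δ) * |X ω| ^ (2 + δ) := by positivity
      exact this.trans (by linarith)
    · have hy : 0 < |X ω| := hε.trans h
      have : X ω ^ 2 ≤ ε ^ (-δ) * |X ω| ^ (2 + δ) := by
        rw [Real.rpow_add hy, Real.rpow_neg hε.le, Real.rpow_two, sq_abs, inv_mul_eq_div,
          le_div_iff₀ (by positivity)]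
        exact mul_le_mul_of_nonneg_left (Real.rpow_le_rpow hε.le h.le hδ.le) (sq_nonneg _)
      exact this.trans (by nlinarith [sq_nonneg ε])
  refine this.trans_eq ?_
  rw [integral_add (integrable_const _) (hint.const_mul _), integral_const_mul]
  simp

lemma norm_charFun_sum_sub_le {ι : Type*} [Fintype ι] {X : ι → Ω → ℝ} (hX : ∀ i, Measurable (X i))
    (hind : iIndepFun X P) (h2 : ∀ i, MemLp (X i) 2 P) (h0 : ∀ i, ∫ ω, X i ω ∂P = 0) {δ ε : ℝ}
    (hδ : 0 < δ) (hε : 0 < ε) (hε1 : ε ≤ 1)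
    (hint : ∀ i, Integrable (fun ω => |X i ω| ^ (2 + δ)) P) (t : ℝ) :
    ‖charFun (P.map fun ω => ∑ i, X i ω) t
        - Real.exp (-(t ^ 2 * (∑ i, ∫ ω, X i ω ^ 2 ∂P) / 2))‖
      ≤ ε * t ^ 2 * (∑ i, ∫ ω, X i ω ^ 2 ∂P)
        + 4 * ε ^ (-δ) * |t| ^ (2 + δ) * (∑ i, ∫ ω, |X i ω| ^ (2 + δ) ∂P)
        + t ^ 4 / 4 * (ε ^ 2 + ε ^ (-δ) * ∑ i, ∫ ω, |X i ω| ^ (2 + δ) ∂P)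
          * ∑ i, ∫ ω, X i ω ^ 2 ∂P := by
  rw [hind.charFun_map_fun_sum_eq_prod (fun i => (hX i).aemeasurable), Finset.prod_apply]
  set v : ι → ℝ := fun i => ∫ ω, X i ω ^ 2 ∂P with hv
  set m : ι → ℝ := fun i => ∫ ω, |X i ω| ^ (2 + δ) ∂P with hm
  have hv0 : ∀ i, 0 ≤ v i := fun i => integral_nonneg fun ω => sq_nonneg _
  have hm0 : ∀ i, 0 ≤ m i := fun i => integral_nonneg fun ω => by positivity
  have hexp : ((Real.exp (-(t ^ 2 * (∑ i, v i) / 2)) : ℝ) : ℂ)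
      = ∏ i, ((Real.exp (-(t ^ 2 * v i / 2)) : ℝ) : ℂ) := by
    rw [← Complex.ofReal_prod, ← Real.exp_sum, Finset.sum_neg_distrib, Finset.mul_sum,
      Finset.sum_div]
  rw [hexp]
  refine (norm_prod_sub_prod_le _ _ _ (fun i => ?_) fun i => ?_).trans ?_
  · have : IsProbabilityMeasure (P.map (X i)) := Measure.isProbabilityMeasure_map (hX i).aemeasurable
    exact norm_charFun_le_one (μ := P.map (X i)) t
  · rw [Complex.norm_real, Real.norm_eq_abs, abs_of_pos (Real.exp_pos _), Real.exp_le_one_iff]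
    have := hv0 i
    have : 0 ≤ t ^ 2 * v i / 2 := by positivity
    linarith
  have key : ∀ i, ‖charFun (P.map (X i)) t - ((Real.exp (-(t ^ 2 * v i / 2)) : ℝ) : ℂ)‖
      ≤ ε * t ^ 2 * v i + 4 * ε ^ (-δ) * |t| ^ (2 + δ) * m i
        + t ^ 4 / 4 * (ε ^ 2 + ε ^ (-δ) * ∑ i, m i) * v i := fun i => by
    have h1 := norm_charFun_sub_quadratic_le (hX i) (h2 i) (h0 i) hδ hε hε1 (hint i) t
    have h3 : ‖((1 - t ^ 2 * v i / 2 : ℝ) : ℂ) - ((Real.exp (-(t ^ 2 * v i / 2)) : ℝ) : ℂ)‖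
        ≤ (t ^ 2 * v i / 2) ^ 2 := by
      rw [← Complex.ofReal_sub, Complex.norm_real, Real.norm_eq_abs]
      have hx : 0 ≤ t ^ 2 * v i / 2 := by have := hv0 i; positivity
      set x := t ^ 2 * v i / 2
      have e1 := Real.add_one_le_exp (-x)
      rw [abs_le]
      refine ⟨?_, by nlinarith⟩
      have e2 := Real.add_one_le_exp x
      have e3 : Real.exp (-x) * Real.exp x = 1 := by rw [← Real.exp_add]; simp
      have e4 : Real.exp (-x) ≤ 1 := by rw [Real.exp_le_one_iff]; linarith
      have e5 := Real.exp_pos (-x)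
      nlinarith
    have h4 : v i ≤ ε ^ 2 + ε ^ (-δ) * ∑ i, m i := by
      refine (integral_sq_le_of_rpow (h2 i) hδ hε (hint i)).trans ?_
      gcongr
      exact Finset.single_le_sum (f := m) (fun j _ => hm0 j) (Finset.mem_univ i)
    have h5 : (t ^ 2 * v i / 2) ^ 2 ≤ t ^ 4 / 4 * (ε ^ 2 + ε ^ (-δ) * ∑ i, m i) * v i := by
      have := mul_le_mul_of_nonneg_left h4 (mul_nonneg (by positivity : 0 ≤ t ^ 4 / 4) (hv0 i))
      nlinarith
    calc _ = ‖(charFun (P.map (X i)) t - ((1 - t ^ 2 * v i / 2 : ℝ) : ℂ))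
          + (((1 - t ^ 2 * v i / 2 : ℝ) : ℂ) - ((Real.exp (-(t ^ 2 * v i / 2)) : ℝ) : ℂ))‖ := by
          congr 1; ring
      _ ≤ _ := (norm_add_le _ _).trans (add_le_add h1 (h3.trans h5))
  refine (Finset.sum_le_sum fun i _ => key i).trans_eq ?_
  rw [Finset.sum_add_distrib, Finset.sum_add_distrib, ← Finset.mul_sum, ← Finset.mul_sum,
    ← Finset.mul_sum]

end CLT

/-- **Lyapunov's central limit theorem** for row-wise independent triangular arrays. -/
theorem lyapunov_clt {Ω : ℕ → Type*} [∀ k, MeasurableSpace (Ω k)] (P : ∀ k, Measure (Ω k))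
    [∀ k, IsProbabilityMeasure (P k)] {ι : ℕ → Type*} [∀ k, Fintype (ι k)]
    (X : ∀ k, ι k → Ω k → ℝ) (hX : ∀ k i, Measurable (X k i)) (hind : ∀ k, iIndepFun (X k) (P k))
    (h2 : ∀ k i, MemLp (X k i) 2 (P k)) (h0 : ∀ k i, ∫ ω, X k i ω ∂(P k) = 0) {δ : ℝ}
    (hδ : 0 < δ) (hint : ∀ k i, Integrable (fun ω => |X k i ω| ^ (2 + δ)) (P k))
    (hvar : Tendsto (fun k => ∑ i, ∫ ω, X k i ω ^ 2 ∂(P k)) atTop (𝓝 1))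
    (hlyap : Tendsto (fun k => ∑ i, ∫ ω, |X k i ω| ^ (2 + δ) ∂(P k)) atTop (𝓝 0)) (t : ℝ) :
    Tendsto (fun k => (P k).real {ω | ∑ i, X k i ω ≤ t}) atTop
      (𝓝 ((gaussianReal 0 1).real (Set.Iic t))) := by
  have hSm : ∀ k, Measurable fun ω => ∑ i, X k i ω := fun k =>
    Finset.measurable_sum _ fun i _ => hX k i
  set ν : ℕ → ProbabilityMeasure ℝ := fun k => ⟨(P k).map fun ω => ∑ i, X k i ω,
    Measure.isProbabilityMeasure_map (hSm k).aemeasurable⟩ with hν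
  set ν₀ : ProbabilityMeasure ℝ := ⟨gaussianReal 0 1, inferInstance⟩ with hν₀
  have hlim : Tendsto ν atTop (𝓝 ν₀) := by
    refine ProbabilityMeasure.tendsto_iff_tendsto_charFun.2 fun u => ?_
    have hg : charFun (ν₀ : Measure ℝ) u = ((Real.exp (-(u ^ 2 * 1 / 2)) : ℝ) : ℂ) := by
      simp only [hν₀, ProbabilityMeasure.coe_mk, charFun_gaussianReal]
      push_cast
      congr 1
      simp
    rw [hg]
    have hmain : Tendsto (fun k => ((Real.exp (-(u ^ 2 *
        (∑ i, ∫ ω, X k i ω ^ 2 ∂(P k)) / 2)) : ℝ) : ℂ)) atTop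
        (𝓝 ((Real.exp (-(u ^ 2 * 1 / 2)) : ℝ) : ℂ)) := by
      refine (Complex.continuous_ofReal.tendsto _).comp ((Real.continuous_exp.tendsto _).comp ?_)
      exact ((hvar.const_mul _).div_const _).neg
    have hdiff : Tendsto (fun k => charFun (ν k : Measure ℝ) u - ((Real.exp (-(u ^ 2 *
        (∑ i, ∫ ω, X k i ω ^ 2 ∂(P k)) / 2)) : ℝ) : ℂ)) atTop (𝓝 0) := by
      rw [Metric.tendsto_atTop']
      intro η hη
      set ε := min 1 (η / (2 * (u ^ 2 + u ^ 4 / 4 + 1))) with hεd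
      have hε : 0 < ε := by positivity
      have hε1 : ε ≤ 1 := min_le_left _ _
      have hb : Tendsto (fun k => ε * u ^ 2 * (∑ i, ∫ ω, X k i ω ^ 2 ∂(P k))
          + 4 * ε ^ (-δ) * |u| ^ (2 + δ) * (∑ i, ∫ ω, |X k i ω| ^ (2 + δ) ∂(P k))
          + u ^ 4 / 4 * (ε ^ 2 + ε ^ (-δ) * ∑ i, ∫ ω, |X k i ω| ^ (2 + δ) ∂(P k))
          * ∑ i, ∫ ω, X k i ω ^ 2 ∂(P k)) atTop
          (𝓝 (ε * u ^ 2 * 1 + 4 * ε ^ (-δ) * |u| ^ (2 + δ) * 0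
          + u ^ 4 / 4 * (ε ^ 2 + ε ^ (-δ) * 0) * 1)) :=
        ((hvar.const_mul _).add (hlyap.const_mul _)).add
          ((((hlyap.const_mul _).const_add _).const_mul _).mul hvar)
      have hlt : ε * u ^ 2 * 1 + 4 * ε ^ (-δ) * |u| ^ (2 + δ) * 0
          + u ^ 4 / 4 * (ε ^ 2 + ε ^ (-δ) * 0) * 1 < η := by
        have h1 : ε * (2 * (u ^ 2 + u ^ 4 / 4 + 1)) ≤ η := by
          rw [← le_div_iff₀ (by positivity)]; exact min_le_right _ _
        have h3 : ε ^ 2 ≤ ε := by nlinarith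
        have h4 : u ^ 4 / 4 * ε ^ 2 ≤ u ^ 4 / 4 * ε := by gcongr
        have h5 : 0 ≤ u ^ 4 := by positivity
        nlinarith [sq_nonneg u, mul_nonneg hε.le (sq_nonneg u), mul_nonneg hε.le h5]
      have hev := hb.eventually (gt_mem_nhds hlt)
      obtain ⟨k₀, hk₀⟩ := eventually_atTop.1 hev
      refine ⟨k₀, fun k hk => ?_⟩
      rw [dist_zero_right]
      exact (norm_charFun_sum_sub_le (hX k) (hind k) (h2 k) (h0 k) hδ hε hε1 (hint k) u).trans_lt
        (hk₀ k hk.le)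
    simpa using hdiff.add hmain
  have hfr : (ν₀ : Measure ℝ) (frontier (Set.Iic t)) = 0 := by
    rw [frontier_Iic]
    have : NullSingletonClass (gaussianReal 0 1) := nullSingletonClass_gaussianReal one_ne_zero
    exact measure_singleton (μ := gaussianReal 0 1) t
  have := ProbabilityMeasure.tendsto_measure_of_null_frontier_of_tendsto' hlim hfr
  have h3 := (ENNReal.tendsto_toReal (measure_ne_top (ν₀ : Measure ℝ) _)).comp this
  refine h3.congr fun k => ?_
  simp only [Function.comp, hν, ProbabilityMeasure.coe_mk]
  rw [Measure.map_apply (hSm k) measurableSet_Iic]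
  rfl

/-! ### Norms of vectors -/

section Norms

variable {p : ℕ}

lemma l1_nonneg (u : Fin p → ℝ) : 0 ≤ l1 u := Finset.sum_nonneg fun _ _ => abs_nonneg _

lemma l2_nonneg (u : Fin p → ℝ) : 0 ≤ l2 u := Real.sqrt_nonneg _

lemma l2_sq (u : Fin p → ℝ) : l2 u ^ 2 = ∑ i, u i ^ 2 :=
  Real.sq_sqrt (Finset.sum_nonneg fun _ _ => sq_nonneg _)

lemma abs_le_l1 (u : Fin p → ℝ) (i : Fin p) : |u i| ≤ l1 u :=
  Finset.single_le_sum (f := fun i => |u i|) (fun _ _ => abs_nonneg _) (Finset.mem_univ i)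

lemma l1_add_le (u v : Fin p → ℝ) : l1 (u + v) ≤ l1 u + l1 v := by
  simp only [l1, ← Finset.sum_add_distrib]
  exact Finset.sum_le_sum fun i _ => abs_add_le _ _

lemma l1_smul (c : ℝ) (u : Fin p → ℝ) : l1 (c • u) = |c| * l1 u := by
  simp [l1, abs_mul, Finset.mul_sum]

lemma l1_pos {u : Fin p → ℝ} (hu : u ≠ 0) : 0 < l1 u := by
  obtain ⟨i, hi⟩ := Function.ne_iff.1 hu
  exact (abs_pos.2 hi).trans_le (abs_le_l1 u i)

lemma l2_pos {u : Fin p → ℝ} (hu : u ≠ 0) : 0 < l2 u := by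
  obtain ⟨i, hi⟩ := Function.ne_iff.1 hu
  refine Real.sqrt_pos.2 (lt_of_lt_of_le (pow_pos (abs_pos.2 hi) 2) ?_)
  rw [sq_abs]
  exact Finset.single_le_sum (f := fun i => u i ^ 2) (fun _ _ => sq_nonneg _) (Finset.mem_univ i)

lemma abs_dotProduct_le {x y : Fin p → ℝ} {b : ℝ} (h : ∀ i, |y i| ≤ b) :
    |x ⬝ᵥ y| ≤ l1 x * b := by
  simp only [dotProduct, l1, Finset.sum_mul]
  refine (Finset.abs_sum_le_sum_abs _ _).trans (Finset.sum_le_sum fun i _ => ?_)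
  rw [abs_mul]
  exact mul_le_mul_of_nonneg_left (h i) (abs_nonneg _)

lemma sum_abs_sq_le (S : Finset (Fin p)) (u : Fin p → ℝ) {s : ℝ} (hS : (S.card : ℝ) ≤ s) :
    (∑ i ∈ S, |u i|) ^ 2 ≤ s * l2 u ^ 2 := by
  have h1 := Finset.sum_mul_sq_le_sq_mul_sq S (fun i => |u i|) (fun _ => 1)
  simp only [mul_one, sq_abs, one_pow, Finset.sum_const, nsmul_eq_mul] at h1
  have h2 : ∑ i ∈ S, u i ^ 2 ≤ l2 u ^ 2 := by
    rw [l2_sq]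
    exact Finset.sum_le_univ_sum_of_nonneg fun i => sq_nonneg _
  have h3 : 0 ≤ l2 u ^ 2 := sq_nonneg _
  calc _ ≤ (∑ i ∈ S, u i ^ 2) * S.card := h1
    _ ≤ l2 u ^ 2 * s := by gcongr
    _ = _ := mul_comm _ _

/-- The support of a vector as a finite set. -/
def supp (u : Fin p → ℝ) : Finset (Fin p) := Finset.univ.filter fun i => u i ≠ 0

lemma card_supp (u : Fin p → ℝ) : (supp u).card = l0 u := by
  rw [l0, ← Set.ncard_coe_finset]
  congr 1
  ext i; simp [supp]

lemma l1_eq_supp_add (u v : Fin p → ℝ) :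
    l1 v = ∑ i ∈ supp u, |v i| + ∑ i ∈ (supp u)ᶜ, |v i| :=
  (Finset.sum_add_sum_compl _ _).symm

lemma l1_sub_l1_le (u v : Fin p → ℝ) :
    l1 u - l1 v ≤ ∑ i ∈ supp u, |(v - u) i| - ∑ i ∈ (supp u)ᶜ, |(v - u) i| := by
  rw [l1_eq_supp_add u u, l1_eq_supp_add u v]
  have h0 : ∀ i ∈ (supp u)ᶜ, u i = 0 := fun i hi => by
    simpa [supp] using hi
  have h1 : ∑ i ∈ (supp u)ᶜ, |u i| = 0 := Finset.sum_eq_zero fun i hi => by simp [h0 i hi]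
  have h2 : ∑ i ∈ (supp u)ᶜ, |(v - u) i| = ∑ i ∈ (supp u)ᶜ, |v i| :=
    Finset.sum_congr rfl fun i hi => by simp [h0 i hi]
  have h3 : ∑ i ∈ supp u, |u i| - ∑ i ∈ supp u, |v i| ≤ ∑ i ∈ supp u, |(v - u) i| := by
    rw [← Finset.sum_sub_distrib]
    refine Finset.sum_le_sum fun i _ => ?_
    rw [Pi.sub_apply, abs_sub_comm]
    exact abs_sub_abs_le_abs_sub _ _
  linarith

lemma l1_sq_le_of_sparse (u : Fin p → ℝ) {s : ℝ} (h : (l0 u : ℝ) ≤ s) : l1 u ^ 2 ≤ s * l2 u ^ 2 := by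
  have h1 := sum_abs_sq_le (supp u) u (s := s) (by rwa [card_supp])
  have h2 := l1_eq_supp_add u u
  have h3 : ∑ i ∈ (supp u)ᶜ, |u i| = 0 := Finset.sum_eq_zero fun i hi => by
    have : u i = 0 := by simpa [supp] using hi
    simp [this]
  rw [h3, add_zero] at h2
  rwa [h2]

end Norms

/-! ### Oracle inequalities -/

section Oracle

variable {p : ℕ} {ι : Type*} {I : Finset ι}

lemma lasso_arith {lam c s ρ DS DC e q t2 : ℝ} (hlam : 0 < lam) (hc : 0 < c) (hs0 : 0 ≤ s)
    (hρ : 72 * s * ρ ≤ c) (hρ0 : 0 ≤ ρ) (hDS0 : 0 ≤ DS) (hDC0 : 0 ≤ DC) (he : 0 ≤ e)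
    (ht : 0 ≤ t2) (hq0 : 0 ≤ q) (hDsq : DS ^ 2 ≤ s * e)
    (hmain : q / 2 + lam / 2 * DC ≤ 3 / 2 * lam * DS + 2 * t2)
    (hRE : c * e - ρ * (DS + DC) ^ 2 ≤ q) :
    DS + DC ≤ 60 * s * lam / c + 12 * t2 / lam ∧ q ≤ 50 * s * lam ^ 2 / c + 10 * t2 := by
  have hlDC := mul_nonneg hlam.le hDC0
  have hlDS := mul_nonneg hlam.le hDS0
  rcases le_or_gt (2 * t2) (lam * DS) with hcase | hcase
  · have h4 : q ≤ 5 * lam * DS := by linarith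
    have h1 : DC ≤ 5 * DS := le_of_mul_le_mul_left (by linarith) hlam
    have h2 : (DS + DC) ^ 2 ≤ 36 * (s * e) := by
      have : (DS + DC) ^ 2 ≤ (6 * DS) ^ 2 := pow_le_pow_left₀ (by positivity) (by linarith) 2
      linarith
    have h3 : c / 2 * e ≤ q := by
      have e1 := mul_le_mul_of_nonneg_left h2 hρ0
      have e2 := mul_le_mul_of_nonneg_right hρ he
      linarith
    have h5 : DS ≤ 10 * s * lam / c := by
      rw [le_div_iff₀ hc]
      rcases hDS0.eq_or_lt with h0 | hpos
      · rw [← h0]; simp only [zero_mul]; positivity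
      · have e1 := mul_le_mul_of_nonneg_left (h3.trans h4) hs0
        have e2 := mul_le_mul_of_nonneg_left hDsq hc.le
        have : DS * (DS * c) ≤ DS * (10 * s * lam) := by linarith
        exact le_of_mul_le_mul_left this hpos
    have h6 : 0 ≤ 12 * t2 / lam := by positivity
    constructor
    · have : 60 * s * lam / c = 6 * (10 * s * lam / c) := by ring
      rw [this]; linarith
    · have : 50 * s * lam ^ 2 / c = 5 * lam * (10 * s * lam / c) := by ring
      rw [this]
      have := mul_le_mul_of_nonneg_left h5 (by positivity : 0 ≤ 5 * lam)
      linarith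
  · have h1 : DS ≤ 2 * t2 / lam := by rw [le_div_iff₀ hlam]; linarith
    have h2 : DC ≤ 10 * t2 / lam := by rw [le_div_iff₀ hlam]; linarith
    have h3 : 0 ≤ 60 * s * lam / c := by positivity
    have h4 : 0 ≤ 50 * s * lam ^ 2 / c := by positivity
    constructor
    · have : 12 * t2 / lam = 2 * t2 / lam + 10 * t2 / lam := by ring
      linarith
    · linarith

/-- Oracle inequality for the lasso with an error that is the sum of a part `u`, nearly
orthogonal to the design, and a part `w` of small norm. -/
lemma lasso_oracle {z : ι → Fin p → ℝ} {y : ι → ℝ} {b₀ b : Fin p → ℝ} {lam t c ρ s : ℝ}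
    (hlam : 0 < lam) (hc : 0 < c) (hs : (l0 b₀ : ℝ) ≤ s) (hρ : 72 * s * ρ ≤ c) (hρ0 : 0 ≤ ρ)
    (hobj : avg I (fun i => (y i - z i ⬝ᵥ b) ^ 2) + lam * l1 b
      ≤ avg I (fun i => (y i - z i ⬝ᵥ b₀) ^ 2) + lam * l1 b₀)
    {u w : ι → ℝ} (hres : ∀ i ∈ I, y i - z i ⬝ᵥ b₀ = u i + w i)
    (hu : |avg I fun i => u i * (z i ⬝ᵥ (b - b₀))| ≤ lam / 4 * l1 (b - b₀))
    (hw : avg I (fun i => w i ^ 2) ≤ t ^ 2)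
    (hRE : c * l2 (b - b₀) ^ 2 - ρ * l1 (b - b₀) ^ 2 ≤ avg I fun i => (z i ⬝ᵥ (b - b₀)) ^ 2) :
    l1 (b - b₀) ≤ 60 * s * lam / c + 12 * t ^ 2 / lam ∧
      avg I (fun i => (z i ⬝ᵥ (b - b₀)) ^ 2) ≤ 50 * s * lam ^ 2 / c + 10 * t ^ 2 := by
  set Δ := b - b₀ with hΔ
  set q := avg I fun i => (z i ⬝ᵥ Δ) ^ 2 with hq
  have hq0 : 0 ≤ q := avg_nonneg fun i _ => sq_nonneg _
  have hexp : avg I (fun i => (y i - z i ⬝ᵥ b) ^ 2) = avg I (fun i => (y i - z i ⬝ᵥ b₀) ^ 2)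
      - 2 * avg I (fun i => u i * (z i ⬝ᵥ Δ)) - 2 * avg I (fun i => w i * (z i ⬝ᵥ Δ)) + q := by
    rw [hq, ← avg_const_mul, ← avg_const_mul, ← avg_sub, ← avg_sub, ← avg_add]
    refine avg_congr fun i hi => ?_
    have h1 : z i ⬝ᵥ b = z i ⬝ᵥ b₀ + z i ⬝ᵥ Δ := by rw [hΔ, dotProduct_sub]; ring
    rw [h1, ← sub_sub, hres i hi]; ring
  have hcs : |avg I fun i => w i * (z i ⬝ᵥ Δ)| ≤ q / 4 + t ^ 2 := by
    refine abs_le_of_sq_le_sq ?_ (by positivity)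
    refine (avg_mul_sq_le _ _).trans ?_
    have := mul_le_mul_of_nonneg_right hw hq0
    nlinarith [sq_nonneg (q / 4 - t ^ 2)]
  have hl := l1_sub_l1_le b₀ b
  have hsplit := l1_eq_supp_add b₀ Δ
  set DS := ∑ i ∈ supp b₀, |Δ i| with hDS
  set DC := ∑ i ∈ (supp b₀)ᶜ, |Δ i| with hDC
  have hDS0 : 0 ≤ DS := Finset.sum_nonneg fun _ _ => abs_nonneg _
  have hDC0 : 0 ≤ DC := Finset.sum_nonneg fun _ _ => abs_nonneg _
  have hDsq : DS ^ 2 ≤ s * l2 Δ ^ 2 := sum_abs_sq_le _ _ (by rwa [card_supp])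
  have hs0 : 0 ≤ s := le_trans (by positivity) hs
  have hu1 := (le_abs_self _).trans hu
  have hw1 := (le_abs_self _).trans hcs
  have hmain : q / 2 + lam / 2 * DC ≤ 3 / 2 * lam * DS + 2 * t ^ 2 := by
    rw [hsplit] at hu1
    nlinarith [mul_le_mul_of_nonneg_left hl hlam.le]
  rw [hsplit] at hRE ⊢
  exact lasso_arith hlam hc hs0 hρ hρ0 hDS0 hDC0 (sq_nonneg _) (sq_nonneg _) hq0 hDsq hmain hRE

/-- Oracle inequality for the Dantzig selector. -/
lemma dantzig_oracle {z : ι → Fin p → ℝ} {b₀ b : Fin p → ℝ} {lam c ρ s : ℝ}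
    (hlam : 0 ≤ lam) (hc : 0 < c) (hs : (l0 b₀ : ℝ) ≤ s) (hρ : 8 * s * ρ ≤ c) (hρ0 : 0 ≤ ρ)
    (hl1 : l1 b ≤ l1 b₀)
    (hfeas : ∀ j, |avg I fun i => z i j * (z i ⬝ᵥ (b - b₀))| ≤ 2 * lam)
    (hRE : c * l2 (b - b₀) ^ 2 - ρ * l1 (b - b₀) ^ 2 ≤ avg I fun i => (z i ⬝ᵥ (b - b₀)) ^ 2) :
    l1 (b - b₀) ≤ 16 * s * lam / c ∧
      avg I (fun i => (z i ⬝ᵥ (b - b₀)) ^ 2) ≤ 32 * s * lam ^ 2 / c := by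
  set Δ := b - b₀ with hΔ
  set q := avg I fun i => (z i ⬝ᵥ Δ) ^ 2 with hq
  have hq1 : q ≤ l1 Δ * (2 * lam) := by
    have : q = Δ ⬝ᵥ fun j => avg I fun i => z i j * (z i ⬝ᵥ Δ) := by
      simp only [dotProduct, ← avg_const_mul, hq]
      rw [← avg_sum]
      refine avg_congr fun i _ => ?_
      rw [sq, Finset.sum_mul]
      exact Finset.sum_congr rfl fun j _ => by ring
    rw [this]
    exact (le_abs_self _).trans (abs_dotProduct_le hfeas)
  have hl := l1_sub_l1_le b₀ b
  have hsplit := l1_eq_supp_add b₀ Δ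
  set DS := ∑ i ∈ supp b₀, |Δ i| with hDS
  set DC := ∑ i ∈ (supp b₀)ᶜ, |Δ i| with hDC
  have hDS0 : 0 ≤ DS := Finset.sum_nonneg fun _ _ => abs_nonneg _
  have hDC0 : 0 ≤ DC := Finset.sum_nonneg fun _ _ => abs_nonneg _
  have hDsq : DS ^ 2 ≤ s * l2 Δ ^ 2 := sum_abs_sq_le _ _ (by rwa [card_supp])
  have hs0 : 0 ≤ s := le_trans (by positivity) hs
  have h1 : DC ≤ DS := by linarith
  rw [hsplit] at hRE hq1 ⊢
  have h2 : (DS + DC) ^ 2 ≤ 4 * (s * l2 Δ ^ 2) := by nlinarith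
  have h3 : c / 2 * l2 Δ ^ 2 ≤ q := by
    nlinarith [mul_le_mul_of_nonneg_left h2 hρ0, sq_nonneg (l2 Δ),
      mul_le_mul_of_nonneg_right hρ (sq_nonneg (l2 Δ))]
  have h4 : q ≤ 4 * lam * DS := by nlinarith
  have h5 : DS ≤ 8 * s * lam / c := by
    rw [le_div_iff₀ hc]
    rcases hDS0.eq_or_lt with h0 | hpos
    · rw [← h0]; simp only [zero_mul]; positivity
    · have : DS * (DS * c) ≤ DS * (8 * s * lam) := by
        nlinarith [mul_le_mul_of_nonneg_left (h3.trans h4) hs0]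
      exact le_of_mul_le_mul_left this hpos
  constructor
  · have : 16 * s * lam / c = 2 * (8 * s * lam / c) := by ring
    rw [this]; linarith
  · have : 32 * s * lam ^ 2 / c = 4 * lam * (8 * s * lam / c) := by ring
    rw [this]
    exact h4.trans (mul_le_mul_of_nonneg_left h5 (by positivity))

lemma abs_le_of_forall_quadratic {a b lam : ℝ} (hb : 0 ≤ b)
    (h : ∀ t : ℝ, 0 ≤ -2 * t * a + t ^ 2 * b + 2 * lam * |t|) : |a| ≤ lam := by
  by_contra hcon
  push Not at hcon
  set x := |a| - lam with hx
  have hx0 : 0 < x := sub_pos.2 hcon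
  have key : ∀ τ : ℝ, 0 ≤ τ → 0 ≤ -2 * τ * |a| + τ ^ 2 * b + 2 * lam * τ := fun τ hτ => by
    rcases le_total 0 a with ha | ha
    · have := h τ; rwa [abs_of_nonneg hτ, ← abs_of_nonneg ha] at this
    · have := h (-τ)
      rw [abs_neg, abs_of_nonneg hτ] at this
      rw [abs_of_nonpos ha]; linarith
  have h1 := key (x / (b + 1)) (by positivity)
  have h2 : -2 * (x / (b + 1)) * |a| + (x / (b + 1)) ^ 2 * b + 2 * lam * (x / (b + 1))
      = (x / (b + 1)) * (x * (b / (b + 1) - 2)) := by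
    rw [hx]; field_simp; ring
  rw [h2] at h1
  have h3 : b / (b + 1) < 1 := by rw [div_lt_one (by positivity)]; linarith
  have h4 : 0 < x / (b + 1) := by positivity
  have h5 : x * (b / (b + 1) - 2) < 0 := by nlinarith
  nlinarith [mul_neg_of_pos_of_neg h4 h5]

/-- The optimality conditions of the lasso. -/
lemma lasso_kkt {z : ι → Fin p → ℝ} {y : ι → ℝ} {g : Fin p → ℝ} {lam : ℝ} {l : Fin p}
    (hlam : 0 ≤ lam)
    (hmin : ∀ t : ℝ, avg I (fun i => (y i - z i ⬝ᵥ g) ^ 2) + 2 * lam * l1 g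
      ≤ avg I (fun i => (y i - z i ⬝ᵥ (g + Pi.single l t)) ^ 2)
        + 2 * lam * l1 (g + Pi.single l t)) :
    |avg I fun i => (y i - z i ⬝ᵥ g) * z i l| ≤ lam := by
  refine abs_le_of_forall_quadratic (b := avg I fun i => z i l ^ 2)
    (avg_nonneg fun i _ => sq_nonneg _) fun t => ?_
  have h1 := hmin t
  have h2 : l1 (g + Pi.single l t) ≤ l1 g + |t| := by
    refine (l1_add_le _ _).trans_eq ?_
    congr 1
    simp only [l1]
    rw [Finset.sum_eq_single l] <;> simp +contextual
  have h3 : avg I (fun i => (y i - z i ⬝ᵥ (g + Pi.single l t)) ^ 2)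
      = avg I (fun i => (y i - z i ⬝ᵥ g) ^ 2)
        - 2 * t * avg I (fun i => (y i - z i ⬝ᵥ g) * z i l) + t ^ 2 * avg I fun i => z i l ^ 2 := by
    rw [← avg_const_mul, ← avg_const_mul, ← avg_sub, ← avg_add]
    refine avg_congr fun i _ => ?_
    rw [dotProduct_add, dotProduct_single]; ring
  have h4 := mul_le_mul_of_nonneg_left h2 (by positivity : 0 ≤ 2 * lam)
  linarith

end Oracle

/-! ### From sparse vectors to all vectors -/

section Maurey

variable {V : Type*} [AddCommGroup V] [Module ℝ V]

/-- Sampling `d` of the vectors `y j` with probabilities `w j`, the value of a quadratic form at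
the sum does not exceed its mean for at least one outcome. -/
lemma exists_sum_le_mean (β : V →ₗ[ℝ] V →ₗ[ℝ] ℝ) {p : ℕ} (w : Fin p → ℝ) (hw : ∀ j, 0 ≤ w j)
    (hw1 : ∑ j, w j = 1) (y : Fin p → V) (d : ℕ) (u : V) :
    ∃ J : Fin d → Fin p, β (u + ∑ i, y (J i)) (u + ∑ i, y (J i))
      ≤ β u u + d * (β u (∑ j, w j • y j) + β (∑ j, w j • y j) u)
        + d * (d - 1) * β (∑ j, w j • y j) (∑ j, w j • y j) + d * ∑ j, w j * β (y j) (y j) := by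
  induction d generalizing u with
  | zero => exact ⟨Fin.elim0, by simp⟩
  | succ d ih =>
    set x := ∑ j, w j • y j with hx
    set F : Fin p → ℝ := fun j => β (u + y j) (u + y j) + d * (β (u + y j) x + β x (u + y j))
      + d * (d - 1) * β x x + d * ∑ j, w j * β (y j) (y j) with hF
    have hl : ∀ v, ∑ j, w j * β v (y j) = β v x := fun v => by
      simp [hx, map_sum]
    have hr : ∀ v, ∑ j, w j * β (y j) v = β x v := fun v => by
      simp [hx, map_sum, LinearMap.sum_apply]
    have hsum : ∑ j, w j * F j = β u u + (d + 1 : ℕ) * (β u x + β x u)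
        + (d + 1 : ℕ) * ((d + 1 : ℕ) - 1) * β x x
        + (d + 1 : ℕ) * ∑ j, w j * β (y j) (y j) := by
      set α := ∑ j, w j * β (y j) (y j) with hα
      have e : ∀ j, w j * F j = w j * (β u u + d * (β u x + β x u) + d * (d - 1) * β x x + d * α)
          + (w j * β u (y j) + w j * β (y j) u + w j * β (y j) (y j)
            + d * (w j * β (y j) x) + d * (w j * β x (y j))) := fun j => by
        simp only [hF, map_add, LinearMap.add_apply]; ring
      simp only [e, Finset.sum_add_distrib, ← Finset.sum_mul, ← Finset.mul_sum, hw1, hl, hr]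
      rw [← hα]; push_cast; ring
    obtain ⟨j, hj⟩ : ∃ j, F j ≤ ∑ j, w j * F j := by
      by_contra hcon
      push Not at hcon
      have h1 : ∀ j, w j * (∑ j, w j * F j) ≤ w j * F j := fun j =>
        mul_le_mul_of_nonneg_left (hcon j).le (hw j)
      obtain ⟨j₀, hj₀⟩ : ∃ j, 0 < w j := by
        by_contra h0
        push Not at h0
        have : ∑ j, w j ≤ 0 := Finset.sum_nonpos fun j _ => h0 j
        linarith
      have h2 : ∑ j, w j * (∑ j, w j * F j) < ∑ j, w j * F j :=
        Finset.sum_lt_sum (fun j _ => h1 j)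
          ⟨j₀, Finset.mem_univ _, mul_lt_mul_of_pos_left (hcon j₀) hj₀⟩
      rw [← Finset.sum_mul, hw1, one_mul] at h2
      exact lt_irrefl _ h2
    obtain ⟨J, hJ⟩ := ih (u + y j)
    refine ⟨Fin.cons j J, ?_⟩
    rw [Fin.sum_univ_succ]
    simp only [Fin.cons_zero, Fin.cons_succ]
    rw [← add_assoc]
    exact (hJ.trans hj).trans_eq hsum

/-- The sum of the signed basis vectors listed by `T`. -/
def signedSum {p d : ℕ} (T : Fin d → Fin p × Bool) : Fin p → ℝ :=
  ∑ i, (if (T i).2 then (1 : ℝ) else -1) • Pi.single (T i).1 (1 : ℝ)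

/-- If a quadratic form is non-negative at all sums of `d` signed basis vectors, then it is
bounded from below at all vectors by a multiple of the squared `ℓ¹`-norm. -/
lemma form_ge_of_signedSum_nonneg {p d : ℕ} (hd : 1 ≤ d)
    (β : (Fin p → ℝ) →ₗ[ℝ] (Fin p → ℝ) →ₗ[ℝ] ℝ)
    (h : ∀ T : Fin d → Fin p × Bool, 0 ≤ β (signedSum T) (signedSum T)) {a : ℝ}
    (ha : ∀ j, β (Pi.single j 1) (Pi.single j 1) ≤ a) (x : Fin p → ℝ) :
    -(a * l1 x ^ 2) ≤ (d - 1) * β x x := by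
  by_cases hx : x = 0
  · simp [hx, l1]
  have hl := l1_pos hx
  set σ : Fin p → ℝ := fun j => if 0 ≤ x j then 1 else -1 with hσ
  have hσx : ∀ j, |x j| * σ j = x j := fun j => by
    simp only [hσ]; split_ifs with h0
    · rw [abs_of_nonneg h0, mul_one]
    · rw [abs_of_neg (not_le.1 h0)]; ring
  have hσσ : ∀ j, σ j * σ j = 1 := fun j => by simp only [hσ]; split_ifs <;> norm_num
  set y : Fin p → Fin p → ℝ := fun j => σ j • Pi.single j (1 : ℝ) with hy
  obtain ⟨J, hJ⟩ := exists_sum_le_mean β (fun j => |x j| / l1 x)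
    (fun j => div_nonneg (abs_nonneg _) hl.le)
    (by rw [← Finset.sum_div]; exact div_self hl.ne') y d 0
  have hxbar : ∑ j, (|x j| / l1 x) • y j = (l1 x)⁻¹ • x := by
    ext i
    simp only [hy, Finset.sum_apply, Pi.smul_apply, smul_eq_mul, Pi.single_apply]
    rw [Finset.sum_eq_single i (fun j _ hj => by simp [hj.symm]) (by simp)]
    simp only [if_true, mul_one]
    rw [div_mul_eq_mul_div, hσx]; ring
  have hpos : 0 ≤ β (0 + ∑ i, y (J i)) (0 + ∑ i, y (J i)) := by
    have := h fun i => (J i, decide (0 ≤ x (J i)))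
    have e : signedSum (fun i => (J i, decide (0 ≤ x (J i)))) = 0 + ∑ i, y (J i) := by
      rw [zero_add]
      refine Finset.sum_congr rfl fun i _ => ?_
      simp [hy, hσ]
    rwa [e] at this
  have hα : ∑ j, |x j| / l1 x * β (y j) (y j) ≤ a := by
    calc _ ≤ ∑ j, |x j| / l1 x * a := by
          refine Finset.sum_le_sum fun j _ =>
            mul_le_mul_of_nonneg_left ?_ (div_nonneg (abs_nonneg _) hl.le)
          simp only [hy, map_smul, LinearMap.smul_apply, smul_eq_mul]
          rw [← mul_assoc, hσσ, one_mul]; exact ha j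
      _ = a := by
          rw [← Finset.sum_mul, ← Finset.sum_div]
          rw [show ∑ i, |x i| = l1 x from rfl, div_self hl.ne', one_mul]
  rw [hxbar] at hJ
  simp only [map_zero, LinearMap.zero_apply, map_smul, LinearMap.smul_apply, smul_eq_mul,
    mul_zero, add_zero, zero_add] at hJ hpos
  have hd0 : (0 : ℝ) < d := by exact_mod_cast hd
  have h1 := hpos.trans hJ
  have h2 : 0 ≤ d * ((d - 1) * ((l1 x)⁻¹ * ((l1 x)⁻¹ * β x x)) + a) := by
    have := mul_le_mul_of_nonneg_left hα hd0.le
    nlinarith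
  have h3 : 0 ≤ (d - 1) * ((l1 x)⁻¹ * ((l1 x)⁻¹ * β x x)) + a := by
    by_contra hcon
    push Not at hcon
    nlinarith [mul_neg_of_pos_of_neg hd0 hcon]
  have h4 := mul_nonneg (sq_nonneg (l1 x)) h3
  have h5 : l1 x ^ 2 * ((d - 1) * ((l1 x)⁻¹ * ((l1 x)⁻¹ * β x x)) + a)
      = (d - 1) * β x x + a * l1 x ^ 2 := by field_simp
  linarith

end Maurey

/-! ### Population quantities -/

lemma integrable_and_integral_le_of_lintegral {α : Type*} [MeasurableSpace α] {μ : Measure α}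
    {g : α → ℝ} (hg : Measurable g) (h0 : ∀ x, 0 ≤ g x) {c : ℝ} (hc : 0 ≤ c)
    (h : ∫⁻ x, ENNReal.ofReal (g x) ∂μ ≤ ENNReal.ofReal c) :
    Integrable g μ ∧ ∫ x, g x ∂μ ≤ c := by
  have hi : Integrable g μ := by
    refine ⟨hg.aestronglyMeasurable, ?_⟩
    rw [hasFiniteIntegral_iff_ofReal (ae_of_all _ h0)]
    exact h.trans_lt ENNReal.ofReal_lt_top
  refine ⟨hi, ?_⟩
  rw [integral_eq_lintegral_of_nonneg_ae (ae_of_all _ h0) hg.aestronglyMeasurable]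
  exact ENNReal.toReal_le_of_le_ofReal hc h

lemma form_integral {p : ℕ} {α : Type*} [MeasurableSpace α] {μ : Measure α} {f g : α → Fin p → ℝ}
    (h : ∀ i j, Integrable (fun z => f z i * g z j) μ) (u w : Fin p → ℝ) :
    u ⬝ᵥ ((Matrix.of fun i j => ∫ z, f z i * g z j ∂μ) *ᵥ w)
      = ∫ z, (u ⬝ᵥ f z) * (w ⬝ᵥ g z) ∂μ := by
  have : ∀ z, (u ⬝ᵥ f z) * (w ⬝ᵥ g z) = ∑ i, ∑ j, u i * w j * (f z i * g z j) := fun z => by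
    simp only [dotProduct, Finset.sum_mul_sum]
    exact Finset.sum_congr rfl fun i _ => Finset.sum_congr rfl fun j _ => by ring
  simp only [this]
  rw [integral_finsetSum _ fun i _ => integrable_finsetSum _ fun j _ => (h i j).const_mul _]
  simp only [dotProduct, mulVec, of_apply, Finset.mul_sum]
  refine Finset.sum_congr rfl fun i _ => ?_
  rw [integral_finsetSum _ fun j _ => (h i j).const_mul _]
  refine Finset.sum_congr rfl fun j _ => ?_
  rw [integral_const_mul]
  ring

lemma integrable_bdd_mul {α : Type*} [MeasurableSpace α] {μ : Measure α} {u g : α → ℝ}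
    (hg : Integrable g μ) (hu : Measurable u) {c : ℝ} (hb : ∀ᵐ x ∂μ, |u x| ≤ c) :
    Integrable (fun x => u x * g x) μ :=
  hg.bdd_mul (c := c) hu.aestronglyMeasurable hb

lemma integrable_of_abs_le {α : Type*} [MeasurableSpace α] {μ : Measure α} [IsFiniteMeasure μ]
    {u : α → ℝ} (hu : Measurable u) {c : ℝ} (hb : ∀ᵐ x ∂μ, |u x| ≤ c) : Integrable u μ :=
  .of_bound hu.aestronglyMeasurable c hb

namespace Model

variable {p : ℕ} (M : Model p)

instance : IsProbabilityMeasure M.PX := M.probX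

instance : IsProbabilityMeasure M.Pε := M.probε

lemma measurable_pair : Measurable fun z : (Fin p → ℝ) × ℝ => (z.1, M.f z.1 + z.2) := by
  have := M.measurable_f
  fun_prop

instance : IsProbabilityMeasure M.PXY :=
  Measure.isProbabilityMeasure_map M.measurable_pair.aemeasurable

lemma map_fst_PXY : M.PXY.map Prod.fst = M.PX := by
  rw [PXY, Measure.map_map measurable_fst M.measurable_pair]
  exact Measure.map_fst_prod.trans (by simp)

lemma ae_fst_PXY {q : (Fin p → ℝ) → Prop} (h : ∀ᵐ x ∂M.PX, q x) : ∀ᵐ z ∂M.PXY, q z.1 := by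
  rw [← M.map_fst_PXY] at h
  exact ae_of_ae_map measurable_fst.aemeasurable h

lemma integral_fst_PXY {g : (Fin p → ℝ) → ℝ} (hg : Measurable g) :
    ∫ z, g z.1 ∂M.PXY = ∫ x, g x ∂M.PX := by
  rw [← M.map_fst_PXY, integral_map measurable_fst.aemeasurable hg.aestronglyMeasurable]

lemma integrable_fst_PXY {g : (Fin p → ℝ) → ℝ} (hg : Integrable g M.PX) :
    Integrable (fun z => g z.1) M.PXY := by
  rw [← M.map_fst_PXY] at hg
  exact hg.comp_measurable measurable_fst

/-- The residual `Y - Xᵀθ`. -/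
def resid (z : Obs p) : ℝ := z.2 - z.1 ⬝ᵥ M.θ

lemma measurable_dotProduct (t : Fin p → ℝ) : Measurable fun x : Fin p → ℝ => x ⬝ᵥ t := by
  unfold dotProduct; fun_prop

lemma measurable_resid : Measurable M.resid := by
  unfold resid
  exact measurable_snd.sub ((measurable_dotProduct M.θ).comp measurable_fst)

lemma measurable_eta : Measurable M.eta := by
  unfold eta
  exact M.measurable_f.sub (measurable_dotProduct M.θ)

lemma integral_PXY {g : Obs p → ℝ} (hg : Measurable g) :
    ∫ z, g z ∂M.PXY = ∫ z, g (z.1, M.f z.1 + z.2) ∂(M.PX.prod M.Pε) := by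
  rw [PXY, integral_map M.measurable_pair.aemeasurable hg.aestronglyMeasurable]

lemma integrable_PXY {g : Obs p → ℝ} (hg : Measurable g)
    (h : Integrable (fun z : (Fin p → ℝ) × ℝ => g (z.1, M.f z.1 + z.2)) (M.PX.prod M.Pε)) :
    Integrable g M.PXY := by
  rw [PXY, integrable_map_measure hg.aestronglyMeasurable M.measurable_pair.aemeasurable]
  exact h

lemma resid_pair (x : Fin p → ℝ) (e : ℝ) : M.resid (x, M.f x + e) = M.eta x + e := by
  simp only [resid, eta]; ring

lemma memLp_dotProduct (t : Fin p → ℝ) : MemLp (fun x : Fin p → ℝ => x ⬝ᵥ t) 2 M.PX := by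
  unfold dotProduct
  refine memLp_finsetSum _ fun j _ => ?_
  simp only [mul_comm _ (t j)]
  exact (M.memLp_X j).const_mul _

lemma memLp_eta : MemLp M.eta 2 M.PX := M.memLp_f.sub (M.memLp_dotProduct M.θ)

/-- The normal equations `E(X η) = 0`. -/
lemma integral_mul_eta (j : Fin p) : ∫ x, x j * M.eta x ∂M.PX = 0 := by
  have hi : Integrable (fun x => x j * M.eta x) M.PX := (M.memLp_X j).integrable_mul M.memLp_eta
  have h2 := (M.memLp_X j).integrable_sq
  have he := M.memLp_eta.integrable_sq
  have key : |∫ x, x j * M.eta x ∂M.PX| ≤ 0 := by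
    refine abs_le_of_forall_quadratic (b := ∫ x, x j ^ 2 ∂M.PX)
      (integral_nonneg fun x => sq_nonneg _) fun t => ?_
    have h1 := M.isMinOn_θ (Set.mem_univ (M.θ + Pi.single j t))
    simp only [Set.mem_ofPred_eq] at h1
    have e1 : ∫ x, (M.f x - x ⬝ᵥ (M.θ + Pi.single j t)) ^ 2 ∂M.PX
        = ∫ x, M.eta x ^ 2 ∂M.PX - 2 * t * ∫ x, x j * M.eta x ∂M.PX
          + t ^ 2 * ∫ x, x j ^ 2 ∂M.PX := by
      have i1 : Integrable (fun x => M.eta x ^ 2 - 2 * t * (x j * M.eta x)) M.PX :=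
        he.sub (hi.const_mul _)
      rw [← integral_const_mul, ← integral_const_mul, ← integral_sub he (hi.const_mul _),
        ← integral_add i1 (h2.const_mul _)]
      congr 1; ext x
      rw [dotProduct_add, dotProduct_single, eta]; ring
    rw [e1] at h1
    have e2 : ∫ x, (M.f x - x ⬝ᵥ M.θ) ^ 2 ∂M.PX = ∫ x, M.eta x ^ 2 ∂M.PX := rfl
    rw [e2] at h1
    linarith
  exact abs_eq_zero.1 (le_antisymm key (abs_nonneg _))

end Model

lemma Assumptions.mono {p n : ℕ} {c₀ C c₀' C' δ : ℝ} {M : Model p} {P : Params}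
    (h : Assumptions c₀ C δ M n P) (hc : c₀' ≤ c₀) (hC : C ≤ C') :
    Assumptions c₀' C' δ M n P where
  subGaussian := by
    obtain ⟨R, h1, h2, h3⟩ := h.subGaussian
    exact ⟨R, h1, h2, fun u hu q hq => (h3 u hu q hq).trans (by gcongr)⟩
  eig_Sigma u := (mul_le_mul_of_nonneg_right hc (sq_nonneg _)).trans (h.eig_Sigma u)
  diag_Sigma j := (h.diag_Sigma j).trans hC
  bounded_X := h.bounded_X
  Φ_nonneg := h.Φ_nonneg
  Φ_le := h.Φ_le.trans hC
  eta_sq := h.eta_sq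
  one_le_s := h.one_le_s
  sparse_θ := h.sparse_θ
  s_log_le := h.s_log_le.trans (by gcongr)
  eig_M3 u := (mul_le_mul_of_nonneg_right hc (sq_nonneg _)).trans (h.eig_M3 u)
  workErr_sq j := (h.workErr_sq j).trans (by gcongr)
  bounded_m := by filter_upwards [h.bounded_m] with x hx using hx.trans hC
  c_nonneg := h.c_nonneg
  one_le_sB := h.one_le_sB
  sparse_B := h.sparse_B
  l1_B := h.l1_B
  sparse_Omega := h.sparse_Omega
  l1_Omega := h.l1_Omega
  moment_ε := h.moment_ε.trans (by gcongr)
  moment_η := h.moment_η.trans (by gcongr)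
  fourth_ε := h.fourth_ε.trans (by gcongr)
  fourth_η := h.fourth_η.trans (by gcongr)

lemma isUnit_det_of_form {p : ℕ} {A : Matrix (Fin p) (Fin p) ℝ} {c : ℝ} (hc : 0 < c)
    (h : ∀ u : Fin p → ℝ, c * l2 u ^ 2 ≤ u ⬝ᵥ (A *ᵥ u)) : IsUnit A.det := by
  rw [isUnit_iff_ne_zero]
  intro h0
  obtain ⟨v, hv, hv0⟩ := Matrix.exists_mulVec_eq_zero_iff.2 h0
  have := h v
  rw [hv0, dotProduct_zero] at this
  have h2 := l2_pos hv
  nlinarith [mul_pos hc (pow_pos h2 2)]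

namespace Assumptions

variable {p n : ℕ} {B δ : ℝ} {M : Model p} {P : Params}

lemma K_bound_fst (hA : Assumptions (1 / B) B δ M n P) :
    ∀ᵐ z ∂M.PXY, ∀ j, |z.1 j| ≤ P.K := M.ae_fst_PXY hA.bounded_X

lemma m_bound_fst (hA : Assumptions (1 / B) B δ M n P) :
    ∀ᵐ z ∂M.PXY, |M.m z.1| ≤ B := M.ae_fst_PXY hA.bounded_m

lemma integrable_coord (hA : Assumptions (1 / B) B δ M n P) (j : Fin p) :
    Integrable (fun x : Fin p → ℝ => x j) M.PX :=
  integrable_of_abs_le (measurable_pi_apply j)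
    (by filter_upwards [hA.bounded_X] with x hx using hx j)

lemma integrable_coord_mul (hA : Assumptions (1 / B) B δ M n P) (j k : Fin p) :
    Integrable (fun x : Fin p → ℝ => x j * x k) M.PX :=
  integrable_bdd_mul (hA.integrable_coord k) (measurable_pi_apply j)
    (by filter_upwards [hA.bounded_X] with x hx using hx j)

lemma form_Sigma (hA : Assumptions (1 / B) B δ M n P) (u w : Fin p → ℝ) :
    u ⬝ᵥ (M.Sigma *ᵥ w) = ∫ x, (x ⬝ᵥ u) * (x ⬝ᵥ w) ∂M.PX := by
  rw [Model.Sigma, form_integral (f := fun x => x) (g := fun x => x) hA.integrable_coord_mul]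
  simp only [dotProduct_comm]

lemma Sigma_symm (M : Model p) : M.Sigmaᵀ = M.Sigma := by
  ext i j
  simp only [Model.Sigma, transpose_apply, of_apply, mul_comm]

lemma Omega_symm (M : Model p) : M.Omegaᵀ = M.Omega := by
  rw [Model.Omega, transpose_nonsing_inv, Sigma_symm]

lemma M3_symm (M : Model p) : M.M3ᵀ = M.M3 := by
  ext i j
  simp only [Model.M3, transpose_apply, of_apply, mul_comm]

lemma Sigma_det (hB : 1 ≤ B) (hA : Assumptions (1 / B) B δ M n P) : IsUnit M.Sigma.det :=
  isUnit_det_of_form (by positivity) hA.eig_Sigma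

lemma M3_det (hB : 1 ≤ B) (hA : Assumptions (1 / B) B δ M n P) : IsUnit M.M3.det :=
  isUnit_det_of_form (by positivity) hA.eig_M3

lemma Sigma_mul_Omega (hB : 1 ≤ B) (hA : Assumptions (1 / B) B δ M n P) :
    M.Sigma * M.Omega = 1 := mul_nonsing_inv _ (hA.Sigma_det hB)

lemma l2_single (j : Fin p) : l2 (Pi.single j (1 : ℝ)) ^ 2 = 1 := by
  rw [l2_sq, Finset.sum_eq_single j] <;> simp +contextual

lemma Sigma_diag_ge (hA : Assumptions (1 / B) B δ M n P) (j : Fin p) : 1 / B ≤ M.Sigma j j := by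
  have := hA.eig_Sigma (Pi.single j 1)
  rwa [l2_single, mul_one, single_one_dotProduct, mulVec_single_one, col_apply] at this

lemma Sigma_diag (M : Model p) (j : Fin p) : M.Sigma j j = ∫ x, x j ^ 2 ∂M.PX := by
  simp only [Model.Sigma, of_apply, sq]

lemma K_nonneg (hA : Assumptions (1 / B) B δ M n P) (j : Fin p) : 0 ≤ P.K := by
  obtain ⟨x, hx⟩ := hA.bounded_X.exists
  exact (abs_nonneg _).trans (hx j)

lemma K_sq_ge (hA : Assumptions (1 / B) B δ M n P) (j : Fin p) : 1 / B ≤ P.K ^ 2 := by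
  refine (hA.Sigma_diag_ge j).trans ?_
  rw [Sigma_diag]
  have : ∫ x : Fin p → ℝ, x j ^ 2 ∂M.PX ≤ ∫ _x, P.K ^ 2 ∂M.PX := by
    refine integral_mono_ae (M.memLp_X j).integrable_sq (integrable_const _) ?_
    filter_upwards [hA.bounded_X] with x hx
    rw [← sq_abs]
    exact pow_le_pow_left₀ (abs_nonneg _) (hx j) 2
  simpa using this

lemma K_ge (hB : 1 ≤ B) (hA : Assumptions (1 / B) B δ M n P) (j : Fin p) : 1 / B ≤ P.K := by
  have h1 := hA.K_sq_ge j
  have h2 := hA.K_nonneg j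
  have h3 : 1 / B ≤ 1 := by rw [div_le_one (by positivity)]; exact hB
  by_contra hcon
  push Not at hcon
  have h4 : 0 < 1 / B := by positivity
  nlinarith

lemma K_pos (hB : 1 ≤ B) (hA : Assumptions (1 / B) B δ M n P) (j : Fin p) : 0 < P.K :=
  lt_of_lt_of_le (by positivity) (hA.K_ge hB j)

/-- The fourth moment of a linear form of `X`. -/
lemma fourth_dotProduct (hB : 1 ≤ B) (hA : Assumptions (1 / B) B δ M n P) (u : Fin p → ℝ) :
    ∫ x, (x ⬝ᵥ u) ^ 4 ∂M.PX ≤ 16 * B ^ 4 * (u ⬝ᵥ (M.Sigma *ᵥ u)) ^ 2 := by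
  obtain ⟨R, hR, hRR, hsub⟩ := hA.subGaussian
  by_cases hu : u = 0
  · simp [hu]
  have hRt : Rᵀ = R := by
    have := hR.isHermitian.eq
    rwa [conjTranspose_eq_transpose_of_trivial] at this
  have hRdet : IsUnit R.det := hR.det_pos.ne'.isUnit
  have hSig : M.Sigma = R⁻¹ * R⁻¹ := by
    rw [← Matrix.mul_inv_rev, hRR, nonsing_inv_nonsing_inv _ (hA.Sigma_det hB)]
  set y := R⁻¹ *ᵥ u with hy
  have hyS : l2 y ^ 2 = u ⬝ᵥ (M.Sigma *ᵥ u) := by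
    have h1 : l2 y ^ 2 = y ⬝ᵥ y := by rw [l2_sq]; simp only [dotProduct, sq]
    have h2 : y = u ᵥ* R⁻¹ := by
      rw [hy, ← vecMul_transpose, transpose_nonsing_inv, hRt]
    rw [h1, hSig, ← mulVec_mulVec, dotProduct_mulVec u, ← h2]
  set S := u ⬝ᵥ (M.Sigma *ᵥ u) with hS
  have hSpos : 0 < S := lt_of_lt_of_le
    (mul_pos (by positivity) (pow_pos (l2_pos hu) 2)) (hA.eig_Sigma u)
  have hl : 0 < l2 y := by
    rcases (l2_nonneg y).eq_or_lt with h0 | h0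
    · rw [← h0] at hyS; simp at hyS; linarith
    · exact h0
  have hunit : l2 ((l2 y)⁻¹ • y) = 1 := by
    have : l2 ((l2 y)⁻¹ • y) ^ 2 = 1 := by
      rw [l2_sq]
      simp only [Pi.smul_apply, smul_eq_mul, mul_pow, ← Finset.mul_sum]
      rw [← l2_sq]; field_simp
    exact (pow_eq_one_iff_of_nonneg (l2_nonneg _) two_ne_zero).1 this
  have h4 := hsub _ hunit 4 (by norm_num)
  have hfun : ∀ x : Fin p → ℝ, ((l2 y)⁻¹ • y) ⬝ᵥ (R *ᵥ x) = (l2 y)⁻¹ * (x ⬝ᵥ u) := fun x => by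
    rw [smul_dotProduct, smul_eq_mul, dotProduct_mulVec, hy]
    congr 1
    rw [← mulVec_transpose, hRt, mulVec_mulVec, mul_nonsing_inv _ hRdet, one_mulVec,
      dotProduct_comm]
  simp only [hfun] at h4
  have hbd : ∀ᵐ x ∂M.PX, |x ⬝ᵥ u| ≤ l1 u * P.K := by
    filter_upwards [hA.bounded_X] with x hx
    rw [dotProduct_comm]; exact abs_dotProduct_le hx
  have hmem : MemLp (fun x : Fin p → ℝ => (l2 y)⁻¹ * (x ⬝ᵥ u)) (ENNReal.ofReal 4) M.PX :=
    (MemLp.of_bound (Model.measurable_dotProduct u).aestronglyMeasurable _ hbd).const_mul _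
  rw [hmem.eLpNorm_eq_integral_rpow_norm (by simp) (by simp),
    ENNReal.ofReal_le_ofReal_iff (by positivity), ENNReal.toReal_ofReal (by norm_num)] at h4
  have h5 : (4 : ℝ) = ((4 : ℕ) : ℝ) := by norm_num
  have hsq : √(4 : ℝ) = 2 := by
    rw [show (4 : ℝ) = 2 ^ 2 by norm_num, Real.sqrt_sq (by norm_num)]
  have hnn : 0 ≤ ∫ x : Fin p → ℝ, ‖(l2 y)⁻¹ * (x ⬝ᵥ u)‖ ^ (4 : ℝ) ∂M.PX :=
    integral_nonneg fun x => by positivity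
  rw [hsq, Real.rpow_inv_le_iff_of_pos hnn (by positivity) (by norm_num)] at h4
  have h6 : ∀ x : Fin p → ℝ, ‖(l2 y)⁻¹ * (x ⬝ᵥ u)‖ ^ (4 : ℝ) = (l2 y ^ 4)⁻¹ * (x ⬝ᵥ u) ^ 4 :=
    fun x => by
      rw [h5, Real.rpow_natCast, Real.norm_eq_abs, ← abs_pow, abs_of_nonneg (by positivity),
        mul_pow, inv_pow]
  simp only [h6, integral_const_mul] at h4
  rw [h5, Real.rpow_natCast, inv_mul_le_iff₀ (by positivity)] at h4
  calc _ ≤ l2 y ^ 4 * (B * 2) ^ 4 := h4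
    _ = 16 * B ^ 4 * (l2 y ^ 2) ^ 2 := by ring
    _ = _ := by rw [hyS]

lemma Sigma_diag_le (hA : Assumptions (1 / B) B δ M n P) (j : Fin p) : M.Sigma j j ≤ B :=
  hA.diag_Sigma j

lemma integrable_pow_coord (hA : Assumptions (1 / B) B δ M n P) (j : Fin p) (k : ℕ) :
    Integrable (fun x : Fin p → ℝ => x j ^ k) M.PX :=
  integrable_of_abs_le ((measurable_pi_apply j).pow_const k) (c := P.K ^ k)
    (by filter_upwards [hA.bounded_X] with x hx
        rw [abs_pow]; exact pow_le_pow_left₀ (abs_nonneg _) (hx j) k)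

lemma fourth_coord (hB : 1 ≤ B) (hA : Assumptions (1 / B) B δ M n P) (j : Fin p) :
    ∫ x, x j ^ 4 ∂M.PX ≤ 16 * B ^ 6 := by
  have := hA.fourth_dotProduct hB (Pi.single j 1)
  simp only [dotProduct_single_one, single_one_dotProduct, mulVec_single_one, col_apply] at this
  refine this.trans ?_
  have h1 := hA.Sigma_diag_le j
  have h2 : 0 ≤ M.Sigma j j := by rw [Sigma_diag]; exact integral_nonneg fun x => sq_nonneg _
  calc _ ≤ 16 * B ^ 4 * B ^ 2 := by gcongr
    _ = _ := by ring

lemma coord_mul_sq (hB : 1 ≤ B) (hA : Assumptions (1 / B) B δ M n P) (j k : Fin p) :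
    ∫ x, (x j * x k) ^ 2 ∂M.PX ≤ 16 * B ^ 6 := by
  have h : ∫ x, (x j * x k) ^ 2 ∂M.PX ≤ ∫ x, (x j ^ 4 / 2 + x k ^ 4 / 2) ∂M.PX := by
    refine integral_mono_of_nonneg (ae_of_all _ fun x => sq_nonneg _)
      (((hA.integrable_pow_coord j 4).div_const 2).add ((hA.integrable_pow_coord k 4).div_const 2))
      (ae_of_all _ fun x => ?_)
    simp only
    nlinarith [sq_nonneg (x j ^ 2 - x k ^ 2)]
  rw [integral_add ((hA.integrable_pow_coord j 4).div_const 2)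
    ((hA.integrable_pow_coord k 4).div_const 2), integral_div, integral_div] at h
  linarith [hA.fourth_coord hB j, hA.fourth_coord hB k]

end Assumptions

lemma abs_add_rpow_le (x y : ℝ) {q : ℝ} (hq : 0 ≤ q) :
    |x + y| ^ q ≤ 2 ^ q * (|x| ^ q + |y| ^ q) := by
  have h1 : |x + y| ≤ 2 * max |x| |y| := by
    refine (abs_add_le _ _).trans ?_
    linarith [le_max_left |x| |y|, le_max_right |x| |y|]
  calc |x + y| ^ q ≤ (2 * max |x| |y|) ^ q := Real.rpow_le_rpow (abs_nonneg _) h1 hq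
    _ = 2 ^ q * max |x| |y| ^ q := Real.mul_rpow (by norm_num) (le_max_of_le_left (abs_nonneg _))
    _ ≤ _ := by
      gcongr
      have hx : 0 ≤ |x| ^ q := by positivity
      have hy : 0 ≤ |y| ^ q := by positivity
      rcases le_total |x| |y| with h | h
      · rw [max_eq_right h]; linarith
      · rw [max_eq_left h]; linarith

namespace Model

variable {p : ℕ} (M : Model p)

/-- The fitted value `B_{·k}ᵀ T₂` of the working regression. -/
def workFit (k : Fin p) (x : Fin p → ℝ) : ℝ := (fun l => M.B l k) ⬝ᵥ M.T2 x

lemma workErr_eq (z : Obs p) (k : Fin p) :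
    M.workErr z k = z.1 k * M.resid z - M.workFit k z.1 := rfl

lemma measurable_T2 (l : Fin p) : Measurable fun x => M.T2 x l := by
  unfold T2
  exact ((measurable_pi_apply l).mul M.measurable_m).sub_const _

lemma measurable_workFit (k : Fin p) : Measurable (M.workFit k) := by
  unfold workFit dotProduct
  exact Finset.measurable_sum _ fun l _ => (M.measurable_T2 l).const_mul _

lemma measurable_workErr (k : Fin p) : Measurable fun z => M.workErr z k := by
  simp only [workErr_eq]
  exact (((measurable_pi_apply k).comp measurable_fst).mul M.measurable_resid).sub
    ((M.measurable_workFit k).comp measurable_fst)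

end Model

namespace Assumptions

variable {p n : ℕ} {B δ : ℝ} {M : Model p} {P : Params}

lemma eta_sq_le (hA : Assumptions (1 / B) B δ M n P) : ∫ x, M.eta x ^ 2 ∂M.PX ≤ P.Φ ^ 2 :=
  (integrable_and_integral_le_of_lintegral (M.measurable_eta.pow_const 2) (fun _ => sq_nonneg _)
    (sq_nonneg _) hA.eta_sq).2

lemma noise_fourth (hB : 1 ≤ B) (hA : Assumptions (1 / B) B δ M n P) :
    Integrable (fun e : ℝ => e ^ 4) M.Pε ∧ ∫ e, e ^ 4 ∂M.Pε ≤ B :=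
  integrable_and_integral_le_of_lintegral (by fun_prop) (fun x => by positivity)
    (by linarith) hA.fourth_ε

lemma eta_fourth (hB : 1 ≤ B) (hA : Assumptions (1 / B) B δ M n P) :
    Integrable (fun x => M.eta x ^ 4) M.PX ∧ ∫ x, M.eta x ^ 4 ∂M.PX ≤ B :=
  integrable_and_integral_le_of_lintegral (M.measurable_eta.pow_const 4) (fun x => by positivity)
    (by linarith) hA.fourth_η

lemma noiseVar_nonneg (M : Model p) : 0 ≤ M.noiseVar := integral_nonneg fun _ => sq_nonneg _

lemma noiseVar_le (hB : 1 ≤ B) (hA : Assumptions (1 / B) B δ M n P) : M.noiseVar ≤ B := by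
  have h := hA.noise_fourth hB
  have h1 : M.noiseVar ≤ ∫ e, (1 / 2 + e ^ 4 / 2) ∂M.Pε := by
    refine integral_mono M.memLp_ε.integrable_sq
      ((integrable_const _).add (h.1.div_const 2)) fun e => ?_
    simp only
    nlinarith [sq_nonneg (e ^ 2 - 1)]
  rw [integral_add (integrable_const _) (h.1.div_const 2),
    integral_div 2 fun e : ℝ => e ^ 4] at h1
  simp at h1
  linarith [h.2]

lemma kappa_sq_le (hB : 1 ≤ B) (hA : Assumptions (1 / B) B δ M n P) :
    M.noiseVar + P.Φ ^ 2 ≤ 2 * B ^ 2 := by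
  have h1 := hA.noiseVar_le hB
  have h2 : P.Φ ^ 2 ≤ B ^ 2 := pow_le_pow_left₀ hA.Φ_nonneg hA.Φ_le 2
  nlinarith

lemma memLp_eta_prod (M : Model p) :
    MemLp (fun z : (Fin p → ℝ) × ℝ => M.eta z.1) 2 (M.PX.prod M.Pε) :=
  M.memLp_eta.comp_fst M.Pε

lemma memLp_eps_prod (M : Model p) :
    MemLp (fun z : (Fin p → ℝ) × ℝ => z.2) 2 (M.PX.prod M.Pε) :=
  MemLp.comp_snd (f := fun e : ℝ => e) M.memLp_ε M.PX

lemma memLp_resid (M : Model p) : MemLp M.resid 2 M.PXY := by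
  refine (memLp_map_measure_iff M.measurable_resid.aestronglyMeasurable
    M.measurable_pair.aemeasurable).2 ?_
  refine ((memLp_eta_prod M).add (memLp_eps_prod M)).congr_norm ?_ (ae_of_all _ fun z => ?_)
  · exact (M.measurable_resid.comp M.measurable_pair).aestronglyMeasurable
  · simp only [Function.comp, Model.resid_pair, Pi.add_apply]

lemma integrable_resid (M : Model p) : Integrable M.resid M.PXY :=
  (memLp_resid M).integrable one_le_two

lemma integrable_resid_sq (M : Model p) : Integrable (fun z => M.resid z ^ 2) M.PXY :=
  (memLp_resid M).integrable_sq

lemma resid_sq_le (hA : Assumptions (1 / B) B δ M n P) :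
    ∫ z, M.resid z ^ 2 ∂M.PXY ≤ M.noiseVar + P.Φ ^ 2 := by
  rw [M.integral_PXY (M.measurable_resid.pow_const 2)]
  simp only [Model.resid_pair]
  have i1 := (memLp_eta_prod M).integrable_sq
  have i2 := (memLp_eps_prod M).integrable_sq
  have i3 : Integrable (fun z : (Fin p → ℝ) × ℝ => M.eta z.1 * z.2) (M.PX.prod M.Pε) :=
    (memLp_eta_prod M).integrable_mul (memLp_eps_prod M)
  have e : ∀ z : (Fin p → ℝ) × ℝ, (M.eta z.1 + z.2) ^ 2
      = M.eta z.1 ^ 2 + 2 * (M.eta z.1 * z.2) + z.2 ^ 2 := fun z => by ring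
  simp only [e]
  have i4 : Integrable (fun z : (Fin p → ℝ) × ℝ => M.eta z.1 ^ 2 + 2 * (M.eta z.1 * z.2))
    (M.PX.prod M.Pε) := i1.add (i3.const_mul _)
  rw [integral_add i4 i2, integral_add i1 (i3.const_mul _), integral_const_mul,
    integral_prod_mul (fun x => M.eta x) (fun e : ℝ => e), M.mean_ε,
    integral_fun_fst (fun x => M.eta x ^ 2), integral_fun_snd (fun e : ℝ => e ^ 2)]
  simp only [probReal_univ, one_smul, mul_zero, add_zero]
  have := hA.eta_sq_le
  simp only [Model.noiseVar]
  linarith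

lemma resid_fourth (hB : 1 ≤ B) (hA : Assumptions (1 / B) B δ M n P) :
    Integrable (fun z => M.resid z ^ 4) M.PXY ∧ ∫ z, M.resid z ^ 4 ∂M.PXY ≤ 16 * B := by
  have h1 := hA.noise_fourth hB
  have h2 := hA.eta_fourth hB
  have i1 : Integrable (fun z : (Fin p → ℝ) × ℝ => M.eta z.1 ^ 4) (M.PX.prod M.Pε) :=
    h2.1.comp_fst M.Pε
  have i2 : Integrable (fun z : (Fin p → ℝ) × ℝ => z.2 ^ 4) (M.PX.prod M.Pε) :=
    h1.1.comp_snd M.PX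
  have hle : ∀ z : (Fin p → ℝ) × ℝ, (M.eta z.1 + z.2) ^ 4
      ≤ 8 * M.eta z.1 ^ 4 + 8 * z.2 ^ 4 := fun z => by
    set a := M.eta z.1
    have e1 : (a + z.2) ^ 2 ≤ 2 * (a ^ 2 + z.2 ^ 2) := by nlinarith [sq_nonneg (a - z.2)]
    have e2 := pow_le_pow_left₀ (sq_nonneg (a + z.2)) e1 2
    nlinarith [sq_nonneg (a ^ 2 - z.2 ^ 2)]
  have i3 : Integrable (fun z : (Fin p → ℝ) × ℝ => 8 * M.eta z.1 ^ 4 + 8 * z.2 ^ 4)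
    (M.PX.prod M.Pε) := (i1.const_mul _).add (i2.const_mul _)
  have i4 : Integrable (fun z : (Fin p → ℝ) × ℝ => (M.eta z.1 + z.2) ^ 4) (M.PX.prod M.Pε) := by
    refine integrable_of_abs_le_integrable i3 ?_ (ae_of_all _ fun z => ?_)
    · exact ((M.measurable_eta.comp measurable_fst).add measurable_snd).pow_const 4
    · rw [abs_of_nonneg (by positivity)]; exact hle z
  constructor
  · refine M.integrable_PXY (M.measurable_resid.pow_const 4) ?_
    simpa only [Model.resid_pair] using i4
  · rw [M.integral_PXY (M.measurable_resid.pow_const 4)]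
    simp only [Model.resid_pair]
    refine (integral_mono i4 i3 hle).trans ?_
    rw [integral_add (i1.const_mul _) (i2.const_mul _), integral_const_mul, integral_const_mul,
      integral_fun_fst (fun x => M.eta x ^ 4), integral_fun_snd (fun e : ℝ => e ^ 4)]
    simp only [probReal_univ, one_smul]
    linarith [h1.2, h2.2]

lemma resid_rpow (hB : 1 ≤ B) (hδ : 0 < δ) (hA : Assumptions (1 / B) B δ M n P) :
    Integrable (fun z => |M.resid z| ^ (2 + δ)) M.PXY ∧
      ∫ z, |M.resid z| ^ (2 + δ) ∂M.PXY ≤ 2 ^ (2 + δ) * (2 * B) := by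
  have h1 := integrable_and_integral_le_of_lintegral (μ := M.Pε)
    (g := fun e : ℝ => |e| ^ (2 + δ)) (by fun_prop) (fun x => by positivity)
    (by linarith) hA.moment_ε
  have h2 := integrable_and_integral_le_of_lintegral (μ := M.PX)
    (g := fun x => |M.eta x| ^ (2 + δ)) (M.measurable_eta.abs.pow_const _)
    (fun x => by positivity) (by linarith) hA.moment_η
  have i1 : Integrable (fun z : (Fin p → ℝ) × ℝ => |M.eta z.1| ^ (2 + δ)) (M.PX.prod M.Pε) :=
    h2.1.comp_fst M.Pε
  have i2 : Integrable (fun z : (Fin p → ℝ) × ℝ => |z.2| ^ (2 + δ)) (M.PX.prod M.Pε) :=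
    h1.1.comp_snd M.PX
  have i3 : Integrable (fun z : (Fin p → ℝ) × ℝ =>
    2 ^ (2 + δ) * (|M.eta z.1| ^ (2 + δ) + |z.2| ^ (2 + δ))) (M.PX.prod M.Pε) :=
    (i1.add i2).const_mul _
  have hle : ∀ z : (Fin p → ℝ) × ℝ, |M.eta z.1 + z.2| ^ (2 + δ)
      ≤ 2 ^ (2 + δ) * (|M.eta z.1| ^ (2 + δ) + |z.2| ^ (2 + δ)) := fun z =>
    abs_add_rpow_le _ _ (by positivity)
  have i4 : Integrable (fun z : (Fin p → ℝ) × ℝ => |M.eta z.1 + z.2| ^ (2 + δ))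
      (M.PX.prod M.Pε) := by
    refine integrable_of_abs_le_integrable i3 ?_ (ae_of_all _ fun z => ?_)
    · exact ((M.measurable_eta.comp measurable_fst).add measurable_snd).abs.pow_const _
    · rw [abs_of_nonneg (by positivity)]; exact hle z
  constructor
  · refine M.integrable_PXY (M.measurable_resid.abs.pow_const _) ?_
    simpa only [Model.resid_pair] using i4
  · rw [M.integral_PXY (M.measurable_resid.abs.pow_const _)]
    simp only [Model.resid_pair]
    refine (integral_mono i4 i3 hle).trans ?_
    rw [integral_const_mul, integral_add i1 i2,
      integral_fun_fst (fun x => |M.eta x| ^ (2 + δ)),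
      integral_fun_snd (fun e : ℝ => |e| ^ (2 + δ))]
    simp only [probReal_univ, one_smul]
    gcongr
    linarith [h1.2, h2.2]

lemma integrable_coord_resid (hA : Assumptions (1 / B) B δ M n P) (j : Fin p) :
    Integrable (fun z : Obs p => z.1 j * M.resid z) M.PXY :=
  integrable_bdd_mul (integrable_resid M) ((measurable_pi_apply j).comp measurable_fst)
    (by filter_upwards [hA.K_bound_fst] with z hz using hz j)

lemma integral_coord_resid (hA : Assumptions (1 / B) B δ M n P) (j : Fin p) :
    ∫ z, z.1 j * M.resid z ∂M.PXY = 0 := by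
  rw [M.integral_PXY (g := fun z => z.1 j * M.resid z)
    (((measurable_pi_apply j).comp measurable_fst).mul M.measurable_resid)]
  simp only [Model.resid_pair, mul_add]
  have i1 : Integrable (fun z : (Fin p → ℝ) × ℝ => z.1 j * M.eta z.1) (M.PX.prod M.Pε) :=
    Integrable.comp_fst (f := fun x : Fin p → ℝ => x j * M.eta x)
      ((M.memLp_X j).integrable_mul M.memLp_eta) M.Pε
  have i2 : Integrable (fun z : (Fin p → ℝ) × ℝ => z.1 j * z.2) (M.PX.prod M.Pε) :=
    (hA.integrable_coord j).mul_prod (M.memLp_ε.integrable one_le_two)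
  rw [integral_add i1 i2, integral_prod_mul (fun x : Fin p → ℝ => x j) (fun e : ℝ => e),
    M.mean_ε, integral_fun_fst (fun x : Fin p → ℝ => x j * M.eta x), M.integral_mul_eta]
  simp

lemma integrable_coord_m (hA : Assumptions (1 / B) B δ M n P) (j : Fin p) :
    Integrable (fun x : Fin p → ℝ => x j * M.m x) M.PX :=
  integrable_bdd_mul (integrable_of_abs_le M.measurable_m hA.bounded_m)
    (measurable_pi_apply j) (by filter_upwards [hA.bounded_X] with x hx using hx j)

lemma coord_m_bound (hA : Assumptions (1 / B) B δ M n P) :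
    ∀ᵐ x ∂M.PX, ∀ j, |x j * M.m x| ≤ P.K * B := by
  filter_upwards [hA.bounded_X, hA.bounded_m] with x h1 h2 j
  rw [abs_mul]
  exact mul_le_mul (h1 j) h2 (abs_nonneg _) ((abs_nonneg _).trans (h1 j))

lemma mu_bound (hA : Assumptions (1 / B) B δ M n P) (j : Fin p) : |M.mu j| ≤ P.K * B := by
  have h1 : |M.mu j| ≤ ∫ _x, P.K * B ∂M.PX :=
    abs_integral_le_integral_abs.trans (integral_mono_ae (hA.integrable_coord_m j).abs
      (integrable_const _) (by filter_upwards [hA.coord_m_bound] with x hx using hx j))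
  simpa using h1

lemma T2_bound (hA : Assumptions (1 / B) B δ M n P) :
    ∀ᵐ x ∂M.PX, ∀ j, |M.T2 x j| ≤ 2 * (P.K * B) := by
  filter_upwards [hA.coord_m_bound] with x hx j
  have := abs_sub (x j * M.m x) (M.mu j)
  simp only [Model.T2]
  linarith [hx j, hA.mu_bound j]

lemma integrable_T2 (hA : Assumptions (1 / B) B δ M n P) (j : Fin p) :
    Integrable (fun x => M.T2 x j) M.PX := (hA.integrable_coord_m j).sub (integrable_const _)

lemma integral_T2 (hA : Assumptions (1 / B) B δ M n P) (j : Fin p) :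
    ∫ x, M.T2 x j ∂M.PX = 0 := by
  simp only [Model.T2]
  rw [integral_sub (hA.integrable_coord_m j) (integrable_const _)]
  simp [Model.mu]

lemma LB_nonneg (hA : Assumptions (1 / B) B δ M n P) (j : Fin p) : 0 ≤ P.LB :=
  (l1_nonneg _).trans (hA.l1_B j)

lemma dotProduct_T2_bound (hA : Assumptions (1 / B) B δ M n P) (a : Fin p → ℝ) :
    ∀ᵐ x ∂M.PX, |a ⬝ᵥ M.T2 x| ≤ l1 a * (2 * (P.K * B)) := by
  filter_upwards [hA.T2_bound] with x hx
  exact abs_dotProduct_le hx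

lemma workFit_bound (hB : 1 ≤ B) (hA : Assumptions (1 / B) B δ M n P) :
    ∀ᵐ x ∂M.PX, ∀ k, |M.workFit k x| ≤ 2 * B * P.K * P.LB := by
  filter_upwards [hA.T2_bound] with x hx k
  refine (abs_dotProduct_le hx).trans ?_
  have := mul_le_mul_of_nonneg_right (hA.l1_B k)
    (mul_nonneg zero_le_two (mul_nonneg (hA.K_nonneg k) (by linarith : 0 ≤ B)))
  linarith

lemma integrable_dotProduct_T2 (hA : Assumptions (1 / B) B δ M n P) (a : Fin p → ℝ) :
    Integrable (fun x => a ⬝ᵥ M.T2 x) M.PX := by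
  unfold dotProduct
  exact integrable_finsetSum _ fun j _ => (hA.integrable_T2 j).const_mul _

lemma integral_dotProduct_T2 (hA : Assumptions (1 / B) B δ M n P) (a : Fin p → ℝ) :
    ∫ x, a ⬝ᵥ M.T2 x ∂M.PX = 0 := by
  unfold dotProduct
  rw [integral_finsetSum _ fun j _ => (hA.integrable_T2 j).const_mul _]
  simp [integral_const_mul, hA.integral_T2]

lemma integrable_T2_mul (hA : Assumptions (1 / B) B δ M n P) (i j : Fin p) :
    Integrable (fun x => M.T2 x i * M.T2 x j) M.PX :=
  integrable_bdd_mul (hA.integrable_T2 j) (M.measurable_T2 i)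
    (by filter_upwards [hA.T2_bound] with x hx using hx i)

lemma form_M3 (hA : Assumptions (1 / B) B δ M n P) (u w : Fin p → ℝ) :
    u ⬝ᵥ (M.M3 *ᵥ w) = ∫ x, (u ⬝ᵥ M.T2 x) * (w ⬝ᵥ M.T2 x) ∂M.PX :=
  form_integral hA.integrable_T2_mul u w

lemma integrable_T2_T1 (hA : Assumptions (1 / B) B δ M n P) (i j : Fin p) :
    Integrable (fun z : Obs p => M.T2 z.1 i * M.T1 z j) M.PXY :=
  integrable_bdd_mul (hA.integrable_coord_resid j) ((M.measurable_T2 i).comp measurable_fst)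
    (M.ae_fst_PXY (by filter_upwards [hA.T2_bound] with x hx using hx i))

lemma integrable_mixed (hA : Assumptions (1 / B) B δ M n P) (i j : Fin p) :
    Integrable (fun z : Obs p => z.1 i * z.1 j * M.m z.1 * M.resid z) M.PXY := by
  have : Integrable (fun z : Obs p => z.1 i * M.m z.1 * (z.1 j * M.resid z)) M.PXY :=
    integrable_bdd_mul (hA.integrable_coord_resid j)
      (((measurable_pi_apply i).mul M.measurable_m).comp measurable_fst)
      (M.ae_fst_PXY (by filter_upwards [hA.coord_m_bound] with x hx using hx i))
  refine this.congr (ae_of_all _ fun z => ?_)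
  simp only; ring

lemma M2_apply (hA : Assumptions (1 / B) B δ M n P) (i j : Fin p) :
    M.M2 i j = ∫ z, z.1 i * z.1 j * M.m z.1 * M.resid z ∂M.PXY := by
  have e : ∀ z : Obs p, M.T2 z.1 i * M.T1 z j
      = z.1 i * z.1 j * M.m z.1 * M.resid z - M.mu i * (z.1 j * M.resid z) := fun z => by
    simp only [Model.T2, Model.T1, Model.resid]; ring
  simp only [Model.M2, of_apply, e]
  rw [integral_sub (hA.integrable_mixed i j) ((hA.integrable_coord_resid j).const_mul _),
    integral_const_mul, hA.integral_coord_resid]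
  simp

lemma B_eq (hA : Assumptions (1 / B) B δ M n P) : M.B = M.M3⁻¹ * M.M2 := by
  rw [Model.B]
  congr 1
  ext i j
  rw [hA.M2_apply]; rfl

lemma M3_mul_B (hB : 1 ≤ B) (hA : Assumptions (1 / B) B δ M n P) : M.M3 * M.B = M.M2 := by
  rw [hA.B_eq, ← Matrix.mul_assoc, mul_nonsing_inv _ (hA.M3_det hB), Matrix.one_mul]

lemma Gam_eq (hA : Assumptions (1 / B) B δ M n P) (ψ : ℝ) (n' N : ℕ) :
    M.Gam ψ n' N = M.M1 - ((N : ℝ) * (2 * ψ - ψ ^ 2) / ((n' : ℝ) + N)) • (M.Bᵀ * M.M2) := by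
  rw [Model.Gam, hA.B_eq, transpose_mul, transpose_nonsing_inv, M3_symm]

lemma workErr_sq_le (hB : 1 ≤ B) (hA : Assumptions (1 / B) B δ M n P) (k : Fin p) :
    Integrable (fun z => M.workErr z k ^ 2) M.PXY ∧ ∫ z, M.workErr z k ^ 2 ∂M.PXY ≤ B :=
  integrable_and_integral_le_of_lintegral ((M.measurable_workErr k).pow_const 2)
    (fun _ => sq_nonneg _) (by linarith) (hA.workErr_sq k)

lemma integrable_workErr (hA : Assumptions (1 / B) B δ M n P) (k : Fin p) :
    Integrable (fun z => M.workErr z k) M.PXY := by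
  simp only [M.workErr_eq]
  exact (hA.integrable_coord_resid k).sub
    (M.integrable_fst_PXY (hA.integrable_dotProduct_T2 _))

lemma integral_workErr (hA : Assumptions (1 / B) B δ M n P) (k : Fin p) :
    ∫ z, M.workErr z k ∂M.PXY = 0 := by
  simp only [M.workErr_eq]
  rw [integral_sub (hA.integrable_coord_resid k)
    (M.integrable_fst_PXY (g := M.workFit k) (hA.integrable_dotProduct_T2 _)),
    hA.integral_coord_resid, M.integral_fst_PXY (M.measurable_workFit k)]
  simp only [Model.workFit, hA.integral_dotProduct_T2, sub_zero]

lemma integral_T2_workErr (hB : 1 ≤ B) (hA : Assumptions (1 / B) B δ M n P) (l k : Fin p) :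
    ∫ z, M.T2 z.1 l * M.workErr z k ∂M.PXY = 0 := by
  have hi : Integrable (fun x => M.T2 x l * M.workFit k x) M.PX :=
    integrable_bdd_mul (hA.integrable_dotProduct_T2 _) (M.measurable_T2 l)
      (by filter_upwards [hA.T2_bound] with x hx using hx l)
  have e : ∀ z : Obs p, M.T2 z.1 l * M.workErr z k
      = M.T2 z.1 l * M.T1 z k - M.T2 z.1 l * M.workFit k z.1 := fun z => by
    rw [M.workErr_eq, mul_sub]; rfl
  simp only [e]
  rw [integral_sub (hA.integrable_T2_T1 l k) (M.integrable_fst_PXY hi),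
    M.integral_fst_PXY (g := fun x => M.T2 x l * M.workFit k x)
      ((M.measurable_T2 l).mul (M.measurable_workFit k))]
  have h1 : ∫ z, M.T2 z.1 l * M.T1 z k ∂M.PXY = M.M2 l k := rfl
  have h2 : ∫ x, M.T2 x l * M.workFit k x ∂M.PX = (M.M3 * M.B) l k := by
    have := hA.form_M3 (Pi.single l 1) (fun i => M.B i k)
    simp only [single_one_dotProduct] at this
    simp only [Model.workFit]
    rw [← this]; rfl
  rw [h1, h2, hA.M3_mul_B hB, sub_self]

lemma integral_coord_m_workErr (hB : 1 ≤ B) (hA : Assumptions (1 / B) B δ M n P) (l k : Fin p) :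
    ∫ z, z.1 l * M.m z.1 * M.workErr z k ∂M.PXY = 0 := by
  have hi : Integrable (fun z : Obs p => M.T2 z.1 l * M.workErr z k) M.PXY :=
    integrable_bdd_mul (hA.integrable_workErr k) ((M.measurable_T2 l).comp measurable_fst)
      (M.ae_fst_PXY (by filter_upwards [hA.T2_bound] with x hx using hx l))
  have e : ∀ z : Obs p, z.1 l * M.m z.1 * M.workErr z k
      = M.T2 z.1 l * M.workErr z k + M.mu l * M.workErr z k := fun z => by
    simp only [Model.T2]; ring
  simp only [e]
  rw [integral_add hi ((hA.integrable_workErr k).const_mul _), integral_const_mul,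
    hA.integral_T2_workErr hB, hA.integral_workErr]
  simp

/-- Second moments of products of a linear form and the residual. -/
lemma dotProduct_resid_sq (hB : 1 ≤ B) (hA : Assumptions (1 / B) B δ M n P) (w : Fin p → ℝ) :
    Integrable (fun z : Obs p => ((z.1 ⬝ᵥ w) * M.resid z) ^ 2) M.PXY ∧
      ∫ z, ((z.1 ⬝ᵥ w) * M.resid z) ^ 2 ∂M.PXY ≤ 16 * B ^ 4 * (w ⬝ᵥ (M.Sigma *ᵥ w)) := by
  have hbd : ∀ᵐ x ∂M.PX, |x ⬝ᵥ w| ≤ l1 w * P.K := by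
    filter_upwards [hA.bounded_X] with x hx
    rw [dotProduct_comm]; exact abs_dotProduct_le hx
  have hm : Measurable fun z : Obs p => z.1 ⬝ᵥ w :=
    (Model.measurable_dotProduct w).comp measurable_fst
  have hi : Integrable (fun z : Obs p => ((z.1 ⬝ᵥ w) * M.resid z) ^ 2) M.PXY := by
    simp only [mul_pow]
    refine integrable_bdd_mul (integrable_resid_sq M) (hm.pow_const 2) (c := (l1 w * P.K) ^ 2) ?_
    filter_upwards [M.ae_fst_PXY hbd] with z hz
    rw [abs_pow]; exact pow_le_pow_left₀ (abs_nonneg _) hz 2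
  refine ⟨hi, ?_⟩
  by_cases hw : w = 0
  · simp [hw]
  set S := w ⬝ᵥ (M.Sigma *ᵥ w) with hS
  have hSpos : 0 < S := lt_of_lt_of_le
    (mul_pos (by positivity) (pow_pos (l2_pos hw) 2)) (hA.eig_Sigma w)
  have h4i : Integrable (fun x : Fin p → ℝ => (x ⬝ᵥ w) ^ 4) M.PX :=
    integrable_of_abs_le ((Model.measurable_dotProduct w).pow_const 4) (c := (l1 w * P.K) ^ 4)
      (by filter_upwards [hbd] with x hx
          rw [abs_pow]; exact pow_le_pow_left₀ (abs_nonneg _) hx 4)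
  have hr := hA.resid_fourth hB
  have h4 := hA.fourth_dotProduct hB w
  have h5 : Integrable (fun z : Obs p => (z.1 ⬝ᵥ w) ^ 4) M.PXY :=
    M.integrable_fst_PXY (g := fun x => (x ⬝ᵥ w) ^ 4) h4i
  have hle : ∫ z, ((z.1 ⬝ᵥ w) * M.resid z) ^ 2 ∂M.PXY
      ≤ ∫ z, ((2 * S)⁻¹ * (z.1 ⬝ᵥ w) ^ 4 + S / 2 * M.resid z ^ 4) ∂M.PXY := by
    refine integral_mono hi ((h5.const_mul _).add (hr.1.const_mul _)) fun z => ?_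
    simp only
    set a := z.1 ⬝ᵥ w
    set b := M.resid z
    have : (2 * S)⁻¹ * a ^ 4 + S / 2 * b ^ 4 - (a * b) ^ 2
        = (2 * S)⁻¹ * (a ^ 2 - S * b ^ 2) ^ 2 := by field_simp; ring
    have h0 : 0 ≤ (2 * S)⁻¹ * (a ^ 2 - S * b ^ 2) ^ 2 := by positivity
    linarith
  rw [integral_add (h5.const_mul _) (hr.1.const_mul _), integral_const_mul, integral_const_mul,
    M.integral_fst_PXY (g := fun x => (x ⬝ᵥ w) ^ 4)
      ((Model.measurable_dotProduct w).pow_const 4)] at hle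
  refine hle.trans ?_
  have e1 : (2 * S)⁻¹ * ∫ x, (x ⬝ᵥ w) ^ 4 ∂M.PX ≤ (2 * S)⁻¹ * (16 * B ^ 4 * S ^ 2) := by gcongr
  have e2 : S / 2 * ∫ z, M.resid z ^ 4 ∂M.PXY ≤ S / 2 * (16 * B) :=
    mul_le_mul_of_nonneg_left hr.2 (by positivity)
  have e3 : (2 * S)⁻¹ * (16 * B ^ 4 * S ^ 2) = 8 * B ^ 4 * S := by field_simp; ring
  have e4 : B ≤ B ^ 4 := le_self_pow₀ hB (by norm_num)
  rw [e3] at e1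
  nlinarith [mul_le_mul_of_nonneg_left e4 hSpos.le]

lemma coord_resid_sq (hB : 1 ≤ B) (hA : Assumptions (1 / B) B δ M n P) (j : Fin p) :
    Integrable (fun z : Obs p => (z.1 j * M.resid z) ^ 2) M.PXY ∧
      ∫ z, (z.1 j * M.resid z) ^ 2 ∂M.PXY ≤ 16 * B ^ 5 := by
  have := hA.dotProduct_resid_sq hB (Pi.single j 1)
  simp only [dotProduct_single_one, single_one_dotProduct, mulVec_single_one, col_apply] at this
  refine ⟨this.1, this.2.trans ?_⟩
  have h1 := hA.Sigma_diag_le j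
  calc _ ≤ 16 * B ^ 4 * B := by gcongr
    _ = _ := by ring

lemma workFit_sq_le (hB : 1 ≤ B) (hA : Assumptions (1 / B) B δ M n P) (k : Fin p) :
    ∫ x, M.workFit k x ^ 2 ∂M.PX ≤ 34 * B ^ 5 := by
  rw [← M.integral_fst_PXY (g := fun x => M.workFit k x ^ 2)
    ((M.measurable_workFit k).pow_const 2)]
  have h1 := hA.workErr_sq_le hB k
  have h2 := hA.coord_resid_sq hB k
  have : ∫ z : Obs p, M.workFit k z.1 ^ 2 ∂M.PXY
      ≤ ∫ z, (2 * (z.1 k * M.resid z) ^ 2 + 2 * M.workErr z k ^ 2) ∂M.PXY := by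
    refine integral_mono_of_nonneg (ae_of_all _ fun z => sq_nonneg _)
      ((h2.1.const_mul _).add (h1.1.const_mul _)) (ae_of_all _ fun z => ?_)
    simp only [M.workErr_eq]
    nlinarith [sq_nonneg (2 * (z.1 k * M.resid z) - M.workFit k z.1)]
  rw [integral_add (h2.1.const_mul _) (h1.1.const_mul _), integral_const_mul,
    integral_const_mul] at this
  have h3 : B ≤ B ^ 5 := le_self_pow₀ hB (by norm_num)
  linarith [h1.2, h2.2]

end Assumptions

/-! ### The law of the sample -/

namespace Model

variable {p : ℕ} (M : Model p) (n N : ℕ)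

instance : IsProbabilityMeasure (M.law n N) := by
  unfold law; infer_instance

lemma map_labelled (i : Fin n) : (M.law n N).map (fun ω => ω.1 i) = M.PXY := by
  have h : MeasurePreserving (fun ω : Sample n N p => ω.1 i) (M.law n N) M.PXY :=
    (measurePreserving_eval (fun _ : Fin n => M.PXY) i).comp measurePreserving_fst
  exact h.map_eq

lemma map_unlabelled (i : Fin N) : (M.law n N).map (fun ω => ω.2 i) = M.PX := by
  have h : MeasurePreserving (fun ω : Sample n N p => ω.2 i) (M.law n N) M.PX :=
    (measurePreserving_eval (fun _ : Fin N => M.PX) i).comp measurePreserving_snd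
  exact h.map_eq

lemma measurable_labelled (i : Fin n) : Measurable fun ω : Sample n N p => ω.1 i :=
  (measurable_pi_apply i).comp measurable_fst

lemma measurable_unlabelled (i : Fin N) : Measurable fun ω : Sample n N p => ω.2 i :=
  (measurable_pi_apply i).comp measurable_snd

/-- Functions of the single observations are independent. -/
lemma iIndepFun_sample {γ : Type*} [MeasurableSpace γ] {G : Fin n → Obs p → γ}
    {H : Fin N → (Fin p → ℝ) → γ} (hG : ∀ i, Measurable (G i)) (hH : ∀ i, Measurable (H i)) :
    iIndepFun (fun (i : Fin n ⊕ Fin N) (ω : Sample n N p) =>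
      Sum.elim (fun i => G i (ω.1 i)) (fun i => H i (ω.2 i)) i) (M.law n N) := by
  have hm : ∀ i : Fin n ⊕ Fin N, Measurable fun ω : Sample n N p =>
      Sum.elim (fun i => G i (ω.1 i)) (fun i => H i (ω.2 i)) i := by
    rintro (i | i)
    · exact (hG i).comp (measurable_labelled n N i)
    · exact (hH i).comp (measurable_unlabelled n N i)
  have hprob : ∀ i : Fin n ⊕ Fin N, IsProbabilityMeasure ((M.law n N).map fun ω : Sample n N p =>
      Sum.elim (fun i => G i (ω.1 i)) (fun i => H i (ω.2 i)) i) := fun i =>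
    Measure.isProbabilityMeasure_map (hm i).aemeasurable
  rw [iIndepFun_iff_map_fun_eq_pi_map fun i => (hm i).aemeasurable]
  symm
  refine Measure.pi_eq fun s hs => ?_
  rw [Measure.map_apply (measurable_pi_lambda _ hm) (MeasurableSet.univ_pi hs)]
  have hpre : (fun (ω : Sample n N p) (i : Fin n ⊕ Fin N) =>
      Sum.elim (fun i => G i (ω.1 i)) (fun i => H i (ω.2 i)) i) ⁻¹' Set.univ.pi s
      = (Set.univ.pi fun i => G i ⁻¹' s (Sum.inl i)) ×ˢ
        (Set.univ.pi fun i => H i ⁻¹' s (Sum.inr i)) := by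
    ext ω
    simp [Set.mem_pi]
  rw [hpre, law, Measure.prod_prod, Measure.pi_pi, Measure.pi_pi, Fintype.prod_sum_type]
  congr 1
  · refine Finset.prod_congr rfl fun i _ => ?_
    rw [← law, Measure.map_apply (hm _) (hs _), ← M.map_labelled n N i,
      Measure.map_apply (measurable_labelled n N i) (hG i (hs _))]
    rfl
  · refine Finset.prod_congr rfl fun i _ => ?_
    rw [← law, Measure.map_apply (hm _) (hs _), ← M.map_unlabelled n N i,
      Measure.map_apply (measurable_unlabelled n N i) (hH i (hs _))]
    rfl

lemma isIID_labelled : IsIID (M.law n N) M.PXY fun (i : Fin n) ω => ω.1 i where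
  measurable := measurable_labelled n N
  map_eq := M.map_labelled n N
  indep := by
    have h := (iIndepFun_pi (μ := fun _ : Fin n => M.PXY) (X := fun _ z => z)
      fun _ => measurable_id.aemeasurable)
    rw [iIndepFun_iff_measure_inter_preimage_eq_mul] at h ⊢
    intro S sets hsets
    have hfst : ∀ A : Set (Fin n → Obs p), MeasurableSet A →
        M.law n N (Prod.fst ⁻¹' A) = Measure.pi (fun _ : Fin n => M.PXY) A := fun A hA =>
      (measurePreserving_fst (μ := Measure.pi fun _ : Fin n => M.PXY)
        (ν := Measure.pi fun _ : Fin N => M.PX)).measure_preimage hA.nullMeasurableSet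
    have h1 := h S hsets
    have e : (⋂ i ∈ S, (fun ω : Sample n N p => ω.1 i) ⁻¹' sets i)
        = Prod.fst ⁻¹' (⋂ i ∈ S, (fun ω : Fin n → Obs p => ω i) ⁻¹' sets i) := by
      ext; simp
    rw [e, hfst _ (S.measurableSet_biInter fun i hi => measurable_pi_apply i (hsets i hi)), h1]
    refine Finset.prod_congr rfl fun i hi => ?_
    exact (hfst _ (measurable_pi_apply i (hsets i hi))).symm

lemma measurable_allX (i : Fin n ⊕ Fin N) : Measurable fun ω : Sample n N p => allX ω i := by
  rcases i with i | i
  · exact measurable_fst.comp (measurable_labelled n N i)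
  · exact measurable_unlabelled n N i

lemma isIID_allX : IsIID (M.law n N) M.PX fun (i : Fin n ⊕ Fin N) ω => allX ω i where
  measurable := measurable_allX n N
  map_eq := by
    rintro (i | i)
    · rw [← M.map_fst_PXY, ← M.map_labelled n N i,
        Measure.map_map measurable_fst (measurable_labelled n N i)]
      rfl
    · exact M.map_unlabelled n N i
  indep := by
    have := M.iIndepFun_sample n N (G := fun _ z => z.1) (H := fun _ x => x)
      (fun _ => measurable_fst) fun _ => measurable_id
    convert this using 2 with i
    ext ω
    rcases i with i | i <;> rfl

end Model

/-! ### Conditioning on the observations outside a fold -/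

namespace CrossFit

variable {n N p : ℕ} (D : CrossFit n N p)

/-- The sample whose labelled observations outside the fold `j` are those of `ω'`, and whose
other observations are those of `ω`. -/
def mix (j : Fin 2) (q : Sample n N p × Sample n N p) : Sample n N p :=
  (fun i => if D.foldL i = j then q.2.1 i else q.1.1 i, q.2.2)

lemma measurable_mix (j : Fin 2) : Measurable (D.mix j) := by
  unfold mix
  refine Measurable.prodMk (measurable_pi_lambda _ fun i => ?_) (by fun_prop)
  by_cases h : D.foldL i = j
  · simp only [h, if_true]; fun_prop
  · simp only [h, if_false]; fun_prop

lemma map_mix (j : Fin 2) (M : Model p) :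
    ((M.law n N).prod (M.law n N)).map (D.mix j) = M.law n N := by
  refine (Measure.prod_eq_generateFrom (μ := Measure.pi fun _ : Fin n => M.PXY)
    (ν := Measure.pi fun _ : Fin N => M.PX) generateFrom_pi
    MeasurableSpace.generateFrom_measurableSet isPiSystem_pi
    MeasurableSpace.isPiSystem_measurableSet
    (Measure.FiniteSpanningSetsIn.pi fun _ => Measure.toFiniteSpanningSetsIn _)
    (Measure.toFiniteSpanningSetsIn _) ?_).symm
  rintro A ⟨s, hs, rfl⟩ A' hA'
  have hs' : ∀ i, MeasurableSet (s i) := by simpa using hs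
  rw [Measure.map_apply (D.measurable_mix j) ((MeasurableSet.univ_pi hs').prod hA')]
  have hpre : D.mix j ⁻¹' ((Set.univ.pi s) ×ˢ A')
      = ((Set.univ.pi fun i => if D.foldL i = j then Set.univ else s i) ×ˢ Set.univ) ×ˢ
        ((Set.univ.pi fun i => if D.foldL i = j then s i else Set.univ) ×ˢ A') := by
    ext q
    simp only [mix, Set.mem_preimage, Set.mem_prod, Set.mem_pi, Set.mem_univ, true_imp_iff,
      and_true]
    constructor
    · rintro ⟨h1, h2⟩
      refine ⟨fun i => ?_, fun i => ?_, h2⟩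
      · have := h1 i
        split_ifs with h
        · trivial
        · simpa [h] using this
      · have := h1 i
        split_ifs with h
        · simpa [h] using this
        · trivial
    · rintro ⟨h1, h2, h3⟩
      refine ⟨fun i => ?_, h3⟩
      have h1 := h1 i
      have h2 := h2 i
      split_ifs with h
      · simpa [h] using h2
      · simpa [h] using h1
  rw [hpre, Measure.prod_prod, Model.law, Measure.prod_prod, Measure.prod_prod, Measure.pi_pi,
    Measure.pi_pi, Measure.pi_pi, measure_univ, mul_one, ← mul_assoc, ← Finset.prod_mul_distrib]
  congr 1
  refine Finset.prod_congr rfl fun i _ => ?_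
  split_ifs <;> simp

lemma mAt_mix (j : Fin 2) (q : Sample n N p × Sample n N p) :
    D.mAt (D.mix j q) j = D.mAt q.1 j := by
  have h : (fun i : {i : Fin n // D.foldL i ≠ j} => (D.mix j q).1 i.1) = fun i => q.1.1 i.1 := by
    funext i
    simp [mix, i.2]
  funext x
  simp only [mAt, h]

lemma measurable_mAt (j : Fin 2) :
    Measurable fun q : Sample n N p × (Fin p → ℝ) => D.mAt q.1 j q.2 := by
  unfold mAt
  refine (D.measurable_mhat j).comp (f := fun q : Sample n N p × (Fin p → ℝ) =>
    ((fun i : {i : Fin n // D.foldL i ≠ j} => q.1.1 i.1), q.2)) ?_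
  fun_prop

lemma measurable_mAt_apply (j : Fin 2) (ω : Sample n N p) : Measurable (D.mAt ω j) :=
  (D.measurable_mAt j).comp (measurable_const.prodMk measurable_id)

/-- A bound for the probability of an event that involves `m̂⁻ʲ` and the observations of the fold
`j` follows from bounds that are uniform over fixed functions in place of `m̂⁻ʲ`. -/
lemma law_le_of_forall_fixed (j : Fin 2) (M : Model p)
    {E : ((Fin p → ℝ) → ℝ) → Sample n N p → Prop}
    (hE : ∀ g q, E g (D.mix j q) ↔ E g q.2)
    (hmeas : MeasurableSet {ω | E (D.mAt ω j) ω}) {x : ℝ} (hx : 0 ≤ x)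
    (h : ∀ ω', (M.law n N).real {ω | E (D.mAt ω' j) ω} ≤ x) :
    (M.law n N).real {ω | E (D.mAt ω j) ω} ≤ x := by
  refine ENNReal.toReal_le_of_le_ofReal hx ?_
  rw [← D.map_mix j M, Measure.map_apply (D.measurable_mix j) hmeas,
    Measure.prod_apply (D.measurable_mix j hmeas)]
  calc _ ≤ ∫⁻ _ω', ENNReal.ofReal x ∂(M.law n N) := by
        refine lintegral_mono fun ω' => ?_
        have e : Prod.mk ω' ⁻¹' (D.mix j ⁻¹' {ω | E (D.mAt ω j) ω})
            = {ω | E (D.mAt ω' j) ω} := by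
          ext ω
          simp only [Set.mem_preimage, Set.mem_ofPred_eq, D.mAt_mix, hE]
        rw [e]
        exact (ENNReal.le_ofReal_iff_toReal_le (measure_ne_top _ _) hx).2 (h ω')
    _ = _ := by simp

end CrossFit

/-! ### Deviations of empirical averages -/

section Sizes

variable {n N p : ℕ} (D : CrossFit n N p)

lemma CrossFit.card_L_add : (D.L 0).card + (D.L 1).card = n := by
  have h := Finset.card_filter_add_card_filter_not (s := (Finset.univ : Finset (Fin n)))
    (fun i => D.foldL i = 0)
  rw [Finset.card_univ, Fintype.card_fin] at h
  refine Eq.trans ?_ h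
  congr 2
  ext i
  simp only [CrossFit.L, Finset.mem_filter, Finset.mem_univ, true_and]
  omega

lemma CrossFit.card_U_add : (D.U 0).card + (D.U 1).card = N := by
  have h := Finset.card_filter_add_card_filter_not (s := (Finset.univ : Finset (Fin N)))
    (fun i => D.foldU i = 0)
  rw [Finset.card_univ, Fintype.card_fin] at h
  refine Eq.trans ?_ h
  congr 2
  ext i
  simp only [CrossFit.U, Finset.mem_filter, Finset.mem_univ, true_and]
  omega

lemma CrossFit.card_L_balanced (j : Fin 2) :
    n ≤ 2 * (D.L j).card + 1 ∧ 2 * (D.L j).card ≤ n + 1 := by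
  have h1 : (D.L 0).card ≤ (D.L 1).card + 1 := D.balancedL 0 1
  have h2 : (D.L 1).card ≤ (D.L 0).card + 1 := D.balancedL 1 0
  have h3 := D.card_L_add
  fin_cases j <;> simp only [Fin.zero_eta, Fin.mk_one] <;> omega

lemma CrossFit.card_U_balanced (j : Fin 2) :
    N ≤ 2 * (D.U j).card + 1 ∧ 2 * (D.U j).card ≤ N + 1 := by
  have h1 : (D.U 0).card ≤ (D.U 1).card + 1 := D.balancedU 0 1
  have h2 : (D.U 1).card ≤ (D.U 0).card + 1 := D.balancedU 1 0
  have h3 := D.card_U_add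
  fin_cases j <;> simp only [Fin.zero_eta, Fin.mk_one] <;> omega

lemma CrossFit.n_le_card_L (hn : 4 ≤ n) (j : Fin 2) : (n : ℝ) ≤ 3 * (D.L j).card := by
  have := D.card_L_balanced j
  have : n ≤ 3 * (D.L j).card := by omega
  exact_mod_cast this

lemma CrossFit.L_nonempty (hn : 4 ≤ n) (j : Fin 2) : (D.L j).Nonempty := by
  have := D.card_L_balanced j
  exact Finset.card_pos.1 (by omega)

/-- The indices of the labelled and unlabelled observations of the fold `j`. -/
def CrossFit.LU (j : Fin 2) : Finset (Fin n ⊕ Fin N) := (D.L j).disjSum (D.U j)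

lemma CrossFit.card_LU (j : Fin 2) : (D.LU j).card = (D.L j).card + (D.U j).card :=
  Finset.card_disjSum _ _

lemma CrossFit.LU_nonempty (hn : 4 ≤ n) (j : Fin 2) : (D.LU j).Nonempty := by
  have := D.card_L_balanced j
  have := D.card_LU j
  exact Finset.card_pos.1 (by omega)

lemma CrossFit.n_le_card_LU (hn : 4 ≤ n) (j : Fin 2) : (n : ℝ) ≤ 3 * (D.LU j).card := by
  have := D.card_L_balanced j
  have := D.card_LU j
  have : n ≤ 3 * (D.LU j).card := by omega
  exact_mod_cast this

lemma rt_nonneg (p n : ℕ) : 0 ≤ rt p n := Real.sqrt_nonneg _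

lemma sqrt_div_card_le {m : ℝ} (hn : 0 < n) (hm : (n : ℝ) ≤ 3 * m) :
    √(Real.log p / m) ≤ 2 * rt p n := by
  have hn' : (0 : ℝ) < n := by exact_mod_cast hn
  have hL : 0 ≤ Real.log p := Real.log_natCast_nonneg p
  rw [rt, show (2 : ℝ) = √4 by
    rw [show (4 : ℝ) = 2 ^ 2 by norm_num, Real.sqrt_sq (by norm_num)], ← Real.sqrt_mul (by norm_num)]
  refine Real.sqrt_le_sqrt ?_
  rw [← mul_div_assoc, div_le_div_iff₀ (by linarith) hn']
  nlinarith

lemma two_mul_exp_le {L : ℝ} {a : ℕ} (hL : 0 < L) (hp : Real.log p = L) (ha : a ≤ p ^ 2)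
    (hp0 : 0 < p) : 2 * (a : ℝ) * Real.exp (-(4 * L)) ≤ 1 / L := by
  have h1 : (a : ℝ) ≤ Real.exp (2 * L) := by
    have : (a : ℝ) ≤ (p : ℝ) ^ 2 := by exact_mod_cast ha
    refine this.trans_eq ?_
    rw [two_mul, Real.exp_add, ← hp, Real.exp_log (by exact_mod_cast hp0), sq]
  have h2 := Real.add_one_le_exp (2 * L)
  have h3 : Real.exp (2 * L) * Real.exp (-(4 * L)) = (Real.exp (2 * L))⁻¹ := by
    rw [← Real.exp_add, ← Real.exp_neg]; congr 1; ring
  calc 2 * (a : ℝ) * Real.exp (-(4 * L)) ≤ 2 * Real.exp (2 * L) * Real.exp (-(4 * L)) := by gcongr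
    _ = 2 * (Real.exp (2 * L))⁻¹ := by rw [mul_assoc, h3]
    _ ≤ 2 * (2 * L)⁻¹ := by gcongr; linarith
    _ = 1 / L := by field_simp

end Sizes

section Base

variable {n N p : ℕ} {B δ : ℝ} {M : Model p} {P : Params}

/-- The bound for one function family over one index set in the sample of covariates. -/
lemma real_not_forall_le {Ω κ : Type*} [MeasurableSpace Ω] {Q : Measure Ω} [IsFiniteMeasure Q]
    {f : κ → Ω → ℝ} {a b x : ℝ} (hab : a ≤ b) (h : Q.real {ω | ∃ k, a ≤ |f k ω|} ≤ x) :
    Q.real {ω | ¬ ∀ k, |f k ω| ≤ b} ≤ x := by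
  refine le_trans (measureReal_mono fun ω hω => ?_) h
  simp only [Set.mem_ofPred_eq, not_forall, not_le] at hω ⊢
  obtain ⟨k, hk⟩ := hω
  exact ⟨k, hab.trans hk.le⟩

lemma real_not_forall_le' {Ω κ : Type*} [MeasurableSpace Ω] {Q : Measure Ω} [IsFiniteMeasure Q]
    {f : κ → Ω → ℝ} {a b x : ℝ} (hab : a ≤ b) (h : Q.real {ω | ∃ k, a < |f k ω|} ≤ x) :
    Q.real {ω | ¬ ∀ k, |f k ω| ≤ b} ≤ x := by
  refine le_trans (measureReal_mono fun ω hω => ?_) h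
  simp only [Set.mem_ofPred_eq, not_forall, not_le] at hω ⊢
  obtain ⟨k, hk⟩ := hω
  exact ⟨k, hab.trans_lt hk⟩

lemma noise_prob (hA : Assumptions (1 / B) B δ M n P)
    (hp : 2 ≤ p) (hn : 0 < n) :
    (M.law n N).real {ω | ¬ ∀ k : Fin p,
      |avg Finset.univ fun i => (ω.1 i).1 k * M.resid (ω.1 i)| ≤ 8 * rateD M n P}
      ≤ 2 / Real.log p := by
  have hL : 0 < Real.log p := Real.log_pos (by exact_mod_cast hp)
  have : Nonempty (Fin n) := ⟨⟨0, hn⟩⟩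
  have hK := hA.K_nonneg ⟨0, by omega⟩
  have h := (M.isIID_labelled n N).envelope_sq_family (s := Finset.univ) (κ := Fin p)
    (g := fun k z => z.1 k * M.resid z) (G := fun z => P.K * |M.resid z|)
    (V := P.K ^ 2 * (M.noiseVar + P.Φ ^ 2)) (L := Real.log p)
    (fun k => ((measurable_pi_apply k).comp measurable_fst).mul M.measurable_resid)
    (M.measurable_resid.abs.const_mul _) ((Assumptions.memLp_resid M).abs.const_mul _)
    (fun k => by
      filter_upwards [hA.K_bound_fst] with z hz
      rw [abs_mul]; exact mul_le_mul_of_nonneg_right (hz k) (abs_nonneg _)) hL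
    (by
      simp only [mul_pow, sq_abs]
      rw [integral_const_mul]
      exact mul_le_mul_of_nonneg_left hA.resid_sq_le (sq_nonneg _)) Finset.univ_nonempty
  simp only [hA.integral_coord_resid, sub_zero, Finset.card_univ, Fintype.card_fin] at h
  refine real_not_forall_le' (le_of_eq ?_) (h.trans ?_)
  · rw [rateD, mul_assoc, mul_div_assoc, Real.sqrt_mul (sq_nonneg _), Real.sqrt_sq hK]
  · have := two_mul_exp_le (a := p) hL rfl (by nlinarith) (by omega)
    have e : 2 / Real.log p = 1 / Real.log p + 1 / Real.log p := by ring
    linarith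

lemma resid_prob (hB : 1 ≤ B) (hA : Assumptions (1 / B) B δ M n P) (hn : 0 < n) {H : ℝ}
    (hH : 0 < H) :
    (M.law n N).real {ω | ¬ avg Finset.univ (fun i => M.resid (ω.1 i) ^ 2) ≤ H}
      ≤ 2 * B ^ 2 / H := by
  have : Nonempty (Fin n) := ⟨⟨0, hn⟩⟩
  have h := (M.isIID_labelled n N).markov_avg (s := Finset.univ) (g := fun z => M.resid z ^ 2)
    (M.measurable_resid.pow_const 2) (Assumptions.integrable_resid_sq M) (fun _ => sq_nonneg _)
    Finset.univ_nonempty hH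
  refine le_trans (measureReal_mono fun ω hω => ?_) (h.trans ?_)
  · exact (not_le.1 hω).le
  · gcongr
    exact hA.resid_sq_le.trans (hA.kappa_sq_le hB)

lemma M1_prob (hB : 1 ≤ B) (hA : Assumptions (1 / B) B δ M n P) (hp : 2 ≤ p) (hn : 0 < n) :
    (M.law n N).real {ω | ¬ ∀ k : Fin p × Fin p,
      |avg Finset.univ (fun i => M.resid (ω.1 i) ^ 2 * ((ω.1 i).1 k.1 * (ω.1 i).1 k.2))
        - M.M1 k.1 k.2| ≤ 32 * B * P.K ^ 2 * rt p n} ≤ 2 / Real.log p := by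
  have hL : 0 < Real.log p := Real.log_pos (by exact_mod_cast hp)
  have : Nonempty (Fin n) := ⟨⟨0, hn⟩⟩
  have hK := hA.K_nonneg ⟨0, by omega⟩
  have hr := hA.resid_fourth hB
  have h := (M.isIID_labelled n N).envelope_sq_family (s := Finset.univ) (κ := Fin p × Fin p)
    (g := fun k z => M.resid z ^ 2 * (z.1 k.1 * z.1 k.2)) (G := fun z => P.K ^ 2 * M.resid z ^ 2)
    (V := (P.K ^ 2) ^ 2 * (16 * B)) (L := Real.log p)
    (fun k => (M.measurable_resid.pow_const 2).mul
      (((measurable_pi_apply k.1).comp measurable_fst).mul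
        ((measurable_pi_apply k.2).comp measurable_fst)))
    ((M.measurable_resid.pow_const 2).const_mul _)
    (by
      refine MemLp.const_mul ((memLp_two_iff_integrable_sq
        (M.measurable_resid.pow_const 2).aestronglyMeasurable).2 ?_) _
      simpa only [← pow_mul] using hr.1)
    (fun k => by
      filter_upwards [hA.K_bound_fst] with z hz
      rw [abs_mul, abs_mul, abs_of_nonneg (sq_nonneg (M.resid z)), mul_comm, sq P.K]
      exact mul_le_mul_of_nonneg_right (mul_le_mul (hz _) (hz _) (abs_nonneg _) hK)
        (sq_nonneg _)) hL
    (by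
      simp only [mul_pow _ (M.resid _ ^ 2)]
      rw [integral_const_mul]
      refine mul_le_mul_of_nonneg_left ?_ (sq_nonneg _)
      simpa only [← pow_mul] using hr.2) Finset.univ_nonempty
  simp only [Finset.card_univ, Fintype.card_fin, Fintype.card_prod] at h
  have hM1 : ∀ k : Fin p × Fin p, ∫ z, M.resid z ^ 2 * (z.1 k.1 * z.1 k.2) ∂M.PXY
      = M.M1 k.1 k.2 := fun k => by
    simp only [Model.M1, of_apply, Model.T1, Model.resid]
    congr 1; ext z; ring
  simp only [hM1] at h
  refine real_not_forall_le' ?_ (h.trans ?_)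
  · have h1 : √((P.K ^ 2) ^ 2 * (16 * B) * Real.log p / n) = P.K ^ 2 * (4 * √B) * rt p n := by
      rw [mul_div_assoc, Real.sqrt_mul (by positivity), Real.sqrt_mul (by positivity),
        Real.sqrt_sq (by positivity), Real.sqrt_mul (by norm_num),
        show √(16 : ℝ) = 4 by
          rw [show (16 : ℝ) = 4 ^ 2 by norm_num, Real.sqrt_sq (by norm_num)], rt]
    rw [h1]
    have h2 : √B ≤ B := Real.sqrt_le_iff.2 ⟨by linarith, by nlinarith⟩
    have h3 := mul_le_mul_of_nonneg_right (mul_le_mul_of_nonneg_left h2 (sq_nonneg P.K))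
      (rt_nonneg p n)
    nlinarith
  · have := two_mul_exp_le (p := p) (a := p * p) hL rfl (by nlinarith) (by omega)
    have e : 2 / Real.log p = 1 / Real.log p + 1 / Real.log p := by ring
    linarith

/-- Deviation of averages of bounded functions of the covariates. -/
lemma bounded_prob {κ ι Ω : Type*} [Fintype κ] [MeasurableSpace Ω] {Q : Measure Ω}
    [IsProbabilityMeasure Q] {Z : ι → Ω → Fin p → ℝ} (hZ : IsIID Q M.PX Z) {s : Finset ι}
    (hs : s.Nonempty) {g : κ → (Fin p → ℝ) → ℝ} (hg : ∀ a, Measurable (g a)) {b V r : ℝ}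
    (hb : ∀ a, ∀ᵐ x ∂M.PX, |g a x| ≤ b) (hV0 : 0 < V)
    (hV : ∀ a, ∫ x, g a x ^ 2 ∂M.PX ≤ V ^ 2) (hp : 2 ≤ p) (hκ : Fintype.card κ ≤ p ^ 2)
    (hr : √(Real.log p / s.card) ≤ r) (hb0 : 0 ≤ b) (hbr : b * r ≤ V) :
    Q.real {ω | ¬ ∀ a, |avg s (fun i => g a (Z i ω)) - ∫ x, g a x ∂M.PX| ≤ 5 * V * r}
      ≤ 1 / Real.log p := by
  have hL : 0 < Real.log p := Real.log_pos (by exact_mod_cast hp)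
  have hm : (0 : ℝ) < s.card := by exact_mod_cast hs.card_pos
  have h := hZ.bernstein_family (s := s) hg hb (V := V ^ 2) (by positivity) hL hV hs (by
    rw [mul_comm (s.card : ℝ), ← div_div, div_right_comm, Real.sqrt_div' _ (sq_nonneg V),
      Real.sqrt_sq hV0.le, ← mul_div_assoc, div_le_one hV0]
    exact (mul_le_mul_of_nonneg_left hr hb0).trans hbr)
  refine real_not_forall_le ?_ (h.trans (two_mul_exp_le hL rfl hκ (by omega)))
  rw [mul_div_assoc, Real.sqrt_mul (sq_nonneg V), Real.sqrt_sq hV0.le, ← mul_assoc]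
  exact mul_le_mul_of_nonneg_left hr (by positivity)

lemma gram_prob (hB : 1 ≤ B) (hA : Assumptions (1 / B) B δ M n P) (hp : 2 ≤ p)
    {ι Ω : Type*} [MeasurableSpace Ω] {Q : Measure Ω}
    [IsProbabilityMeasure Q] {Z : ι → Ω → Fin p → ℝ} (hZ : IsIID Q M.PX Z) {s : Finset ι}
    (hs : s.Nonempty) {r : ℝ} (hr : √(Real.log p / s.card) ≤ r) (hKr : P.K ^ 2 * r ≤ 1) :
    Q.real {ω | ¬ ∀ k : Fin p × Fin p,
      |avg s (fun i => Z i ω k.1 * Z i ω k.2) - M.Sigma k.1 k.2| ≤ 20 * B ^ 3 * r}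
      ≤ 1 / Real.log p := by
  have h := bounded_prob (M := M) hZ hs (κ := Fin p × Fin p) (g := fun k x => x k.1 * x k.2)
    (b := P.K ^ 2) (V := 4 * B ^ 3) (r := r)
    (fun k => (measurable_pi_apply _).mul (measurable_pi_apply _))
    (fun k => by
      filter_upwards [hA.bounded_X] with x hx
      rw [abs_mul, sq]
      exact mul_le_mul (hx _) (hx _) (abs_nonneg _) ((abs_nonneg _).trans (hx k.1)))
    (by positivity) (fun k => (hA.coord_mul_sq hB _ _).trans (by
      rw [mul_pow, ← pow_mul]; norm_num)) hp (by simp [sq]) hr (sq_nonneg _)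
    (hKr.trans (by nlinarith [one_le_pow₀ hB (n := 3)]))
  rw [show 5 * (4 * B ^ 3) * r = 20 * B ^ 3 * r by ring] at h
  simpa only [Model.Sigma, of_apply] using h

end Base

/-! ### Restricted eigenvalues -/

lemma dotProduct_avg_mulVec {ι : Type*} (s : Finset ι) {p : ℕ} (z w : ι → Fin p → ℝ)
    (c : ι → ℝ) (x y : Fin p → ℝ) :
    x ⬝ᵥ ((Matrix.of fun k l => avg s fun i => c i * (z i k * w i l)) *ᵥ y)
      = avg s fun i => c i * ((z i ⬝ᵥ x) * (w i ⬝ᵥ y)) := by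
  have : ∀ i, c i * ((z i ⬝ᵥ x) * (w i ⬝ᵥ y)) = ∑ k, ∑ l, c i * (z i k * x k * (w i l * y l)) :=
    fun i => by
      rw [dotProduct, dotProduct, Finset.sum_mul_sum]
      simp only [Finset.mul_sum]
  simp only [this, avg_sum]
  simp only [dotProduct, mulVec, of_apply, Finset.mul_sum]
  refine Finset.sum_congr rfl fun k _ => Finset.sum_congr rfl fun l _ => ?_
  rw [← avg_mul_const, ← avg_const_mul]
  refine avg_congr fun i _ => by ring

section RE

variable {n N p : ℕ} {B δ : ℝ} {M : Model p} {P : Params}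

lemma RE_of_signedSum {ι : Type*} {s : Finset ι} {z : ι → Fin p → ℝ} {d : ℕ} (hd : 1 ≤ d)
    (hB : 1 ≤ B) (hA : Assumptions (1 / B) B δ M n P)
    (h : ∀ T : Fin d → Fin p × Bool,
      (signedSum T ⬝ᵥ (M.Sigma *ᵥ signedSum T)) / 2 ≤ avg s fun i => (z i ⬝ᵥ signedSum T) ^ 2)
    (hdiag : ∀ j, avg s (fun i => z i j * z i j) - M.Sigma j j ≤ B / 2) (x : Fin p → ℝ) :
    (d - 1) * (1 / (2 * B) * l2 x ^ 2) - B * l1 x ^ 2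
      ≤ (d - 1) * avg s fun i => (z i ⬝ᵥ x) ^ 2 := by
  set A : Matrix (Fin p) (Fin p) ℝ :=
    (Matrix.of fun k l => avg s fun i => 1 * (z i k * z i l)) - (1 / 2 : ℝ) • M.Sigma with hAdef
  have hform : ∀ x : Fin p → ℝ, Matrix.toLinearMap₂' ℝ A x x
      = avg s (fun i => (z i ⬝ᵥ x) ^ 2) - (x ⬝ᵥ (M.Sigma *ᵥ x)) / 2 := fun x => by
    rw [Matrix.toLinearMap₂'_apply', hAdef, sub_mulVec, dotProduct_sub, dotProduct_avg_mulVec,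
      smul_mulVec, dotProduct_smul, smul_eq_mul]
    simp only [one_mul, ← sq]
    ring
  have key := form_ge_of_signedSum_nonneg hd (Matrix.toLinearMap₂' ℝ A)
    (fun T => by rw [hform]; linarith [h T]) (a := B) (fun j => by
      rw [hform, single_one_dotProduct, mulVec_single_one, col_apply]
      simp only [dotProduct_single_one, sq]
      have h1 := hdiag j
      have h2 := hA.diag_Sigma j
      linarith) x
  rw [hform] at key
  have h2 := hA.eig_Sigma x
  have hd' : (0 : ℝ) ≤ d - 1 := by
    have : (1 : ℝ) ≤ d := by exact_mod_cast hd
    linarith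
  have h3 := mul_le_mul_of_nonneg_left h2 hd'
  have h4 : (d - 1 : ℝ) * (1 / (2 * B) * l2 x ^ 2) = (d - 1 : ℝ) * (1 / B * l2 x ^ 2) / 2 := by
    field_simp
  rw [h4]
  nlinarith

lemma quadratic_lower_prob (hB : 1 ≤ B) (hA : Assumptions (1 / B) B δ M n P) (hn : 0 < n)
    (u : Fin p → ℝ) :
    (M.law n N).real {ω | avg Finset.univ (fun i => ((ω.1 i).1 ⬝ᵥ u) ^ 2)
      < (u ⬝ᵥ (M.Sigma *ᵥ u)) / 2} ≤ Real.exp (-(n / (128 * B ^ 4))) := by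
  have : Nonempty (Fin n) := ⟨⟨0, hn⟩⟩
  have hm : Measurable fun x : Fin p → ℝ => (x ⬝ᵥ u) ^ 2 :=
    (Model.measurable_dotProduct u).pow_const 2
  have h4 := hA.fourth_dotProduct hB u
  have h4i : Integrable (fun x : Fin p → ℝ => (x ⬝ᵥ u) ^ 4) M.PX :=
    integrable_of_abs_le ((Model.measurable_dotProduct u).pow_const 4) (c := (l1 u * P.K) ^ 4)
      (by
        filter_upwards [hA.bounded_X] with x hx
        rw [abs_pow, dotProduct_comm]
        exact pow_le_pow_left₀ (abs_nonneg _) (abs_dotProduct_le hx) 4)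
  have hS : ∫ x, (x ⬝ᵥ u) ^ 2 ∂M.PX = u ⬝ᵥ (M.Sigma *ᵥ u) := by
    simp only [hA.form_Sigma, sq]
  have h := (M.isIID_labelled n N).lower_tail_avg (s := Finset.univ)
    (g := fun z => (z.1 ⬝ᵥ u) ^ 2) (hm.comp measurable_fst) (fun _ => sq_nonneg _)
    (a := 16 * B ^ 4)
    ((memLp_two_iff_integrable_sq (hm.comp measurable_fst).aestronglyMeasurable).2 (by
      have : Integrable (fun x : Fin p → ℝ => ((x ⬝ᵥ u) ^ 2) ^ 2) M.PX := by
        simpa only [← pow_mul] using h4i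
      exact M.integrable_fst_PXY this))
    (by positivity)
    (by
      have e1 := M.integral_fst_PXY (g := fun x : Fin p → ℝ => ((x ⬝ᵥ u) ^ 2) ^ 2) (hm.pow_const 2)
      have e2 := M.integral_fst_PXY (g := fun x : Fin p → ℝ => (x ⬝ᵥ u) ^ 2) hm
      rw [e1, e2, hS]
      simpa only [← pow_mul] using h4) Finset.univ_nonempty
  have e2 := M.integral_fst_PXY (g := fun x : Fin p → ℝ => (x ⬝ᵥ u) ^ 2) hm
  rw [e2, hS, Finset.card_univ, Fintype.card_fin] at h
  refine h.trans_eq ?_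
  congr 3
  ring

/-- Lower bound for the empirical quadratic form. -/
def RestrictedEig {ι : Type*} (B : ℝ) (P : Params) (s : Finset ι) (z : ι → Fin p → ℝ) : Prop :=
  ∀ x : Fin p → ℝ, 1 / (2 * B) * l2 x ^ 2 - 1 / (16 * B * P.s) * l1 x ^ 2
    ≤ avg s fun i => (z i ⬝ᵥ x) ^ 2

lemma RE_prob (hB : 1 ≤ B) (hA : Assumptions (1 / B) B δ M n P) (hp : 2 ≤ p) (hn : 0 < n)
    (hs : 9216 * B ^ 6 * P.s * rt p n ^ 2 ≤ 1) :
    (M.law n N).real {ω | (∀ j, |avg Finset.univ (fun i => (ω.1 i).1 j * (ω.1 i).1 j)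
        - M.Sigma j j| ≤ B / 2) ∧
      ¬ RestrictedEig B P Finset.univ fun i => (ω.1 i).1} ≤ Real.exp (-(n / (256 * B ^ 4))) := by
  have hn' : (0 : ℝ) < n := by exact_mod_cast hn
  have hs1 : (1 : ℝ) ≤ P.s := by exact_mod_cast hA.one_le_s
  have hB0 : 0 < B := by linarith
  have hB2 : 1 ≤ B ^ 2 := one_le_pow₀ hB
  set d := ⌈16 * B ^ 2 * P.s⌉₊ + 1 with hd
  have hd1 : 16 * B ^ 2 * P.s ≤ (d : ℝ) - 1 := by
    rw [hd]; push_cast; linarith [Nat.le_ceil (16 * B ^ 2 * (P.s : ℝ))]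
  have hd2 : (d : ℝ) ≤ 18 * B ^ 2 * P.s := by
    have := (Nat.ceil_lt_add_one (show 0 ≤ 16 * B ^ 2 * (P.s : ℝ) by positivity)).le
    rw [hd]; push_cast; nlinarith
  have hL : 0 < Real.log p := Real.log_pos (by exact_mod_cast hp)
  have hp' : (2 : ℝ) ≤ p := by exact_mod_cast hp
  have hU := real_exists_le_card_mul (P := M.law n N) (κ := Fin d → Fin p × Bool)
    (E := fun T => {ω | avg Finset.univ (fun i => ((ω.1 i).1 ⬝ᵥ signedSum T) ^ 2)
      < (signedSum T ⬝ᵥ (M.Sigma *ᵥ signedSum T)) / 2})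
    fun T => quadratic_lower_prob hB hA hn (signedSum T)
  refine (measureReal_mono fun ω hω => ?_).trans (hU.trans ?_)
  · obtain ⟨h1, h2⟩ := hω
    by_contra hT
    simp only [Set.mem_ofPred_eq, not_exists, not_lt] at hT
    refine h2 fun x => ?_
    have h3 := RE_of_signedSum (s := Finset.univ) (z := fun i => (ω.1 i).1) (d := d) (by omega) hB hA
      hT (fun j => (le_abs_self _).trans (h1 j)) x
    have hd0 : 0 < (d : ℝ) - 1 := lt_of_lt_of_le (by positivity) hd1
    refine le_of_mul_le_mul_left (le_trans ?_ h3) hd0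
    have h4 : B ≤ ((d : ℝ) - 1) * (1 / (16 * B * P.s)) := by
      rw [mul_one_div, le_div_iff₀ (by positivity)]
      nlinarith
    have h5 := mul_le_mul_of_nonneg_right h4 (sq_nonneg (l1 x))
    nlinarith
  · have hcard : (Fintype.card (Fin d → Fin p × Bool) : ℝ) ≤ Real.exp (n / (256 * B ^ 4)) := by
      have e : (Fintype.card (Fin d → Fin p × Bool) : ℝ) = ((p : ℝ) * 2) ^ d := by simp
      have h2p : (p : ℝ) * 2 ≤ Real.exp (2 * Real.log p) := by
        rw [two_mul, Real.exp_add, Real.exp_log (by linarith)]; nlinarith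
      rw [e]
      refine (pow_le_pow_left₀ (by positivity) h2p d).trans ?_
      rw [← Real.exp_nat_mul]
      refine Real.exp_le_exp.2 ?_
      rw [rt, Real.sq_sqrt (by positivity)] at hs
      have h6 : 9216 * B ^ 6 * (P.s * Real.log p) ≤ n := by
        have := mul_le_mul_of_nonneg_right hs hn'.le
        rw [one_mul] at this
        calc _ = 9216 * B ^ 6 * P.s * (Real.log p / n) * n := by field_simp
          _ ≤ _ := this
      rw [le_div_iff₀ (by positivity)]
      have h7 := mul_le_mul_of_nonneg_right hd2 hL.le
      have h8 : (d : ℝ) * Real.log p * (512 * B ^ 4)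
          ≤ 18 * B ^ 2 * P.s * Real.log p * (512 * B ^ 4) := by gcongr
      nlinarith
    calc _ ≤ Real.exp (n / (256 * B ^ 4)) * Real.exp (-(n / (128 * B ^ 4))) := by gcongr
      _ = _ := by rw [← Real.exp_add]; congr 1; field_simp; ring

end RE

/-! ### Deviations over one fold -/

/-- The sample is large in comparison with the parameters. -/
structure Regime (B : ℝ) (p n : ℕ) (P : Params) : Prop where
  one_le_B : 1 ≤ B
  two_le_p : 2 ≤ p
  four_le_n : 4 ≤ n
  K_sq : 240 * B ^ 5 * (P.K ^ 2 * rt p n) ≤ 1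
  K_LB : 240 * B * (P.K * P.LB * rt p n) ≤ 1
  s_sq : 9216 * B ^ 6 * P.s * rt p n ^ 2 ≤ 1

section Fold

variable {n N p : ℕ} {B δ : ℝ} {M : Model p} {P : Params}

lemma Model.isIID_X (M : Model p) (n N : ℕ) :
    IsIID (M.law n N) M.PX fun (i : Fin n) ω => (ω.1 i).1 where
  measurable i := measurable_fst.comp (Model.measurable_labelled n N i)
  map_eq i := (M.isIID_allX n N).map_eq (Sum.inl i)
  indep := (M.isIID_labelled n N).indep.comp (fun _ => Prod.fst) fun _ => measurable_fst

namespace Regime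

lemma log_pos (hR : Regime B p n P) : 0 < Real.log p :=
  Real.log_pos (by exact_mod_cast hR.two_le_p)

lemma n_pos (hR : Regime B p n P) : 0 < n := by have := hR.four_le_n; omega

lemma rt_pos (hR : Regime B p n P) : 0 < rt p n := by
  have h1 := hR.log_pos
  have h2 : (0 : ℝ) < n := by exact_mod_cast hR.n_pos
  exact Real.sqrt_pos.2 (by positivity)

lemma K_pos (hR : Regime B p n P) (hA : Assumptions (1 / B) B δ M n P) : 0 < P.K :=
  hA.K_pos hR.one_le_B ⟨0, by have := hR.two_le_p; omega⟩

lemma LB_nonneg (hR : Regime B p n P) (hA : Assumptions (1 / B) B δ M n P) : 0 ≤ P.LB :=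
  hA.LB_nonneg ⟨0, by have := hR.two_le_p; omega⟩

lemma one_le_BK (hR : Regime B p n P) (hA : Assumptions (1 / B) B δ M n P) : 1 ≤ B * P.K := by
  have h := hA.K_ge hR.one_le_B ⟨0, by have := hR.two_le_p; omega⟩
  have hB0 : 0 < B := by linarith [hR.one_le_B]
  rwa [div_le_iff₀' hB0] at h

lemma one_le_BK_sq (hR : Regime B p n P) (hA : Assumptions (1 / B) B δ M n P) :
    1 ≤ B * P.K ^ 2 := by
  have h := hA.K_sq_ge ⟨0, by have := hR.two_le_p; omega⟩
  have hB0 : 0 < B := by linarith [hR.one_le_B]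
  rwa [div_le_iff₀' hB0] at h

lemma K_sq_rt (hR : Regime B p n P) : 240 * (P.K ^ 2 * rt p n) ≤ 1 := by
  have h1 := one_le_pow₀ hR.one_le_B (n := 5)
  have h2 : 0 ≤ P.K ^ 2 * rt p n := mul_nonneg (sq_nonneg _) (rt_nonneg _ _)
  nlinarith [hR.K_sq]

lemma K_rt (hR : Regime B p n P) (hA : Assumptions (1 / B) B δ M n P) :
    240 * B ^ 4 * (P.K * rt p n) ≤ 1 := by
  refine le_trans ?_ hR.K_sq
  have h1 := hR.one_le_BK hA
  have h2 := mul_nonneg (hR.K_pos hA).le hR.rt_pos.le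
  have h3 : 0 ≤ B ^ 4 * (P.K * rt p n) := by have := hR.one_le_B; positivity
  nlinarith

lemma rt_le (hR : Regime B p n P) (hA : Assumptions (1 / B) B δ M n P) :
    240 * B ^ 4 * rt p n ≤ 1 := by
  refine le_trans ?_ hR.K_sq
  have h1 := hR.one_le_BK_sq hA
  have h3 : 0 ≤ B ^ 4 * rt p n := by have := hR.one_le_B; have := hR.rt_pos; positivity
  nlinarith

end Regime

lemma two_div_log {x : ℝ} : 1 / x + 1 / x = 2 / x := by ring

/-- Deviation of averages of functions with a square integrable envelope. -/
lemma envelope_sq_prob {α κ ι Ω : Type*} [Fintype κ] [MeasurableSpace Ω] [MeasurableSpace α]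
    {Q : Measure Ω} [IsProbabilityMeasure Q] {μ : Measure α} [IsProbabilityMeasure μ]
    {Z : ι → Ω → α} (hZ : IsIID Q μ Z) {s : Finset ι} (hs : s.Nonempty) (hp : 2 ≤ p)
    {g : κ → α → ℝ} (hg : ∀ a, Measurable (g a)) {G : α → ℝ} (hG : Measurable G)
    (hG2 : MemLp G 2 μ) (hgG : ∀ a, ∀ᵐ x ∂μ, |g a x| ≤ G x) {V r : ℝ} (hV0 : 0 ≤ V)
    (hV : ∫ x, G x ^ 2 ∂μ ≤ V ^ 2) (hκ : Fintype.card κ ≤ p ^ 2)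
    (hr : √(Real.log p / s.card) ≤ r) :
    Q.real {ω | ¬ ∀ a, |avg s (fun i => g a (Z i ω)) - ∫ x, g a x ∂μ| ≤ 8 * V * r}
      ≤ 2 / Real.log p := by
  have hL : 0 < Real.log p := Real.log_pos (by exact_mod_cast hp)
  have h := hZ.envelope_sq_family hg hG hG2 hgG hL hV hs
  refine real_not_forall_le' ?_ (h.trans ?_)
  · rw [mul_div_assoc, Real.sqrt_mul (sq_nonneg V), Real.sqrt_sq hV0, mul_assoc]
    gcongr
  · have := two_mul_exp_le hL rfl hκ (by omega)
    rw [← two_div_log]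
    linarith

variable (D : CrossFit n N p) (j : Fin 2)

lemma sqrt_log_div_card_L (hR : Regime B p n P) :
    √(Real.log p / (D.L j).card) ≤ 2 * rt p n :=
  sqrt_div_card_le hR.n_pos (D.n_le_card_L hR.four_le_n j)

lemma sqrt_log_div_card_LU (hR : Regime B p n P) :
    √(Real.log p / (D.LU j).card) ≤ 2 * rt p n :=
  sqrt_div_card_le hR.n_pos (D.n_le_card_LU hR.four_le_n j)

lemma M2_prob (hR : Regime B p n P) (hA : Assumptions (1 / B) B δ M n P) :
    (M.law n N).real {ω | ¬ ∀ k : Fin p × Fin p,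
      |avg (D.L j) (fun i => (ω.1 i).1 k.1 * (ω.1 i).1 k.2 * M.m (ω.1 i).1 * M.resid (ω.1 i))
        - M.M2 k.1 k.2| ≤ 32 * B ^ 2 * P.K ^ 2 * rt p n} ≤ 2 / Real.log p := by
  have hK := (hR.K_pos hA).le
  have hB := hR.one_le_B
  have hB0 : 0 < B := by linarith
  have h := envelope_sq_prob (M.isIID_labelled n N) (D.L_nonempty hR.four_le_n j) hR.two_le_p
    (κ := Fin p × Fin p) (g := fun k z => z.1 k.1 * z.1 k.2 * M.m z.1 * M.resid z)
    (G := fun z => P.K ^ 2 * B * |M.resid z|) (V := 2 * B ^ 2 * P.K ^ 2) (r := 2 * rt p n)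
    (fun k => ((((measurable_pi_apply k.1).comp measurable_fst).mul
      ((measurable_pi_apply k.2).comp measurable_fst)).mul
        (M.measurable_m.comp measurable_fst)).mul M.measurable_resid)
    (M.measurable_resid.abs.const_mul _) ((Assumptions.memLp_resid M).abs.const_mul _)
    (fun k => by
      filter_upwards [hA.K_bound_fst, hA.m_bound_fst] with z hz hm
      rw [abs_mul, abs_mul, abs_mul, sq]
      have h1 := hz k.1
      have h2 := hz k.2
      gcongr) (by positivity)
    (by
      simp only [mul_pow, sq_abs]
      rw [integral_const_mul]
      have h1 := hA.resid_sq_le.trans (hA.kappa_sq_le hB)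
      calc _ ≤ (P.K ^ 2) ^ 2 * B ^ 2 * (2 * B ^ 2) := by gcongr
        _ = 2 * (B ^ 4 * P.K ^ 4) := by ring
        _ ≤ 4 * (B ^ 4 * P.K ^ 4) := by gcongr; norm_num
        _ = _ := by ring) (by simp [sq]) (sqrt_log_div_card_L D j hR)
  simp only [← hA.M2_apply] at h
  rw [show 8 * (2 * B ^ 2 * P.K ^ 2) * (2 * rt p n) = 32 * B ^ 2 * P.K ^ 2 * rt p n by ring] at h
  exact h

lemma abs_workErr_le (hR : Regime B p n P) (hA : Assumptions (1 / B) B δ M n P) :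
    ∀ᵐ z ∂M.PXY, ∀ k, |M.workErr z k| ≤ P.K * (|M.resid z| + 2 * B * P.LB) := by
  filter_upwards [hA.K_bound_fst, M.ae_fst_PXY (hA.workFit_bound hR.one_le_B)] with z h1 h2 k
  rw [M.workErr_eq]
  refine (abs_sub _ _).trans ?_
  rw [abs_mul]
  have := mul_le_mul_of_nonneg_right (h1 k) (abs_nonneg (M.resid z))
  nlinarith [h2 k]

lemma work_prob (hR : Regime B p n P) (hA : Assumptions (1 / B) B δ M n P)
    {u : Fin p → (Fin p → ℝ) → ℝ} (hu : ∀ a, Measurable (u a)) {U : ℝ} (hU0 : 0 < U)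
    (hU : ∀ a, ∀ᵐ x ∂M.PX, |u a x| ≤ U) (hz0 : ∀ a k, ∫ z, u a z.1 * M.workErr z k ∂M.PXY = 0) :
    (M.law n N).real {ω | ¬ ∀ k : Fin p × Fin p,
      |avg (D.L j) (fun i => u k.1 (ω.1 i).1 * M.workErr (ω.1 i) k.2)| ≤ 14 * U * B * rt p n}
      ≤ 1 / Real.log p + 1024 * (P.K ^ 2 * rt p n) ^ 2 := by
  have hK := (hR.K_pos hA).le
  have hB := hR.one_le_B
  have hB0 : 0 < B := by linarith
  have hL := hR.log_pos
  have hLB := hR.LB_nonneg hA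
  have hs := D.L_nonempty hR.four_le_n j
  have hm : (0 : ℝ) < (D.L j).card := by exact_mod_cast hs.card_pos
  have hrj := sqrt_log_div_card_L D j hR
  set rj := √(Real.log p / (D.L j).card) with hrj_def
  have hrj0 : 0 < rj := Real.sqrt_pos.2 (by positivity)
  have hsB0 : 0 < √B := Real.sqrt_pos.2 hB0
  have hsB1 : 1 ≤ √B := Real.one_le_sqrt.2 hB
  have hsBB : √B ≤ B := Real.sqrt_le_iff.2 ⟨by linarith, by nlinarith⟩
  have hV : √(U ^ 2 * B * Real.log p / (D.L j).card) = U * √B * rj := by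
    rw [mul_div_assoc, Real.sqrt_mul (by positivity), Real.sqrt_mul (by positivity),
      Real.sqrt_sq hU0.le]
  have hτ : √((D.L j).card * (U ^ 2 * B) / Real.log p) = U * √B / rj := by
    rw [hrj_def, eq_div_iff (by rw [← hrj_def]; exact hrj0.ne'), ← Real.sqrt_mul (by positivity)]
    rw [show ((D.L j).card : ℝ) * (U ^ 2 * B) / Real.log p * (Real.log p / (D.L j).card)
      = U ^ 2 * B by field_simp, Real.sqrt_mul (by positivity), Real.sqrt_sq hU0.le]
  set τ := U * √B / rj with hτ_def
  have hτ0 : 0 < τ := by positivity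
  have hw := abs_workErr_le hR hA
  have hwe : ∀ k, Measurable fun z => M.workErr z k := M.measurable_workErr
  set G : Obs p → ℝ := fun z => U * (P.K * (|M.resid z| + 2 * B * P.LB)) with hG
  have hG0 : ∀ z, 0 ≤ G z := fun z => by simp only [hG]; positivity
  have hGm : Measurable G :=
    ((M.measurable_resid.abs.add_const _).const_mul _).const_mul _
  have hGi : Integrable G M.PXY :=
    (((Assumptions.integrable_resid M).abs.add (integrable_const _)).const_mul _).const_mul _
  have hgb : ∀ a k, ∀ᵐ z ∂M.PXY, |u a z.1 * M.workErr z k| ≤ G z := fun a k => by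
    filter_upwards [hw, M.ae_fst_PXY (hU a)] with z h1 h2
    rw [abs_mul]
    exact mul_le_mul h2 (h1 k) (abs_nonneg _) hU0.le
  have h4 := hA.resid_fourth hB
  have hsq : ∀ a k, Integrable (fun z => (u a z.1 * M.workErr z k) ^ 2) M.PXY ∧
      ∫ z, (u a z.1 * M.workErr z k) ^ 2 ∂M.PXY ≤ U ^ 2 * B := fun a k => by
    have h1 := hA.workErr_sq_le hB k
    have hle : ∀ᵐ z ∂M.PXY, (u a z.1 * M.workErr z k) ^ 2 ≤ U ^ 2 * M.workErr z k ^ 2 := by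
      filter_upwards [M.ae_fst_PXY (hU a)] with z h2
      rw [mul_pow, ← sq_abs (u a z.1)]
      gcongr
    have hi : Integrable (fun z => (u a z.1 * M.workErr z k) ^ 2) M.PXY :=
      integrable_of_abs_le_integrable (h1.1.const_mul (U ^ 2))
        ((((hu a).comp measurable_fst).mul (hwe k)).pow_const 2)
        (by filter_upwards [hle] with z hz; rwa [abs_of_nonneg (sq_nonneg _)])
    refine ⟨hi, (integral_mono_ae hi (h1.1.const_mul _) hle).trans ?_⟩
    rw [integral_const_mul]
    exact mul_le_mul_of_nonneg_left h1.2 (sq_nonneg _)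
  have hz1 : 256 * (P.K ^ 2 * rj) ^ 2 ≤ 1024 * (P.K ^ 2 * rt p n) ^ 2 := by
    have : (P.K ^ 2 * rj) ^ 2 ≤ (P.K ^ 2 * (2 * rt p n)) ^ 2 := by gcongr
    nlinarith
  have hz2 : 1024 * (P.K ^ 2 * rt p n) ^ 2 ≤ 1 := by
    have h1 := hR.K_sq_rt
    have h2 : 0 ≤ P.K ^ 2 * rt p n := mul_nonneg (sq_nonneg _) (rt_nonneg _ _)
    nlinarith
  have hdom : ∀ z, {z | τ < G z}.indicator G z ≤ (2 * U * P.K) ^ 4 / τ ^ 3 * M.resid z ^ 4 := by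
    intro z
    by_cases hz : τ < G z
    · rw [Set.indicator_of_mem (show z ∈ {z | τ < G z} from hz)]
      have h1 : U * (P.K * (2 * B * P.LB)) ≤ τ / 2 := by
        rw [hτ_def, div_div, le_div_iff₀ (by positivity)]
        have h2 : 4 * (B * P.K * P.LB) * rj ≤ 1 := by
          have h3 : 4 * (B * P.K * P.LB) * rj ≤ 4 * (B * P.K * P.LB) * (2 * rt p n) := by gcongr
          have h4 := hR.K_LB
          have h5 : 0 ≤ B * (P.K * P.LB * rt p n) := by have := rt_nonneg p n; positivity
          nlinarith
        calc U * (P.K * (2 * B * P.LB)) * (rj * 2) = U * (4 * (B * P.K * P.LB) * rj) := by ring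
          _ ≤ U * 1 := by gcongr
          _ ≤ U * √B := by gcongr
      set y := 2 * U * P.K * |M.resid z| with hy
      have h2 : G z ≤ y := by
        simp only [hG] at hz ⊢
        rw [hy]
        nlinarith
      have h3 : τ < y := hz.trans_le h2
      have h4 : (2 * U * P.K) ^ 4 * M.resid z ^ 4 = y ^ 4 := by
        rw [hy, mul_pow _ |M.resid z| 4, pow_abs, abs_of_nonneg (by positivity)]
      rw [div_mul_eq_mul_div, h4, le_div_iff₀ (by positivity)]
      calc G z * τ ^ 3 ≤ y * y ^ 3 := by gcongr
        _ = _ := by ring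
    · rw [Set.indicator_of_notMem (show z ∉ {z | τ < G z} from hz)]
      positivity
  have h := (M.isIID_labelled n N).envelope_tail_family (s := D.L j) (κ := Fin p × Fin p)
    (g := fun k z => u k.1 z.1 * M.workErr z k.2) (G := G) (V := U ^ 2 * B)
    (L := Real.log p) (z := 1024 * (P.K ^ 2 * rt p n) ^ 2)
    (fun k => ((hu k.1).comp measurable_fst).mul (hwe k.2)) hGm hG0 hGi
    (fun k => hgb k.1 k.2) (by positivity) hL (fun k => (hsq k.1 k.2).1)
    (fun k => (hsq k.1 k.2).2) hs hz2
    (by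
      rw [hτ, hV]
      refine le_trans (integral_mono_ae (hGi.indicator (measurableSet_lt measurable_const hGm))
        (h4.1.const_mul _) (ae_of_all _ hdom)) ?_
      rw [integral_const_mul]
      calc _ ≤ (2 * U * P.K) ^ 4 / τ ^ 3 * (16 * B) := by gcongr; exact h4.2
        _ = 256 * (P.K ^ 2 * rj) ^ 2 * (U * (B / (√B ^ 2 * √B)) * rj) := by
          rw [hτ_def]; field_simp; ring
        _ ≤ 1024 * (P.K ^ 2 * rt p n) ^ 2 * (U * √B * rj) := by
          have : B / (√B ^ 2 * √B) ≤ √B := by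
            rw [Real.sq_sqrt hB0.le, div_mul_eq_div_div, div_self hB0.ne']
            exact (div_le_one hsB0).2 hsB1 |>.trans hsB1
          gcongr)
  simp only [hz0, sub_zero] at h
  refine real_not_forall_le' ?_ (h.trans ?_)
  · rw [hV]
    calc 7 * (U * √B * rj) ≤ 7 * (U * B * (2 * rt p n)) := by gcongr
      _ = _ := by ring
  · have := two_mul_exp_le (p := p) (a := Fintype.card (Fin p × Fin p)) hL rfl (by simp [sq])
      (by have := hR.two_le_p; omega)
    linarith

lemma workFit_prob (hR : Regime B p n P) (hA : Assumptions (1 / B) B δ M n P) :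
    (M.law n N).real {ω | ¬ ∀ k : Fin p,
      avg (D.L j) (fun i => M.workFit k (ω.1 i).1 ^ 2) ≤ 35 * B ^ 5} ≤ 1 / Real.log p := by
  have hK := hR.K_pos hA
  have hB := hR.one_le_B
  have hB0 : 0 < B := by linarith
  have hLB := hR.LB_nonneg hA
  have hr := hR.rt_pos
  set W := 2 * B * P.K * (P.LB + 1) with hW
  have hW0 : 0 < W := by positivity
  have hWr : 60 * (W * rt p n) ≤ 1 := by
    have h1 := hR.K_LB
    have h2 := hR.K_rt hA
    have h3 : 0 ≤ P.K * rt p n := by positivity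
    have h4 : B ≤ B ^ 4 := le_self_pow₀ hB (by norm_num)
    have h5 : B * (P.K * rt p n) ≤ B ^ 4 * (P.K * rt p n) := by gcongr
    rw [hW]
    nlinarith
  have hbd : ∀ᵐ x ∂M.PX, ∀ k, |M.workFit k x| ≤ W := by
    filter_upwards [hA.workFit_bound hB] with x hx k
    refine (hx k).trans ?_
    rw [hW]; gcongr; linarith
  have h := bounded_prob (M := M) (M.isIID_X n N) (D.L_nonempty hR.four_le_n j) (κ := Fin p)
    (g := fun k x => M.workFit k x ^ 2) (b := W ^ 2) (V := W * (6 * B ^ 3)) (r := 2 * rt p n)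
    (fun k => (M.measurable_workFit k).pow_const 2)
    (fun k => by
      filter_upwards [hbd] with x hx
      rw [abs_pow]
      exact pow_le_pow_left₀ (abs_nonneg _) (hx k) 2)
    (by positivity)
    (fun k => by
      have hle : ∀ᵐ x ∂M.PX, (M.workFit k x ^ 2) ^ 2 ≤ W ^ 2 * M.workFit k x ^ 2 := by
        filter_upwards [hbd] with x hx
        rw [sq (M.workFit k x ^ 2)]
        refine mul_le_mul_of_nonneg_right ?_ (sq_nonneg _)
        rw [← sq_abs]
        exact pow_le_pow_left₀ (abs_nonneg _) (hx k) 2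
      have hi1 : Integrable (fun x => M.workFit k x ^ 2) M.PX :=
        integrable_of_abs_le ((M.measurable_workFit k).pow_const 2) (c := W ^ 2)
          (by filter_upwards [hbd] with x hx
              rw [abs_pow]; exact pow_le_pow_left₀ (abs_nonneg _) (hx k) 2)
      have hi2 : Integrable (fun x => (M.workFit k x ^ 2) ^ 2) M.PX :=
        integrable_of_abs_le_integrable (hi1.const_mul (W ^ 2))
          (((M.measurable_workFit k).pow_const 2).pow_const 2)
          (by filter_upwards [hle] with x hx; rwa [abs_of_nonneg (sq_nonneg _)])
      refine (integral_mono_ae hi2 (hi1.const_mul _) hle).trans ?_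
      rw [integral_const_mul, mul_pow W]
      refine mul_le_mul_of_nonneg_left ((hA.workFit_sq_le hB k).trans ?_) (sq_nonneg _)
      have : B ^ 5 ≤ B ^ 6 := pow_le_pow_right₀ hB (by norm_num)
      nlinarith)
    hR.two_le_p (by have := hR.two_le_p; rw [Fintype.card_fin]; nlinarith)
    (sqrt_log_div_card_L D j hR) (by positivity)
    (by
      rw [sq, mul_assoc]
      have h3 := one_le_pow₀ hB (n := 3)
      exact mul_le_mul_of_nonneg_left (by nlinarith) hW0.le)
  refine le_trans (measureReal_mono fun ω hω => ?_) h
  simp only [Set.mem_ofPred_eq] at hω ⊢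
  refine fun hall => hω fun k => ?_
  have h1 := (le_abs_self _).trans (hall k)
  have h2 := hA.workFit_sq_le hB k
  have h3 : B ^ 3 ≤ B ^ 5 := pow_le_pow_right₀ hB (by norm_num)
  have h4 : 5 * (W * (6 * B ^ 3)) * (2 * rt p n) ≤ B ^ 5 := by
    calc _ = 60 * (W * rt p n) * B ^ 3 := by ring
      _ ≤ 1 * B ^ 3 := by gcongr
      _ ≤ _ := by linarith
  linarith

lemma mean_prob (hR : Regime B p n P) (hA : Assumptions (1 / B) B δ M n P)
    {ι Ω : Type*} [MeasurableSpace Ω] {Q : Measure Ω}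
    [IsProbabilityMeasure Q] {Z : ι → Ω → Fin p → ℝ} (hZ : IsIID Q M.PX Z) {s : Finset ι}
    (hs : s.Nonempty) (hr : √(Real.log p / s.card) ≤ 2 * rt p n) :
    Q.real {ω | ¬ ∀ l : Fin p,
      |avg s (fun i => Z i ω l * M.m (Z i ω)) - M.mu l| ≤ 10 * B ^ 2 * rt p n}
      ≤ 1 / Real.log p := by
  have hK := hR.K_pos hA
  have hB := hR.one_le_B
  have hB0 : 0 < B := by linarith
  have h := bounded_prob (M := M) hZ hs (κ := Fin p) (g := fun k x => x k * M.m x)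
    (b := P.K * B) (V := B ^ 2) (r := 2 * rt p n)
    (fun k => (measurable_pi_apply _).mul M.measurable_m)
    (fun k => by filter_upwards [hA.coord_m_bound] with x hx using hx k)
    (by positivity) (fun k => by
      have hle : ∀ᵐ x ∂M.PX, (x k * M.m x) ^ 2 ≤ B ^ 2 * x k ^ 2 := by
        filter_upwards [hA.bounded_m] with x hx
        rw [mul_pow, mul_comm, ← sq_abs (M.m x)]
        gcongr
      have hi := hA.integrable_pow_coord k 2
      refine (integral_mono_ae (integrable_of_abs_le_integrable (hi.const_mul (B ^ 2))
        (((measurable_pi_apply k).mul M.measurable_m).pow_const 2)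
        (by filter_upwards [hle] with x hx; rwa [abs_of_nonneg (sq_nonneg _)]))
        (hi.const_mul _) hle).trans ?_
      rw [integral_const_mul, ← Assumptions.Sigma_diag]
      have h1 := hA.diag_Sigma k
      calc B ^ 2 * M.Sigma k k ≤ B ^ 2 * B := by gcongr
        _ ≤ B ^ 2 * B ^ 2 := by gcongr; exact le_self_pow₀ hB (by norm_num)
        _ = _ := by ring) hR.two_le_p
    (by have := hR.two_le_p; rw [Fintype.card_fin]; nlinarith) hr (by positivity)
    (by
      have h1 := hR.K_rt hA
      have h2 : 0 ≤ P.K * rt p n := mul_nonneg hK.le (rt_nonneg _ _)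
      have h3 := one_le_pow₀ hB (n := 4)
      nlinarith)
  rw [show 5 * B ^ 2 * (2 * rt p n) = 10 * B ^ 2 * rt p n by ring] at h
  simpa only [Model.mu] using h

lemma gram_m_prob (hR : Regime B p n P) (hA : Assumptions (1 / B) B δ M n P) :
    (M.law n N).real {ω | ¬ ∀ k : Fin p × Fin p,
      |avg (D.L j) (fun i => (ω.1 i).1 k.1 * M.m (ω.1 i).1 * ((ω.1 i).1 k.2 * M.m (ω.1 i).1))
        - ∫ x, x k.1 * M.m x * (x k.2 * M.m x) ∂M.PX| ≤ 40 * B ^ 5 * rt p n}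
      ≤ 1 / Real.log p := by
  have hK := hR.K_pos hA
  have hB := hR.one_le_B
  have hB0 : 0 < B := by linarith
  have h := bounded_prob (M := M) (M.isIID_X n N) (D.L_nonempty hR.four_le_n j)
    (κ := Fin p × Fin p) (g := fun k x => x k.1 * M.m x * (x k.2 * M.m x))
    (b := (P.K * B) ^ 2) (V := 4 * B ^ 5) (r := 2 * rt p n)
    (fun k => ((measurable_pi_apply _).mul M.measurable_m).mul
      ((measurable_pi_apply _).mul M.measurable_m))
    (fun k => by
      filter_upwards [hA.coord_m_bound] with x hx
      rw [abs_mul, sq]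
      exact mul_le_mul (hx _) (hx _) (abs_nonneg _) (by positivity))
    (by positivity) (fun k => by
      have hle : ∀ᵐ x ∂M.PX, (x k.1 * M.m x * (x k.2 * M.m x)) ^ 2
          ≤ B ^ 4 * (x k.1 * x k.2) ^ 2 := by
        filter_upwards [hA.bounded_m] with x hx
        calc _ = |M.m x| ^ 4 * (x k.1 * x k.2) ^ 2 := by
              rw [pow_abs, abs_of_nonneg (by positivity)]; ring
          _ ≤ _ := by gcongr
      have hi : Integrable (fun x : Fin p → ℝ => (x k.1 * x k.2) ^ 2) M.PX :=
        integrable_of_abs_le (((measurable_pi_apply k.1).mul (measurable_pi_apply k.2)).pow_const 2)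
          (c := (P.K * P.K) ^ 2) (by
            filter_upwards [hA.bounded_X] with x hx
            rw [abs_pow, abs_mul]
            have h1 := hx k.1
            have h2 := hx k.2
            gcongr)
      refine (integral_mono_ae (integrable_of_abs_le_integrable (hi.const_mul (B ^ 4))
        ((((measurable_pi_apply _).mul M.measurable_m).mul
          ((measurable_pi_apply _).mul M.measurable_m)).pow_const 2)
        (by filter_upwards [hle] with x hx; rwa [abs_of_nonneg (sq_nonneg _)]))
        (hi.const_mul _) hle).trans ?_
      rw [integral_const_mul]
      calc B ^ 4 * _ ≤ B ^ 4 * (16 * B ^ 6) := by gcongr; exact hA.coord_mul_sq hB _ _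
        _ = _ := by ring) hR.two_le_p
    (by simp [sq]) (sqrt_log_div_card_L D j hR) (by positivity)
    (by
      have h1 := hR.K_sq_rt
      have h2 : 0 ≤ P.K ^ 2 * rt p n := mul_nonneg (sq_nonneg _) (rt_nonneg _ _)
      have h3 : B ^ 2 ≤ B ^ 5 := pow_le_pow_right₀ hB (by norm_num)
      have h4 : B ^ 2 * (P.K ^ 2 * rt p n) ≤ B ^ 2 * 1 := by gcongr; linarith
      nlinarith)
  rw [show 5 * (4 * B ^ 5) * (2 * rt p n) = 40 * B ^ 5 * rt p n by ring] at h
  exact h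

end Fold

/-! ### Deviations that involve the estimated working function -/

lemma real_not_and_le {Ω : Type*} [MeasurableSpace Ω] {Q : Measure Ω} [IsFiniteMeasure Q]
    {E F : Ω → Prop} {a b : ℝ} (hE : Q.real {ω | ¬ E ω} ≤ a) (hF : Q.real {ω | ¬ F ω} ≤ b) :
    Q.real {ω | ¬ (E ω ∧ F ω)} ≤ a + b := by
  refine le_trans (measureReal_mono (s₂ := {ω | ¬ E ω} ∪ {ω | ¬ F ω}) fun ω hω => ?_)
    ((measureReal_union_le _ _).trans (add_le_add hE hF))
  simp only [Set.mem_union, Set.mem_ofPred_eq] at hω ⊢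
  tauto

/-- `y²` if `|y| ≤ τ`, and `0` otherwise. -/
def sqBelow (τ y : ℝ) : ℝ := if |y| ≤ τ then y ^ 2 else 0

/-- `|y|` if `|y| > τ`, and `0` otherwise. -/
def absAbove (τ y : ℝ) : ℝ := if |y| ≤ τ then 0 else |y|

lemma sqBelow_nonneg (τ y : ℝ) : 0 ≤ sqBelow τ y := by
  unfold sqBelow; split_ifs <;> positivity

lemma absAbove_nonneg (τ y : ℝ) : 0 ≤ absAbove τ y := by
  unfold absAbove; split_ifs <;> positivity

lemma sqBelow_le (τ y : ℝ) : sqBelow τ y ≤ y ^ 2 := by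
  unfold sqBelow; split_ifs
  · exact le_rfl
  · positivity

lemma sqBelow_sq_le {τ : ℝ} (y : ℝ) : sqBelow τ y ^ 2 ≤ τ ^ 2 * y ^ 2 := by
  unfold sqBelow
  split_ifs with h
  · rw [sq (y ^ 2), ← sq_abs y]
    gcongr
  · simp only [ne_eq, OfNat.ofNat_ne_zero, not_false_eq_true, zero_pow]
    positivity

lemma mul_absAbove_le {τ : ℝ} (y : ℝ) : τ * absAbove τ y ≤ y ^ 2 := by
  unfold absAbove
  split_ifs with h
  · rw [mul_zero]; positivity
  · rw [← sq_abs, sq]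
    exact mul_le_mul_of_nonneg_right (not_le.1 h).le (abs_nonneg _)

lemma absAbove_mul_le {r q c : ℝ} (hr : 0 < r) (hc : 0 < c) (hq : 0 ≤ q) (hqr : q ^ 2 = r)
    (y e : ℝ) :
    absAbove (c / r) y * |e| ≤ q * (3 / 4 * (y ^ 2 / c) + c * e ^ 4 / 4) := by
  unfold absAbove
  split_ifs with h
  · rw [zero_mul]; positivity
  have h1 : c < |y| * r := (div_lt_iff₀ hr).1 (not_le.1 h)
  have hy : 0 < |y| := lt_of_le_of_lt (by positivity) (not_le.1 h)
  set w := √(|y| / c) with hw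
  have hw2 : w ^ 2 = |y| / c := Real.sq_sqrt (by positivity)
  have hw0 : 0 ≤ w := Real.sqrt_nonneg _
  have hyw : |y| = c * w ^ 2 := by rw [hw2]; field_simp
  have hqw : 1 ≤ q * w := by
    have : 1 ≤ (q * w) ^ 2 := by
      rw [mul_pow, hqr, hw2, ← mul_div_assoc, le_div_iff₀ hc]; linarith
    nlinarith [mul_nonneg hq hw0]
  have h2 : 4 * (w ^ 3 * |e|) ≤ 3 * w ^ 4 + e ^ 4 := by
    have : e ^ 4 = |e| ^ 4 := by rw [pow_abs, abs_of_nonneg (by positivity)]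
    rw [this]
    nlinarith [sq_nonneg (w ^ 2 - |e| ^ 2), sq_nonneg (w * (w - |e|)), sq_nonneg (w ^ 2 - w * |e|),
      sq_nonneg (w - |e|), mul_nonneg hw0 (abs_nonneg e)]
  have hy2 : y ^ 2 / c = c * w ^ 4 := by
    rw [← sq_abs, hyw]; field_simp
  rw [hy2, hyw]
  have h3 : c * w ^ 2 * |e| ≤ c * w ^ 2 * |e| * (q * w) :=
    le_mul_of_one_le_right (by positivity) hqw
  have h4 := mul_le_mul_of_nonneg_left h2 (mul_nonneg hq hc.le)
  nlinarith

lemma measurable_sqBelow (τ : ℝ) : Measurable (sqBelow τ) := by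
  unfold sqBelow
  exact Measurable.ite (measurableSet_le (by fun_prop) (by fun_prop)) (by fun_prop) (by fun_prop)

lemma measurable_absAbove (τ : ℝ) : Measurable (absAbove τ) := by
  unfold absAbove
  exact Measurable.ite (measurableSet_le (by fun_prop) (by fun_prop)) (by fun_prop) (by fun_prop)

/-- The bounds on the fold `j` that involve the difference `g - m`. -/
structure GoodDiff {n N p : ℕ} (B H : ℝ) (M : Model p) (P : Params) (D : CrossFit n N p)
    (j : Fin 2) (g : (Fin p → ℝ) → ℝ) (ω : Sample n N p) : Prop where
  sq : avg (D.L j) (fun i => (g (ω.1 i).1 - M.m (ω.1 i).1) ^ 2) ≤ H * (P.c + rt p n) ^ 2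
  below : avg (D.L j) (fun i => sqBelow ((P.c + rt p n) / rt p n)
    (g (ω.1 i).1 - M.m (ω.1 i).1)) ≤ 2 * B ^ 2 * (P.c + rt p n) ^ 2
  above : P.K * avg (D.L j) (fun i => absAbove ((P.c + rt p n) / rt p n)
    (g (ω.1 i).1 - M.m (ω.1 i).1) * (|M.resid (ω.1 i)| + 2 * B * P.LB)) ≤ P.c + rt p n
  mean : ∀ l, |avg (D.L j) (fun i => (ω.1 i).1 l * (g (ω.1 i).1 - M.m (ω.1 i).1))
    - avg (D.LU j) (fun i => allX ω i l * (g (allX ω i) - M.m (allX ω i)))|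
      ≤ 32 * (P.K * B * (P.c + rt p n)) * rt p n

section Diff

variable {n N p : ℕ} {B δ : ℝ} {M : Model p} {P : Params}

lemma integral_sq_le_of_eLpNorm {h : (Fin p → ℝ) → ℝ} (hm : Measurable h) {b : ℝ} (hb : 0 ≤ b)
    (hh : eLpNorm h 2 M.PX ≤ ENNReal.ofReal b) :
    MemLp h 2 M.PX ∧ ∫ x, h x ^ 2 ∂M.PX ≤ b ^ 2 := by
  have h2 : MemLp h 2 M.PX := ⟨hm.aestronglyMeasurable, hh.trans_lt ENNReal.ofReal_lt_top⟩
  refine ⟨h2, ?_⟩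
  have e := h2.eLpNorm_eq_integral_rpow_norm (by norm_num) (by norm_num)
  rw [e] at hh
  have h3 := (ENNReal.ofReal_le_ofReal_iff hb).1 hh
  simp only [ENNReal.toReal_ofNat, Real.rpow_two, Real.norm_eq_abs, sq_abs] at h3
  rw [← one_div, ← Real.sqrt_eq_rpow] at h3
  exact (Real.sqrt_le_left hb).1 h3

/-- The bounds on the fold `j` hold with high probability for a fixed function. -/
lemma goodDiff_prob (hR : Regime B p n P) (hA : Assumptions (1 / B) B δ M n P)
    (D : CrossFit n N p) (j : Fin 2) {H : ℝ} (hH : 0 < H)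
    {g : (Fin p → ℝ) → ℝ} (hg : Measurable g)
    (hgm : eLpNorm (fun x => g x - M.m x) 2 M.PX ≤ ENNReal.ofReal (B * P.c)) :
    (M.law n N).real {ω | ¬ GoodDiff B H M P D j g ω}
      ≤ B ^ 2 / H + 7 / Real.log p
        + (5 * B ^ 2 * (P.K * √(rt p n)) + 2 * B ^ 3 * (P.K * P.LB * rt p n)) := by
  have hK := hR.K_pos hA
  have hB := hR.one_le_B
  have hB0 : 0 < B := by linarith
  have hL := hR.log_pos
  have hLB := hR.LB_nonneg hA
  have hs := D.L_nonempty hR.four_le_n j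
  have hsU := D.LU_nonempty hR.four_le_n j
  have hm : (0 : ℝ) < (D.L j).card := by exact_mod_cast hs.card_pos
  have hr := hR.rt_pos
  have hn0 : (0 : ℝ) < n := by exact_mod_cast hR.n_pos
  set r := rt p n with hr_def
  set c := P.c + r with hc_def
  have hc : 0 < c := by have := hA.c_nonneg; linarith
  have hcc : P.c ≤ c := by linarith
  set h : (Fin p → ℝ) → ℝ := fun x => g x - M.m x with hh
  have hhm : Measurable h := hg.sub M.measurable_m
  obtain ⟨h2, hI⟩ := integral_sq_le_of_eLpNorm hhm (mul_nonneg hB0.le hA.c_nonneg) hgm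
  have hI' : ∫ x, h x ^ 2 ∂M.PX ≤ B ^ 2 * c ^ 2 := by
    refine hI.trans ?_
    rw [mul_pow]
    have := hA.c_nonneg
    gcongr
  have hi := h2.integrable_sq
  have hX := M.isIID_X n N
  have hXY := M.isIID_labelled n N
  have hall := M.isIID_allX n N
  have p1 : (M.law n N).real {ω | ¬ avg (D.L j) (fun i => h (ω.1 i).1 ^ 2) ≤ H * c ^ 2}
      ≤ B ^ 2 / H := by
    have := hX.markov_avg (s := D.L j) (g := fun x => h x ^ 2) (hhm.pow_const 2) hi
      (fun _ => sq_nonneg _) hs (t := H * c ^ 2) (by positivity)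
    refine le_trans (measureReal_mono fun ω hω => (not_le.1 hω).le) (this.trans ?_)
    rw [div_le_div_iff₀ (by positivity) hH]
    nlinarith
  have p2 : (M.law n N).real {ω | ¬ avg (D.L j) (fun i => sqBelow (c / r) (h (ω.1 i).1))
      ≤ 2 * B ^ 2 * c ^ 2} ≤ 3 / Real.log p := by
    have hm1 : Measurable fun x => sqBelow (c / r) (h x) := (measurable_sqBelow _).comp hhm
    have hi2 : Integrable (fun x => sqBelow (c / r) (h x) ^ 2) M.PX :=
      integrable_of_abs_le_integrable (hi.const_mul ((c / r) ^ 2)) (hm1.pow_const 2)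
        (ae_of_all _ fun x => by
          rw [abs_of_nonneg (sq_nonneg _)]; exact sqBelow_sq_le _)
    have hi1 : Integrable (fun x => sqBelow (c / r) (h x)) M.PX :=
      integrable_of_abs_le_integrable hi hm1
        (ae_of_all _ fun x => by
          rw [abs_of_nonneg (sqBelow_nonneg _ _)]; exact sqBelow_le _ _)
    have hI1 : ∫ x, sqBelow (c / r) (h x) ∂M.PX ≤ B ^ 2 * c ^ 2 :=
      (integral_mono hi1 hi fun x => sqBelow_le _ _).trans hI'
    have hI2 : ∫ x, sqBelow (c / r) (h x) ^ 2 ∂M.PX ≤ (c / r) ^ 2 * (B ^ 2 * c ^ 2) := by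
      refine (integral_mono hi2 (hi.const_mul _) fun x => sqBelow_sq_le _).trans ?_
      rw [integral_const_mul]
      gcongr
    have := hX.chebyshev_avg (s := D.L j) (g := fun x => sqBelow (c / r) (h x)) hm1
      ((memLp_two_iff_integrable_sq hm1.aestronglyMeasurable).2 hi2) hs (t := B ^ 2 * c ^ 2)
      (by positivity)
    refine le_trans (measureReal_mono fun ω hω => ?_) (this.trans ?_)
    · have := not_le.1 hω
      simp only [Set.mem_ofPred_eq]
      linarith
    · have hr2 : r ^ 2 * n = Real.log p := by
        rw [hr_def, rt, Real.sq_sqrt (by positivity)]; field_simp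
      have hn3 := D.n_le_card_L hR.four_le_n j
      have hB2 := one_le_pow₀ hB (n := 2)
      calc _ ≤ (c / r) ^ 2 * (B ^ 2 * c ^ 2) / ((D.L j).card * (B ^ 2 * c ^ 2) ^ 2) := by gcongr
        _ = 1 / (B ^ 2 * (r ^ 2 * (D.L j).card)) := by field_simp
        _ ≤ 1 / (1 * (Real.log p / 3)) := by
          have : Real.log p / 3 ≤ r ^ 2 * (D.L j).card := by rw [← hr2]; nlinarith [sq_nonneg r]
          gcongr
        _ = 3 / Real.log p := by field_simp
  have p3 : (M.law n N).real {ω | ¬ P.K * avg (D.L j) (fun i => absAbove (c / r) (h (ω.1 i).1)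
      * (|M.resid (ω.1 i)| + 2 * B * P.LB)) ≤ c}
      ≤ 5 * B ^ 2 * (P.K * √r) + 2 * B ^ 3 * (P.K * P.LB * r) := by
    have h4 := hA.resid_fourth hB
    have hm1 : Measurable fun z : Obs p => absAbove (c / r) (h z.1)
        * (|M.resid z| + 2 * B * P.LB) :=
      (((measurable_absAbove _).comp hhm).comp measurable_fst).mul
        (M.measurable_resid.abs.add_const _)
    set G : Obs p → ℝ := fun z => √r * (3 / 4 * (h z.1 ^ 2 / c) + c * M.resid z ^ 4 / 4)
      + 2 * B * P.LB * (r / c) * h z.1 ^ 2 with hG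
    have hi' : Integrable (fun z : Obs p => h z.1 ^ 2) M.PXY :=
      M.integrable_fst_PXY (g := fun x => h x ^ 2) hi
    have hI'' : ∫ z, h z.1 ^ 2 ∂M.PXY ≤ B ^ 2 * c ^ 2 := by
      rw [M.integral_fst_PXY (g := fun x => h x ^ 2) (hhm.pow_const 2)]; exact hI'
    have ia : Integrable (fun z : Obs p => 3 / 4 * (h z.1 ^ 2 / c)) M.PXY :=
      (hi'.div_const c).const_mul _
    have ib : Integrable (fun z : Obs p => c * M.resid z ^ 4 / 4) M.PXY :=
      (h4.1.const_mul c).div_const 4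
    have iab : Integrable (fun z : Obs p => √r * (3 / 4 * (h z.1 ^ 2 / c)
      + c * M.resid z ^ 4 / 4)) M.PXY := (ia.add ib).const_mul _
    have ic : Integrable (fun z : Obs p => 2 * B * P.LB * (r / c) * h z.1 ^ 2) M.PXY :=
      hi'.const_mul _
    have hGi : Integrable G M.PXY := iab.add ic
    have hle : ∀ z : Obs p, absAbove (c / r) (h z.1) * (|M.resid z| + 2 * B * P.LB) ≤ G z := by
      intro z
      have e1 := absAbove_mul_le hr hc (Real.sqrt_nonneg r) (Real.sq_sqrt hr.le) (h z.1)
        (M.resid z)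
      have e2 := mul_absAbove_le (τ := c / r) (h z.1)
      have e3 : absAbove (c / r) (h z.1) ≤ r / c * h z.1 ^ 2 := by
        have := mul_le_mul_of_nonneg_left e2 (show 0 ≤ r / c by positivity)
        rwa [← mul_assoc, show r / c * (c / r) = 1 by field_simp, one_mul] at this
      have e4 := mul_le_mul_of_nonneg_left e3 (show 0 ≤ 2 * B * P.LB by positivity)
      simp only [hG]
      rw [mul_add]
      nlinarith
    have h0 : ∀ z : Obs p, 0 ≤ absAbove (c / r) (h z.1) * (|M.resid z| + 2 * B * P.LB) :=
      fun z => mul_nonneg (absAbove_nonneg _ _) (by positivity)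
    have hint : Integrable (fun z : Obs p => absAbove (c / r) (h z.1)
        * (|M.resid z| + 2 * B * P.LB)) M.PXY :=
      integrable_of_abs_le_integrable hGi hm1
        (ae_of_all _ fun z => by rw [abs_of_nonneg (h0 z)]; exact hle z)
    have := hXY.markov_avg (s := D.L j) hm1 hint h0 hs (t := c / P.K) (by positivity)
    refine le_trans (measureReal_mono fun ω hω => ?_) (this.trans ?_)
    · have := not_le.1 hω
      simp only [Set.mem_ofPred_eq]
      rw [div_le_iff₀' hK]
      exact this.le
    · have hGI : ∫ z, G z ∂M.PXY ≤ √r * (3 / 4 * (B ^ 2 * c ^ 2 / c) + c * (16 * B) / 4)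
          + 2 * B * P.LB * (r / c) * (B ^ 2 * c ^ 2) := by
        simp only [hG]
        rw [integral_add iab ic, integral_const_mul, integral_add ia ib, integral_const_mul,
          integral_div c, integral_div 4 fun z : Obs p => c * M.resid z ^ 4, integral_const_mul,
          integral_const_mul]
        gcongr
        exact h4.2
      rw [div_div_eq_mul_div, div_le_iff₀ hc]
      have hGI2 := (integral_mono hint hGi hle).trans hGI
      have hBB : B ≤ B ^ 2 := le_self_pow₀ hB (by norm_num)
      have e1 : √r * (3 / 4 * (B ^ 2 * c ^ 2 / c) + c * (16 * B) / 4)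
          + 2 * B * P.LB * (r / c) * (B ^ 2 * c ^ 2)
          = c * (√r * (3 / 4 * B ^ 2 + 4 * B) + 2 * B ^ 3 * P.LB * r) := by
        field_simp
        ring
      rw [e1] at hGI2
      calc _ ≤ c * (√r * (3 / 4 * B ^ 2 + 4 * B) + 2 * B ^ 3 * P.LB * r) * P.K := by gcongr
        _ ≤ c * (√r * (5 * B ^ 2) + 2 * B ^ 3 * P.LB * r) * P.K := by gcongr; linarith
        _ = _ := by ring
  have hV : ∫ x, (P.K * |h x|) ^ 2 ∂M.PX ≤ (P.K * B * c) ^ 2 := by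
    simp only [mul_pow, sq_abs]
    rw [integral_const_mul, mul_assoc]
    gcongr
  have hdom : ∀ l, ∀ᵐ x ∂M.PX, |x l * h x| ≤ P.K * |h x| := fun l => by
    filter_upwards [hA.bounded_X] with x hx
    rw [abs_mul]
    exact mul_le_mul_of_nonneg_right (hx l) (abs_nonneg _)
  have hcard : Fintype.card (Fin p) ≤ p ^ 2 := by
    have := hR.two_le_p; rw [Fintype.card_fin]; nlinarith
  have p4 := envelope_sq_prob hX hs hR.two_le_p (κ := Fin p) (g := fun l x => x l * h x)
    (G := fun x => P.K * |h x|) (fun l => (measurable_pi_apply l).mul hhm)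
    (hhm.abs.const_mul _) (h2.abs.const_mul _) hdom (by positivity) hV hcard
    (sqrt_log_div_card_L D j hR)
  have p5 := envelope_sq_prob hall hsU hR.two_le_p (κ := Fin p) (g := fun l x => x l * h x)
    (G := fun x => P.K * |h x|) (fun l => (measurable_pi_apply l).mul hhm)
    (hhm.abs.const_mul _) (h2.abs.const_mul _) hdom (by positivity) hV hcard
    (sqrt_log_div_card_LU D j hR)
  have hsum : B ^ 2 / H + 7 / Real.log p + (5 * B ^ 2 * (P.K * √r) + 2 * B ^ 3 * (P.K * P.LB * r))
      = B ^ 2 / H + (3 / Real.log p + ((5 * B ^ 2 * (P.K * √r) + 2 * B ^ 3 * (P.K * P.LB * r))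
        + (2 / Real.log p + 2 / Real.log p))) := by ring
  rw [hsum]
  have pall := real_not_and_le p1 (real_not_and_le p2 (real_not_and_le p3
    (real_not_and_le p4 p5)))
  refine le_trans ?_ pall
  refine measureReal_mono fun ω hω hall => hω ?_
  · obtain ⟨q1, q2, q3, q4, q5⟩ := hall
    refine ⟨q1, q2, q3, fun l => ?_⟩
    have e4 := abs_le.1 (q4 l)
    have e5 := abs_le.1 (q5 l)
    rw [abs_le]
    constructor <;> linarith [e4.1, e4.2, e5.1, e5.2]

end Diff

/-! ### The good event -/

section Good

variable {n N p : ℕ} {B δ : ℝ} {M : Model p} {P : Params}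

lemma measurable_avg_pi {ι Ω : Type*} [MeasurableSpace Ω] {s : Finset ι} {g : ι → Ω → ℝ}
    (hg : ∀ i, Measurable (g i)) : Measurable fun ω => avg s fun i => g i ω := by
  unfold avg
  exact (Finset.measurable_sum _ fun i _ => hg i).const_mul _

lemma goodDiff_mix (D : CrossFit n N p) (j : Fin 2) {H : ℝ} (g : (Fin p → ℝ) → ℝ)
    (q : Sample n N p × Sample n N p) :
    GoodDiff B H M P D j g (D.mix j q) ↔ GoodDiff B H M P D j g q.2 := by
  have h1 : ∀ i ∈ D.L j, (D.mix j q).1 i = q.2.1 i := fun i hi => by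
    have : D.foldL i = j := (Finset.mem_filter.1 hi).2
    simp [CrossFit.mix, this]
  have h2 : ∀ i ∈ D.LU j, allX (D.mix j q) i = allX q.2 i := fun i hi => by
    rcases i with i | i
    · have hi' : i ∈ D.L j := by simpa [CrossFit.LU] using hi
      simp [allX, h1 i hi']
    · simp [allX, CrossFit.mix]
  have e1 : ∀ F : Obs p → ℝ, avg (D.L j) (fun i => F ((D.mix j q).1 i))
      = avg (D.L j) fun i => F (q.2.1 i) := fun F => avg_congr fun i hi => by rw [h1 i hi]
  have e2 : ∀ F : (Fin p → ℝ) → ℝ, avg (D.LU j) (fun i => F (allX (D.mix j q) i))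
      = avg (D.LU j) fun i => F (allX q.2 i) := fun F => avg_congr fun i hi => by rw [h2 i hi]
  have a1 := e1 fun z => (g z.1 - M.m z.1) ^ 2
  have a2 := e1 fun z => sqBelow ((P.c + rt p n) / rt p n) (g z.1 - M.m z.1)
  have a3 := e1 fun z => absAbove ((P.c + rt p n) / rt p n) (g z.1 - M.m z.1)
    * (|M.resid z| + 2 * B * P.LB)
  have a4 := fun l => e1 fun z => z.1 l * (g z.1 - M.m z.1)
  have a5 := fun l => e2 fun x => x l * (g x - M.m x)
  constructor
  · rintro ⟨b1, b2, b3, b4⟩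
    exact ⟨a1 ▸ b1, a2 ▸ b2, a3 ▸ b3, fun l => by rw [← a4, ← a5]; exact b4 l⟩
  · rintro ⟨b1, b2, b3, b4⟩
    exact ⟨a1.symm ▸ b1, a2.symm ▸ b2, a3.symm ▸ b3, fun l => by rw [a4, a5]; exact b4 l⟩

lemma measurableSet_goodDiff (D : CrossFit n N p) (j : Fin 2) {H : ℝ} :
    MeasurableSet {ω : Sample n N p | GoodDiff B H M P D j (D.mAt ω j) ω} := by
  have hd : ∀ i : Fin n ⊕ Fin N, Measurable fun ω : Sample n N p =>
      D.mAt ω j (allX ω i) - M.m (allX ω i) := fun i =>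
    ((D.measurable_mAt j).comp (measurable_id.prodMk (Model.measurable_allX n N i))).sub
      (M.measurable_m.comp (Model.measurable_allX n N i))
  have hdL : ∀ i : Fin n, Measurable fun ω : Sample n N p =>
      D.mAt ω j (ω.1 i).1 - M.m (ω.1 i).1 := fun i => hd (Sum.inl i)
  have hx : ∀ (i : Fin n ⊕ Fin N) l, Measurable fun ω : Sample n N p => allX ω i l := fun i l =>
    (measurable_pi_apply l).comp (Model.measurable_allX n N i)
  have hxL : ∀ (i : Fin n) l, Measurable fun ω : Sample n N p => (ω.1 i).1 l :=
    fun i l => hx (Sum.inl i) l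
  have e : {ω : Sample n N p | GoodDiff B H M P D j (D.mAt ω j) ω} = {ω | _ ∧ _ ∧ _ ∧ _} :=
    Set.ext fun ω => ⟨fun h => ⟨h.1, h.2, h.3, h.4⟩, fun h => ⟨h.1, h.2.1, h.2.2.1, h.2.2.2⟩⟩
  rw [e]
  refine MeasurableSet.inter ?_ (MeasurableSet.inter ?_ (MeasurableSet.inter ?_ ?_))
  · exact measurableSet_le (measurable_avg_pi fun i => (hdL i).pow_const 2) measurable_const
  · exact measurableSet_le (measurable_avg_pi fun i => (measurable_sqBelow _).comp (hdL i))
      measurable_const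
  · exact measurableSet_le ((measurable_avg_pi fun i => ((measurable_absAbove _).comp (hdL i)).mul
      (((M.measurable_resid.comp (Model.measurable_labelled n N i)).abs).add_const _)).const_mul _)
      measurable_const
  · refine measurableSet_setOfPred.2 (Measurable.forall fun l => measurableSet_setOfPred.1 ?_)
    exact measurableSet_le ((measurable_avg_pi fun i => (hxL i l).mul (hdL i)).sub
        (measurable_avg_pi fun i => (hx i l).mul (hd i))).abs measurable_const

lemma measurable_eLpNorm_mAt (D : CrossFit n N p) (j : Fin 2) :
    Measurable fun ω : Sample n N p => eLpNorm (fun x => D.mAt ω j x - M.m x) 2 M.PX := by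
  simp only [eLpNorm_eq_lintegral_rpow_enorm_toReal (p := 2) (by norm_num) (by norm_num)]
  refine Measurable.pow_const ?_ _
  refine Measurable.lintegral_prod_right' (f := fun q : Sample n N p × (Fin p → ℝ) =>
    ‖D.mAt q.1 j q.2 - M.m q.2‖ₑ ^ (ENNReal.toReal 2)) ?_
  exact (((D.measurable_mAt j).sub (M.measurable_m.comp measurable_snd)).enorm).pow_const _

/-- The probability of the exceptional event of one fold. -/
lemma goodDiff_mAt_prob (hR : Regime B p n P) (hA : Assumptions (1 / B) B δ M n P)
    (D : CrossFit n N p) (j : Fin 2) {H : ℝ} (hH : 0 < H) :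
    (M.law n N).real {ω | eLpNorm (fun x => D.mAt ω j x - M.m x) 2 M.PX ≤ ENNReal.ofReal (B * P.c)
        ∧ ¬ GoodDiff B H M P D j (D.mAt ω j) ω}
      ≤ B ^ 2 / H + 7 / Real.log p
        + (5 * B ^ 2 * (P.K * √(rt p n)) + 2 * B ^ 3 * (P.K * P.LB * rt p n)) := by
  have hx : 0 ≤ B ^ 2 / H + 7 / Real.log p
      + (5 * B ^ 2 * (P.K * √(rt p n)) + 2 * B ^ 3 * (P.K * P.LB * rt p n)) := by
    have h1 := hR.log_pos
    have h2 := hR.one_le_B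
    have h3 := hR.K_pos hA
    have h4 := hR.LB_nonneg hA
    have h5 := hR.rt_pos
    positivity
  refine D.law_le_of_forall_fixed j M (E := fun g ω =>
    eLpNorm (fun x => g x - M.m x) 2 M.PX ≤ ENNReal.ofReal (B * P.c) ∧ ¬ GoodDiff B H M P D j g ω)
    (fun g q => by rw [goodDiff_mix]) ?_ hx fun ω' => ?_
  · exact (measurableSet_le (measurable_eLpNorm_mAt D j) measurable_const).inter
      (measurableSet_goodDiff D j).compl
  · by_cases h : eLpNorm (fun x => D.mAt ω' j x - M.m x) 2 M.PX ≤ ENNReal.ofReal (B * P.c)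
    · simp only [h, true_and]
      exact goodDiff_prob hR hA D j hH (D.measurable_mAt_apply j ω') h
    · simp only [h, false_and]
      simpa using hx

/-- The event on which the estimators are analysed. -/
structure Good (B H : ℝ) (M : Model p) (P : Params) (D : CrossFit n N p) (ω : Sample n N p) :
    Prop where
  bounded_X : ∀ i l, |allX ω i l| ≤ P.K
  bounded_m : ∀ i, |M.m (allX ω i)| ≤ B
  workFit_le : ∀ i k, |M.workFit k (allX ω i)| ≤ 2 * B * P.K * P.LB
  noise : ∀ k, |avg Finset.univ fun i => (ω.1 i).1 k * M.resid (ω.1 i)| ≤ 8 * rateD M n P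
  gram : ∀ k : Fin p × Fin p, |avg Finset.univ (fun i => (ω.1 i).1 k.1 * (ω.1 i).1 k.2)
    - M.Sigma k.1 k.2| ≤ 20 * B ^ 3 * rt p n
  gram_all : ∀ k : Fin p × Fin p, |avg Finset.univ (fun i => allX ω i k.1 * allX ω i k.2)
    - M.Sigma k.1 k.2| ≤ 20 * B ^ 3 * rt p (n + N)
  restricted_eig : RestrictedEig B P Finset.univ fun i => (ω.1 i).1
  resid_sq : avg Finset.univ (fun i => M.resid (ω.1 i) ^ 2) ≤ H
  M1_dev : ∀ k : Fin p × Fin p,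
    |avg Finset.univ (fun i => M.resid (ω.1 i) ^ 2 * ((ω.1 i).1 k.1 * (ω.1 i).1 k.2))
      - M.M1 k.1 k.2| ≤ 32 * B * P.K ^ 2 * rt p n
  M2_dev : ∀ j, ∀ k : Fin p × Fin p,
    |avg (D.L j) (fun i => (ω.1 i).1 k.1 * (ω.1 i).1 k.2 * M.m (ω.1 i).1 * M.resid (ω.1 i))
      - M.M2 k.1 k.2| ≤ 32 * B ^ 2 * P.K ^ 2 * rt p n
  work : ∀ j, ∀ k : Fin p × Fin p,
    |avg (D.L j) (fun i => (ω.1 i).1 k.1 * M.m (ω.1 i).1 * M.workErr (ω.1 i) k.2)|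
      ≤ 14 * (P.K * B) * B * rt p n
  work_mean : ∀ j k, |avg (D.L j) (fun i => M.workErr (ω.1 i) k)| ≤ 14 * B * rt p n
  workFit_sq : ∀ j k, avg (D.L j) (fun i => M.workFit k (ω.1 i).1 ^ 2) ≤ 35 * B ^ 5
  mean_L : ∀ j l, |avg (D.L j) (fun i => (ω.1 i).1 l * M.m (ω.1 i).1) - M.mu l|
    ≤ 10 * B ^ 2 * rt p n
  mean_LU : ∀ j l, |avg (D.LU j) (fun i => allX ω i l * M.m (allX ω i)) - M.mu l|
    ≤ 10 * B ^ 2 * rt p n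
  gram_m : ∀ j, ∀ k : Fin p × Fin p,
    |avg (D.L j) (fun i => (ω.1 i).1 k.1 * M.m (ω.1 i).1 * ((ω.1 i).1 k.2 * M.m (ω.1 i).1))
      - ∫ x, x k.1 * M.m x * (x k.2 * M.m x) ∂M.PX| ≤ 40 * B ^ 5 * rt p n
  diff : ∀ j, GoodDiff B H M P D j (D.mAt ω j) ω

lemma real_not_of_ae {Ω : Type*} [MeasurableSpace Ω] {Q : Measure Ω} {E : Ω → Prop}
    (h : ∀ᵐ ω ∂Q, E ω) : Q.real {ω | ¬ E ω} ≤ 0 := by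
  rw [measureReal_def, ae_iff.1 h]; simp

lemma real_not_forall_fin_two {Ω : Type*} [MeasurableSpace Ω] {Q : Measure Ω} [IsFiniteMeasure Q]
    {E : Fin 2 → Ω → Prop} {a : ℝ} (h : ∀ j, Q.real {ω | ¬ E j ω} ≤ a) :
    Q.real {ω | ¬ ∀ j, E j ω} ≤ 2 * a := by
  have := real_exists_le_card_mul (P := Q) (E := fun j => {ω | ¬ E j ω}) h
  refine le_trans (measureReal_mono fun ω hω => ?_) (this.trans (by simp))
  simpa only [Set.mem_ofPred_eq, not_forall] using hω

lemma rt_antitone {n n' : ℕ} (hn : 0 < n) (h : n ≤ n') : rt p n' ≤ rt p n := by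
  unfold rt
  have h1 : (n : ℝ) ≤ n' := by exact_mod_cast h
  have h2 : (0 : ℝ) < n := by exact_mod_cast hn
  have h3 := Real.log_natCast_nonneg p
  gcongr

/-- A bound for the probability of the exceptional event. -/
def badProb (B H : ℝ) (p n : ℕ) (P : Params) : ℝ :=
  4 * B ^ 2 / H + 40 / Real.log p + Real.exp (-(n / (256 * B ^ 4)))
    + 4096 * (P.K ^ 2 * rt p n) ^ 2
    + 2 * (5 * B ^ 2 * (P.K * √(rt p n)) + 2 * B ^ 3 * (P.K * P.LB * rt p n))

lemma good_prob (hR : Regime B p n P) (hA : Assumptions (1 / B) B δ M n P)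
    (D : CrossFit n N p) {H : ℝ} (hH : 0 < H) :
    (M.law n N).real {ω | (∀ j, eLpNorm (fun x => D.mAt ω j x - M.m x) 2 M.PX
        ≤ ENNReal.ofReal (B * P.c)) ∧ ¬ Good B H M P D ω} ≤ badProb B H p n P := by
  have hB := hR.one_le_B
  have hB0 : 0 < B := by linarith
  have hp := hR.two_le_p
  have hn := hR.n_pos
  have hK := hR.K_pos hA
  have hX := M.isIID_X n N
  have hall := M.isIID_allX n N
  have : Nonempty (Fin n) := ⟨⟨0, hn⟩⟩
  have hae : ∀ {q : (Fin p → ℝ) → Prop}, (∀ᵐ x ∂M.PX, q x) →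
      (M.law n N).real {ω | ¬ ∀ i, q (allX ω i)} ≤ 0 := fun hq => by
    refine real_not_of_ae ?_
    filter_upwards [hall.ae_forall Finset.univ hq] with ω hω i using hω i (Finset.mem_univ i)
  have q1 := hae hA.bounded_X
  have q2 := hae hA.bounded_m
  have q3 := hae (hA.workFit_bound hB)
  have q4 := noise_prob (N := N) hA hp hn
  have hKr : P.K ^ 2 * rt p n ≤ 1 := by
    linarith [hR.K_sq_rt, mul_nonneg (sq_nonneg P.K) (rt_nonneg p n)]
  have hrN : rt p (n + N) ≤ rt p n := rt_antitone hn (by omega)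
  have q5 := gram_prob hB hA hp hX (s := Finset.univ) Finset.univ_nonempty (r := rt p n)
    (by simp [rt]) hKr
  have q6 := gram_prob hB hA hp hall (s := Finset.univ) Finset.univ_nonempty (r := rt p (n + N))
    (by simp [rt]) ((mul_le_mul_of_nonneg_left hrN (sq_nonneg _)).trans hKr)
  have q7 := RE_prob (N := N) hB hA hp hn hR.s_sq
  have q8 := resid_prob (N := N) hB hA hn hH
  have q9 := M1_prob (N := N) hB hA hp hn
  have q10 := real_not_forall_fin_two fun j => M2_prob D j hR hA
  have q11 := real_not_forall_fin_two fun j => work_prob D j hR hA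
    (u := fun l x => x l * M.m x) (U := P.K * B)
    (fun l => (measurable_pi_apply l).mul M.measurable_m) (by positivity)
    (fun l => by filter_upwards [hA.coord_m_bound] with x hx using hx l)
    (fun l k => hA.integral_coord_m_workErr hB l k)
  have q12 := real_not_forall_fin_two fun j => work_prob D j hR hA
    (u := fun _ _ => 1) (U := 1) (fun _ => measurable_const) one_pos
    (fun l => by simp) (fun l k => by simpa using hA.integral_workErr k)
  have q13 := real_not_forall_fin_two fun j => workFit_prob D j hR hA
  have q14 := real_not_forall_fin_two fun j => mean_prob hR hA hX (D.L_nonempty hR.four_le_n j)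
    (sqrt_log_div_card_L D j hR)
  have q15 := real_not_forall_fin_two fun j => mean_prob hR hA hall (D.LU_nonempty hR.four_le_n j)
    (sqrt_log_div_card_LU D j hR)
  have q16 := real_not_forall_fin_two fun j => gram_m_prob D j hR hA
  have q17 := real_not_forall_fin_two (Q := M.law n N) (E := fun j ω =>
    eLpNorm (fun x => D.mAt ω j x - M.m x) 2 M.PX ≤ ENNReal.ofReal (B * P.c) →
      GoodDiff B H M P D j (D.mAt ω j) ω) fun j => by
    simpa only [Classical.not_imp] using goodDiff_mAt_prob hR hA D j hH
  have q7' : (M.law n N).real {ω | ¬ ((∀ j, |avg Finset.univ (fun i => (ω.1 i).1 j * (ω.1 i).1 j)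
      - M.Sigma j j| ≤ B / 2) → RestrictedEig B P Finset.univ fun i => (ω.1 i).1)}
      ≤ Real.exp (-(n / (256 * B ^ 4))) := by
    simpa only [Classical.not_imp] using q7
  have pall := real_not_and_le q1 <| real_not_and_le q2 <| real_not_and_le q3 <|
    real_not_and_le q4 <| real_not_and_le q5 <| real_not_and_le q6 <| real_not_and_le q7' <|
    real_not_and_le q8 <| real_not_and_le q9 <| real_not_and_le q10 <| real_not_and_le q11 <|
    real_not_and_le q12 <| real_not_and_le q13 <| real_not_and_le q14 <| real_not_and_le q15 <|
    real_not_and_le q16 q17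
  refine le_trans ?_ (pall.trans ?_)
  · refine measureReal_mono fun ω hω hg => hω.2 ?_
    obtain ⟨g1, g2, g3, g4, g5, g6, g7, g8, g9, g10, g11, g12, g13, g14, g15, g16, g17⟩ := hg
    refine ⟨g1, g2, g3, g4, g5, g6, g7 fun j => ?_, g8, g9, g10, g11, fun j k => ?_, g13, g14, g15,
      g16, fun j => g17 j (hω.1 j)⟩
    · refine (g5 (j, j)).trans ?_
      have h1 := hR.rt_le hA
      have h2 : B ^ 3 * rt p n ≤ B ^ 4 * rt p n := by
        have := rt_nonneg p n
        gcongr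
        norm_num
      linarith
    · simpa using g12 j (k, k)
  · unfold badProb
    have e : (10 : ℝ) / Real.log p = 10 * (1 / Real.log p) := by ring
    have hL : 0 ≤ 1 / Real.log p := by have := hR.log_pos; positivity
    have e2 : 2 * B ^ 2 / H + 2 * (B ^ 2 / H) = 4 * B ^ 2 / H := by ring
    have e3 : ∀ a : ℝ, a / Real.log p = a * (1 / Real.log p) := fun a => by ring
    rw [e3 2, e3 40, e3 7, ← e2]
    linarith

end Good

/-! ### The Dantzig selector and the node-wise lasso on the good event -/

lemma avg_univ_fin {n : ℕ} (g : Fin n → ℝ) : avg Finset.univ g = (n : ℝ)⁻¹ * ∑ i, g i := by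
  simp [avg]

lemma avg_univ_sum {n N : ℕ} (g : Fin n ⊕ Fin N → ℝ) :
    avg Finset.univ g = ((n : ℝ) + N)⁻¹ * ∑ i, g i := by
  simp [avg]

section Gram

variable {ι : Type*} {s : Finset ι} {p : ℕ} {z : ι → Fin p → ℝ}
  {S : Matrix (Fin p) (Fin p) ℝ} {ε : ℝ}

lemma gram_mulVec (h : ∀ k : Fin p × Fin p, |avg s (fun i => z i k.1 * z i k.2) - S k.1 k.2| ≤ ε)
    (a : Fin p → ℝ) (l : Fin p) :
    |avg s (fun i => z i l * (z i ⬝ᵥ a)) - (S *ᵥ a) l| ≤ l1 a * ε := by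
  have e : avg s (fun i => z i l * (z i ⬝ᵥ a)) - (S *ᵥ a) l
      = a ⬝ᵥ fun k => avg s (fun i => z i l * z i k) - S l k := by
    simp only [dotProduct, Finset.mul_sum, avg_sum, mulVec, ← Finset.sum_sub_distrib]
    refine Finset.sum_congr rfl fun k _ => ?_
    rw [mul_sub, ← avg_const_mul]
    congr 1
    · exact avg_congr fun i _ => by ring
    · ring
  rw [e]
  exact abs_dotProduct_le fun k => h (l, k)

lemma gram_form (h : ∀ k : Fin p × Fin p, |avg s (fun i => z i k.1 * z i k.2) - S k.1 k.2| ≤ ε)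
    (a : Fin p → ℝ) :
    |avg s (fun i => (z i ⬝ᵥ a) ^ 2) - a ⬝ᵥ (S *ᵥ a)| ≤ l1 a ^ 2 * ε := by
  have e : avg s (fun i => (z i ⬝ᵥ a) ^ 2) - a ⬝ᵥ (S *ᵥ a)
      = a ⬝ᵥ fun l => avg s (fun i => z i l * (z i ⬝ᵥ a)) - (S *ᵥ a) l := by
    have e1 : avg s (fun i => (z i ⬝ᵥ a) ^ 2)
        = a ⬝ᵥ fun l => avg s (fun i => z i l * (z i ⬝ᵥ a)) := by
      simp only [dotProduct, ← avg_const_mul]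
      rw [← avg_sum]
      refine avg_congr fun i _ => ?_
      rw [sq, Finset.sum_mul]
      exact Finset.sum_congr rfl fun j _ => by ring
    rw [e1, ← dotProduct_sub]; rfl
  rw [e, sq, mul_assoc]
  exact abs_dotProduct_le (gram_mulVec h a)

lemma avg_mul_dotProduct (u : ι → ℝ) (a : Fin p → ℝ) :
    avg s (fun i => u i * (z i ⬝ᵥ a)) = a ⬝ᵥ fun l => avg s fun i => u i * z i l := by
  simp only [dotProduct, ← avg_const_mul]
  rw [← avg_sum]
  refine avg_congr fun i _ => ?_
  rw [Finset.mul_sum]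
  exact Finset.sum_congr rfl fun j _ => by ring

end Gram

section Estimation

variable {n N p : ℕ} {B H A δ : ℝ} {M : Model p} {P : Params} {D : CrossFit n N p}
  {ω : Sample n N p}

lemma rateD_nonneg (hK : 0 ≤ P.K) : 0 ≤ rateD M n P := mul_nonneg hK (Real.sqrt_nonneg _)

lemma dantzig_bound (hR : Regime B p n P) (hA : Assumptions (1 / B) B δ M n P)
    (hG : Good B H M P D ω) {lam : ℝ} {t : Fin p → ℝ} (hlam : 8 * rateD M n P ≤ lam)
    (hlamA : lam ≤ A * rateD M n P) (ht : IsDantzig ω lam t) :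
    l1 (t - M.θ) ≤ 32 * A * B * (P.s * rateD M n P) ∧
      avg Finset.univ (fun i => ((ω.1 i).1 ⬝ᵥ (t - M.θ)) ^ 2)
        ≤ 64 * A ^ 2 * B * (P.s * rateD M n P ^ 2) := by
  have hB := hR.one_le_B
  have hB0 : 0 < B := by linarith
  have hD := rateD_nonneg (M := M) (n := n) (hR.K_pos hA).le
  have hs : (0 : ℝ) < P.s := by exact_mod_cast hA.one_le_s
  have hlam0 : 0 ≤ lam := by linarith
  have hθ : DantzigFeasible ω lam M.θ := fun k => by
    have h := hG.noise k
    rw [avg_univ_fin] at h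
    refine le_trans (le_of_eq ?_) (h.trans hlam)
    congr 2
    exact Finset.sum_congr rfl fun i _ => by rw [Model.resid]; ring
  have hfeas : ∀ k, |avg Finset.univ fun i => (ω.1 i).1 k * ((ω.1 i).1 ⬝ᵥ (t - M.θ))|
      ≤ 2 * lam := fun k => by
    have h1 := ht.1 k
    have h2 := hθ k
    have e : avg Finset.univ (fun i => (ω.1 i).1 k * ((ω.1 i).1 ⬝ᵥ (t - M.θ)))
        = (n : ℝ)⁻¹ * ∑ i, ((ω.1 i).2 - (ω.1 i).1 ⬝ᵥ M.θ) * (ω.1 i).1 k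
          - (n : ℝ)⁻¹ * ∑ i, ((ω.1 i).2 - (ω.1 i).1 ⬝ᵥ t) * (ω.1 i).1 k := by
      rw [avg_univ_fin, ← mul_sub, ← Finset.sum_sub_distrib]
      congr 1
      exact Finset.sum_congr rfl fun i _ => by rw [dotProduct_sub]; ring
    rw [e]
    refine (abs_sub _ _).trans ?_
    linarith
  obtain ⟨h1, h2⟩ := dantzig_oracle (I := Finset.univ) (z := fun i => (ω.1 i).1) (b₀ := M.θ)
    (b := t) (lam := lam) (c := 1 / (2 * B)) (ρ := 1 / (16 * B * P.s)) (s := P.s) hlam0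
    (by positivity) (by exact_mod_cast hA.sparse_θ)
    (le_of_eq (by field_simp; norm_num)) (by positivity) (ht.2 _ hθ) hfeas
    (hG.restricted_eig _)
  constructor
  · refine h1.trans ?_
    rw [div_div_eq_mul_div, div_one]
    have := mul_le_mul_of_nonneg_left hlamA (show 0 ≤ 32 * B * (P.s : ℝ) by positivity)
    nlinarith
  · refine h2.trans ?_
    rw [div_div_eq_mul_div, div_one]
    have h3 : lam ^ 2 ≤ (A * rateD M n P) ^ 2 := by gcongr
    have := mul_le_mul_of_nonneg_left h3 (show 0 ≤ 64 * B * (P.s : ℝ) by positivity)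
    nlinarith

/-! ### The precision matrix -/

namespace Assumptions

lemma Omega_comm (M : Model p) (k l : Fin p) : M.Omega k l = M.Omega l k := by
  conv_lhs => rw [← Omega_symm M, transpose_apply]

lemma Sigma_mulVec_Omega (hB : 1 ≤ B) (hA : Assumptions (1 / B) B δ M n P) (k : Fin p) :
    M.Sigma *ᵥ M.Omega k = Pi.single k 1 := by
  have h := hA.Sigma_mul_Omega hB
  ext l
  have h1 : (M.Sigma *ᵥ M.Omega k) l = (M.Sigma * M.Omega) l k := by
    simp only [mulVec, dotProduct, mul_apply]
    exact Finset.sum_congr rfl fun i _ => by rw [Omega_comm]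
  rw [h1, h, one_apply, Pi.single_apply]

lemma Omega_form (hB : 1 ≤ B) (hA : Assumptions (1 / B) B δ M n P) (k : Fin p) :
    M.Omega k ⬝ᵥ (M.Sigma *ᵥ M.Omega k) = M.Omega k k := by
  rw [hA.Sigma_mulVec_Omega hB, dotProduct_single_one]

lemma l2_Omega (hB : 1 ≤ B) (hA : Assumptions (1 / B) B δ M n P) (k : Fin p) :
    l2 (M.Omega k) ^ 2 ≤ B * M.Omega k k := by
  have h := hA.eig_Sigma (M.Omega k)
  rw [hA.Omega_form hB] at h
  have hB0 : 0 < B := by linarith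
  rwa [div_mul_eq_mul_div, one_mul, div_le_iff₀' hB0] at h

lemma Omega_diag_ge (hB : 1 ≤ B) (hA : Assumptions (1 / B) B δ M n P) (k : Fin p) :
    1 / B ≤ M.Omega k k := by
  have hB0 : 0 < B := by linarith
  have h := hA.eig_Sigma (Pi.single k (1 / B) - M.Omega k)
  have h0 : 0 ≤ 1 / B * l2 (Pi.single k (1 / B) - M.Omega k) ^ 2 := by positivity
  have e : Pi.single k (1 / B) = (1 / B) • (Pi.single k 1 : Fin p → ℝ) := by
    rw [← Pi.single_smul, smul_eq_mul, mul_one]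
  have h2 : M.Omega k ⬝ᵥ (M.Sigma *ᵥ Pi.single k 1) = 1 := by
    rw [dotProduct_mulVec, ← mulVec_transpose, Sigma_symm, hA.Sigma_mulVec_Omega hB,
      single_one_dotProduct, Pi.single_eq_same]
  rw [e, mulVec_sub, mulVec_smul, hA.Sigma_mulVec_Omega hB, sub_dotProduct, dotProduct_sub,
    dotProduct_sub, smul_dotProduct, smul_dotProduct, dotProduct_smul, dotProduct_smul, h2,
    dotProduct_single_one, single_one_dotProduct, mulVec_single_one, col_apply,
    Pi.single_eq_same, dotProduct_single_one] at h
  rw [e] at h0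
  simp only [smul_eq_mul, mul_one] at h
  have h3 : 1 / B * (1 / B * M.Sigma k k) ≤ 1 / B := by
    have := hA.diag_Sigma k
    have h4 : 1 / B * M.Sigma k k ≤ 1 := by
      rw [div_mul_eq_mul_div, one_mul, div_le_one hB0]; exact this
    calc _ ≤ 1 / B * 1 := by gcongr
      _ = _ := mul_one _
  linarith

lemma Omega_diag_le (hB : 1 ≤ B) (hA : Assumptions (1 / B) B δ M n P) (k : Fin p) :
    M.Omega k k ≤ B := by
  have hB0 : 0 < B := by linarith
  have h1 := hA.l2_Omega hB k
  have h2 := hA.Omega_diag_ge hB k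
  have h3 : 0 < M.Omega k k := lt_of_lt_of_le (by positivity) h2
  have h4 : M.Omega k k ^ 2 ≤ l2 (M.Omega k) ^ 2 := by
    rw [l2_sq]
    exact Finset.single_le_sum (f := fun i => M.Omega k i ^ 2) (fun _ _ => sq_nonneg _)
      (Finset.mem_univ k)
  nlinarith

lemma l1_Omega_le_sqrt (hB : 1 ≤ B) (hA : Assumptions (1 / B) B δ M n P) (k : Fin p) :
    l1 (M.Omega k) ≤ √P.sΩ * B := by
  have hB0 : 0 < B := by linarith
  have h1 := l1_sq_le_of_sparse (M.Omega k) (s := P.sΩ) (by exact_mod_cast hA.sparse_Omega k)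
  have h2 := hA.l2_Omega hB k
  have h3 := hA.Omega_diag_le hB k
  refine le_of_sq_le_sq ?_ (by positivity)
  rw [mul_pow, Real.sq_sqrt (by positivity)]
  refine h1.trans (mul_le_mul_of_nonneg_left ?_ (by positivity))
  nlinarith

lemma one_le_sΩ (hB : 1 ≤ B) (hA : Assumptions (1 / B) B δ M n P) (k : Fin p) :
    1 ≤ P.sΩ := by
  refine le_trans ?_ (hA.sparse_Omega k)
  have h2 := hA.Omega_diag_ge hB k
  have h3 : M.Omega k k ≠ 0 := (lt_of_lt_of_le (by positivity) h2).ne'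
  exact (Set.ncard_pos (Set.toFinite _)).2 ⟨k, h3⟩

lemma LΩ_ge (hB : 1 ≤ B) (hA : Assumptions (1 / B) B δ M n P) (k : Fin p) : 1 / B ≤ P.LΩ :=
  ((hA.Omega_diag_ge hB k).trans (le_abs_self _)).trans ((abs_le_l1 _ k).trans (hA.l1_Omega k))

end Assumptions

end Estimation

section Nodewise

variable {n N p : ℕ} {B H A δ : ℝ} {M : Model p} {P : Params} {D : CrossFit n N p}
  {ω : Sample n N p}

/-- The coefficients of the regression of the `k`-th covariate on the others. -/
def Model.nodeCoef (M : Model p) (k : Fin p) : Fin p → ℝ :=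
  fun l => if l = k then 0 else -(M.Omega k l / M.Omega k k)

lemma Model.sub_dotProduct_nodeCoef (M : Model p) {k : Fin p} (h : M.Omega k k ≠ 0)
    (x : Fin p → ℝ) : x k - x ⬝ᵥ M.nodeCoef k = (M.Omega k k)⁻¹ * (x ⬝ᵥ M.Omega k) := by
  have e : M.nodeCoef k = Pi.single k 1 - (M.Omega k k)⁻¹ • M.Omega k := by
    ext l
    simp only [nodeCoef, Pi.sub_apply, Pi.single_apply, Pi.smul_apply, smul_eq_mul]
    split_ifs with hl
    · rw [hl, inv_mul_cancel₀ h, sub_self]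
    · rw [div_eq_inv_mul, zero_sub]
  rw [e, dotProduct_sub, dotProduct_single_one, dotProduct_smul, smul_eq_mul]
  ring

lemma Model.l0_nodeCoef (M : Model p) (k : Fin p) : l0 (M.nodeCoef k) ≤ l0 (M.Omega k) := by
  refine Set.ncard_le_ncard (fun l hl => ?_) (Set.toFinite _)
  simp only [Function.mem_support, nodeCoef, ne_eq] at hl ⊢
  intro h0
  exact hl (by rw [h0]; simp)

/-- The unlabelled sample is large in comparison with the parameters of the precision matrix. -/
structure RegimeΩ (A B : ℝ) (p n N : ℕ) (P : Params) : Prop where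
  small : 1440 * A * B ^ 12 * ((P.K * P.LΩ) ^ 2 * P.sΩ * rt p (n + N)) ≤ 1
  one_le_A : 1 ≤ A

namespace RegimeΩ

lemma one_le_BLΩ (hR : Regime B p n P) (hA : Assumptions (1 / B) B δ M n P) :
    1 ≤ B * P.LΩ := by
  have h := hA.LΩ_ge hR.one_le_B ⟨0, by have := hR.two_le_p; omega⟩
  have hB0 : 0 < B := by linarith [hR.one_le_B]
  rwa [div_le_iff₀' hB0] at h

lemma LΩ_pos (hR : Regime B p n P) (hA : Assumptions (1 / B) B δ M n P) : 0 < P.LΩ := by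
  have h := one_le_BLΩ hR hA
  have := hR.one_le_B
  by_contra h0
  nlinarith

lemma one_le_sΩ (hR : Regime B p n P) (hA : Assumptions (1 / B) B δ M n P) : (1 : ℝ) ≤ P.sΩ := by
  exact_mod_cast hA.one_le_sΩ hR.one_le_B ⟨0, by have := hR.two_le_p; omega⟩

lemma rt_pos (hR : Regime B p n P) (N : ℕ) : 0 < rt p (n + N) := by
  have h1 := hR.log_pos
  have h2 : (0 : ℝ) < ((n + N : ℕ) : ℝ) := by exact_mod_cast (by have := hR.n_pos; omega)
  exact Real.sqrt_pos.2 (by positivity)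

lemma rateN_pos (hR : Regime B p n P) (hA : Assumptions (1 / B) B δ M n P) (N : ℕ) :
    0 < rateN p n N P :=
  mul_pos (mul_pos (hR.K_pos hA) (LΩ_pos hR hA)) (rt_pos hR N)

lemma sΩ_rateN (hS : RegimeΩ A B p n N P) (hR : Regime B p n P)
    (hA : Assumptions (1 / B) B δ M n P) :
    1440 * A * B ^ 10 * (P.sΩ * rateN p n N P) ≤ 1 := by
  refine le_trans ?_ hS.small
  have h1 := hR.one_le_BK hA
  have h2 := one_le_BLΩ hR hA
  have h3 : 1 ≤ B * P.K * (B * P.LΩ) := one_le_mul_of_one_le_of_one_le h1 h2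
  have hK := hR.K_pos hA
  have hL := LΩ_pos hR hA
  have hr := rt_pos hR N
  have hB := hR.one_le_B
  have hA1 := hS.one_le_A
  have h4 : 0 ≤ 1440 * A * B ^ 10 * (P.sΩ * rateN p n N P) := by
    have := rateN_pos hR hA N; positivity
  calc _ ≤ 1440 * A * B ^ 10 * (P.sΩ * rateN p n N P) * (B * P.K * (B * P.LΩ)) :=
        le_mul_of_one_le_right h4 h3
    _ = _ := by rw [rateN]; ring

lemma sΩ_K_rt (hS : RegimeΩ A B p n N P) (hR : Regime B p n P)
    (hA : Assumptions (1 / B) B δ M n P) :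
    1440 * A * B ^ 9 * (P.sΩ * P.K * rt p (n + N)) ≤ 1 := by
  refine le_trans ?_ (hS.sΩ_rateN hR hA)
  have h2 := one_le_BLΩ hR hA
  have hK := hR.K_pos hA
  have hr := rt_pos hR N
  have hB := hR.one_le_B
  have hA1 := hS.one_le_A
  calc _ ≤ 1440 * A * B ^ 9 * (P.sΩ * P.K * rt p (n + N)) * (B * P.LΩ) :=
        le_mul_of_one_le_right (by positivity) h2
    _ = _ := by rw [rateN]; ring

lemma sΩ_rt (hS : RegimeΩ A B p n N P) (hR : Regime B p n P)
    (hA : Assumptions (1 / B) B δ M n P) :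
    1440 * A * B ^ 8 * (P.sΩ * rt p (n + N)) ≤ 1 := by
  refine le_trans ?_ (hS.sΩ_K_rt hR hA)
  have h2 := hR.one_le_BK hA
  have hr := rt_pos hR N
  have hB := hR.one_le_B
  have hA1 := hS.one_le_A
  calc _ ≤ 1440 * A * B ^ 8 * (P.sΩ * rt p (n + N)) * (B * P.K) :=
        le_mul_of_one_le_right (by positivity) h2
    _ = _ := by ring

end RegimeΩ

lemma nodewise_bound (hS : RegimeΩ A B p n N P) (hR : Regime B p n P)
    (hA : Assumptions (1 / B) B δ M n P)
    (hG : Good B H M P D ω) {lam : ℝ} {g : Fin p → ℝ} {k : Fin p}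
    (hlam : 40 * B ^ 5 * rateN p n N P ≤ lam)
    (hlamA : lam ≤ A * rateN p n N P) (hg : IsNodewise ω k lam g) :
    l1 (g - M.nodeCoef k) ≤ 120 * A * B * (P.sΩ * rateN p n N P) ∧
      avg Finset.univ (fun i => (allX ω i ⬝ᵥ (g - M.nodeCoef k)) ^ 2)
        ≤ 200 * A ^ 2 * B * (P.sΩ * rateN p n N P ^ 2) := by
  have hB := hR.one_le_B
  have hB0 : 0 < B := by linarith
  have hν := RegimeΩ.rateN_pos hR hA N
  have hlam0 : 0 < lam := lt_of_lt_of_le (by positivity) hlam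
  have hs := RegimeΩ.one_le_sΩ hR hA
  have hr := RegimeΩ.rt_pos hR N
  have hΩ := hA.Omega_diag_ge hB k
  have hΩ0 : 0 < M.Omega k k := lt_of_lt_of_le (by positivity) hΩ
  have hinv : (M.Omega k k)⁻¹ ≤ B := by
    rw [inv_le_comm₀ hΩ0 hB0, ← one_div]; exact hΩ
  have hgk : M.nodeCoef k k = 0 := by simp [Model.nodeCoef]
  have hres := fun x => M.sub_dotProduct_nodeCoef hΩ0.ne' x
  have hnoise : ∀ l, l ≠ k → |avg Finset.univ fun i =>
      (allX ω i k - allX ω i ⬝ᵥ M.nodeCoef k) * allX ω i l| ≤ lam / 2 := fun l hl => by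
    have h1 := gram_mulVec hG.gram_all (M.Omega k) l
    rw [hA.Sigma_mulVec_Omega hB, Pi.single_eq_of_ne hl, sub_zero] at h1
    have e : avg Finset.univ (fun i => (allX ω i k - allX ω i ⬝ᵥ M.nodeCoef k) * allX ω i l)
        = (M.Omega k k)⁻¹ * avg Finset.univ fun i => allX ω i l * (allX ω i ⬝ᵥ M.Omega k) := by
      rw [← avg_const_mul]
      exact avg_congr fun i _ => by rw [hres]; ring
    rw [e, abs_mul, abs_of_pos (inv_pos.2 hΩ0)]
    have h2 := one_le_mul_of_one_le_of_one_le hB (hR.one_le_BK hA)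
    have hL := RegimeΩ.LΩ_pos hR hA
    calc _ ≤ B * (P.LΩ * (20 * B ^ 3 * rt p (n + N))) := by
          gcongr
          refine h1.trans ?_
          have := hA.l1_Omega k
          gcongr
      _ = 20 * B ^ 4 * (P.LΩ * rt p (n + N)) := by ring
      _ ≤ 20 * B ^ 4 * (P.LΩ * rt p (n + N)) * (B * P.K) :=
          le_mul_of_one_le_right (by positivity) (hR.one_le_BK hA)
      _ = 40 * B ^ 5 * rateN p n N P / 2 := by rw [rateN]; ring
      _ ≤ lam / 2 := by gcongr
  have hmin := hg.2 (show M.nodeCoef k ∈ {g' : Fin p → ℝ | g' k = 0} from hgk)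
  simp only [Set.mem_ofPred_eq, ← avg_univ_sum] at hmin
  obtain ⟨h1, h2⟩ := lasso_oracle (I := Finset.univ) (z := allX ω) (y := fun i => allX ω i k)
    (b₀ := M.nodeCoef k) (b := g) (lam := 2 * lam) (t := 0) (c := 1 / B)
    (ρ := 20 * B ^ 3 * rt p (n + N)) (s := P.sΩ) (by positivity) (by positivity)
    (by exact_mod_cast (M.l0_nodeCoef k).trans (hA.sparse_Omega k))
    (by
      rw [le_div_iff₀ hB0]
      have h3 := hS.sΩ_rt hR hA
      have h4 : B ^ 4 ≤ A * B ^ 8 := by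
        have h5 : B ^ 4 ≤ B ^ 8 := pow_le_pow_right₀ hB (by norm_num)
        nlinarith [hS.one_le_A, pow_pos hB0 8]
      calc 72 * P.sΩ * (20 * B ^ 3 * rt p (n + N)) * B
          = 1440 * B ^ 4 * (P.sΩ * rt p (n + N)) := by ring
        _ ≤ 1440 * (A * B ^ 8) * (P.sΩ * rt p (n + N)) := by gcongr
        _ ≤ 1 := by linarith)
    (by positivity) hmin (u := fun i => allX ω i k - allX ω i ⬝ᵥ M.nodeCoef k) (w := fun _ => 0)
    (fun i _ => by simp)
    (by
      rw [avg_mul_dotProduct]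
      have e : (g - M.nodeCoef k) ⬝ᵥ (fun l => avg Finset.univ fun i =>
          (allX ω i k - allX ω i ⬝ᵥ M.nodeCoef k) * allX ω i l)
          = (g - M.nodeCoef k) ⬝ᵥ (fun l => if l = k then 0 else avg Finset.univ fun i =>
          (allX ω i k - allX ω i ⬝ᵥ M.nodeCoef k) * allX ω i l) := by
        refine Finset.sum_congr rfl fun l _ => ?_
        simp only
        split_ifs with hl
        · rw [hl, Pi.sub_apply, hg.1, hgk]; ring
        · rfl
      rw [e, mul_comm]
      refine (abs_dotProduct_le (b := lam / 2) fun l => ?_).trans (le_of_eq (by ring))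
      split_ifs with hl
      · rw [abs_zero]; positivity
      · exact hnoise l hl)
    (by simp [avg])
    (by
      have h3 := (abs_le.1 (gram_form hG.gram_all (g - M.nodeCoef k))).1
      have h4 := hA.eig_Sigma (g - M.nodeCoef k)
      linarith)
  rw [div_div_eq_mul_div, div_one] at h1 h2
  constructor
  · refine h1.trans ?_
    rw [zero_pow two_ne_zero, mul_zero, zero_div, add_zero]
    calc 60 * P.sΩ * (2 * lam) * B = 120 * B * P.sΩ * lam := by ring
      _ ≤ 120 * B * P.sΩ * (A * rateN p n N P) := by gcongr
      _ = _ := by ring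
  · refine h2.trans ?_
    rw [zero_pow two_ne_zero, mul_zero, add_zero]
    calc 50 * P.sΩ * (2 * lam) ^ 2 * B = 200 * B * P.sΩ * lam ^ 2 := by ring
      _ ≤ 200 * B * P.sΩ * (A * rateN p n N P) ^ 2 := by gcongr
      _ = _ := by ring

lemma nodewise_kkt {lam : ℝ} {g : Fin p → ℝ} {k : Fin p} (hlam : 0 ≤ lam)
    (hg : IsNodewise ω k lam g) {l : Fin p} (hl : l ≠ k) :
    |avg Finset.univ fun i => (allX ω i k - allX ω i ⬝ᵥ g) * allX ω i l| ≤ lam := by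
  refine lasso_kkt hlam fun t => ?_
  have hmin := hg.2 (show g + Pi.single l t ∈ {g' : Fin p → ℝ | g' k = 0} by
    simp [hg.1, hl.symm])
  simpa only [Set.mem_ofPred_eq, ← avg_univ_sum] using hmin

/-- `τ̂ₖ²` is close to its target. -/
lemma tauSq_bound (hS : RegimeΩ A B p n N P) (hR : Regime B p n P)
    (hA : Assumptions (1 / B) B δ M n P)
    (hG : Good B H M P D ω) {lam : ℝ} {g : Fin p → Fin p → ℝ} {k : Fin p}
    (hlam : 40 * B ^ 5 * rateN p n N P ≤ lam)
    (hlamA : lam ≤ A * rateN p n N P) (hg : IsNodewise ω k lam (g k)) :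
    |tauSq ω g k - (M.Omega k k)⁻¹| ≤ 40 * A * B ^ 5 * (√P.sΩ * rateN p n N P) := by
  have hB := hR.one_le_B
  have hB0 : 0 < B := by linarith
  have hA1 := hS.one_le_A
  have hν := RegimeΩ.rateN_pos hR hA N
  have hs := RegimeΩ.one_le_sΩ hR hA
  have hr := RegimeΩ.rt_pos hR N
  have hΩ := hA.Omega_diag_ge hB k
  have hΩ0 : 0 < M.Omega k k := lt_of_lt_of_le (by positivity) hΩ
  have hinv : (M.Omega k k)⁻¹ ≤ B := by
    rw [inv_le_comm₀ hΩ0 hB0, ← one_div]; exact hΩ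
  have hL := RegimeΩ.LΩ_pos hR hA
  obtain ⟨-, h2⟩ := nodewise_bound hS hR hA hG hlam hlamA hg
  set Δ := g k - M.nodeCoef k with hΔ
  have h1 := gram_mulVec hG.gram_all (M.Omega k) k
  rw [hA.Sigma_mulVec_Omega hB, Pi.single_eq_same] at h1
  have e : tauSq ω g k - (M.Omega k k)⁻¹ = (M.Omega k k)⁻¹
      * (avg Finset.univ (fun i => allX ω i k * (allX ω i ⬝ᵥ M.Omega k)) - 1)
      - avg Finset.univ (fun i => allX ω i k * (allX ω i ⬝ᵥ Δ)) := by
    rw [mul_sub, mul_one, ← avg_const_mul, sub_right_comm, ← avg_sub, tauSq, ← avg_univ_sum]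
    congr 1
    refine avg_congr fun i _ => ?_
    have h3 := M.sub_dotProduct_nodeCoef hΩ0.ne' (allX ω i)
    rw [hΔ, dotProduct_sub]
    linear_combination (allX ω i k) * h3
  have hsq : avg Finset.univ (fun i => allX ω i k ^ 2) ≤ 2 * B := by
    have h3 := (abs_le.1 (hG.gram_all (k, k))).2
    have h4 := hA.diag_Sigma k
    have h5 : 20 * B ^ 3 * rt p (n + N) ≤ B := by
      have h6 := hS.sΩ_rt hR hA
      have h7 : B ^ 3 ≤ B ^ 8 := pow_le_pow_right₀ hB (by norm_num)
      have h8 : B ^ 3 * rt p (n + N) ≤ A * B ^ 8 * (P.sΩ * rt p (n + N)) := by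
        calc B ^ 3 * rt p (n + N) ≤ B ^ 8 * rt p (n + N) := by gcongr
          _ = 1 * B ^ 8 * (1 * rt p (n + N)) := by ring
          _ ≤ _ := by gcongr
      nlinarith
    simp only [sq]
    linarith
  have h3 : |avg Finset.univ fun i => allX ω i k * (allX ω i ⬝ᵥ Δ)|
      ≤ 20 * A * B * (√P.sΩ * rateN p n N P) := by
    refine (abs_avg_mul_le _ _).trans ?_
    rw [← Real.sqrt_mul (avg_nonneg fun i _ => sq_nonneg _)]
    refine Real.sqrt_le_iff.2 ⟨by positivity, ?_⟩
    calc _ ≤ 2 * B * (200 * A ^ 2 * B * (P.sΩ * rateN p n N P ^ 2)) := by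
          gcongr
          exact avg_nonneg fun i _ => sq_nonneg _
      _ = (20 * A * B) ^ 2 * (P.sΩ * rateN p n N P ^ 2) := by ring
      _ = _ := by rw [mul_pow (20 * A * B), mul_pow √(P.sΩ : ℝ), Real.sq_sqrt (by positivity)]
  have h4 : |(M.Omega k k)⁻¹
      * (avg Finset.univ (fun i => allX ω i k * (allX ω i ⬝ᵥ M.Omega k)) - 1)|
      ≤ 20 * A * B ^ 5 * (√P.sΩ * rateN p n N P) := by
    rw [abs_mul, abs_of_pos (inv_pos.2 hΩ0)]
    have hs1 : 1 ≤ √(P.sΩ : ℝ) := Real.one_le_sqrt.2 hs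
    calc _ ≤ B * (P.LΩ * (20 * B ^ 3 * rt p (n + N))) := by
          gcongr
          refine h1.trans ?_
          have := hA.l1_Omega k
          gcongr
      _ = 20 * B ^ 4 * (P.LΩ * rt p (n + N)) := by ring
      _ ≤ 20 * B ^ 4 * (P.LΩ * rt p (n + N)) * (B * P.K) :=
          le_mul_of_one_le_right (by positivity) (hR.one_le_BK hA)
      _ = 20 * 1 * B ^ 5 * (1 * rateN p n N P) := by rw [rateN]; ring
      _ ≤ _ := by gcongr
  rw [e]
  refine (abs_sub _ _).trans ?_
  have h5 : 20 * A * B * (√P.sΩ * rateN p n N P) ≤ 20 * A * B ^ 5 * (√P.sΩ * rateN p n N P) := by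
    gcongr
    exact le_self_pow₀ hB (by norm_num)
  linarith

/-- The rows of `Ω̂`. -/
lemma omegaHat_bound (hS : RegimeΩ A B p n N P) (hR : Regime B p n P)
    (hA : Assumptions (1 / B) B δ M n P)
    (hG : Good B H M P D ω) {lam : ℝ} {g : Fin p → Fin p → ℝ} {k : Fin p}
    (hlam : 40 * B ^ 5 * rateN p n N P ≤ lam)
    (hlamA : lam ≤ A * rateN p n N P) (hg : IsNodewise ω k lam (g k)) :
    l1 (omegaHat ω g k - M.Omega k) ≤ 320 * A * B ^ 9 * (P.sΩ * rateN p n N P) ∧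
      (∀ l, |avg Finset.univ (fun i => (allX ω i ⬝ᵥ omegaHat ω g k) * allX ω i l)
        - (1 : Matrix (Fin p) (Fin p) ℝ) k l| ≤ 2 * A * B * rateN p n N P) ∧
      l1 (omegaHat ω g k) ≤ 2 * P.LΩ := by
  have hB := hR.one_le_B
  have hB0 : 0 < B := by linarith
  have hA1 := hS.one_le_A
  have hν := RegimeΩ.rateN_pos hR hA N
  have hs := RegimeΩ.one_le_sΩ hR hA
  have hs1 : 1 ≤ √(P.sΩ : ℝ) := Real.one_le_sqrt.2 hs
  have hss : √(P.sΩ : ℝ) * √(P.sΩ : ℝ) = P.sΩ := Real.mul_self_sqrt (by positivity)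
  have hss' : √(P.sΩ : ℝ) ≤ P.sΩ := by nlinarith
  have hL := RegimeΩ.LΩ_pos hR hA
  have hΩ := hA.Omega_diag_ge hB k
  have hΩ' := hA.Omega_diag_le hB k
  have hΩ0 : 0 < M.Omega k k := lt_of_lt_of_le (by positivity) hΩ
  obtain ⟨h1, -⟩ := nodewise_bound hS hR hA hG hlam hlamA hg
  have hτ := tauSq_bound hS hR hA hG hlam hlamA hg
  set τ := tauSq ω g k with hτ_def
  have hsmall : 40 * A * B ^ 5 * (√P.sΩ * rateN p n N P) ≤ 1 / (2 * B) := by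
    rw [le_div_iff₀ (by positivity)]
    have h3 := hS.sΩ_rateN hR hA
    calc 40 * A * B ^ 5 * (√P.sΩ * rateN p n N P) * (2 * B)
        = 80 * A * B ^ 6 * (√P.sΩ * rateN p n N P) := by ring
      _ ≤ 1440 * A * B ^ 10 * (P.sΩ * rateN p n N P) := by
          gcongr <;> first | exact hB | norm_num
      _ ≤ 1 := h3
  have hinv : 1 / B ≤ (M.Omega k k)⁻¹ := by
    rw [one_div]; exact inv_anti₀ hΩ0 hΩ'
  have hτ1 : 1 / (2 * B) ≤ τ := by
    have := (abs_le.1 (hτ.trans hsmall)).1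
    have e : 1 / B = 1 / (2 * B) + 1 / (2 * B) := by field_simp; norm_num
    linarith
  have hτ0 : 0 < τ := lt_of_lt_of_le (by positivity) hτ1
  have hτi : τ⁻¹ ≤ 2 * B := by
    rw [inv_le_comm₀ hτ0 (by positivity), ← one_div]; exact hτ1
  have hdiff : |τ⁻¹ - M.Omega k k| ≤ 80 * A * B ^ 7 * (√P.sΩ * rateN p n N P) := by
    have e : τ⁻¹ - M.Omega k k = τ⁻¹ * M.Omega k k * ((M.Omega k k)⁻¹ - τ) := by field_simp
    rw [e, abs_mul, abs_of_pos (by positivity), abs_sub_comm]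
    calc _ ≤ 2 * B * B * (40 * A * B ^ 5 * (√P.sΩ * rateN p n N P)) := by gcongr
      _ = _ := by ring
  have hrow : omegaHat ω g k - M.Omega k = (-τ⁻¹) • (g k - M.nodeCoef k)
      + ((M.Omega k k)⁻¹ * (τ⁻¹ - M.Omega k k)) • M.Omega k := by
    ext l
    simp only [omegaHat, of_apply, Pi.sub_apply, Pi.add_apply, Pi.smul_apply, smul_eq_mul,
      Model.nodeCoef, ← hτ_def]
    split_ifs with hl
    · rw [hl, hg.1]; field_simp; ring
    · field_simp; ring
  have hbound : l1 (omegaHat ω g k - M.Omega k)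
      ≤ 320 * A * B ^ 9 * (P.sΩ * rateN p n N P) := by
    rw [hrow]
    refine (l1_add_le _ _).trans ?_
    rw [l1_smul, l1_smul, abs_neg, abs_of_pos (inv_pos.2 hτ0), abs_mul,
      abs_of_pos (inv_pos.2 hΩ0)]
    have h4 : (M.Omega k k)⁻¹ ≤ B := by
      rw [inv_le_comm₀ hΩ0 hB0, ← one_div]; exact hΩ
    calc _ ≤ 2 * B * (120 * A * B * (P.sΩ * rateN p n N P))
          + B * (80 * A * B ^ 7 * (√P.sΩ * rateN p n N P)) * (√P.sΩ * B) := by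
          gcongr
          · exact l1_nonneg _
          · exact l1_nonneg _
          · exact hA.l1_Omega_le_sqrt hB k
      _ = (240 * A * B ^ 2 + 80 * A * B ^ 9) * (P.sΩ * rateN p n N P) := by
          linear_combination (80 * A * B ^ 9 * rateN p n N P) * hss
      _ ≤ (240 * A * B ^ 9 + 80 * A * B ^ 9) * (P.sΩ * rateN p n N P) := by
          gcongr <;> first | exact hB | norm_num
      _ = _ := by ring
  refine ⟨hbound, fun l => ?_, ?_⟩
  · have hx : ∀ i, allX ω i ⬝ᵥ omegaHat ω g k = τ⁻¹ * (allX ω i k - allX ω i ⬝ᵥ g k) := fun i => by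
      have e : omegaHat ω g k = τ⁻¹ • (Pi.single k 1 - g k) := by
        ext l
        simp only [omegaHat, of_apply, Pi.smul_apply, Pi.sub_apply, Pi.single_apply, smul_eq_mul,
          ← hτ_def]
        split_ifs with hl
        · rw [hl, hg.1]; ring
        · ring
      rw [e, dotProduct_smul, dotProduct_sub, dotProduct_single_one, smul_eq_mul]
    have e2 : avg Finset.univ (fun i => (allX ω i ⬝ᵥ omegaHat ω g k) * allX ω i l)
        = τ⁻¹ * avg Finset.univ fun i => (allX ω i k - allX ω i ⬝ᵥ g k) * allX ω i l := by
      rw [← avg_const_mul]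
      exact avg_congr fun i _ => by rw [hx]; ring
    rw [e2]
    by_cases hl : l = k
    · have e3 : avg Finset.univ (fun i => (allX ω i k - allX ω i ⬝ᵥ g k) * allX ω i l) = τ := by
        rw [hτ_def, tauSq, avg_univ_sum, hl]
      rw [e3, hl, one_apply_eq, inv_mul_cancel₀ hτ0.ne', sub_self, abs_zero]
      positivity
    · rw [one_apply_ne (Ne.symm hl), sub_zero, abs_mul, abs_of_pos (inv_pos.2 hτ0)]
      have hlam0 : 0 ≤ lam := le_trans (by positivity) hlam
      calc _ ≤ 2 * B * (A * rateN p n N P) := by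
            gcongr
            exact (nodewise_kkt hlam0 hg hl).trans hlamA
        _ = _ := by ring
  · have h5 : l1 (omegaHat ω g k) ≤ l1 (omegaHat ω g k - M.Omega k) + l1 (M.Omega k) := by
      have := l1_add_le (omegaHat ω g k - M.Omega k) (M.Omega k)
      rwa [sub_add_cancel] at this
    have h6 := hA.l1_Omega k
    have h7 : 320 * A * B ^ 9 * (P.sΩ * rateN p n N P) ≤ P.LΩ := by
      have h8 := hS.sΩ_K_rt hR hA
      have hr := RegimeΩ.rt_pos hR N
      have hK := hR.K_pos hA
      calc 320 * A * B ^ 9 * (P.sΩ * rateN p n N P)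
          = 320 * A * B ^ 9 * (P.sΩ * P.K * rt p (n + N)) * P.LΩ := by rw [rateN]; ring
        _ ≤ 1440 * A * B ^ 9 * (P.sΩ * P.K * rt p (n + N)) * P.LΩ := by gcongr; norm_num
        _ ≤ 1 * P.LΩ := by gcongr
        _ = _ := one_mul _
    linarith

end Nodewise

/-! ### The lasso estimate of the columns of `B` on the good event -/

section LassoB

variable {n N p : ℕ} {B H A CB δ : ℝ} {M : Model p} {P : Params} {D : CrossFit n N p}
  {ω : Sample n N p}

/-- The order of the approximation error of the working regression. -/
def misfit (M : Model p) (n : ℕ) (P : Params) : ℝ :=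
  P.K * P.LB * (P.c + rt p n) + P.K * (√P.s * rateD M n P)

lemma misfit_eq : misfit M n P = P.K * P.LB * (P.c + rt p n)
    + P.K ^ 2 * √(P.s * (M.noiseVar + P.Φ ^ 2) * Real.log p / n) := by
  rw [misfit, rateD, show (P.s : ℝ) * (M.noiseVar + P.Φ ^ 2) * Real.log p / n
    = P.s * ((M.noiseVar + P.Φ ^ 2) * Real.log p / n) by ring, Real.sqrt_mul (by positivity)]
  ring

/-- The order of the `ℓ¹`-error of the estimated columns of `B`. -/
def rateB (M : Model p) (n : ℕ) (P : Params) : ℝ :=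
  P.sB * (P.K * (P.c + rt p n)) + √P.sB * misfit M n P

/-- The estimation error of `m̂` is small in comparison with the sparsity of `B`. -/
structure RegimeB (B H : ℝ) (p n : ℕ) (P : Params) : Prop where
  small : 5472 * B ^ 7 * H * (P.sB * P.K ^ 2 * (P.c + rt p n)) ≤ 1
  one_le_H : 1 ≤ H

namespace RegimeB

lemma ct_pos (hR : Regime B p n P) (hA : Assumptions (1 / B) B δ M n P) :
    0 < P.c + rt p n := add_pos_of_nonneg_of_pos hA.c_nonneg hR.rt_pos

lemma one_le_sB (hA : Assumptions (1 / B) B δ M n P) : (1 : ℝ) ≤ P.sB := by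
  exact_mod_cast hA.one_le_sB

lemma K_ct (hS : RegimeB B H p n P) (hR : Regime B p n P) (hA : Assumptions (1 / B) B δ M n P) :
    5472 * B ^ 6 * H * (P.K * (P.c + rt p n)) ≤ 1 := by
  refine le_trans ?_ hS.small
  have hc := ct_pos hR hA
  have hK := hR.K_pos hA
  have hB := hR.one_le_B
  have hH := hS.one_le_H
  calc 5472 * B ^ 6 * H * (P.K * (P.c + rt p n))
      ≤ 5472 * B ^ 6 * H * (P.K * (P.c + rt p n)) * (B * P.K) :=
        le_mul_of_one_le_right (by positivity) (hR.one_le_BK hA)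
    _ ≤ 5472 * B ^ 6 * H * (P.K * (P.c + rt p n)) * (B * P.K) * P.sB :=
        le_mul_of_one_le_right (by positivity) (one_le_sB hA)
    _ = _ := by ring

lemma ct_le (hS : RegimeB B H p n P) (hR : Regime B p n P) (hA : Assumptions (1 / B) B δ M n P) :
    5472 * B ^ 5 * H * (P.c + rt p n) ≤ 1 := by
  refine le_trans ?_ (hS.K_ct hR hA)
  have hc := ct_pos hR hA
  have hB := hR.one_le_B
  have hH := hS.one_le_H
  calc 5472 * B ^ 5 * H * (P.c + rt p n)
      ≤ 5472 * B ^ 5 * H * (P.c + rt p n) * (B * P.K) :=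
        le_mul_of_one_le_right (by positivity) (hR.one_le_BK hA)
    _ = _ := by ring

lemma ct_le_one (hS : RegimeB B H p n P) (hR : Regime B p n P)
    (hA : Assumptions (1 / B) B δ M n P) : P.c + rt p n ≤ 1 := by
  refine le_trans ?_ (hS.ct_le hR hA)
  have hc := ct_pos hR hA
  have h1 : 1 ≤ 5472 * B ^ 5 * H :=
    one_le_mul_of_one_le_of_one_le
      (one_le_mul_of_one_le_of_one_le (by norm_num) (one_le_pow₀ hR.one_le_B)) hS.one_le_H
  exact le_mul_of_one_le_left hc.le h1

end RegimeB

lemma misfit_nonneg (hR : Regime B p n P) (hA : Assumptions (1 / B) B δ M n P) :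
    0 ≤ misfit M n P := by
  have h1 := hR.K_pos hA
  have h2 := hR.LB_nonneg hA
  have h3 := RegimeB.ct_pos hR hA
  have h4 := rateD_nonneg (M := M) (n := n) h1.le
  unfold misfit
  positivity

lemma lamOpt_bound (hR : Regime B p n P) (hA : Assumptions (1 / B) B δ M n P) (hCB : 2 ≤ CB)
    {lam : ℝ} (h : IsLamOpt CB M n P lam) :
    P.sB * lam + lam⁻¹ * misfit M n P ^ 2 ≤ CB * rateB M n P := by
  have hK := hR.K_pos hA
  have hc := RegimeB.ct_pos hR hA
  have hs := RegimeB.one_le_sB hA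
  have hs0 : 0 < √(P.sB : ℝ) := Real.sqrt_pos.2 (by linarith)
  have hss : √(P.sB : ℝ) * √(P.sB : ℝ) = P.sB := Real.mul_self_sqrt (by positivity)
  have ht := misfit_nonneg hR hA
  set t := misfit M n P with ht_def
  set lam₁ := CB * P.K * (P.c + rt p n) + t / √P.sB with hlam₁
  have h0 : 0 < CB * P.K * (P.c + rt p n) := by positivity
  have h1 : lam₁ ∈ Set.Ici (CB * P.K * (P.c + rt p n)) := by
    simp only [Set.mem_Ici, hlam₁]
    have : 0 ≤ t / √P.sB := by positivity
    linarith
  have h2 := h.2 h1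
  simp only [Set.mem_ofPred_eq, ← misfit_eq, ← ht_def] at h2
  have h3 : lam₁⁻¹ * t ^ 2 ≤ √P.sB * t := by
    have hl0 : 0 < lam₁ := lt_of_lt_of_le h0 h1
    rw [inv_mul_le_iff₀ hl0]
    have h4 : t / √P.sB * (√P.sB * t) = t ^ 2 := by field_simp
    have h5 : 0 ≤ CB * P.K * (P.c + rt p n) * (√P.sB * t) := by positivity
    rw [hlam₁]
    nlinarith
  have h4 : P.sB * lam₁ = CB * (P.sB * (P.K * (P.c + rt p n))) + √P.sB * t := by
    rw [hlam₁, mul_add]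
    have : P.sB * (t / √(P.sB : ℝ)) = √P.sB * t := by
      rw [← mul_div_assoc, div_eq_iff hs0.ne']; linear_combination (-t) * hss
    rw [this]; ring
  have h5 : 2 * (√P.sB * t) ≤ CB * (√P.sB * t) := by gcongr
  rw [rateB, mul_add]
  linarith

variable {j : Fin 2}

lemma avg_fold_le (hR : Regime B p n P) (D : CrossFit n N p) (j : Fin 2) {g : Fin n → ℝ}
    (hg : ∀ i, 0 ≤ g i) : avg (D.L j) g ≤ 3 * avg Finset.univ g :=
  avg_subset_le (Finset.subset_univ _) (fun i _ => hg i) (D.L_nonempty hR.four_le_n j)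
    (by simpa using D.n_le_card_L hR.four_le_n j)

lemma Good.X_le (hG : Good B H M P D ω) (i : Fin n) (l : Fin p) : |(ω.1 i).1 l| ≤ P.K :=
  hG.bounded_X (Sum.inl i) l

lemma Good.m_le (hG : Good B H M P D ω) (i : Fin n) : |M.m (ω.1 i).1| ≤ B :=
  hG.bounded_m (Sum.inl i)

/-- `m̂⁻ʲ - m` at the `i`-th labelled observation. -/
def CrossFit.diffAt (D : CrossFit n N p) (M : Model p) (ω : Sample n N p) (j : Fin 2)
    (i : Fin n) : ℝ := D.mAt ω j (ω.1 i).1 - M.m (ω.1 i).1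

lemma Good.avg_diff_sq (hG : Good B H M P D ω) (j : Fin 2) :
    avg (D.L j) (fun i => D.diffAt M ω j i ^ 2) ≤ H * (P.c + rt p n) ^ 2 := (hG.diff j).sq

lemma Good.avg_abs_diff (hG : Good B H M P D ω) (hS : RegimeB B H p n P) (hR : Regime B p n P)
    (hA : Assumptions (1 / B) B δ M n P) (j : Fin 2) :
    avg (D.L j) (fun i => |D.diffAt M ω j i|) ≤ H * (P.c + rt p n) := by
  have hc := RegimeB.ct_pos hR hA
  have hH := hS.one_le_H
  refine (avg_abs_le_sqrt (D.L_nonempty hR.four_le_n j) _).trans ?_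
  refine Real.sqrt_le_iff.2 ⟨by positivity, (hG.avg_diff_sq j).trans ?_⟩
  rw [mul_pow]
  gcongr
  exact le_self_pow₀ hH (by norm_num)

lemma muL_eq (D : CrossFit n N p) (ω : Sample n N p) (j : Fin 2) (l : Fin p) :
    D.muL ω j l = avg (D.L j) (fun i => (ω.1 i).1 l * M.m (ω.1 i).1)
      + avg (D.L j) fun i => (ω.1 i).1 l * D.diffAt M ω j i := by
  rw [← avg_add]
  exact avg_congr fun i _ => by rw [CrossFit.diffAt]; ring

lemma abs_avg_mul_le_of_bound {ι : Type*} {s : Finset ι} {f g : ι → ℝ} {b : ℝ}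
    (hf : ∀ i, |f i| ≤ b) : |avg s fun i => f i * g i| ≤ b * avg s fun i => |g i| := by
  refine (abs_avg_le _).trans ?_
  rw [← avg_const_mul]
  refine avg_mono fun i _ => ?_
  rw [abs_mul]
  exact mul_le_mul_of_nonneg_right (hf i) (abs_nonneg _)

lemma muL_dev (hG : Good B H M P D ω) (hS : RegimeB B H p n P) (hR : Regime B p n P)
    (hA : Assumptions (1 / B) B δ M n P) (j : Fin 2) (l : Fin p) :
    |D.muL ω j l - M.mu l| ≤ 11 * B ^ 3 * H * (P.K * (P.c + rt p n)) := by
  have hK := hR.K_pos hA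
  have hB := hR.one_le_B
  have hc := RegimeB.ct_pos hR hA
  have hH := hS.one_le_H
  have h1 := hG.mean_L j l
  have h2 := abs_avg_mul_le_of_bound (s := D.L j) (g := fun i => D.diffAt M ω j i)
    (fun i => hG.X_le i l)
  have h3 := mul_le_mul_of_nonneg_left (hG.avg_abs_diff hS hR hA j) hK.le
  have h4 : 10 * B ^ 2 * rt p n ≤ 10 * B ^ 3 * H * (P.K * (P.c + rt p n)) := by
    have hr := hR.rt_pos
    calc 10 * B ^ 2 * rt p n ≤ 10 * B ^ 2 * rt p n * (B * P.K) :=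
          le_mul_of_one_le_right (by positivity) (hR.one_le_BK hA)
      _ = 10 * B ^ 3 * 1 * (P.K * (0 + rt p n)) := by ring
      _ ≤ _ := by have := hA.c_nonneg; gcongr
  have h5 : P.K * (H * (P.c + rt p n)) ≤ B ^ 3 * H * (P.K * (P.c + rt p n)) := by
    calc _ = 1 * H * (P.K * (P.c + rt p n)) := by ring
      _ ≤ _ := by gcongr; exact one_le_pow₀ hB
  rw [muL_eq (M := M), add_sub_right_comm]
  refine (abs_add_le _ _).trans ?_
  linarith

lemma muL_le (hG : Good B H M P D ω) (hS : RegimeB B H p n P) (hR : Regime B p n P)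
    (hA : Assumptions (1 / B) B δ M n P) (j : Fin 2) (l : Fin p) :
    |D.muL ω j l| ≤ 2 * (P.K * B) := by
  have h1 := muL_dev hG hS hR hA j l
  have h2 := hA.mu_bound l
  have hK := hR.K_pos hA
  have hB := hR.one_le_B
  have hc := RegimeB.ct_pos hR hA
  have hH := hS.one_le_H
  have h3 : 11 * B ^ 3 * H * (P.K * (P.c + rt p n)) ≤ P.K * B := by
    have h4 := hS.ct_le hR hA
    calc 11 * B ^ 3 * H * (P.K * (P.c + rt p n)) = 11 * B ^ 3 * H * (P.c + rt p n) * P.K := by ring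
      _ ≤ 5472 * B ^ 5 * H * (P.c + rt p n) * P.K := by
          gcongr <;> first | exact hB | norm_num
      _ ≤ 1 * P.K := by gcongr
      _ ≤ P.K * B := by nlinarith
  have h4 := abs_add_le (D.muL ω j l - M.mu l) (M.mu l)
  rw [sub_add_cancel] at h4
  linarith

lemma Assumptions.M3_apply (hA : Assumptions (1 / B) B δ M n P) (k l : Fin p) :
    M.M3 k l = ∫ x, x k * M.m x * (x l * M.m x) ∂M.PX - M.mu k * M.mu l := by
  have i0 : Integrable (fun x => x k * M.m x * (x l * M.m x)) M.PX :=
    integrable_bdd_mul (hA.integrable_coord_m l) ((measurable_pi_apply k).mul M.measurable_m)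
      (by filter_upwards [hA.coord_m_bound] with x hx using hx k)
  have i1 := (hA.integrable_coord_m k).mul_const (M.mu l)
  have i2 := (hA.integrable_coord_m l).const_mul (M.mu k)
  have e : ∀ x, M.T2 x k * M.T2 x l = x k * M.m x * (x l * M.m x) - x k * M.m x * M.mu l
      - M.mu k * (x l * M.m x) + M.mu k * M.mu l := fun x => by
    simp only [Model.T2]; ring
  have i3 : Integrable (fun x => x k * M.m x * (x l * M.m x) - x k * M.m x * M.mu l) M.PX :=
    i0.sub i1
  have i4 : Integrable (fun x => x k * M.m x * (x l * M.m x) - x k * M.m x * M.mu l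
      - M.mu k * (x l * M.m x)) M.PX := i3.sub i2
  simp only [Model.M3, of_apply, e]
  rw [integral_add i4 (integrable_const _), integral_sub i3 i2, integral_sub i0 i1,
    integral_mul_const, integral_const_mul]
  simp only [integral_const, probReal_univ, one_smul]
  simp only [Model.mu]
  ring

/-- The regressors of the lasso for `B`. -/
def CrossFit.regressor (D : CrossFit n N p) (ω : Sample n N p) (j : Fin 2) (i : Fin n) :
    Fin p → ℝ := fun l => (ω.1 i).1 l * D.mAt ω j (ω.1 i).1 - D.muL ω j l

lemma gram_regressor (hG : Good B H M P D ω) (hS : RegimeB B H p n P) (hR : Regime B p n P)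
    (hA : Assumptions (1 / B) B δ M n P) (j : Fin 2) (k : Fin p × Fin p) :
    |avg (D.L j) (fun i => D.regressor ω j i k.1 * D.regressor ω j i k.2) - M.M3 k.1 k.2|
      ≤ 76 * B ^ 6 * H * (P.K ^ 2 * (P.c + rt p n)) := by
  have hK := hR.K_pos hA
  have hB := hR.one_le_B
  have hc := RegimeB.ct_pos hR hA
  have hH := hS.one_le_H
  have hne := D.L_nonempty hR.four_le_n j
  have hmu : ∀ l, D.muL ω j l = avg (D.L j) fun i => (ω.1 i).1 l * D.mAt ω j (ω.1 i).1 :=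
    fun l => rfl
  have e1 : avg (D.L j) (fun i => D.regressor ω j i k.1 * D.regressor ω j i k.2)
      = avg (D.L j) (fun i => (ω.1 i).1 k.1 * M.m (ω.1 i).1 * ((ω.1 i).1 k.2 * M.m (ω.1 i).1))
        + avg (D.L j) (fun i => (ω.1 i).1 k.1 * (ω.1 i).1 k.2
          * (2 * M.m (ω.1 i).1 * D.diffAt M ω j i + D.diffAt M ω j i ^ 2))
        - D.muL ω j k.1 * D.muL ω j k.2 := by
    have e2 : ∀ i, D.regressor ω j i k.1 * D.regressor ω j i k.2
        = (ω.1 i).1 k.1 * D.mAt ω j (ω.1 i).1 * ((ω.1 i).1 k.2 * D.mAt ω j (ω.1 i).1)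
          - D.muL ω j k.1 * ((ω.1 i).1 k.2 * D.mAt ω j (ω.1 i).1)
          - D.muL ω j k.2 * ((ω.1 i).1 k.1 * D.mAt ω j (ω.1 i).1)
          + D.muL ω j k.1 * D.muL ω j k.2 := fun i => by
      simp only [CrossFit.regressor]; ring
    simp only [e2]
    rw [avg_add, avg_sub, avg_sub, avg_const_mul, avg_const_mul, ← hmu, ← hmu, avg_const hne,
      ← avg_add]
    have e3 : avg (D.L j) (fun i => (ω.1 i).1 k.1 * D.mAt ω j (ω.1 i).1
        * ((ω.1 i).1 k.2 * D.mAt ω j (ω.1 i).1))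
        = avg (D.L j) fun i => (ω.1 i).1 k.1 * M.m (ω.1 i).1 * ((ω.1 i).1 k.2 * M.m (ω.1 i).1)
        + (ω.1 i).1 k.1 * (ω.1 i).1 k.2
          * (2 * M.m (ω.1 i).1 * D.diffAt M ω j i + D.diffAt M ω j i ^ 2) :=
      avg_congr fun i _ => by rw [CrossFit.diffAt]; ring
    rw [e3]
    ring
  have h1 := hG.gram_m j k
  have h2 : |avg (D.L j) (fun i => (ω.1 i).1 k.1 * (ω.1 i).1 k.2
      * (2 * M.m (ω.1 i).1 * D.diffAt M ω j i + D.diffAt M ω j i ^ 2))|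
      ≤ 3 * B ^ 6 * H * (P.K ^ 2 * (P.c + rt p n)) := by
    have h3 : |avg (D.L j) (fun i => (ω.1 i).1 k.1 * (ω.1 i).1 k.2
        * (2 * M.m (ω.1 i).1 * D.diffAt M ω j i + D.diffAt M ω j i ^ 2))|
        ≤ P.K ^ 2 * avg (D.L j) fun i => |2 * M.m (ω.1 i).1 * D.diffAt M ω j i
          + D.diffAt M ω j i ^ 2| := by
      refine abs_avg_mul_le_of_bound fun i => ?_
      rw [abs_mul, sq]
      exact mul_le_mul (hG.X_le i _) (hG.X_le i _) (abs_nonneg _) hK.le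
    have h4 : avg (D.L j) (fun i => |2 * M.m (ω.1 i).1 * D.diffAt M ω j i
          + D.diffAt M ω j i ^ 2|) ≤ 2 * B * (H * (P.c + rt p n)) + H * (P.c + rt p n) ^ 2 := by
      have h5 : avg (D.L j) (fun i => |2 * M.m (ω.1 i).1 * D.diffAt M ω j i
          + D.diffAt M ω j i ^ 2|) ≤ avg (D.L j) fun i => 2 * B * |D.diffAt M ω j i|
          + D.diffAt M ω j i ^ 2 := by
        refine avg_mono fun i _ => (abs_add_le _ _).trans ?_
        rw [abs_mul, abs_mul, abs_two, abs_of_nonneg (sq_nonneg (D.diffAt M ω j i))]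
        have := hG.m_le i
        gcongr
      refine h5.trans ?_
      rw [avg_add, avg_const_mul]
      have := hG.avg_abs_diff hS hR hA j
      have := hG.avg_diff_sq j
      gcongr
    have h6 : (P.c + rt p n) ^ 2 ≤ P.c + rt p n := by
      have := hS.ct_le_one hR hA
      nlinarith
    have h7 : B ≤ B ^ 6 := le_self_pow₀ hB (by norm_num)
    have h8 : H * (P.c + rt p n) ^ 2 ≤ B ^ 6 * H * (P.c + rt p n) := by
      calc H * (P.c + rt p n) ^ 2 ≤ H * (P.c + rt p n) := by gcongr
        _ = 1 * H * (P.c + rt p n) := by ring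
        _ ≤ _ := by gcongr; exact one_le_pow₀ hB
    calc _ ≤ P.K ^ 2 * (2 * B * (H * (P.c + rt p n)) + H * (P.c + rt p n) ^ 2) :=
          h3.trans (by gcongr)
      _ ≤ P.K ^ 2 * (2 * B ^ 6 * (H * (P.c + rt p n)) + B ^ 6 * H * (P.c + rt p n)) := by
          refine mul_le_mul_of_nonneg_left (add_le_add (by gcongr) h8) (by positivity)
      _ = _ := by ring
  have h3 : |D.muL ω j k.1 * D.muL ω j k.2 - M.mu k.1 * M.mu k.2|
      ≤ 33 * B ^ 6 * H * (P.K ^ 2 * (P.c + rt p n)) := by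
    have e : D.muL ω j k.1 * D.muL ω j k.2 - M.mu k.1 * M.mu k.2
        = (D.muL ω j k.1 - M.mu k.1) * D.muL ω j k.2 + M.mu k.1 * (D.muL ω j k.2 - M.mu k.2) := by
      ring
    rw [e]
    refine (abs_add_le _ _).trans ?_
    rw [abs_mul, abs_mul]
    have a1 := muL_dev hG hS hR hA j k.1
    have a2 := muL_dev hG hS hR hA j k.2
    have a3 := muL_le hG hS hR hA j k.2
    have a4 := hA.mu_bound k.1
    calc _ ≤ 11 * B ^ 3 * H * (P.K * (P.c + rt p n)) * (2 * (P.K * B))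
          + P.K * B * (11 * B ^ 3 * H * (P.K * (P.c + rt p n))) := by gcongr
      _ = 33 * B ^ 4 * H * (P.K ^ 2 * (P.c + rt p n)) := by ring
      _ ≤ _ := by gcongr <;> first | exact hB | norm_num
  have h4 : 40 * B ^ 5 * rt p n ≤ 40 * B ^ 6 * H * (P.K ^ 2 * (P.c + rt p n)) := by
    have hr := hR.rt_pos
    calc 40 * B ^ 5 * rt p n ≤ 40 * B ^ 5 * rt p n * (B * P.K ^ 2) :=
          le_mul_of_one_le_right (by positivity) (hR.one_le_BK_sq hA)
      _ = 40 * B ^ 6 * 1 * (P.K ^ 2 * (0 + rt p n)) := by ring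
      _ ≤ _ := by have := hA.c_nonneg; gcongr
  rw [e1, hA.M3_apply]
  rw [abs_le] at h1 h2 h3 ⊢
  constructor <;> linarith [h1.1, h1.2, h2.1, h2.2, h3.1, h3.2]

end LassoB

section LassoBound

variable {n N p : ℕ} {B H A CB δ : ℝ} {M : Model p} {P : Params} {D : CrossFit n N p}
  {ω : Sample n N p}

lemma avg_workErr_sq (hG : Good B H M P D ω) (hR : Regime B p n P)
    (hA : Assumptions (1 / B) B δ M n P) (j : Fin 2) (k : Fin p) :
    avg (D.L j) (fun i => M.workErr (ω.1 i) k ^ 2) ≤ 172 * B ^ 5 := by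
  have hB := hR.one_le_B
  have h1 : avg (D.L j) (fun i => ((ω.1 i).1 k * M.resid (ω.1 i)) ^ 2) ≤ 51 * B ^ 5 := by
    have h2 := avg_fold_le hR D j (g := fun i => ((ω.1 i).1 k * M.resid (ω.1 i)) ^ 2)
      fun i => sq_nonneg _
    have h3 := (abs_le.1 (hG.M1_dev (k, k))).2
    have e : avg Finset.univ (fun i => M.resid (ω.1 i) ^ 2 * ((ω.1 i).1 k * (ω.1 i).1 k))
        = avg Finset.univ fun i => ((ω.1 i).1 k * M.resid (ω.1 i)) ^ 2 :=
      avg_congr fun i _ => by ring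
    have h4 : M.M1 k k ≤ 16 * B ^ 5 := by
      refine le_trans (le_of_eq ?_) (hA.coord_resid_sq hR.one_le_B k).2
      simp only [Model.M1, of_apply, Model.T1, Model.resid, sq]
    have h5 : 32 * B * P.K ^ 2 * rt p n ≤ B ^ 5 := by
      have h6 := hR.K_sq_rt
      have h7 : B ≤ B ^ 5 := le_self_pow₀ hB (by norm_num)
      have h8 : 0 ≤ P.K ^ 2 * rt p n := mul_nonneg (sq_nonneg _) (rt_nonneg _ _)
      calc 32 * B * P.K ^ 2 * rt p n = 32 * (P.K ^ 2 * rt p n) * B := by ring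
        _ ≤ 1 * B := by gcongr; linarith
        _ ≤ _ := by linarith
    simp only at h3
    rw [e] at h3
    linarith
  have h2 := hG.workFit_sq j k
  have h3 : avg (D.L j) (fun i => M.workErr (ω.1 i) k ^ 2)
      ≤ avg (D.L j) fun i => 2 * ((ω.1 i).1 k * M.resid (ω.1 i)) ^ 2
        + 2 * M.workFit k (ω.1 i).1 ^ 2 := avg_mono fun i _ => by
    rw [M.workErr_eq]
    nlinarith [sq_nonneg ((ω.1 i).1 k * M.resid (ω.1 i) + M.workFit k (ω.1 i).1)]
  rw [avg_add, avg_const_mul, avg_const_mul] at h3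
  linarith

lemma Good.workErr_le (hG : Good B H M P D ω) (i : Fin n) (k : Fin p) :
    |M.workErr (ω.1 i) k| ≤ P.K * (|M.resid (ω.1 i)| + 2 * B * P.LB) := by
  rw [M.workErr_eq]
  refine (abs_sub _ _).trans ?_
  rw [abs_mul]
  have h1 := mul_le_mul_of_nonneg_right (hG.X_le i k) (abs_nonneg (M.resid (ω.1 i)))
  have h2 : |M.workFit k (ω.1 i).1| ≤ _ := hG.workFit_le (Sum.inl i) k
  nlinarith

lemma abs_le_sqrt_sqBelow_add (τ y : ℝ) : |y| ≤ √(sqBelow τ y) + absAbove τ y := by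
  unfold sqBelow absAbove
  split_ifs
  · rw [Real.sqrt_sq_eq_abs, add_zero]
  · simp

/-- The noise level of the lasso for `B`. -/
lemma noise_regressor (hG : Good B H M P D ω) (hS : RegimeB B H p n P) (hR : Regime B p n P)
    (hA : Assumptions (1 / B) B δ M n P) (j : Fin 2) (k l : Fin p) :
    |avg (D.L j) fun i => M.workErr (ω.1 i) k * D.regressor ω j i l|
      ≤ 62 * B ^ 4 * (P.K * (P.c + rt p n)) := by
  have hK := hR.K_pos hA
  have hB := hR.one_le_B
  have hc := RegimeB.ct_pos hR hA
  have hr := hR.rt_pos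
  have hrc : rt p n ≤ P.c + rt p n := by linarith [hA.c_nonneg]
  have hLB := hR.LB_nonneg hA
  set c := P.c + rt p n with hc_def
  have e : avg (D.L j) (fun i => M.workErr (ω.1 i) k * D.regressor ω j i l)
      = avg (D.L j) (fun i => (ω.1 i).1 l * M.m (ω.1 i).1 * M.workErr (ω.1 i) k)
        + avg (D.L j) (fun i => (ω.1 i).1 l * (D.diffAt M ω j i * M.workErr (ω.1 i) k))
        - D.muL ω j l * avg (D.L j) fun i => M.workErr (ω.1 i) k := by
    rw [← avg_const_mul, ← avg_add, ← avg_sub]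
    refine avg_congr fun i _ => ?_
    rw [CrossFit.diffAt, CrossFit.regressor]
    ring
  have h1 := hG.work j (l, k)
  have h3 : |D.muL ω j l * avg (D.L j) fun i => M.workErr (ω.1 i) k|
      ≤ 2 * (P.K * B) * (14 * B * rt p n) := by
    rw [abs_mul]
    have := muL_le hG hS hR hA j l
    have := hG.work_mean j k
    gcongr
  have h2 : |avg (D.L j) (fun i => (ω.1 i).1 l * (D.diffAt M ω j i * M.workErr (ω.1 i) k))|
      ≤ P.K * (19 * B ^ 4 * c + c) := by
    refine (abs_avg_mul_le_of_bound fun i => hG.X_le i l).trans ?_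
    refine mul_le_mul_of_nonneg_left ?_ hK.le
    set τ := c / rt p n with hτ
    have h4 : avg (D.L j) (fun i => |D.diffAt M ω j i * M.workErr (ω.1 i) k|)
        ≤ avg (D.L j) fun i => √(sqBelow τ (D.diffAt M ω j i)) * |M.workErr (ω.1 i) k|
          + P.K * (absAbove τ (D.diffAt M ω j i) * (|M.resid (ω.1 i)| + 2 * B * P.LB)) := by
      refine avg_mono fun i _ => ?_
      rw [abs_mul]
      have a1 := abs_le_sqrt_sqBelow_add τ (D.diffAt M ω j i)
      have a2 := mul_le_mul_of_nonneg_right a1 (abs_nonneg (M.workErr (ω.1 i) k))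
      have a3 := mul_le_mul_of_nonneg_left (hG.workErr_le i k)
        (absAbove_nonneg τ (D.diffAt M ω j i))
      nlinarith
    refine h4.trans ?_
    rw [avg_add, avg_const_mul]
    refine add_le_add ?_ (hG.diff j).above
    refine (le_abs_self _).trans ((abs_avg_mul_le _ _).trans ?_)
    simp only [sq_abs]
    rw [← Real.sqrt_mul (avg_nonneg fun i _ => sq_nonneg _)]
    refine Real.sqrt_le_iff.2 ⟨by positivity, ?_⟩
    have e2 : avg (D.L j) (fun i => √(sqBelow τ (D.diffAt M ω j i)) ^ 2)
        = avg (D.L j) fun i => sqBelow τ (D.diffAt M ω j i) :=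
      avg_congr fun i _ => Real.sq_sqrt (sqBelow_nonneg _ _)
    rw [e2]
    have b1 : avg (D.L j) (fun i => sqBelow τ (D.diffAt M ω j i)) ≤ 2 * B ^ 2 * c ^ 2 :=
      (hG.diff j).below
    have b2 := avg_workErr_sq hG hR hA j k
    have b3 : 0 ≤ avg (D.L j) fun i => M.workErr (ω.1 i) k ^ 2 := avg_nonneg fun i _ => sq_nonneg _
    calc _ ≤ 2 * B ^ 2 * c ^ 2 * (172 * B ^ 5) := by gcongr
      _ = 344 * B ^ 7 * c ^ 2 := by ring
      _ ≤ 361 * B ^ 8 * c ^ 2 := by gcongr <;> first | exact hB | norm_num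
      _ = _ := by ring
  rw [e]
  have h5 : |avg (D.L j) (fun i => (ω.1 i).1 l * M.m (ω.1 i).1 * M.workErr (ω.1 i) k)
      + avg (D.L j) (fun i => (ω.1 i).1 l * (D.diffAt M ω j i * M.workErr (ω.1 i) k))
      - D.muL ω j l * avg (D.L j) fun i => M.workErr (ω.1 i) k|
      ≤ 14 * (P.K * B) * B * rt p n + P.K * (19 * B ^ 4 * c + c)
        + 2 * (P.K * B) * (14 * B * rt p n) :=
    (abs_sub _ _).trans (add_le_add ((abs_add_le _ _).trans (add_le_add h1 h2)) h3)
  refine h5.trans ?_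
  have h6 : P.K * B ^ 2 * rt p n ≤ P.K * B ^ 4 * c := by
    gcongr <;> first | exact hB | norm_num
  have h7 : P.K * c ≤ B ^ 4 * (P.K * c) := le_mul_of_one_le_left (by positivity) (one_le_pow₀ hB)
  nlinarith

lemma Assumptions.abs_B_dotProduct (hA : Assumptions (1 / B) B δ M n P) (k : Fin p)
    {y : Fin p → ℝ} {b : ℝ} (h : ∀ l, |y l| ≤ b) (hb : 0 ≤ b) :
    |(fun l => M.B l k) ⬝ᵥ y| ≤ P.LB * b :=
  (abs_dotProduct_le h).trans (mul_le_mul_of_nonneg_right (hA.l1_B k) hb)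

/-- The constant in the bound for the approximation error. -/
def misfitConst (A B H : ℝ) : ℝ := 20 * B ^ 3 * H + 24 * A * B

lemma misfit_sq (hG : Good B H M P D ω) (hS : RegimeB B H p n P) (hR : Regime B p n P)
    (hA : Assumptions (1 / B) B δ M n P) (hA0 : 0 ≤ A) (j : Fin 2) (k : Fin p) {h : Fin p → ℝ}
    (hh : avg Finset.univ (fun i => ((ω.1 i).1 ⬝ᵥ h) ^ 2)
      ≤ 64 * A ^ 2 * B * (P.s * rateD M n P ^ 2)) :
    avg (D.L j) (fun i => ((fun l => M.B l k) ⬝ᵥ (D.muL ω j - M.mu)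
      - (fun l => M.B l k) ⬝ᵥ (fun l => (ω.1 i).1 l) * D.diffAt M ω j i
      - (ω.1 i).1 k * ((ω.1 i).1 ⬝ᵥ h)) ^ 2) ≤ (misfitConst A B H * misfit M n P) ^ 2 := by
  have hK := hR.K_pos hA
  have hB := hR.one_le_B
  have hc := RegimeB.ct_pos hR hA
  have hH := hS.one_le_H
  have hLB := hR.LB_nonneg hA
  have hD := rateD_nonneg (M := M) (n := n) hK.le
  have hne := D.L_nonempty hR.four_le_n j
  set c := P.c + rt p n with hc_def
  set β : Fin p → ℝ := fun l => M.B l k with hβ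
  have a1 : (β ⬝ᵥ (D.muL ω j - M.mu)) ^ 2 ≤ (P.LB * (11 * B ^ 3 * H * (P.K * c))) ^ 2 := by
    rw [← sq_abs]
    exact pow_le_pow_left₀ (abs_nonneg _)
      (hA.abs_B_dotProduct k (fun l => muL_dev hG hS hR hA j l) (by positivity)) 2
  have a2 : ∀ i, (β ⬝ᵥ (fun l => (ω.1 i).1 l) * D.diffAt M ω j i) ^ 2
      ≤ (P.LB * P.K) ^ 2 * D.diffAt M ω j i ^ 2 := fun i => by
    rw [mul_pow, ← sq_abs (β ⬝ᵥ _)]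
    gcongr
    exact hA.abs_B_dotProduct k (hG.X_le i) hK.le
  have a3 : ∀ i, ((ω.1 i).1 k * ((ω.1 i).1 ⬝ᵥ h)) ^ 2 ≤ P.K ^ 2 * ((ω.1 i).1 ⬝ᵥ h) ^ 2 :=
    fun i => by
      rw [mul_pow, ← sq_abs ((ω.1 i).1 k)]
      have := hG.X_le i k
      gcongr
  have h1 : avg (D.L j) (fun i => (β ⬝ᵥ (D.muL ω j - M.mu)
      - β ⬝ᵥ (fun l => (ω.1 i).1 l) * D.diffAt M ω j i
      - (ω.1 i).1 k * ((ω.1 i).1 ⬝ᵥ h)) ^ 2)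
      ≤ avg (D.L j) fun i => 3 * (P.LB * (11 * B ^ 3 * H * (P.K * c))) ^ 2
        + 3 * (P.LB * P.K) ^ 2 * D.diffAt M ω j i ^ 2 + 3 * P.K ^ 2 * ((ω.1 i).1 ⬝ᵥ h) ^ 2 := by
    refine avg_mono fun i _ => ?_
    have b2 := a2 i
    have b3 := a3 i
    set u := β ⬝ᵥ (D.muL ω j - M.mu)
    set v := β ⬝ᵥ (fun l => (ω.1 i).1 l) * D.diffAt M ω j i
    set w := (ω.1 i).1 k * ((ω.1 i).1 ⬝ᵥ h)
    nlinarith [sq_nonneg (u + v), sq_nonneg (u + w), sq_nonneg (v - w)]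
  rw [avg_add, avg_add, avg_const hne, avg_const_mul, avg_const_mul] at h1
  have h2 := hG.avg_diff_sq j
  have h3 := (avg_fold_le hR D j (g := fun i => ((ω.1 i).1 ⬝ᵥ h) ^ 2) fun i => sq_nonneg _).trans
    (mul_le_mul_of_nonneg_left hh zero_le_three)
  have h4 : 3 * (P.LB * (11 * B ^ 3 * H * (P.K * c))) ^ 2 + 3 * (P.LB * P.K) ^ 2 * (H * c ^ 2)
      ≤ (20 * B ^ 3 * H * (P.K * P.LB * c)) ^ 2 := by
    have hHH : H ≤ (B ^ 3 * H) ^ 2 := by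
      have : 1 ≤ B ^ 3 := one_le_pow₀ hB
      calc H ≤ B ^ 3 * H := le_mul_of_one_le_left (by linarith) this
        _ ≤ _ := le_self_pow₀ (one_le_mul_of_one_le_of_one_le this hH) (by norm_num)
    have : 3 * (P.LB * P.K) ^ 2 * (H * c ^ 2)
        ≤ 3 * (P.LB * P.K) ^ 2 * ((B ^ 3 * H) ^ 2 * c ^ 2) := by gcongr
    calc _ ≤ 3 * (P.LB * (11 * B ^ 3 * H * (P.K * c))) ^ 2
          + 3 * (P.LB * P.K) ^ 2 * ((B ^ 3 * H) ^ 2 * c ^ 2) := by linarith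
      _ = 366 * (B ^ 3 * H * (P.K * P.LB * c)) ^ 2 := by ring
      _ ≤ 400 * (B ^ 3 * H * (P.K * P.LB * c)) ^ 2 := by gcongr; norm_num
      _ = _ := by ring
  have h5 : 3 * P.K ^ 2 * (3 * (64 * A ^ 2 * B * (P.s * rateD M n P ^ 2)))
      ≤ (24 * A * B * (P.K * (√P.s * rateD M n P))) ^ 2 := by
    have hs : √(P.s : ℝ) ^ 2 = P.s := Real.sq_sqrt (by positivity)
    calc _ = 576 * A ^ 2 * B * (P.K ^ 2 * (P.s * rateD M n P ^ 2)) := by ring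
      _ ≤ 576 * A ^ 2 * B ^ 2 * (P.K ^ 2 * (P.s * rateD M n P ^ 2)) := by
          gcongr; exact le_self_pow₀ hB (by norm_num)
      _ = _ := by linear_combination (-576 * A ^ 2 * B ^ 2 * P.K ^ 2 * rateD M n P ^ 2) * hs
  have h6 : 20 * B ^ 3 * H * (P.K * P.LB * c) + 24 * A * B * (P.K * (√P.s * rateD M n P))
      ≤ misfitConst A B H * misfit M n P := by
    rw [misfitConst, misfit]
    have b1 : 0 ≤ 20 * B ^ 3 * H * (P.K * (√P.s * rateD M n P)) := by positivity
    have b2 : 0 ≤ 24 * A * B * (P.K * P.LB * c) := by positivity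
    nlinarith
  have h7 : 0 ≤ 20 * B ^ 3 * H * (P.K * P.LB * c) := by positivity
  have h8 : 0 ≤ 24 * A * B * (P.K * (√P.s * rateD M n P)) := by positivity
  have h9 : 3 * (P.LB * P.K) ^ 2 * avg (D.L j) (fun i => D.diffAt M ω j i ^ 2)
      ≤ 3 * (P.LB * P.K) ^ 2 * (H * c ^ 2) := by gcongr
  have h10 : 3 * P.K ^ 2 * avg (D.L j) (fun i => ((ω.1 i).1 ⬝ᵥ h) ^ 2)
      ≤ 3 * P.K ^ 2 * (3 * (64 * A ^ 2 * B * (P.s * rateD M n P ^ 2))) := by gcongr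
  calc _ ≤ (20 * B ^ 3 * H * (P.K * P.LB * c)) ^ 2
        + (24 * A * B * (P.K * (√P.s * rateD M n P))) ^ 2 := by linarith
    _ ≤ (20 * B ^ 3 * H * (P.K * P.LB * c) + 24 * A * B * (P.K * (√P.s * rateD M n P))) ^ 2 := by
        nlinarith [mul_nonneg h7 h8]
    _ ≤ _ := by gcongr

/-- The constant in the bound for the columns of `B`. -/
def lassoBConst (A B H CB : ℝ) : ℝ := (60 * B + 12 * misfitConst A B H ^ 2) * CB

lemma lassoB_bound (hG : Good B H M P D ω) (hS : RegimeB B H p n P) (hR : Regime B p n P)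
    (hA : Assumptions (1 / B) B δ M n P) (hA0 : 0 ≤ A) (hCB : 248 * B ^ 4 ≤ CB) {lam : ℝ}
    (hlam : IsLamOpt CB M n P lam) {t : Fin p → ℝ}
    (ht : avg Finset.univ (fun i => ((ω.1 i).1 ⬝ᵥ (t - M.θ)) ^ 2)
      ≤ 64 * A ^ 2 * B * (P.s * rateD M n P ^ 2)) (j : Fin 2) (k : Fin p) {b : Fin p → ℝ}
    (hb : D.IsLassoB ω t lam j k b) :
    l1 (b - fun l => M.B l k) ≤ lassoBConst A B H CB * rateB M n P := by
  have hK := hR.K_pos hA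
  have hB := hR.one_le_B
  have hB0 : 0 < B := by linarith
  have hc := RegimeB.ct_pos hR hA
  have hH := hS.one_le_H
  have hB4 : 1 ≤ B ^ 4 := one_le_pow₀ hB
  have hlam0 : 0 < lam := lt_of_lt_of_le (by
    have : 0 < CB := by linarith
    positivity) hlam.1
  have hobj := hb (Set.mem_univ fun l => M.B l k)
  have e1 : ∀ b' : Fin p → ℝ, ((D.L j).card : ℝ)⁻¹ * ∑ i ∈ D.L j,
      ((ω.1 i).1 k * ((ω.1 i).2 - (ω.1 i).1 ⬝ᵥ t)
        - ∑ l, b' l * ((ω.1 i).1 l * D.mAt ω j (ω.1 i).1 - D.muL ω j l)) ^ 2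
      = avg (D.L j) fun i => ((ω.1 i).1 k * ((ω.1 i).2 - (ω.1 i).1 ⬝ᵥ t)
        - D.regressor ω j i ⬝ᵥ b') ^ 2 := fun b' => by
    refine avg_congr fun i _ => ?_
    rw [dotProduct_comm (D.regressor ω j i)]
    rfl
  simp only [Set.mem_ofPred_eq, e1] at hobj
  obtain ⟨h1, -⟩ := lasso_oracle (I := D.L j) (z := D.regressor ω j)
    (y := fun i => (ω.1 i).1 k * ((ω.1 i).2 - (ω.1 i).1 ⬝ᵥ t))
    (b₀ := fun l => M.B l k) (b := b) (lam := lam) (t := misfitConst A B H * misfit M n P)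
    (c := 1 / B) (ρ := 76 * B ^ 6 * H * (P.K ^ 2 * (P.c + rt p n))) (s := P.sB) hlam0
    (by positivity) (by exact_mod_cast hA.sparse_B k)
    (by
      rw [le_div_iff₀ hB0]
      refine le_trans (le_of_eq ?_) hS.small
      ring)
    (by positivity) hobj (u := fun i => M.workErr (ω.1 i) k)
    (w := fun i => (fun l => M.B l k) ⬝ᵥ (D.muL ω j - M.mu)
      - (fun l => M.B l k) ⬝ᵥ (fun l => (ω.1 i).1 l) * D.diffAt M ω j i
      - (ω.1 i).1 k * ((ω.1 i).1 ⬝ᵥ (t - M.θ)))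
    (fun i _ => by
      have e2 : D.regressor ω j i ⬝ᵥ (fun l => M.B l k)
          = M.workFit k (ω.1 i).1 + (fun l => M.B l k) ⬝ᵥ (fun l => (ω.1 i).1 l)
            * D.diffAt M ω j i - (fun l => M.B l k) ⬝ᵥ (D.muL ω j - M.mu) := by
        simp only [Model.workFit, dotProduct, Finset.sum_mul, ← Finset.sum_add_distrib,
          ← Finset.sum_sub_distrib]
        refine Finset.sum_congr rfl fun l _ => ?_
        simp only [CrossFit.regressor, Model.T2, CrossFit.diffAt, Pi.sub_apply]
        ring
      rw [e2, M.workErr_eq, Model.resid, dotProduct_sub (ω.1 i).1 t]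
      ring)
    (by
      rw [avg_mul_dotProduct, mul_comm]
      refine abs_dotProduct_le fun l => ?_
      refine (noise_regressor hG hS hR hA j k l).trans ?_
      rw [le_div_iff₀ (by norm_num)]
      refine le_trans ?_ hlam.1
      calc _ = 248 * B ^ 4 * (P.K * (P.c + rt p n)) := by ring
        _ ≤ CB * (P.K * (P.c + rt p n)) := by gcongr
        _ = _ := by ring)
    (misfit_sq hG hS hR hA hA0 j k ht)
    (by
      have h3 := (abs_le.1 (gram_form (gram_regressor hG hS hR hA j)
        (b - fun l => M.B l k))).1
      have h4 := hA.eig_M3 (b - fun l => M.B l k)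
      linarith)
  refine h1.trans ?_
  have h2 := lamOpt_bound hR hA (by linarith) hlam
  have hT : 0 ≤ 60 * B + 12 * misfitConst A B H ^ 2 := by positivity
  have h3 := mul_le_mul_of_nonneg_left h2 hT
  rw [div_div_eq_mul_div, div_one, lassoBConst, mul_assoc (60 * B + _)]
  refine le_trans ?_ h3
  have h4 : 0 ≤ 12 * misfitConst A B H ^ 2 * (P.sB * lam) := by positivity
  have h5 : 0 ≤ 60 * B * (lam⁻¹ * misfit M n P ^ 2) := by positivity
  rw [mul_pow, div_eq_mul_inv]
  nlinarith

end LassoBound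

/-! ### The plug-in variance on the good event -/

section Forms

variable {p : ℕ}

lemma abs_le_maxNorm (G : Matrix (Fin p) (Fin p) ℝ) (k l : Fin p) : |G k l| ≤ maxNorm G :=
  le_ciSup (f := fun ij : Fin p × Fin p => |G ij.1 ij.2|) (Set.finite_range _).bddAbove (k, l)

lemma abs_form_le {G : Matrix (Fin p) (Fin p) ℝ} {b : ℝ} (h : ∀ k l, |G k l| ≤ b)
    (x y : Fin p → ℝ) : |x ⬝ᵥ (G *ᵥ y)| ≤ l1 x * (l1 y * b) :=
  abs_dotProduct_le fun k => by
    rw [mulVec, dotProduct_comm]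
    exact abs_dotProduct_le (h k)

lemma l1_vecMul_le {W : Matrix (Fin p) (Fin p) ℝ} {b : ℝ} (h : ∀ k, l1 (W k) ≤ b)
    (v : Fin p → ℝ) : l1 (v ᵥ* W) ≤ l1 v * b := by
  simp only [l1, vecMul, dotProduct]
  calc ∑ l, |∑ k, v k * W k l| ≤ ∑ l, ∑ k, |v k| * |W k l| :=
        Finset.sum_le_sum fun l _ => (Finset.abs_sum_le_sum_abs _ _).trans_eq
          (Finset.sum_congr rfl fun k _ => abs_mul _ _)
    _ = ∑ k, |v k| * l1 (W k) := by
        rw [Finset.sum_comm]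
        simp only [l1, Finset.mul_sum]
    _ ≤ ∑ k, |v k| * b := Finset.sum_le_sum fun k _ =>
        mul_le_mul_of_nonneg_left (h k) (abs_nonneg _)
    _ = _ := by rw [Finset.sum_mul]

lemma form_conj (W G : Matrix (Fin p) (Fin p) ℝ) (v : Fin p → ℝ) :
    v ⬝ᵥ ((W * G * Wᵀ) *ᵥ v) = (v ᵥ* W) ⬝ᵥ (G *ᵥ (v ᵥ* W)) := by
  rw [← mulVec_mulVec, ← mulVec_mulVec, mulVec_transpose, dotProduct_mulVec]

/-- Perturbation of a quadratic form. -/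
lemma abs_form_sub_form_le {G G' : Matrix (Fin p) (Fin p) ℝ} {a b : Fin p → ℝ} {α β d e g : ℝ}
    (ha : l1 a ≤ α) (hb : l1 b ≤ β) (hab : l1 (a - b) ≤ d) (hG : ∀ k l, |(G' - G) k l| ≤ e)
    (hG0 : ∀ k l, |G k l| ≤ g) (he : 0 ≤ e) (hg : 0 ≤ g) :
    |a ⬝ᵥ (G' *ᵥ a) - b ⬝ᵥ (G *ᵥ b)| ≤ α ^ 2 * e + d * (α + β) * g := by
  have h1 : a ⬝ᵥ (G' *ᵥ a) - b ⬝ᵥ (G *ᵥ b) = a ⬝ᵥ ((G' - G) *ᵥ a)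
      + (a - b) ⬝ᵥ (G *ᵥ a) + b ⬝ᵥ (G *ᵥ (a - b)) := by
    rw [sub_mulVec, mulVec_sub, dotProduct_sub, dotProduct_sub, sub_dotProduct]
    ring
  rw [h1]
  have h2 := abs_form_le hG a a
  have h3 := abs_form_le hG0 (a - b) a
  have h4 := abs_form_le hG0 b (a - b)
  have n1 := l1_nonneg a
  have n2 := l1_nonneg b
  have n3 := l1_nonneg (a - b)
  have nα := n1.trans ha
  have nβ := n2.trans hb
  have nd := n3.trans hab
  have h5 : l1 a * (l1 a * e) ≤ α * (α * e) := by gcongr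
  have h6 : l1 (a - b) * (l1 a * g) ≤ d * (α * g) := by gcongr
  have h7 : l1 b * (l1 (a - b) * g) ≤ β * (d * g) := by gcongr
  refine (abs_add_le _ _).trans ((add_le_add_left (abs_add_le _ _) _).trans ?_)
  linarith

end Forms

section Variance

variable {n N p : ℕ} {B H A CB δ ψ : ℝ} {M : Model p} {P : Params} {D : CrossFit n N p}
  {ω : Sample n N p}

lemma sqrt_mul_log_div (a : ℝ) (ha : 0 ≤ a) : √(a * Real.log p / n) = √a * rt p n := by
  rw [rt, mul_div_assoc, Real.sqrt_mul ha]

lemma rateD_eq :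
    rateD M n P = P.K * (√(M.noiseVar + P.Φ ^ 2) * rt p n) := by
  rw [rateD, sqrt_mul_log_div _ (add_nonneg (Assumptions.noiseVar_nonneg M) (sq_nonneg _))]

lemma kappa_le (hR : Regime B p n P) (hA : Assumptions (1 / B) B δ M n P) :
    √(M.noiseVar + P.Φ ^ 2) ≤ 2 * B := by
  have hB := hR.one_le_B
  refine Real.sqrt_le_iff.2 ⟨by linarith, (hA.kappa_sq_le hB).trans ?_⟩
  nlinarith

lemma rateD_le (hR : Regime B p n P) (hA : Assumptions (1 / B) B δ M n P) :
    rateD M n P ≤ 2 * B * (P.K * rt p n) := by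
  have h1 := kappa_le hR hA
  have h2 := (hR.K_pos hA).le
  have h3 := hR.rt_pos.le
  rw [rateD_eq]
  calc _ ≤ P.K * (2 * B * rt p n) := by gcongr
    _ = _ := by ring

lemma one_le_sqrt_s (hA : Assumptions (1 / B) B δ M n P) : 1 ≤ √(P.s : ℝ) :=
  Real.one_le_sqrt.2 (by exact_mod_cast hA.one_le_s)

lemma one_le_sqrt_sB (hA : Assumptions (1 / B) B δ M n P) : 1 ≤ √(P.sB : ℝ) :=
  Real.one_le_sqrt.2 (by exact_mod_cast hA.one_le_sB)

lemma Rem_eq : Rem p n P = P.K * (P.sB + √P.sB * P.LB) * (rt p n + P.c)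
    + P.K ^ 2 * (√P.s * √P.sB * rt p n) + P.K * P.LB * (√P.s * rt p n) := by
  rw [Rem, sqrt_mul_log_div _ (by positivity), sqrt_mul_log_div _ (by positivity),
    Real.sqrt_mul (by positivity)]

lemma rateB_le_Rem (hR : Regime B p n P) (hA : Assumptions (1 / B) B δ M n P) :
    rateB M n P ≤ 2 * B * Rem p n P := by
  have hK := hR.K_pos hA
  have hLB := hR.LB_nonneg hA
  have hc := RegimeB.ct_pos hR hA
  have hr := hR.rt_pos
  have hB := hR.one_le_B
  have h1 := rateD_le hR hA
  have e : √P.sB * (P.K * (√P.s * rateD M n P))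
      ≤ 2 * B * (P.K ^ 2 * (√P.s * √P.sB * rt p n)) := by
    calc _ ≤ √P.sB * (P.K * (√P.s * (2 * B * (P.K * rt p n)))) := by gcongr
      _ = _ := by ring
  have h2 : 0 ≤ P.K * (P.sB + √P.sB * P.LB) * (rt p n + P.c) := by
    rw [add_comm (rt p n)]; positivity
  have h3 : 0 ≤ P.K * P.LB * (√P.s * rt p n) := by positivity
  rw [rateB, misfit, Rem_eq]
  nlinarith

lemma LB_ct_le_Rem (hR : Regime B p n P) (hA : Assumptions (1 / B) B δ M n P) :
    P.LB * (P.c + rt p n) ≤ B * Rem p n P := by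
  have hK := hR.K_pos hA
  have hLB := hR.LB_nonneg hA
  have hc := RegimeB.ct_pos hR hA
  have hr := hR.rt_pos
  have hB := hR.one_le_B
  have hs := one_le_sqrt_sB hA
  have h1 : P.LB * (P.c + rt p n) ≤ B * P.K * (√P.sB * P.LB * (P.c + rt p n)) := by
    calc P.LB * (P.c + rt p n) = 1 * (1 * P.LB * (P.c + rt p n)) := by ring
      _ ≤ _ := by
        gcongr
        exact hR.one_le_BK hA
  have h2 : 0 ≤ B * (P.K * P.sB * (P.c + rt p n)) := by positivity
  have h3 : 0 ≤ B * (P.K ^ 2 * (√P.s * √P.sB * rt p n)) := by positivity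
  have h4 : 0 ≤ B * (P.K * P.LB * (√P.s * rt p n)) := by positivity
  rw [Rem_eq]
  nlinarith

lemma LB_sqrt_le_Rem (hR : Regime B p n P) (hA : Assumptions (1 / B) B δ M n P) :
    P.LB * (P.K * (√P.s * rt p n)) ≤ Rem p n P := by
  have hK := hR.K_pos hA
  have hLB := hR.LB_nonneg hA
  have hc := RegimeB.ct_pos hR hA
  have hr := hR.rt_pos
  have h2 : 0 ≤ P.K * (P.sB + √P.sB * P.LB) * (rt p n + P.c) := by
    rw [add_comm (rt p n)]; positivity
  have h3 : 0 ≤ P.K ^ 2 * (√P.s * √P.sB * rt p n) := by positivity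
  rw [Rem_eq]
  nlinarith

lemma K_sq_sqrt_le_Rem (hR : Regime B p n P) (hA : Assumptions (1 / B) B δ M n P) :
    P.K ^ 2 * (√P.s * rt p n) ≤ Rem p n P := by
  have hK := hR.K_pos hA
  have hLB := hR.LB_nonneg hA
  have hc := RegimeB.ct_pos hR hA
  have hr := hR.rt_pos
  have hs := one_le_sqrt_sB hA
  have h2 : 0 ≤ P.K * (P.sB + √P.sB * P.LB) * (rt p n + P.c) := by
    rw [add_comm (rt p n)]; positivity
  have h3 : 0 ≤ P.K * P.LB * (√P.s * rt p n) := by positivity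
  have h4 : P.K ^ 2 * (√P.s * rt p n) ≤ P.K ^ 2 * (√P.s * √P.sB * rt p n) := by
    calc _ = P.K ^ 2 * (√P.s * 1 * rt p n) := by ring
      _ ≤ _ := by gcongr
  rw [Rem_eq]
  linarith

lemma K_sqrt_le (hR : Regime B p n P) (hA : Assumptions (1 / B) B δ M n P)
    (hRem : Rem p n P ≤ 1) : P.K * (√P.s * rt p n) ≤ B := by
  have h1 := K_sq_sqrt_le_Rem hR hA
  have hK := hR.K_pos hA
  have hB := hR.one_le_B
  have hr := hR.rt_pos
  calc P.K * (√P.s * rt p n) ≤ P.K * (√P.s * rt p n) * (B * P.K) :=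
        le_mul_of_one_le_right (by positivity) (hR.one_le_BK hA)
    _ = B * (P.K ^ 2 * (√P.s * rt p n)) := by ring
    _ ≤ B * 1 := by gcongr; linarith
    _ = B := mul_one B

/-- The prediction error of the Dantzig selector, in terms of `K √(s log p / n)`. -/
lemma sqrt_pred_le (hR : Regime B p n P) (hA : Assumptions (1 / B) B δ M n P)
    {h : Fin p → ℝ} (hh : avg Finset.univ (fun i => ((ω.1 i).1 ⬝ᵥ h) ^ 2)
      ≤ 64 * A ^ 2 * B * (P.s * rateD M n P ^ 2)) :
    avg Finset.univ (fun i => ((ω.1 i).1 ⬝ᵥ h) ^ 2)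
      ≤ (16 * A * B ^ 2 * (P.K * (√P.s * rt p n))) ^ 2 := by
  refine hh.trans ?_
  have hB := hR.one_le_B
  have hD := rateD_nonneg (M := M) (n := n) (hR.K_pos hA).le
  have hs : √(P.s : ℝ) ^ 2 = P.s := Real.sq_sqrt (by positivity)
  calc _ ≤ 64 * A ^ 2 * B ^ 2 * (P.s * (2 * B * (P.K * rt p n)) ^ 2) := by
        gcongr
        · exact le_self_pow₀ hB (by norm_num)
        · exact rateD_le hR hA
    _ = _ := by linear_combination (-256 * A ^ 2 * B ^ 4 * P.K ^ 2 * rt p n ^ 2) * hs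

/-- The constant in the bound for `M̂₁`. -/
def M1Const (A B H : ℝ) : ℝ := 32 * B ^ 2 + 16 * A * B ^ 2 * (2 * H + 16 * A * B ^ 3)

lemma M1hat_dev (hG : Good B H M P D ω) (hS : RegimeB B H p n P) (hR : Regime B p n P)
    (hA : Assumptions (1 / B) B δ M n P) (hA0 : 0 ≤ A) (hRem : Rem p n P ≤ 1) {F : Fit p}
    (hh : avg Finset.univ (fun i => ((ω.1 i).1 ⬝ᵥ (F.θD - M.θ)) ^ 2)
      ≤ 64 * A ^ 2 * B * (P.s * rateD M n P ^ 2)) (k l : Fin p) :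
    |F.M1hat ω k l - M.M1 k l| ≤ M1Const A B H * (P.K ^ 3 * (√P.s * rt p n)) := by
  have hK := hR.K_pos hA
  have hB := hR.one_le_B
  have hH := hS.one_le_H
  have hr := hR.rt_pos
  have hq := sqrt_pred_le hR hA hh
  set q := 16 * A * B ^ 2 * (P.K * (√P.s * rt p n)) with hq_def
  have hq0 : 0 ≤ q := by positivity
  set g : Fin n → ℝ := fun i => (ω.1 i).1 ⬝ᵥ (F.θD - M.θ) with hg
  have e : F.M1hat ω k l = avg Finset.univ (fun i => M.resid (ω.1 i) ^ 2
      * ((ω.1 i).1 k * (ω.1 i).1 l)) + avg Finset.univ (fun i => (ω.1 i).1 k * (ω.1 i).1 l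
      * (-2 * (M.resid (ω.1 i) * g i) + g i ^ 2)) := by
    simp only [Fit.M1hat, of_apply]
    rw [← avg_add, avg_univ_fin]
    congr 1
    refine Finset.sum_congr rfl fun i _ => ?_
    simp only [hg, dotProduct_sub, Model.resid]
    ring
  have h1 := hG.M1_dev (k, l)
  have h2 : |avg Finset.univ (fun i => (ω.1 i).1 k * (ω.1 i).1 l
      * (-2 * (M.resid (ω.1 i) * g i) + g i ^ 2))| ≤ P.K ^ 2 * (2 * (H * q) + q ^ 2) := by
    refine (abs_avg_mul_le_of_bound (b := P.K ^ 2) fun i => ?_).trans ?_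
    · rw [abs_mul, sq]
      exact mul_le_mul (hG.X_le i _) (hG.X_le i _) (abs_nonneg _) hK.le
    · refine mul_le_mul_of_nonneg_left ?_ (sq_nonneg _)
      have h3 : avg Finset.univ (fun i => |-2 * (M.resid (ω.1 i) * g i) + g i ^ 2|)
          ≤ avg Finset.univ fun i => 2 * (|M.resid (ω.1 i)| * |g i|) + g i ^ 2 := by
        refine avg_mono fun i _ => (abs_add_le _ _).trans ?_
        rw [abs_mul, abs_mul, abs_neg, abs_two, abs_of_nonneg (sq_nonneg (g i))]
      refine h3.trans ?_
      rw [avg_add, avg_const_mul]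
      have h4 := (le_abs_self _).trans (abs_avg_mul_le (s := Finset.univ)
        (fun i => |M.resid (ω.1 i)|) fun i => |g i|)
      simp only [sq_abs] at h4
      have h5 : √(avg Finset.univ fun i => M.resid (ω.1 i) ^ 2) ≤ H :=
        Real.sqrt_le_iff.2 ⟨by linarith, hG.resid_sq.trans (le_self_pow₀ hH (by norm_num))⟩
      have h6 : √(avg Finset.univ fun i => g i ^ 2) ≤ q := Real.sqrt_le_iff.2 ⟨hq0, hq⟩
      have h7 : √(avg Finset.univ fun i => M.resid (ω.1 i) ^ 2)
          * √(avg Finset.univ fun i => g i ^ 2) ≤ H * q := by gcongr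
      linarith
  have h3 : 32 * B * P.K ^ 2 * rt p n ≤ 32 * B ^ 2 * (P.K ^ 3 * (√P.s * rt p n)) := by
    have hs := one_le_sqrt_s hA
    calc _ ≤ 32 * B * P.K ^ 2 * rt p n * (B * P.K) :=
          le_mul_of_one_le_right (by positivity) (hR.one_le_BK hA)
      _ = 32 * B ^ 2 * (P.K ^ 3 * (1 * rt p n)) := by ring
      _ ≤ _ := by gcongr
  have h4 : P.K ^ 2 * (2 * (H * q) + q ^ 2)
      ≤ 16 * A * B ^ 2 * (2 * H + 16 * A * B ^ 3) * (P.K ^ 3 * (√P.s * rt p n)) := by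
    have h5 : q ≤ 16 * A * B ^ 3 := by
      calc q ≤ 16 * A * B ^ 2 * B := by
            rw [hq_def]; gcongr; exact K_sqrt_le hR hA hRem
        _ = _ := by ring
    calc _ = P.K ^ 2 * (q * (2 * H + q)) := by ring
      _ ≤ P.K ^ 2 * (q * (2 * H + 16 * A * B ^ 3)) := by gcongr
      _ = _ := by rw [hq_def]; ring
  rw [e, add_sub_right_comm]
  refine (abs_add_le _ _).trans ?_
  rw [M1Const, add_mul]
  simp only at h1
  linarith

/-- The constant in the bound for `M̂₂`. -/
def M2Const (A B H : ℝ) : ℝ := 32 * B ^ 2 + 3 * H + (2 * B + 2 * H) * (16 * A * B ^ 2)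

lemma M2hatFold_dev (hG : Good B H M P D ω) (hS : RegimeB B H p n P) (hR : Regime B p n P)
    (hA : Assumptions (1 / B) B δ M n P) (hA0 : 0 ≤ A) {F : Fit p}
    (hh : avg Finset.univ (fun i => ((ω.1 i).1 ⬝ᵥ (F.θD - M.θ)) ^ 2)
      ≤ 64 * A ^ 2 * B * (P.s * rateD M n P ^ 2)) (j : Fin 2) (k l : Fin p) :
    |F.M2hatFold D ω j k l - M.M2 k l|
      ≤ M2Const A B H * (P.K ^ 2 * (P.c + rt p n + P.K * (√P.s * rt p n))) := by
  have hK := hR.K_pos hA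
  have hB := hR.one_le_B
  have hH := hS.one_le_H
  have hr := hR.rt_pos
  have hc := RegimeB.ct_pos hR hA
  have hne := D.L_nonempty hR.four_le_n j
  have hq := sqrt_pred_le hR hA hh
  set q := 16 * A * B ^ 2 * (P.K * (√P.s * rt p n)) with hq_def
  have hq0 : 0 ≤ q := by positivity
  set g : Fin n → ℝ := fun i => (ω.1 i).1 ⬝ᵥ (F.θD - M.θ) with hg
  set c := P.c + rt p n with hc_def
  have e : F.M2hatFold D ω j k l = avg (D.L j) (fun i => (ω.1 i).1 k * (ω.1 i).1 l
      * M.m (ω.1 i).1 * M.resid (ω.1 i)) + avg (D.L j) (fun i => (ω.1 i).1 k * (ω.1 i).1 l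
      * (M.resid (ω.1 i) * D.diffAt M ω j i - M.m (ω.1 i).1 * g i - g i * D.diffAt M ω j i)) := by
    simp only [Fit.M2hatFold, of_apply]
    rw [← avg_add]
    refine avg_congr fun i _ => ?_
    simp only [hg, dotProduct_sub, Model.resid, CrossFit.diffAt]
    ring
  have hg2 : avg (D.L j) (fun i => g i ^ 2) ≤ (2 * q) ^ 2 := by
    have := (avg_fold_le hR D j (g := fun i => g i ^ 2) fun i => sq_nonneg _).trans
      (mul_le_mul_of_nonneg_left hq zero_le_three)
    nlinarith [sq_nonneg q]
  have he2 : avg (D.L j) (fun i => M.resid (ω.1 i) ^ 2) ≤ 3 * H :=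
    (avg_fold_le hR D j (g := fun i => M.resid (ω.1 i) ^ 2) fun i => sq_nonneg _).trans
      (mul_le_mul_of_nonneg_left hG.resid_sq zero_le_three)
  have hd2 := hG.avg_diff_sq j
  have hg3 : √(avg (D.L j) fun i => g i ^ 2) ≤ 2 * q :=
    Real.sqrt_le_iff.2 ⟨by linarith, hg2⟩
  have hd3 : √(avg (D.L j) fun i => D.diffAt M ω j i ^ 2) ≤ H * c := by
    refine Real.sqrt_le_iff.2 ⟨by positivity, hd2.trans ?_⟩
    rw [mul_pow]
    gcongr
    exact le_self_pow₀ hH (by norm_num)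
  have b1 : avg (D.L j) (fun i => |M.resid (ω.1 i)| * |D.diffAt M ω j i|) ≤ 3 * H * c := by
    have h4 := (le_abs_self _).trans (abs_avg_mul_le (s := D.L j)
      (fun i => |M.resid (ω.1 i)|) fun i => |D.diffAt M ω j i|)
    simp only [sq_abs] at h4
    refine h4.trans ?_
    rw [← Real.sqrt_mul (avg_nonneg fun i _ => sq_nonneg _)]
    refine Real.sqrt_le_iff.2 ⟨by positivity, ?_⟩
    calc _ ≤ 3 * H * (H * c ^ 2) := by
          gcongr
          exact avg_nonneg fun i _ => sq_nonneg _
      _ = 3 * (H * c) ^ 2 := by ring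
      _ ≤ 9 * (H * c) ^ 2 := by gcongr; norm_num
      _ = _ := by ring
  have b2 : avg (D.L j) (fun i => |g i|) ≤ 2 * q := (avg_abs_le_sqrt hne g).trans hg3
  have b3 : avg (D.L j) (fun i => |g i| * |D.diffAt M ω j i|) ≤ 2 * q * H := by
    have h4 := (le_abs_self _).trans (abs_avg_mul_le (s := D.L j)
      (fun i => |g i|) fun i => |D.diffAt M ω j i|)
    simp only [sq_abs] at h4
    refine h4.trans ?_
    have hc1 := hS.ct_le_one hR hA
    calc _ ≤ 2 * q * (H * c) := by gcongr
      _ ≤ 2 * q * (H * 1) := by gcongr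
      _ = _ := by ring
  have h2 : |avg (D.L j) (fun i => (ω.1 i).1 k * (ω.1 i).1 l
      * (M.resid (ω.1 i) * D.diffAt M ω j i - M.m (ω.1 i).1 * g i - g i * D.diffAt M ω j i))|
      ≤ P.K ^ 2 * (3 * H * c + B * (2 * q) + 2 * q * H) := by
    refine (abs_avg_mul_le_of_bound (b := P.K ^ 2) fun i => ?_).trans ?_
    · rw [abs_mul, sq]
      exact mul_le_mul (hG.X_le i _) (hG.X_le i _) (abs_nonneg _) hK.le
    · refine mul_le_mul_of_nonneg_left ?_ (sq_nonneg _)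
      have h3 : avg (D.L j) (fun i => |M.resid (ω.1 i) * D.diffAt M ω j i - M.m (ω.1 i).1 * g i
          - g i * D.diffAt M ω j i|) ≤ avg (D.L j) fun i => |M.resid (ω.1 i)| * |D.diffAt M ω j i|
          + B * |g i| + |g i| * |D.diffAt M ω j i| := by
        refine avg_mono fun i _ => (abs_sub _ _).trans (add_le_add ((abs_sub _ _).trans ?_) ?_)
        · rw [abs_mul, abs_mul]
          have := hG.m_le i
          gcongr
        · rw [abs_mul]
      refine h3.trans ?_
      rw [avg_add, avg_add, avg_const_mul]
      have := mul_le_mul_of_nonneg_left b2 (by linarith : 0 ≤ B)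
      linarith
  have h1 := hG.M2_dev j (k, l)
  have h3 : 32 * B ^ 2 * P.K ^ 2 * rt p n ≤ 32 * B ^ 2 * P.K ^ 2 * c := by
    gcongr; linarith [hA.c_nonneg]
  rw [e, add_sub_right_comm]
  refine (abs_add_le _ _).trans ?_
  simp only at h1
  have h4 : 32 * B ^ 2 * P.K ^ 2 * c + P.K ^ 2 * (3 * H * c + B * (2 * q) + 2 * q * H)
      ≤ M2Const A B H * (P.K ^ 2 * (c + P.K * (√P.s * rt p n))) := by
    have a1 : 0 ≤ (32 * B ^ 2 + 3 * H) * (P.K ^ 2 * (P.K * (√P.s * rt p n))) := by positivity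
    have a2 : 0 ≤ (2 * B + 2 * H) * (16 * A * B ^ 2) * (P.K ^ 2 * c) := by positivity
    rw [M2Const, hq_def]
    linarith
  linarith

lemma M2_bound (hR : Regime B p n P) (hA : Assumptions (1 / B) B δ M n P) (k l : Fin p) :
    |M.M2 k l| ≤ 9 * B ^ 5 := by
  have hB := hR.one_le_B
  have h1 := hA.coord_resid_sq hB l
  have h2 : Integrable (fun z : Obs p => (z.1 k * M.m z.1) ^ 2) M.PXY ∧
      ∫ z : Obs p, (z.1 k * M.m z.1) ^ 2 ∂M.PXY ≤ B ^ 3 := by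
    have hle : ∀ᵐ x ∂M.PX, (x k * M.m x) ^ 2 ≤ B ^ 2 * x k ^ 2 := by
      filter_upwards [hA.bounded_m] with x hx
      rw [mul_pow, mul_comm, ← sq_abs (M.m x)]
      gcongr
    have hm : Measurable fun x : Fin p → ℝ => (x k * M.m x) ^ 2 :=
      ((measurable_pi_apply k).mul M.measurable_m).pow_const 2
    have hi := hA.integrable_pow_coord k 2
    have hi2 : Integrable (fun x : Fin p → ℝ => (x k * M.m x) ^ 2) M.PX :=
      integrable_of_abs_le_integrable (hi.const_mul (B ^ 2)) hm
        (by filter_upwards [hle] with x hx; rwa [abs_of_nonneg (sq_nonneg _)])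
    refine ⟨M.integrable_fst_PXY hi2, ?_⟩
    rw [M.integral_fst_PXY (g := fun x => (x k * M.m x) ^ 2) hm]
    refine (integral_mono_ae hi2 (hi.const_mul _) hle).trans ?_
    rw [integral_const_mul, ← Assumptions.Sigma_diag]
    have := hA.diag_Sigma k
    calc B ^ 2 * M.Sigma k k ≤ B ^ 2 * B := by gcongr
      _ = _ := by ring
  rw [hA.M2_apply]
  refine abs_integral_le_integral_abs.trans ?_
  have i3 : Integrable (fun z : Obs p => (z.1 k * M.m z.1) ^ 2 / 2
      + (z.1 l * M.resid z) ^ 2 / 2) M.PXY := (h2.1.div_const 2).add (h1.1.div_const 2)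
  refine (integral_mono (hA.integrable_mixed k l).abs i3 fun z => ?_).trans ?_
  · simp only
    rw [show z.1 k * z.1 l * M.m z.1 * M.resid z = (z.1 k * M.m z.1) * (z.1 l * M.resid z) by ring,
      abs_mul]
    nlinarith [sq_nonneg (|z.1 k * M.m z.1| - |z.1 l * M.resid z|), sq_abs (z.1 k * M.m z.1),
      sq_abs (z.1 l * M.resid z)]
  · rw [integral_add (h2.1.div_const 2) (h1.1.div_const 2), integral_div, integral_div]
    have : B ^ 3 ≤ B ^ 5 := pow_le_pow_right₀ hB (by norm_num)
    have : 0 ≤ B ^ 5 := by positivity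
    linarith [h1.2, h2.2]

end Variance

section Variance

variable {n N p : ℕ} {B H A CB δ ψ : ℝ} {M : Model p} {P : Params} {D : CrossFit n N p}
  {ω : Sample n N p} {F : Fit p}

/-- The error bounds for the solutions of the three optimization problems. -/
structure FitBounds (A B H CB : ℝ) (M : Model p) (P : Params) (ω : Sample n N p) (F : Fit p) :
    Prop where
  l1_θ : l1 (F.θD - M.θ) ≤ 32 * A * B * (P.s * rateD M n P)
  pred : avg Finset.univ (fun i => ((ω.1 i).1 ⬝ᵥ (F.θD - M.θ)) ^ 2)
    ≤ 64 * A ^ 2 * B * (P.s * rateD M n P ^ 2)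
  omega_sub : ∀ k, l1 (omegaHat ω F.γ k - M.Omega k) ≤ 320 * A * B ^ 9 * (P.sΩ * rateN p n N P)
  omega_gram : ∀ k l, |avg Finset.univ (fun i => (allX ω i ⬝ᵥ omegaHat ω F.γ k) * allX ω i l)
    - (1 : Matrix (Fin p) (Fin p) ℝ) k l| ≤ 2 * A * B * rateN p n N P
  l1_omega : ∀ k, l1 (omegaHat ω F.γ k) ≤ 2 * P.LΩ
  B_sub : ∀ j k, l1 (F.b j k - fun l => M.B l k) ≤ lassoBConst A B H CB * rateB M n P

lemma fitBounds (hG : Good B H M P D ω) (hS : RegimeΩ A B p n N P) (hSB : RegimeB B H p n P)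
    (hR : Regime B p n P) (hA : Assumptions (1 / B) B δ M n P) (hCB : 248 * B ^ 4 ≤ CB)
    {lamD lamB : ℝ} {lamN : Fin p → ℝ} (hD : 8 * rateD M n P ≤ lamD)
    (hDA : lamD ≤ A * rateD M n P) (hN : ∀ k, 40 * B ^ 5 * rateN p n N P ≤ lamN k)
    (hNA : ∀ k, lamN k ≤ A * rateN p n N P) (hlamB : IsLamOpt CB M n P lamB)
    (hF : IsFit D ω lamD lamN lamB F) : FitBounds A B H CB M P ω F := by
  have h1 := dantzig_bound hR hA hG hD hDA hF.dantzig
  have h2 := fun k => omegaHat_bound hS hR hA hG (hN k) (hNA k) (hF.nodewise k)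
  exact ⟨h1.1, h1.2, fun k => (h2 k).1, fun k => (h2 k).2.1, fun k => (h2 k).2.2,
    fun j k => lassoB_bound hG hSB hR hA (zero_le_one.trans hS.one_le_A) hCB hlamB h1.2 j k
      (hF.lassoB j k)⟩

lemma FitBounds.Bhat_sub (hF : FitBounds A B H CB M P ω F) (k : Fin p) :
    l1 (fun l => F.Bhat l k - M.B l k) ≤ lassoBConst A B H CB * rateB M n P := by
  have e : (fun l => F.Bhat l k - M.B l k)
      = (1 / 2 : ℝ) • ((F.b 0 k - fun l => M.B l k) + (F.b 1 k - fun l => M.B l k)) := by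
    ext l
    simp only [Fit.Bhat, of_apply, Pi.smul_apply, Pi.add_apply, Pi.sub_apply, smul_eq_mul]
    ring
  rw [e, l1_smul, abs_of_nonneg (by norm_num)]
  linarith [l1_add_le (F.b 0 k - fun l => M.B l k) (F.b 1 k - fun l => M.B l k),
    hF.B_sub 0 k, hF.B_sub 1 k]

lemma M2Const_nonneg (hA0 : 0 ≤ A) (hB : 1 ≤ B) (hH : 1 ≤ H) : 0 ≤ M2Const A B H := by
  rw [M2Const]; positivity

lemma lassoBConst_nonneg (hB : 1 ≤ B) (hCB : 0 ≤ CB) : 0 ≤ lassoBConst A B H CB := by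
  rw [lassoBConst]; positivity

lemma M2hat_dev (hG : Good B H M P D ω) (hS : RegimeB B H p n P) (hR : Regime B p n P)
    (hA : Assumptions (1 / B) B δ M n P) (hA0 : 0 ≤ A) (hF : FitBounds A B H CB M P ω F)
    (k l : Fin p) : |F.M2hat D ω k l - M.M2 k l|
      ≤ M2Const A B H * (P.K ^ 2 * (P.c + rt p n + P.K * (√P.s * rt p n))) := by
  have h0 := M2hatFold_dev hG hS hR hA hA0 hF.pred 0 k l
  have h1 := M2hatFold_dev hG hS hR hA hA0 hF.pred 1 k l
  have e : F.M2hat D ω k l - M.M2 k l = 1 / 2 * ((F.M2hatFold D ω 0 k l - M.M2 k l)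
      + (F.M2hatFold D ω 1 k l - M.M2 k l)) := by
    simp only [Fit.M2hat, Matrix.smul_apply, Matrix.add_apply, smul_eq_mul]
    ring
  rw [e, abs_mul, abs_of_nonneg (by norm_num : (0 : ℝ) ≤ 1 / 2)]
  linarith [abs_add_le (F.M2hatFold D ω 0 k l - M.M2 k l) (F.M2hatFold D ω 1 k l - M.M2 k l)]

lemma M2hat_bound (hG : Good B H M P D ω) (hS : RegimeB B H p n P) (hR : Regime B p n P)
    (hA : Assumptions (1 / B) B δ M n P) (hA0 : 0 ≤ A) (hRem : Rem p n P ≤ 1)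
    (hF : FitBounds A B H CB M P ω F) (k l : Fin p) :
    |F.M2hat D ω k l| ≤ P.K ^ 2 * (9 * B ^ 7 + M2Const A B H * (1 + B)) := by
  have h1 := M2hat_dev hG hS hR hA hA0 hF k l
  have h2 := M2_bound hR hA k l
  have hB := hR.one_le_B
  have hBK : 1 ≤ (B * P.K) ^ 2 := one_le_pow₀ (hR.one_le_BK hA)
  have h3 : 9 * B ^ 5 ≤ P.K ^ 2 * (9 * B ^ 7) := by
    calc 9 * B ^ 5 ≤ 9 * B ^ 5 * (B * P.K) ^ 2 := le_mul_of_one_le_right (by positivity) hBK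
      _ = _ := by ring
  have h4 : M2Const A B H * (P.K ^ 2 * (P.c + rt p n + P.K * (√P.s * rt p n)))
      ≤ M2Const A B H * (P.K ^ 2 * (1 + B)) := by
    have := M2Const_nonneg hA0 hB hS.one_le_H
    have := hS.ct_le_one hR hA
    have := K_sqrt_le hR hA hRem
    gcongr
  have h5 := abs_sub_abs_le_abs_sub (F.M2hat D ω k l) (M.M2 k l)
  linarith

/-- The constant in the bound for `B̂ᵀ M̂₂`. -/
def BM2Const (A B H CB : ℝ) : ℝ :=
  2 * B * lassoBConst A B H CB * (9 * B ^ 7 + M2Const A B H * (1 + B)) + M2Const A B H * (B + 1)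

lemma BM2hat_dev (hG : Good B H M P D ω) (hS : RegimeB B H p n P) (hR : Regime B p n P)
    (hA : Assumptions (1 / B) B δ M n P) (hA0 : 0 ≤ A) (hCB : 0 ≤ CB) (hRem : Rem p n P ≤ 1)
    (hF : FitBounds A B H CB M P ω F) (k l : Fin p) :
    |(F.Bhatᵀ * F.M2hat D ω) k l - (M.Bᵀ * M.M2) k l|
      ≤ BM2Const A B H CB * (P.K ^ 2 * Rem p n P) := by
  have hB := hR.one_le_B
  have hM2 := M2Const_nonneg hA0 hB hS.one_le_H
  have hlB := lassoBConst_nonneg (A := A) (H := H) hB hCB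
  have e : (F.Bhatᵀ * F.M2hat D ω) k l - (M.Bᵀ * M.M2) k l
      = (fun i => F.Bhat i k - M.B i k) ⬝ᵥ (fun i => F.M2hat D ω i l)
        + (fun i => M.B i k) ⬝ᵥ (fun i => F.M2hat D ω i l - M.M2 i l) := by
    simp only [mul_apply, transpose_apply, dotProduct]
    rw [← Finset.sum_sub_distrib, ← Finset.sum_add_distrib]
    exact Finset.sum_congr rfl fun i _ => by ring
  have h1 := abs_dotProduct_le (x := fun i => F.Bhat i k - M.B i k)
    (M2hat_bound hG hS hR hA hA0 hRem hF · l)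
  have h2 := abs_dotProduct_le (x := fun i => M.B i k) (M2hat_dev hG hS hR hA hA0 hF · l)
  have h3 : l1 (fun i => F.Bhat i k - M.B i k) * (P.K ^ 2 * (9 * B ^ 7 + M2Const A B H * (1 + B)))
      ≤ lassoBConst A B H CB * (2 * B * Rem p n P)
        * (P.K ^ 2 * (9 * B ^ 7 + M2Const A B H * (1 + B))) := by
    gcongr
    exact (hF.Bhat_sub k).trans (mul_le_mul_of_nonneg_left (rateB_le_Rem hR hA) hlB)
  have h4 : l1 (fun i => M.B i k) * (M2Const A B H
      * (P.K ^ 2 * (P.c + rt p n + P.K * (√P.s * rt p n))))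
      ≤ M2Const A B H * (P.K ^ 2 * (B * Rem p n P + Rem p n P)) := by
    have hc := RegimeB.ct_pos hR hA
    have hK := hR.K_pos hA
    have hr := hR.rt_pos
    calc _ ≤ P.LB * (M2Const A B H * (P.K ^ 2 * (P.c + rt p n + P.K * (√P.s * rt p n)))) := by
          gcongr
          exact hA.l1_B k
      _ = M2Const A B H * (P.K ^ 2 * (P.LB * (P.c + rt p n)
          + P.LB * (P.K * (√P.s * rt p n)))) := by ring
      _ ≤ _ := by
        have := add_le_add (LB_ct_le_Rem hR hA) (LB_sqrt_le_Rem hR hA)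
        gcongr
  rw [e]
  refine (abs_add_le _ _).trans ?_
  rw [BM2Const]
  linarith

lemma GamHat_dev (hG : Good B H M P D ω) (hS : RegimeB B H p n P) (hR : Regime B p n P)
    (hA : Assumptions (1 / B) B δ M n P) (hA0 : 0 ≤ A) (hCB : 0 ≤ CB) (hRem : Rem p n P ≤ 1)
    (hF : FitBounds A B H CB M P ω F) (k l : Fin p) :
    |(F.GamHat D ω ψ - M.Gam ψ n N) k l| ≤ M1Const A B H * (P.K ^ 3 * (√P.s * rt p n))
      + |2 * ψ - ψ ^ 2| * BM2Const A B H CB * (N * P.K ^ 2 / (n + N) * Rem p n P) := by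
  have h1 := M1hat_dev hG hS hR hA hA0 hRem hF.pred k l
  have h2 := BM2hat_dev hG hS hR hA hA0 hCB hRem hF k l
  have e : (F.GamHat D ω ψ - M.Gam ψ n N) k l = (F.M1hat ω k l - M.M1 k l)
      - (N : ℝ) * (2 * ψ - ψ ^ 2) / (n + N) * ((F.Bhatᵀ * F.M2hat D ω) k l
        - (M.Bᵀ * M.M2) k l) := by
    rw [hA.Gam_eq]
    simp only [Fit.GamHat, Matrix.sub_apply, Matrix.smul_apply, smul_eq_mul]
    ring
  rw [e]
  refine (abs_sub _ _).trans (add_le_add h1 ?_)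
  rw [abs_mul, abs_div, abs_mul, abs_of_nonneg (Nat.cast_nonneg N),
    abs_of_nonneg (by positivity : (0 : ℝ) ≤ n + N)]
  calc _ ≤ (N : ℝ) * |2 * ψ - ψ ^ 2| / (n + N) * (BM2Const A B H CB * (P.K ^ 2 * Rem p n P)) := by
        gcongr
    _ = _ := by ring

/-- The constant in the bound for the plug-in variance. -/
def varConst (A B H CB ψ : ℝ) : ℝ :=
  4 * M1Const A B H + 4 * (|2 * ψ - ψ ^ 2| * BM2Const A B H CB) + 960 * A * B ^ 9

lemma varHat_dev (hG : Good B H M P D ω) (hS : RegimeB B H p n P) (hR : Regime B p n P)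
    (hA : Assumptions (1 / B) B δ M n P) (hA0 : 0 ≤ A) (hCB : 0 ≤ CB) (hRem : Rem p n P ≤ 1)
    (hF : FitBounds A B H CB M P ω F) (v : Fin p → ℝ) :
    |F.varHat D ω ψ v - M.asympVar ψ n N v| ≤ varConst A B H CB ψ * varRate M ψ n N P v := by
  have hB := hR.one_le_B
  have hH := hS.one_le_H
  have hK := hR.K_pos hA
  have hr := hR.rt_pos
  have hLB := hR.LB_nonneg hA
  have hν := RegimeΩ.rateN_pos hR hA N
  have hc := RegimeB.ct_pos hR hA
  have hL := RegimeΩ.LΩ_pos hR hA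
  have hM2 := M2Const_nonneg hA0 hB hH
  have hlB := lassoBConst_nonneg (A := A) (H := H) hB hCB
  have hBM : 0 ≤ BM2Const A B H CB := by rw [BM2Const]; positivity
  have hM1 : 0 ≤ M1Const A B H := by rw [M1Const]; positivity
  have hRem0 : 0 ≤ Rem p n P := (K_sq_sqrt_le_Rem hR hA).trans' (by positivity)
  have hg : 0 ≤ maxNorm (M.Gam ψ n N) := Real.iSup_nonneg fun _ => abs_nonneg _
  have hv := l1_nonneg v
  have e1 : F.varHat D ω ψ v = (v ᵥ* omegaHat ω F.γ) ⬝ᵥ (F.GamHat D ω ψ *ᵥ (v ᵥ* omegaHat ω F.γ)) :=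
    form_conj _ _ _
  have e2 : M.asympVar ψ n N v = (v ᵥ* M.Omega) ⬝ᵥ (M.Gam ψ n N *ᵥ (v ᵥ* M.Omega)) := by
    rw [← form_conj, Assumptions.Omega_symm, Model.asympVar]
  have h := abs_form_sub_form_le (a := v ᵥ* omegaHat ω F.γ) (b := v ᵥ* M.Omega)
    (d := l1 v * (320 * A * B ^ 9 * (P.sΩ * rateN p n N P))) (l1_vecMul_le hF.l1_omega v) (l1_vecMul_le hA.l1_Omega v)
    (by rw [← vecMul_sub]; exact l1_vecMul_le hF.omega_sub v)
    (GamHat_dev (ψ := ψ) hG hS hR hA hA0 hCB hRem hF) (abs_le_maxNorm _) (by positivity) hg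
  rw [e1, e2]
  refine h.trans ?_
  rw [varRate, sqrt_mul_log_div _ (by positivity), varConst, rateN]
  have n1 : 0 ≤ l1 v ^ 2 * (P.K * P.LΩ ^ 2 * P.sΩ * rt p (n + N) * maxNorm (M.Gam ψ n N)) := by
    have := (RegimeΩ.rt_pos hR N).le
    positivity
  have n2 : 0 ≤ l1 v ^ 2 * (P.K ^ 3 * P.LΩ ^ 2 * (√P.s * rt p n)) := by positivity
  have n3 : 0 ≤ l1 v ^ 2 * ((N : ℝ) * P.K ^ 2 * P.LΩ ^ 2 / ((n : ℝ) + N) * Rem p n P) := by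
    positivity
  set T1 := l1 v ^ 2 * (P.K * P.LΩ ^ 2 * P.sΩ * rt p (n + N) * maxNorm (M.Gam ψ n N)) with hT1
  set T2 := l1 v ^ 2 * (P.K ^ 3 * P.LΩ ^ 2 * (√P.s * rt p n)) with hT2
  set T3 := l1 v ^ 2 * ((N : ℝ) * P.K ^ 2 * P.LΩ ^ 2 / ((n : ℝ) + N) * Rem p n P) with hT3
  set X := |2 * ψ - ψ ^ 2| * BM2Const A B H CB with hX
  have hX0 : 0 ≤ X := by positivity
  have hY0 : 0 ≤ 960 * A * B ^ 9 := by positivity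
  calc _ = 4 * M1Const A B H * T2 + 4 * X * T3 + 960 * A * B ^ 9 * T1 := by
        rw [hT1, hT2, hT3]; ring
    _ ≤ (4 * M1Const A B H + 4 * X + 960 * A * B ^ 9) * T2
        + (4 * M1Const A B H + 4 * X + 960 * A * B ^ 9) * T3
        + (4 * M1Const A B H + 4 * X + 960 * A * B ^ 9) * T1 := by
        gcongr <;> linarith
    _ = _ := by rw [hT1, hT2, hT3]; ring

end Variance

/-! ### The linear expansion on the good event -/

section Expansion

variable {n N p : ℕ} {B H A CB δ ψ : ℝ} {M : Model p} {P : Params} {D : CrossFit n N p}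
  {ω : Sample n N p} {F : Fit p}

/-- The mean of `X g(X)` over the labelled data of a fold minus the mean over the whole fold. -/
def CrossFit.meanGap (D : CrossFit n N p) (g : (Fin p → ℝ) → ℝ) (ω : Sample n N p) (j : Fin 2) :
    Fin p → ℝ := fun l => avg (D.L j) (fun i => (ω.1 i).1 l * g (ω.1 i).1)
      - avg (D.LU j) (fun i => allX ω i l * g (allX ω i))

lemma muL_sub_muLU (D : CrossFit n N p) (M : Model p) (ω : Sample n N p) (j : Fin 2) :
    D.muL ω j - D.muLU ω j = D.meanGap M.m ω j + D.meanGap (fun x => D.mAt ω j x - M.m x) ω j := by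
  have e : D.muL ω j - D.muLU ω j = D.meanGap (D.mAt ω j) ω j := by
    ext l
    simp only [Pi.sub_apply, CrossFit.muL, CrossFit.muLU, CrossFit.meanGap, avg, CrossFit.LU,
      Finset.card_disjSum, Finset.sum_disjSum, allX, Sum.elim_inl, Sum.elim_inr, Nat.cast_add]
  rw [e]
  ext l
  simp only [Pi.add_apply, CrossFit.meanGap, mul_sub, avg_sub]
  ring

lemma sum_muL_sub_muLU (D : CrossFit n N p) (M : Model p) (ω : Sample n N p) :
    ∑ j, (D.muL ω j - D.muLU ω j) = (∑ j, D.meanGap M.m ω j)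
      + ∑ j, D.meanGap (fun x => D.mAt ω j x - M.m x) ω j := by
  rw [← Finset.sum_add_distrib]
  exact Finset.sum_congr rfl fun j _ => muL_sub_muLU D M ω j

/-- The score vector `n⁻¹ ∑ X e`. -/
def Model.scoreL (M : Model p) (ω : Sample n N p) : Fin p → ℝ :=
  fun k => avg Finset.univ fun i => (ω.1 i).1 k * M.resid (ω.1 i)

/-- The leading term of `θ̂ᵈ - θ`, up to the factor `Ω`. -/
def Model.score (M : Model p) (D : CrossFit n N p) (ψ : ℝ) (ω : Sample n N p) : Fin p → ℝ :=
  M.scoreL ω - (ψ / 2) • (M.Bᵀ *ᵥ ∑ j, D.meanGap M.m ω j)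

lemma thetaHat_sub_eq (F : Fit p) (D : CrossFit n N p) (M : Model p) (ω : Sample n N p) (ψ : ℝ) :
    F.thetaHat D ω ψ - M.θ - M.Omega *ᵥ M.score D ψ ω
      = ((1 - omegaHat ω F.γ * sigmaHat ω) *ᵥ (F.θD - M.θ)
        + (omegaHat ω F.γ - M.Omega) *ᵥ M.scoreL ω)
      - (ψ / 2) • ((omegaHat ω F.γ - M.Omega) *ᵥ (M.Bᵀ *ᵥ ∑ j, D.meanGap M.m ω j)
        + omegaHat ω F.γ *ᵥ ((F.Bhat - M.B)ᵀ *ᵥ ∑ j, (D.muL ω j - D.muLU ω j))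
        + omegaHat ω F.γ *ᵥ (M.Bᵀ *ᵥ ∑ j, D.meanGap (fun x => D.mAt ω j x - M.m x) ω j)) := by
  have e : (fun k => (n : ℝ)⁻¹ * ∑ i, (ω.1 i).1 k * (ω.1 i).2)
      = M.scoreL ω + sigmaHat ω *ᵥ M.θ := by
    ext k
    simp only [Pi.add_apply, Model.scoreL, mulVec, dotProduct, sigmaHat, of_apply, avg_univ_fin,
      Model.resid, mul_assoc, Finset.sum_mul, ← Finset.mul_sum]
    rw [← mul_add, Finset.sum_comm, ← Finset.sum_add_distrib]
    congr 1
    refine Finset.sum_congr rfl fun i _ => ?_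
    rw [← Finset.mul_sum]
    ring
  rw [Fit.thetaHat, Fit.xiHat, e, sum_muL_sub_muLU D M, Model.score]
  simp only [transpose_sub, sub_mulVec, mulVec_add, mulVec_sub, mulVec_smul, one_mulVec,
    ← mulVec_mulVec, smul_add, smul_sub]
  abel

lemma abs_mulVec_le {W : Matrix (Fin p) (Fin p) ℝ} {y : Fin p → ℝ} {a b : ℝ} {k : Fin p}
    (hW : l1 (W k) ≤ a) (hy : ∀ l, |y l| ≤ b) (hb : 0 ≤ b) : |(W *ᵥ y) k| ≤ a * b :=
  (abs_dotProduct_le hy).trans (mul_le_mul_of_nonneg_right hW hb)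

lemma abs_sum_fin_two_le {x : Fin 2 → Fin p → ℝ} {b : ℝ} {l : Fin p} (h : ∀ j, |x j l| ≤ b) :
    |(∑ j, x j) l| ≤ 2 * b := by
  rw [Fin.sum_univ_two, Pi.add_apply]
  linarith [abs_add_le (x 0 l) (x 1 l), h 0, h 1]

lemma meanGap_m_le (hG : Good B H M P D ω) (j : Fin 2) (l : Fin p) :
    |D.meanGap M.m ω j l| ≤ 20 * B ^ 2 * rt p n := by
  have h1 := hG.mean_L j l
  have h2 := hG.mean_LU j l
  rw [CrossFit.meanGap]
  rw [abs_le] at *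
  constructor <;> linarith [h1.1, h1.2, h2.1, h2.2]

lemma omega_sigmaHat_dev (hG : Good B H M P D ω) (hA1 : 1 ≤ A) (hR : Regime B p n P)
    (hA : Assumptions (1 / B) B δ M n P) (hF : FitBounds A B H CB M P ω F) (k l : Fin p) :
    |(1 - omegaHat ω F.γ * sigmaHat ω) k l|
      ≤ (80 * B ^ 4 + 2 * A * B) * (P.LΩ * (P.K * rt p n)) := by
  have hB := hR.one_le_B
  have hK := hR.K_pos hA
  have hr := hR.rt_pos
  have hL := RegimeΩ.LΩ_pos hR hA
  have h1 := gram_mulVec (z := fun i => (ω.1 i).1) hG.gram (omegaHat ω F.γ k) l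
  have h2 := gram_mulVec hG.gram_all (omegaHat ω F.γ k) l
  have h3 := hF.omega_gram k l
  have e1 : (omegaHat ω F.γ * sigmaHat ω) k l
      = avg Finset.univ fun i => (ω.1 i).1 l * ((ω.1 i).1 ⬝ᵥ omegaHat ω F.γ k) := by
    rw [avg_mul_dotProduct]
    simp only [mul_apply, dotProduct, sigmaHat, of_apply, avg_univ_fin]
    refine Finset.sum_congr rfl fun i _ => ?_
    simp only [mul_comm]
  have e2 : avg Finset.univ (fun i => (allX ω i ⬝ᵥ omegaHat ω F.γ k) * allX ω i l)
      = avg Finset.univ fun i => allX ω i l * (allX ω i ⬝ᵥ omegaHat ω F.γ k) :=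
    avg_congr fun i _ => mul_comm _ _
  have hrN : rt p (n + N) ≤ rt p n := rt_antitone hR.n_pos (by omega)
  have b1 : l1 (omegaHat ω F.γ k) * (20 * B ^ 3 * rt p n) ≤ 40 * B ^ 4 * (P.LΩ * (P.K * rt p n)) := by
    calc _ ≤ 2 * P.LΩ * (20 * B ^ 3 * rt p n) := by
          gcongr
          exact hF.l1_omega k
      _ ≤ 2 * P.LΩ * (20 * B ^ 3 * rt p n) * (B * P.K) :=
          le_mul_of_one_le_right (by positivity) (hR.one_le_BK hA)
      _ = _ := by ring
  have b2 : l1 (omegaHat ω F.γ k) * (20 * B ^ 3 * rt p (n + N))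
      ≤ l1 (omegaHat ω F.γ k) * (20 * B ^ 3 * rt p n) := by
    have := l1_nonneg (omegaHat ω F.γ k)
    gcongr
  have b3 : 2 * A * B * rateN p n N P ≤ 2 * A * B * (P.LΩ * (P.K * rt p n)) := by
    rw [rateN]
    calc _ = 2 * A * B * (P.LΩ * (P.K * rt p (n + N))) := by ring
      _ ≤ _ := by gcongr
  rw [Matrix.sub_apply, e1]
  rw [e2] at h3
  rw [abs_le] at *
  constructor <;> linarith [h1.1, h1.2, h2.1, h2.2, h3.1, h3.2]

/-- The constant in the linear expansion. -/
def expConst (A B H CB ψ : ℝ) : ℝ := 32 * A * B ^ 2 * (80 * B ^ 4 + 2 * A * B) + 2560 * A * B ^ 9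
  + |ψ / 2| * (12800 * A * B ^ 12 + 208 * B ^ 3 * lassoBConst A B H CB + 128 * B ^ 2)

lemma expansion (hG : Good B H M P D ω) (hS : RegimeΩ A B p n N P) (hSB : RegimeB B H p n P)
    (hR : Regime B p n P) (hA : Assumptions (1 / B) B δ M n P) (hCB : 0 ≤ CB)
    (hF : FitBounds A B H CB M P ω F) (v : Fin p → ℝ) :
    |v ⬝ᵥ (F.thetaHat D ω ψ - M.θ) - v ⬝ᵥ (M.Omega *ᵥ M.score D ψ ω)|
      ≤ expConst A B H CB ψ * expRate M n N P v := by
  have hA1 := hS.one_le_A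
  have hB := hR.one_le_B
  have hH := hSB.one_le_H
  have hK := hR.K_pos hA
  have hr := hR.rt_pos
  have hLB := hR.LB_nonneg hA
  have hc := RegimeB.ct_pos hR hA
  have hL := RegimeΩ.LΩ_pos hR hA
  have hrN := RegimeΩ.rt_pos hR N
  have hlB := lassoBConst_nonneg (A := A) (H := H) hB hCB
  have hBK := hR.one_le_BK hA
  have hν := RegimeΩ.rateN_pos hR hA N
  have hKc : P.K * (P.c + rt p n) ≤ 1 := by
    refine le_trans ?_ (hSB.K_ct hR hA)
    exact le_mul_of_one_le_left (by positivity) (one_le_mul_of_one_le_of_one_le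
      (one_le_mul_of_one_le_of_one_le (by norm_num) (one_le_pow₀ hB)) hH)
  set κ := √(M.noiseVar + P.Φ ^ 2) with hκ
  have hκ0 : 0 ≤ κ := Real.sqrt_nonneg _
  have hD : rateD M n P = P.K * (κ * rt p n) := rateD_eq
  have hsB := one_le_sqrt_sB hA
  set mx := max (P.s : ℝ) P.sB with hmx
  have hmx1 : (P.s : ℝ) ≤ mx := le_max_left _ _
  have hmx2 : √P.sB * √P.s ≤ mx := by
    have h1 : √(P.sB : ℝ) ≤ √mx := Real.sqrt_le_sqrt (le_max_right _ _)
    have h2 : √(P.s : ℝ) ≤ √mx := Real.sqrt_le_sqrt (le_max_left _ _)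
    calc _ ≤ √mx * √mx := by gcongr
      _ = mx := Real.mul_self_sqrt (le_max_of_le_left (by positivity))
  set E := P.LΩ * P.K ^ 2 * rt p n with hE
  have hE0 : 0 ≤ E := by positivity
  set E1 := κ * P.sΩ * rt p (n + N) with hE1
  set E2 := P.LB * P.sΩ * rt p (n + N) with hE2
  set E3 := (P.sB + √P.sB * P.LB) * (P.c + rt p n) with hE3
  set E4 := P.K * mx * κ * rt p n with hE4
  have hmx0 : 0 ≤ mx := le_max_of_le_left (by positivity)
  have hE10 : 0 ≤ E1 := by positivity
  have hE20 : 0 ≤ E2 := by positivity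
  have hE30 : 0 ≤ E3 := by positivity
  have hE40 : 0 ≤ E4 := by positivity
  have hW : ∀ l, |(∑ j, D.meanGap M.m ω j) l| ≤ 2 * (20 * B ^ 2 * rt p n) := fun l =>
    abs_sum_fin_two_le fun j => meanGap_m_le hG j l
  have hV : ∀ l, |(∑ j, D.meanGap (fun x => D.mAt ω j x - M.m x) ω j) l|
      ≤ 2 * (32 * (P.K * B * (P.c + rt p n)) * rt p n) := fun l =>
    abs_sum_fin_two_le fun j => (hG.diff j).mean l
  have hWV : ∀ l, |(∑ j, (D.muL ω j - D.muLU ω j)) l| ≤ 104 * B ^ 2 * rt p n := fun l => by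
    rw [sum_muL_sub_muLU D M, Pi.add_apply]
    have h3 : 2 * (32 * (P.K * B * (P.c + rt p n)) * rt p n) ≤ 64 * B ^ 2 * rt p n := by
      calc _ = 64 * (B * (P.K * (P.c + rt p n)) * rt p n) := by ring
        _ ≤ 64 * (B * B * rt p n) := by
          gcongr
          linarith
        _ = _ := by ring
    linarith [abs_add_le ((∑ j, D.meanGap M.m ω j) l)
      ((∑ j, D.meanGap (fun x => D.mAt ω j x - M.m x) ω j) l), hW l, hV l]
  have hBT : ∀ k, l1 ((M.Bᵀ : Matrix (Fin p) (Fin p) ℝ) k) ≤ P.LB := fun k => hA.l1_B k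
  have hBhat : ∀ k, l1 ((F.Bhat - M.B)ᵀ k) ≤ lassoBConst A B H CB * (P.K * (E3 + E4)) := fun k => by
    refine (hF.Bhat_sub k).trans (mul_le_mul_of_nonneg_left ?_ hlB)
    rw [rateB, misfit, hD]
    calc _ = P.K * (E3 + P.K * (√P.sB * √P.s) * κ * rt p n) := by rw [hE3]; ring
      _ ≤ _ := by rw [hE4]; gcongr
  rw [← dotProduct_sub, thetaHat_sub_eq]
  refine (abs_dotProduct_le (b := expConst A B H CB ψ * (E * (E1 + E2 + E3 + E4))) fun k => ?_).trans_eq ?_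
  swap
  · rw [expRate, hE, hE1, hE2, hE3, hE4]; ring
  have t1 : |((1 - omegaHat ω F.γ * sigmaHat ω) *ᵥ (F.θD - M.θ)) k|
      ≤ 32 * A * B ^ 2 * (80 * B ^ 4 + 2 * A * B) * (E * E4) := by
    rw [mulVec, dotProduct_comm]
    refine (abs_dotProduct_le (omega_sigmaHat_dev hG hA1 hR hA hF k)).trans ?_
    calc _ ≤ 32 * A * B * (mx * (P.K * (κ * rt p n)))
          * ((80 * B ^ 4 + 2 * A * B) * (P.LΩ * (P.K * rt p n))) := by
          gcongr
          refine hF.l1_θ.trans ?_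
          rw [hD]
          gcongr
      _ ≤ 32 * A * B * (mx * (P.K * (κ * rt p n)))
          * ((80 * B ^ 4 + 2 * A * B) * (P.LΩ * (P.K * rt p n))) * (B * P.K) :=
          le_mul_of_one_le_right (by positivity) hBK
      _ = _ := by rw [hE, hE4]; ring
  have t2 : |((omegaHat ω F.γ - M.Omega) *ᵥ M.scoreL ω) k| ≤ 2560 * A * B ^ 9 * (E * E1) := by
    refine (abs_mulVec_le (hF.omega_sub k) hG.noise (by rw [hD]; positivity)).trans_eq ?_
    rw [hD, rateN, hE, hE1]
    ring
  have t3 : |((omegaHat ω F.γ - M.Omega) *ᵥ (M.Bᵀ *ᵥ ∑ j, D.meanGap M.m ω j)) k|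
      ≤ 12800 * A * B ^ 12 * (E * E2) := by
    refine (abs_mulVec_le (hF.omega_sub k) (fun l => abs_mulVec_le (hBT l) hW (by positivity))
      (by positivity)).trans ?_
    rw [rateN]
    calc _ ≤ 320 * A * B ^ 9 * (P.sΩ * (P.K * P.LΩ * rt p (n + N)))
          * (P.LB * (2 * (20 * B ^ 2 * rt p n))) * (B * P.K) :=
          le_mul_of_one_le_right (by positivity) hBK
      _ = _ := by rw [hE, hE2]; ring
  have t4 : |(omegaHat ω F.γ *ᵥ ((F.Bhat - M.B)ᵀ *ᵥ ∑ j, (D.muL ω j - D.muLU ω j))) k|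
      ≤ 208 * B ^ 3 * lassoBConst A B H CB * (E * (E3 + E4)) := by
    refine (abs_mulVec_le (hF.l1_omega k) (fun l => abs_mulVec_le (hBhat l) hWV (by positivity))
      (by positivity)).trans ?_
    calc _ ≤ 2 * P.LΩ * (lassoBConst A B H CB * (P.K * (E3 + E4)) * (104 * B ^ 2 * rt p n))
          * (B * P.K) := le_mul_of_one_le_right (by positivity) hBK
      _ = _ := by rw [hE]; ring
  have t5 : |(omegaHat ω F.γ *ᵥ (M.Bᵀ *ᵥ ∑ j, D.meanGap (fun x => D.mAt ω j x - M.m x) ω j)) k|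
      ≤ 128 * B ^ 2 * (E * E3) := by
    refine (abs_mulVec_le (hF.l1_omega k) (fun l => abs_mulVec_le (hBT l) hV (by positivity))
      (by positivity)).trans ?_
    have h1 : P.LB * (P.c + rt p n) ≤ E3 := by
      calc _ ≤ (P.sB + √P.sB * P.LB) * (P.c + rt p n) := by
            gcongr
            nlinarith [Nat.cast_nonneg (α := ℝ) P.sB]
        _ = _ := rfl
    calc _ = 128 * B * (P.LΩ * P.K * rt p n) * (P.LB * (P.c + rt p n)) := by ring
      _ ≤ 128 * B * (P.LΩ * P.K * rt p n) * E3 := by gcongr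
      _ ≤ 128 * B * (P.LΩ * P.K * rt p n) * E3 * (B * P.K) :=
          le_mul_of_one_le_right (by positivity) hBK
      _ = _ := by rw [hE]; ring
  simp only [Pi.sub_apply, Pi.add_apply, Pi.smul_apply, smul_eq_mul]
  refine (abs_sub _ _).trans ((add_le_add (abs_add_le _ _) (abs_mul _ _).le).trans ?_)
  have t6 := (abs_add_le _ _).trans (add_le_add ((abs_add_le _ _).trans (add_le_add t3 t4)) t5)
  have t7 := mul_le_mul_of_nonneg_left t6 (abs_nonneg (ψ / 2))
  have t8 := add_le_add (add_le_add t1 t2) t7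
  refine t8.trans ?_
  have m1 : E * E1 ≤ E * (E1 + E2 + E3 + E4) := by gcongr; linarith
  have m2 : E * E2 ≤ E * (E1 + E2 + E3 + E4) := by gcongr; linarith
  have m3 : E * E3 ≤ E * (E1 + E2 + E3 + E4) := by gcongr; linarith
  have m4 : E * E4 ≤ E * (E1 + E2 + E3 + E4) := by gcongr; linarith
  have m5 : E * (E3 + E4) ≤ E * (E1 + E2 + E3 + E4) := by gcongr; linarith
  calc _ ≤ 32 * A * B ^ 2 * (80 * B ^ 4 + 2 * A * B) * (E * (E1 + E2 + E3 + E4))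
        + 2560 * A * B ^ 9 * (E * (E1 + E2 + E3 + E4))
        + |ψ / 2| * (12800 * A * B ^ 12 * (E * (E1 + E2 + E3 + E4))
          + 208 * B ^ 3 * lassoBConst A B H CB * (E * (E1 + E2 + E3 + E4))
          + 128 * B ^ 2 * (E * (E1 + E2 + E3 + E4))) := by gcongr
    _ = _ := by rw [expConst]; ring

end Expansion

/-! ### The linear part as a sum of independent variables -/

section Fold

variable {n N p : ℕ} (D : CrossFit n N p)

lemma CrossFit.sum_L (g : Fin 2 → Fin n → ℝ) :
    ∑ j, ∑ i ∈ D.L j, g j i = ∑ i, g (D.foldL i) i := by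
  rw [← Finset.sum_fiberwise Finset.univ D.foldL]
  exact Finset.sum_congr rfl fun j _ => Finset.sum_congr rfl fun i hi => by
    rw [(Finset.mem_filter.1 hi).2]

lemma CrossFit.sum_U (g : Fin 2 → Fin N → ℝ) :
    ∑ j, ∑ i ∈ D.U j, g j i = ∑ i, g (D.foldU i) i := by
  rw [← Finset.sum_fiberwise Finset.univ D.foldU]
  exact Finset.sum_congr rfl fun j _ => Finset.sum_congr rfl fun i hi => by
    rw [(Finset.mem_filter.1 hi).2]

/-- The weight of a labelled observation in `avg (L j) - avg (LU j)`. -/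
def CrossFit.coefL (j : Fin 2) : ℝ := ((D.L j).card : ℝ)⁻¹ - ((D.LU j).card : ℝ)⁻¹

/-- The weight of an unlabelled observation in `avg (LU j) - avg (L j)`. -/
def CrossFit.coefU (j : Fin 2) : ℝ := ((D.LU j).card : ℝ)⁻¹

lemma CrossFit.sum_gap (g : (Fin p → ℝ) → ℝ) (ω : Sample n N p) :
    ∑ j, (avg (D.L j) (fun i => g (ω.1 i).1) - avg (D.LU j) (fun i => g (allX ω i)))
      = ∑ i, D.coefL (D.foldL i) * g (ω.1 i).1 - ∑ i, D.coefU (D.foldU i) * g (ω.2 i) := by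
  rw [← D.sum_L fun j i => D.coefL j * g (ω.1 i).1, ← D.sum_U fun j i => D.coefU j * g (ω.2 i),
    ← Finset.sum_sub_distrib]
  refine Finset.sum_congr rfl fun j _ => ?_
  simp only [avg, CrossFit.coefL, CrossFit.coefU, ← Finset.mul_sum]
  conv_lhs => enter [2, 2]; rw [CrossFit.LU, Finset.sum_disjSum]
  simp only [allX, Sum.elim_inl, Sum.elim_inr]
  ring

/-- The effect of rounding in one fold. -/
lemma CrossFit.fold_variance (hn : 4 ≤ n) (ψ : ℝ) (j : Fin 2) :
    |n * ((D.L j).card * (ψ * ((n : ℝ)⁻¹ * D.coefL j) - ψ ^ 2 / 4 * D.coefL j ^ 2)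
        - (D.U j).card * (ψ ^ 2 / 4 * D.coefU j ^ 2)) - (N : ℝ) * (2 * ψ - ψ ^ 2) / (n + N) / 2|
      ≤ 3 / 2 * (|ψ| + ψ ^ 2) / n := by
  have hn0 : (0 : ℝ) < n := by exact_mod_cast (by omega : 0 < n)
  have hN0 : (0 : ℝ) ≤ N := Nat.cast_nonneg _
  have h3 := D.n_le_card_L hn j
  obtain ⟨l1, l2⟩ := D.card_L_balanced j
  obtain ⟨u1, u2⟩ := D.card_U_balanced j
  rw [CrossFit.coefL, CrossFit.coefU, CrossFit.card_LU]
  generalize (D.L j).card = a' at *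
  generalize (D.U j).card = b' at *
  have l1' : (n : ℝ) ≤ 2 * a' + 1 := by exact_mod_cast l1
  have l2' : 2 * (a' : ℝ) ≤ n + 1 := by exact_mod_cast l2
  have u1' : (N : ℝ) ≤ 2 * b' + 1 := by exact_mod_cast u1
  have u2' : 2 * (b' : ℝ) ≤ N + 1 := by exact_mod_cast u2
  have hb : (0 : ℝ) ≤ b' := Nat.cast_nonneg _
  push_cast
  set a : ℝ := (a' : ℝ)
  set b : ℝ := (b' : ℝ)
  set m : ℝ := (n : ℝ)
  set q : ℝ := (N : ℝ)
  have ha : 0 < a := by linarith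
  have hab : 0 < a + b := by linarith
  set π := b / (a + b) with hπ
  have hπ0 : 0 ≤ π := by positivity
  have hπ1 : π ≤ 1 := (div_le_one hab).2 (by linarith)
  have e : m * (a * (ψ * (m⁻¹ * (a⁻¹ - (a + b)⁻¹)) - ψ ^ 2 / 4 * (a⁻¹ - (a + b)⁻¹) ^ 2)
      - b * (ψ ^ 2 / 4 * (a + b)⁻¹ ^ 2)) - q * (2 * ψ - ψ ^ 2) / (m + q) / 2
      = (ψ - ψ ^ 2 / 2) * (π - q / (m + q)) - ψ ^ 2 / 4 * (π * (m / a - 2)) := by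
    have : m + q ≠ 0 := by positivity
    rw [hπ]
    field_simp
    ring
  have h1 : |π - q / (m + q)| ≤ 3 / 2 / m := by
    have e1 : π - q / (m + q) = ((2 * b - q) * m - q * (2 * a - m)) / (2 * ((a + b) * (m + q))) := by
      have : m + q ≠ 0 := by positivity
      rw [hπ]
      field_simp
      ring
    rw [e1, abs_div, abs_of_pos (by positivity : 0 < 2 * ((a + b) * (m + q))),
      div_le_div_iff₀ (by positivity) hn0]
    have h4 : |(2 * b - q) * m - q * (2 * a - m)| ≤ m + q := by
      rw [abs_le]
      constructor <;> nlinarith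
    calc _ ≤ (m + q) * m := by gcongr
      _ ≤ 3 / 2 * (2 * ((a + b) * (m + q))) := by nlinarith
  have h2 : |m / a - 2| ≤ 3 / m := by
    rw [div_sub' ha.ne', abs_div, abs_of_pos ha, div_le_div_iff₀ ha hn0]
    have : |m - a * 2| ≤ 1 := by rw [abs_le]; constructor <;> linarith
    nlinarith
  rw [e]
  refine (abs_sub _ _).trans ?_
  rw [abs_mul, abs_mul, abs_mul, abs_of_nonneg (by positivity : 0 ≤ ψ ^ 2 / 4), abs_of_nonneg hπ0]
  have h5 : |ψ - ψ ^ 2 / 2| ≤ |ψ| + ψ ^ 2 / 2 := by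
    refine (abs_sub _ _).trans ?_
    rw [abs_of_nonneg (by positivity : 0 ≤ ψ ^ 2 / 2)]
  calc _ ≤ (|ψ| + ψ ^ 2 / 2) * (3 / 2 / m) + ψ ^ 2 / 4 * (1 * (3 / m)) := by gcongr
    _ = _ := by ring

end Fold

section Influence

variable {n N p : ℕ} {B δ : ℝ} {M : Model p} {P : Params}

/-- The influence of a labelled observation through `X e`. -/
def Model.infA (M : Model p) (w : Fin p → ℝ) (z : Obs p) : ℝ := (z.1 ⬝ᵥ w) * M.resid z

/-- The influence of an observation through `X m(X) - μ`. -/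
def Model.infB (M : Model p) (w : Fin p → ℝ) (x : Fin p → ℝ) : ℝ := (M.B *ᵥ w) ⬝ᵥ M.T2 x

lemma Model.measurable_infA (w : Fin p → ℝ) : Measurable (M.infA w) := by
  unfold Model.infA dotProduct
  exact (Finset.measurable_sum _ fun i _ =>
    (((measurable_pi_apply i).comp measurable_fst).mul_const _)).mul M.measurable_resid

lemma Model.measurable_infB (w : Fin p → ℝ) : Measurable (M.infB w) := by
  unfold Model.infB dotProduct
  exact Finset.measurable_sum _ fun i _ => (M.measurable_T2 i).const_mul _

lemma infA_eq (w : Fin p → ℝ) (z : Obs p) : M.infA w z = w ⬝ᵥ M.T1 z := by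
  simp only [Model.infA, dotProduct, Model.T1, Model.resid, Finset.sum_mul]
  exact Finset.sum_congr rfl fun i _ => by ring

namespace Assumptions

lemma memLp_infA (hB : 1 ≤ B) (hA : Assumptions (1 / B) B δ M n P) (w : Fin p → ℝ) :
    MemLp (M.infA w) 2 M.PXY :=
  (memLp_two_iff_integrable_sq (M.measurable_infA w).aestronglyMeasurable).2
    (hA.dotProduct_resid_sq hB w).1

lemma integral_infA (hA : Assumptions (1 / B) B δ M n P) (w : Fin p → ℝ) :
    ∫ z, M.infA w z ∂M.PXY = 0 := by
  have h : ∀ i, Integrable (fun z => M.T1 z i) M.PXY := hA.integrable_coord_resid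
  simp only [infA_eq, dotProduct]
  rw [integral_finsetSum _ fun i _ => (h i).const_mul _]
  refine Finset.sum_eq_zero fun i _ => ?_
  rw [integral_const_mul]
  exact mul_eq_zero_of_right _ (hA.integral_coord_resid i)

lemma memLp_infB (hA : Assumptions (1 / B) B δ M n P) (w : Fin p → ℝ) :
    MemLp (M.infB w) 2 M.PX :=
  have := M.probX
  MemLp.of_bound (M.measurable_infB w).aestronglyMeasurable _ (hA.dotProduct_T2_bound _)

lemma memLp_infB_fst (hA : Assumptions (1 / B) B δ M n P) (w : Fin p → ℝ) :
    MemLp (fun z : Obs p => M.infB w z.1) 2 M.PXY := by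
  have h := hA.memLp_infB w
  rw [← M.map_fst_PXY] at h
  exact h.comp_of_map measurable_fst.aemeasurable

lemma form_M1 (hB : 1 ≤ B) (hA : Assumptions (1 / B) B δ M n P) (w : Fin p → ℝ) :
    w ⬝ᵥ (M.M1 *ᵥ w) = ∫ z, M.infA w z ^ 2 ∂M.PXY := by
  have h : ∀ j, MemLp (fun z => M.T1 z j) 2 M.PXY := fun j =>
    (memLp_two_iff_integrable_sq
      (((measurable_pi_apply j).comp measurable_fst).mul M.measurable_resid).aestronglyMeasurable).2
        (hA.coord_resid_sq hB j).1
  rw [Model.M1, form_integral fun i j => (h i).integrable_mul (h j)]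
  simp only [infA_eq, sq]

lemma form_M2 (hA : Assumptions (1 / B) B δ M n P) (w : Fin p → ℝ) :
    (M.B *ᵥ w) ⬝ᵥ (M.M2 *ᵥ w) = ∫ z, M.infB w z.1 * M.infA w z ∂M.PXY := by
  rw [Model.M2, form_integral (f := fun z : Obs p => M.T2 z.1) (g := M.T1) hA.integrable_T2_T1]
  simp only [infA_eq, Model.infB]

lemma integral_infB_infA (hB : 1 ≤ B) (hA : Assumptions (1 / B) B δ M n P) (w : Fin p → ℝ) :
    ∫ z, M.infB w z.1 * M.infA w z ∂M.PXY = ∫ x, M.infB w x ^ 2 ∂M.PX := by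
  rw [← hA.form_M2, ← hA.M3_mul_B hB, ← mulVec_mulVec, hA.form_M3]
  simp only [Model.infB, sq]

lemma infB_sq_le (hB : 1 ≤ B) (hA : Assumptions (1 / B) B δ M n P) (w : Fin p → ℝ) :
    ∫ x, M.infB w x ^ 2 ∂M.PX ≤ ∫ z, M.infA w z ^ 2 ∂M.PXY := by
  have h1 := hA.memLp_infB_fst w
  have h2 := hA.memLp_infA hB w
  have e : ∫ z : Obs p, M.infB w z.1 ^ 2 ∂M.PXY = ∫ x, M.infB w x ^ 2 ∂M.PX :=
    M.integral_fst_PXY (g := fun x => M.infB w x ^ 2) ((M.measurable_infB w).pow_const 2)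
  have h3 : ∫ z, 2 * (M.infB w z.1 * M.infA w z) ∂M.PXY
      ≤ ∫ z, (M.infB w z.1 ^ 2 + M.infA w z ^ 2) ∂M.PXY :=
    integral_mono ((h1.integrable_mul h2).const_mul 2) (h1.integrable_sq.add h2.integrable_sq)
      fun z => by simp only; nlinarith [sq_nonneg (M.infB w z.1 - M.infA w z)]
  rw [integral_const_mul, hA.integral_infB_infA hB,
    integral_add h1.integrable_sq h2.integrable_sq, e] at h3
  linarith

lemma asympVar_eq (hB : 1 ≤ B) (hA : Assumptions (1 / B) B δ M n P) (ψ : ℝ) (n' N : ℕ)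
    (v : Fin p → ℝ) : M.asympVar ψ n' N v = ∫ z, M.infA (M.Omega *ᵥ v) z ^ 2 ∂M.PXY
      - N * (2 * ψ - ψ ^ 2) / (n' + N) * ∫ x, M.infB (M.Omega *ᵥ v) x ^ 2 ∂M.PX := by
  have e : M.asympVar ψ n' N v = (M.Omega *ᵥ v) ⬝ᵥ (M.Gam ψ n' N *ᵥ (M.Omega *ᵥ v)) := by
    have := form_conj M.Omega (M.Gam ψ n' N) v
    rw [← mulVec_transpose, Omega_symm] at this
    exact this
  rw [e, hA.Gam_eq, sub_mulVec, smul_mulVec, dotProduct_sub, dotProduct_smul, hA.form_M1 hB,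
    ← hA.integral_infB_infA hB, ← hA.form_M2, ← mulVec_mulVec, smul_eq_mul,
    dotProduct_mulVec _ M.Bᵀ, vecMul_transpose]

lemma infA_sq_le (hB : 1 ≤ B) (hA : Assumptions (1 / B) B δ M n P) (v : Fin p → ℝ) :
    ∫ z, M.infA (M.Omega *ᵥ v) z ^ 2 ∂M.PXY ≤ 16 * B ^ 5 * l2 v ^ 2 := by
  have hB0 : 0 < B := by linarith
  refine (hA.dotProduct_resid_sq hB _).2.trans ?_
  set w := M.Omega *ᵥ v with hw
  have e : M.Sigma *ᵥ w = v := by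
    rw [hw, mulVec_mulVec, Model.Omega, mul_nonsing_inv _ (hA.Sigma_det hB), one_mulVec]
  have h1 := hA.eig_Sigma w
  have h2 : w ⬝ᵥ v ≤ l2 w * l2 v := by
    rw [l2, l2]
    exact Real.sum_mul_le_sqrt_mul_sqrt _ _ _
  rw [e] at h1 ⊢
  have h3 : w ⬝ᵥ v ≤ B * l2 v ^ 2 := by
    have n1 := l2_nonneg w
    have n2 := l2_nonneg v
    have h4 : l2 w ^ 2 ≤ B * (l2 w * l2 v) := by
      rw [one_div, inv_mul_le_iff₀ hB0] at h1
      nlinarith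
    have h5 : l2 w ≤ B * l2 v := by
      rcases n1.eq_or_lt with h | h
      · rw [← h]; positivity
      · nlinarith
    nlinarith
  calc _ ≤ 16 * B ^ 4 * (B * l2 v ^ 2) := by gcongr
    _ = _ := by ring

end Assumptions

end Influence

section Linear

variable {n N p : ℕ} {B δ ψ : ℝ} {M : Model p} {P : Params}

/-- The contribution of a labelled observation to the linear part. -/
def Model.linL (M : Model p) (D : CrossFit n N p) (ψ : ℝ) (w : Fin p → ℝ) (i : Fin n)
    (z : Obs p) : ℝ :=
  √n * ((n : ℝ)⁻¹ * M.infA w z - ψ / 2 * D.coefL (D.foldL i) * M.infB w z.1)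

/-- The contribution of an unlabelled observation to the linear part. -/
def Model.linU (M : Model p) (D : CrossFit n N p) (ψ : ℝ) (w : Fin p → ℝ) (i : Fin N)
    (x : Fin p → ℝ) : ℝ := √n * (ψ / 2 * D.coefU (D.foldU i) * M.infB w x)

/-- The summands of the linear part. -/
def Model.lin (M : Model p) (D : CrossFit n N p) (ψ : ℝ) (w : Fin p → ℝ) (i : Fin n ⊕ Fin N)
    (ω : Sample n N p) : ℝ :=
  Sum.elim (fun i => M.linL D ψ w i (ω.1 i)) (fun i => M.linU D ψ w i (ω.2 i)) i

lemma avg_infB {ι : Type*} {s : Finset ι} (hs : s.Nonempty) (x : ι → Fin p → ℝ) (w : Fin p → ℝ) :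
    avg s (fun i => M.infB w (x i)) = (M.B *ᵥ w) ⬝ᵥ (fun l => avg s fun i => x i l * M.m (x i))
      - (M.B *ᵥ w) ⬝ᵥ M.mu := by
  have e : ∀ i, M.infB w (x i) = M.m (x i) * (x i ⬝ᵥ (M.B *ᵥ w)) - (M.B *ᵥ w) ⬝ᵥ M.mu := fun i => by
    simp only [Model.infB, Model.T2, dotProduct, Finset.mul_sum, ← Finset.sum_sub_distrib]
    exact Finset.sum_congr rfl fun l _ => by ring
  simp only [e]
  rw [avg_sub, avg_const hs, avg_mul_dotProduct]
  simp only [mul_comm]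

lemma sqrt_mul_score_eq_sum (hn : 4 ≤ n) (D : CrossFit n N p) (v : Fin p → ℝ)
    (ω : Sample n N p) : √n * (v ⬝ᵥ (M.Omega *ᵥ M.score D ψ ω))
      = ∑ i, M.lin D ψ (M.Omega *ᵥ v) i ω := by
  set w := M.Omega *ᵥ v with hw
  have e1 : v ⬝ᵥ (M.Omega *ᵥ M.score D ψ ω) = w ⬝ᵥ M.score D ψ ω := by
    rw [dotProduct_mulVec, ← mulVec_transpose, Assumptions.Omega_symm]
  have e2 : w ⬝ᵥ M.scoreL ω = avg Finset.univ fun i => M.infA w (ω.1 i) := by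
    have := avg_mul_dotProduct (s := Finset.univ) (z := fun i => (ω.1 i).1)
      (fun i => M.resid (ω.1 i)) w
    simp only [mul_comm (M.resid _)] at this
    exact this.symm
  have e3 : w ⬝ᵥ (M.Bᵀ *ᵥ ∑ j, D.meanGap M.m ω j)
      = ∑ i, D.coefL (D.foldL i) * M.infB w (ω.1 i).1
        - ∑ i, D.coefU (D.foldU i) * M.infB w (ω.2 i) := by
    rw [← D.sum_gap, dotProduct_mulVec, vecMul_transpose, dotProduct_sum]
    refine Finset.sum_congr rfl fun j _ => ?_
    rw [avg_infB (D.L_nonempty hn j), avg_infB (D.LU_nonempty hn j), sub_sub_sub_cancel_right,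
      ← dotProduct_sub]
    rfl
  rw [e1, Model.score, dotProduct_sub, dotProduct_smul, e2, e3, Fintype.sum_sum_type, avg_univ_fin]
  simp only [Model.lin, Sum.elim_inl, Sum.elim_inr, Model.linL, Model.linU, smul_eq_mul]
  rw [← Finset.mul_sum, ← Finset.mul_sum, ← mul_add, Finset.sum_sub_distrib]
  simp only [mul_assoc, ← Finset.mul_sum]
  ring

lemma Model.measurable_linL (D : CrossFit n N p) (w : Fin p → ℝ) (i : Fin n) :
    Measurable (M.linL D ψ w i) :=
  (((M.measurable_infA w).const_mul _).sub
    (((M.measurable_infB w).comp measurable_fst).const_mul _)).const_mul _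

lemma Model.measurable_linU (D : CrossFit n N p) (w : Fin p → ℝ) (i : Fin N) :
    Measurable (M.linU D ψ w i) :=
  ((M.measurable_infB w).const_mul _).const_mul _

lemma Model.integral_labelled {g : Obs p → ℝ} (hg : Measurable g) (i : Fin n) :
    ∫ ω : Sample n N p, g (ω.1 i) ∂M.law n N = ∫ z, g z ∂M.PXY := by
  rw [← M.map_labelled (n := n) (N := N) i, integral_map
    (Model.measurable_labelled n N i).aemeasurable hg.aestronglyMeasurable]

lemma Model.integral_unlabelled {g : (Fin p → ℝ) → ℝ} (hg : Measurable g) (i : Fin N) :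
    ∫ ω : Sample n N p, g (ω.2 i) ∂M.law n N = ∫ x, g x ∂M.PX := by
  rw [← M.map_unlabelled (n := n) (N := N) i, integral_map
    (Model.measurable_unlabelled n N i).aemeasurable hg.aestronglyMeasurable]

namespace Assumptions

lemma memLp_linL (hB : 1 ≤ B) (hA : Assumptions (1 / B) B δ M n P) (D : CrossFit n N p)
    (w : Fin p → ℝ) (i : Fin n) : MemLp (M.linL D ψ w i) 2 M.PXY :=
  (((hA.memLp_infA hB w).const_mul _).sub ((hA.memLp_infB_fst w).const_mul _)).const_mul _

lemma memLp_linU (hA : Assumptions (1 / B) B δ M n P) (D : CrossFit n N p)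
    (w : Fin p → ℝ) (i : Fin N) : MemLp (M.linU D ψ w i) 2 M.PX :=
  ((hA.memLp_infB w).const_mul _).const_mul _

lemma integral_linL (hB : 1 ≤ B) (hA : Assumptions (1 / B) B δ M n P) (D : CrossFit n N p)
    (w : Fin p → ℝ) (i : Fin n) : ∫ z, M.linL D ψ w i z ∂M.PXY = 0 := by
  have h1 := ((hA.memLp_infA hB w).integrable one_le_two).const_mul (n : ℝ)⁻¹
  have h2 := ((hA.memLp_infB_fst w).integrable one_le_two).const_mul
    (ψ / 2 * D.coefL (D.foldL i))
  simp only [Model.linL]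
  rw [integral_const_mul, integral_sub h1 h2, integral_const_mul, integral_const_mul,
    hA.integral_infA, M.integral_fst_PXY (M.measurable_infB w)]
  simp only [Model.infB, hA.integral_dotProduct_T2, mul_zero, sub_zero]

lemma integral_linU (hA : Assumptions (1 / B) B δ M n P) (D : CrossFit n N p)
    (w : Fin p → ℝ) (i : Fin N) : ∫ x, M.linU D ψ w i x ∂M.PX = 0 := by
  simp only [Model.linU, integral_const_mul, Model.infB, hA.integral_dotProduct_T2, mul_zero]

lemma integral_linL_sq (hB : 1 ≤ B) (hA : Assumptions (1 / B) B δ M n P) (D : CrossFit n N p)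
    (w : Fin p → ℝ) (i : Fin n) : ∫ z, M.linL D ψ w i z ^ 2 ∂M.PXY
      = n * ((n : ℝ)⁻¹ ^ 2 * (∫ z, M.infA w z ^ 2 ∂M.PXY)
        - (ψ * ((n : ℝ)⁻¹ * D.coefL (D.foldL i)) - ψ ^ 2 / 4 * D.coefL (D.foldL i) ^ 2)
          * ∫ x, M.infB w x ^ 2 ∂M.PX) := by
  have h1 := hA.memLp_infA hB w
  have h2 := hA.memLp_infB_fst w
  set c := D.coefL (D.foldL i) with hc
  have e : ∀ z, M.linL D ψ w i z ^ 2 = n * ((n : ℝ)⁻¹ ^ 2 * M.infA w z ^ 2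
      - ψ * ((n : ℝ)⁻¹ * c) * (M.infB w z.1 * M.infA w z)
      + ψ ^ 2 / 4 * c ^ 2 * M.infB w z.1 ^ 2) := fun z => by
    rw [Model.linL, mul_pow, Real.sq_sqrt (Nat.cast_nonneg n)]
    ring
  have e2 : ∫ z : Obs p, M.infB w z.1 ^ 2 ∂M.PXY = ∫ x, M.infB w x ^ 2 ∂M.PX :=
    M.integral_fst_PXY (g := fun x => M.infB w x ^ 2) ((M.measurable_infB w).pow_const 2)
  have i1 := h1.integrable_sq.const_mul ((n : ℝ)⁻¹ ^ 2)
  have i2 : Integrable (fun z => ψ * ((n : ℝ)⁻¹ * c) * (M.infB w z.1 * M.infA w z)) M.PXY :=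
    (h2.integrable_mul h1).const_mul _
  have i3 := h2.integrable_sq.const_mul (ψ ^ 2 / 4 * c ^ 2)
  have e3 := hA.integral_infB_infA hB w
  simp only [e]
  rw [integral_const_mul, integral_add _ i3, integral_sub i1 i2, integral_const_mul,
    integral_const_mul, integral_const_mul, e2, e3]
  · ring
  · exact i1.sub i2

lemma integral_linU_sq (D : CrossFit n N p) (w : Fin p → ℝ) (i : Fin N) :
    ∫ x, M.linU D ψ w i x ^ 2 ∂M.PX
      = n * (ψ ^ 2 / 4 * D.coefU (D.foldU i) ^ 2) * ∫ x, M.infB w x ^ 2 ∂M.PX := by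
  rw [← integral_const_mul]
  congr 1
  ext x
  rw [Model.linU, mul_pow, Real.sq_sqrt (Nat.cast_nonneg n)]
  ring

/-- The variance of the linear part agrees with the asymptotic variance up to rounding. -/
lemma variance_lin (hB : 1 ≤ B) (hA : Assumptions (1 / B) B δ M n P) (hn : 4 ≤ n)
    (D : CrossFit n N p) (v : Fin p → ℝ) :
    |∑ i, ∫ ω, M.lin D ψ (M.Omega *ᵥ v) i ω ^ 2 ∂M.law n N - M.asympVar ψ n N v|
      ≤ 48 * B ^ 5 * (|ψ| + ψ ^ 2) * l2 v ^ 2 / n := by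
  set w := M.Omega *ᵥ v with hw
  have hn0 : (0 : ℝ) < n := by exact_mod_cast (by omega : 0 < n)
  rw [hA.asympVar_eq hB, Fintype.sum_sum_type]
  simp only [Model.lin, Sum.elim_inl, Sum.elim_inr]
  have a1 : ∀ i : Fin n, ∫ ω : Sample n N p, M.linL D ψ w i (ω.1 i) ^ 2 ∂M.law n N
      = ∫ z, M.linL D ψ w i z ^ 2 ∂M.PXY := fun i =>
    M.integral_labelled ((M.measurable_linL D w i).pow_const 2) i
  have a2 : ∀ i : Fin N, ∫ ω : Sample n N p, M.linU D ψ w i (ω.2 i) ^ 2 ∂M.law n N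
      = ∫ z, M.linU D ψ w i z ^ 2 ∂M.PX := fun i =>
    M.integral_unlabelled ((M.measurable_linU D w i).pow_const 2) i
  simp only [a1, a2, hA.integral_linL_sq hB, integral_linU_sq]
  have h1 := hA.infB_sq_le hB w
  have h2 := hA.infA_sq_le hB v
  have h3 : 0 ≤ ∫ x, M.infB w x ^ 2 ∂M.PX := integral_nonneg fun x => sq_nonneg _
  rw [← hw] at *
  set Sa := ∫ z, M.infA w z ^ 2 ∂M.PXY
  set Sb := ∫ x, M.infB w x ^ 2 ∂M.PX
  rw [← D.sum_L fun j _ => (n : ℝ) * ((n : ℝ)⁻¹ ^ 2 * Sa - (ψ * ((n : ℝ)⁻¹ * D.coefL j)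
      - ψ ^ 2 / 4 * D.coefL j ^ 2) * Sb),
    ← D.sum_U fun j _ => (n : ℝ) * (ψ ^ 2 / 4 * D.coefU j ^ 2) * Sb]
  simp only [Finset.sum_const, nsmul_eq_mul, Fin.sum_univ_two]
  have hc : ((D.L 0).card : ℝ) + (D.L 1).card = n := by exact_mod_cast D.card_L_add
  have f0 := D.fold_variance hn ψ 0
  have f1 := D.fold_variance hn ψ 1
  set g0 := (n : ℝ) * ((D.L 0).card * (ψ * ((n : ℝ)⁻¹ * D.coefL 0) - ψ ^ 2 / 4 * D.coefL 0 ^ 2)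
        - (D.U 0).card * (ψ ^ 2 / 4 * D.coefU 0 ^ 2)) with hg0
  set g1 := (n : ℝ) * ((D.L 1).card * (ψ * ((n : ℝ)⁻¹ * D.coefL 1) - ψ ^ 2 / 4 * D.coefL 1 ^ 2)
        - (D.U 1).card * (ψ ^ 2 / 4 * D.coefU 1 ^ 2)) with hg1
  set T := (N : ℝ) * (2 * ψ - ψ ^ 2) / (n + N) with hT
  have hone : (n : ℝ) * ((n : ℝ)⁻¹ ^ 2 * (((D.L 0).card : ℝ) + (D.L 1).card)) = 1 := by
    rw [hc]; field_simp
  have e : (D.L 0).card * ((n : ℝ) * ((n : ℝ)⁻¹ ^ 2 * Sa - (ψ * ((n : ℝ)⁻¹ * D.coefL 0)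
      - ψ ^ 2 / 4 * D.coefL 0 ^ 2) * Sb)) + (D.L 1).card * ((n : ℝ) * ((n : ℝ)⁻¹ ^ 2 * Sa
        - (ψ * ((n : ℝ)⁻¹ * D.coefL 1) - ψ ^ 2 / 4 * D.coefL 1 ^ 2) * Sb))
      + ((D.U 0).card * ((n : ℝ) * (ψ ^ 2 / 4 * D.coefU 0 ^ 2) * Sb)
        + (D.U 1).card * ((n : ℝ) * (ψ ^ 2 / 4 * D.coefU 1 ^ 2) * Sb)) - (Sa - T * Sb)
      = -(((g0 - T / 2) + (g1 - T / 2)) * Sb) := by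
    rw [hg0, hg1]
    linear_combination Sa * hone
  rw [e, abs_neg, abs_mul, abs_of_nonneg h3]
  have hψ : 0 ≤ 3 / 2 * (|ψ| + ψ ^ 2) / n := by positivity
  calc _ ≤ (3 / 2 * (|ψ| + ψ ^ 2) / n + 3 / 2 * (|ψ| + ψ ^ 2) / n) * (16 * B ^ 5 * l2 v ^ 2) := by
        have := (abs_add_le (g0 - T / 2) (g1 - T / 2)).trans (add_le_add f0 f1)
        gcongr
        exact h1.trans h2
    _ = _ := by ring

end Assumptions

end Linear

section Lyapunov

variable {n N p : ℕ} {B δ ψ : ℝ} {M : Model p} {P : Params}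

lemma l1_Omega_mulVec (hA : Assumptions (1 / B) B δ M n P) (v : Fin p → ℝ) :
    l1 (M.Omega *ᵥ v) ≤ l1 v * P.LΩ := by
  have h := l1_vecMul_le hA.l1_Omega v
  rwa [← mulVec_transpose, Assumptions.Omega_symm] at h

lemma l1_B_mulVec (hA : Assumptions (1 / B) B δ M n P) (w : Fin p → ℝ) :
    l1 (M.B *ᵥ w) ≤ l1 w * P.LB := by
  have h := l1_vecMul_le (W := M.Bᵀ) (b := P.LB) (fun k => hA.l1_B k) w
  rwa [vecMul_transpose] at h

lemma infA_rpow (hB : 1 ≤ B) (hδ : 0 < δ) (hA : Assumptions (1 / B) B δ M n P) (w : Fin p → ℝ)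
    {Q : ℝ} (hQ : l1 w * P.K ≤ Q) :
    Integrable (fun z => |M.infA w z| ^ (2 + δ)) M.PXY ∧
      ∫ z, |M.infA w z| ^ (2 + δ) ∂M.PXY ≤ Q ^ (2 + δ) * (2 ^ (2 + δ) * (2 * B)) := by
  obtain ⟨h1, h2⟩ := hA.resid_rpow hB hδ
  have hle : ∀ᵐ z ∂M.PXY, |M.infA w z| ^ (2 + δ) ≤ Q ^ (2 + δ) * |M.resid z| ^ (2 + δ) := by
    filter_upwards [hA.K_bound_fst] with z hz
    have h3 : |z.1 ⬝ᵥ w| ≤ Q := by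
      rw [dotProduct_comm]; exact (abs_dotProduct_le hz).trans hQ
    rw [Model.infA, abs_mul, Real.mul_rpow (abs_nonneg _) (abs_nonneg _)]
    gcongr
  have hi : Integrable (fun z => |M.infA w z| ^ (2 + δ)) M.PXY :=
    integrable_of_abs_le_integrable (h1.const_mul _) ((M.measurable_infA w).abs.pow_const _)
      (by filter_upwards [hle] with z hz; rwa [abs_of_nonneg (by positivity)])
  refine ⟨hi, (integral_mono_ae hi (h1.const_mul _) hle).trans ?_⟩
  rw [integral_const_mul]
  by_cases hp : Nonempty (Fin p)
  · have hQ0 : 0 ≤ Q := (mul_nonneg (l1_nonneg _) (hA.K_nonneg hp.some)).trans hQ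
    gcongr
  · have : IsEmpty (Fin p) := not_nonempty_iff.1 hp
    have hQ0 : 0 ≤ Q := by simpa [l1] using hQ
    gcongr

lemma infB_rpow (hδ : 0 < δ) (hA : Assumptions (1 / B) B δ M n P) (w : Fin p → ℝ) {Q : ℝ}
    (hQ : l1 (M.B *ᵥ w) * (2 * (P.K * B)) ≤ Q) :
    Integrable (fun x => |M.infB w x| ^ (2 + δ)) M.PX ∧
      ∫ x, |M.infB w x| ^ (2 + δ) ∂M.PX ≤ Q ^ (2 + δ) := by
  have hle : ∀ᵐ x ∂M.PX, |M.infB w x| ^ (2 + δ) ≤ Q ^ (2 + δ) := by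
    filter_upwards [hA.dotProduct_T2_bound (M.B *ᵥ w)] with x hx
    exact Real.rpow_le_rpow (abs_nonneg _) (hx.trans hQ) (by linarith)
  have hi : Integrable (fun x => |M.infB w x| ^ (2 + δ)) M.PX :=
    integrable_of_abs_le ((M.measurable_infB w).abs.pow_const _)
      (by filter_upwards [hle] with z hz; rwa [abs_of_nonneg (by positivity)])
  refine ⟨hi, (integral_mono_ae hi (integrable_const _) hle).trans ?_⟩
  simp

lemma coefL_rpow (hn : 4 ≤ n) (D : CrossFit n N p) (hδ : 0 < δ) (j : Fin 2) :
    |D.coefL j| ^ (2 + δ) ≤ 4 * (N / (n + N)) * (4 / n) ^ (2 + δ) := by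
  have hn0 : (0 : ℝ) < n := by exact_mod_cast (by omega : 0 < n)
  have h3 := D.n_le_card_L hn j
  have h4 : n + N ≤ 4 * ((D.L j).card + (D.U j).card) := by
    have := D.card_L_balanced j
    have := D.card_U_balanced j
    omega
  have h5 : (D.U j).card ≤ N := by
    have := D.card_U_balanced j
    omega
  have h4' : (n : ℝ) + N ≤ 4 * ((D.L j).card + (D.U j).card) := by exact_mod_cast h4
  have h5' : ((D.U j).card : ℝ) ≤ N := by exact_mod_cast h5
  rw [CrossFit.coefL, CrossFit.card_LU]
  push_cast
  set a : ℝ := ((D.L j).card : ℝ)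
  have hb : (0 : ℝ) ≤ (D.U j).card := Nat.cast_nonneg _
  set b : ℝ := ((D.U j).card : ℝ)
  have ha : 0 < a := by linarith
  have hab : 0 < a + b := by linarith
  have hN : (0 : ℝ) ≤ N := Nat.cast_nonneg _
  have e : a⁻¹ - (a + b)⁻¹ = b / (a + b) * (1 / a) := by field_simp; ring
  have hπ0 : 0 ≤ b / (a + b) := by positivity
  have hπ1 : b / (a + b) ≤ 1 := (div_le_one hab).2 (by linarith)
  have hπ : b / (a + b) ≤ 4 * (N / (n + N)) := by
    rw [← mul_div_assoc, div_le_div_iff₀ hab (by positivity)]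
    calc b * (n + N) ≤ N * (4 * (a + b)) := by gcongr
      _ = _ := by ring
  rw [e, abs_of_nonneg (by positivity), Real.mul_rpow hπ0 (by positivity)]
  have h1a : 1 / a ≤ 4 / n := by
    rw [div_le_div_iff₀ ha hn0]
    linarith
  refine mul_le_mul ?_ (by gcongr) (by positivity) (by positivity)
  · calc (b / (a + b)) ^ (2 + δ) ≤ (b / (a + b)) ^ (1 : ℝ) :=
          Real.rpow_le_rpow_of_exponent_ge_of_imp hπ0 hπ1 (by linarith) (fun _ h => by exfalso; linarith)
      _ ≤ _ := by rwa [Real.rpow_one]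

lemma coefU_rpow (hn : 4 ≤ n) (D : CrossFit n N p) (hδ : 0 < δ) (j : Fin 2) :
    N * |D.coefU j| ^ (2 + δ) ≤ n * (N / (n + N) * (4 / n) ^ (2 + δ)) := by
  have hn0 : (0 : ℝ) < n := by exact_mod_cast (by omega : 0 < n)
  have hN : (0 : ℝ) ≤ N := Nat.cast_nonneg _
  have h4 : n + N ≤ 4 * (D.LU j).card := by
    have := D.card_LU j
    have := D.card_L_balanced j
    have := D.card_U_balanced j
    omega
  have h4' : (n : ℝ) + N ≤ 4 * (D.LU j).card := by exact_mod_cast h4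
  have hpos : (0 : ℝ) < (D.LU j).card := by linarith
  have hs : (0 : ℝ) < n + N := by positivity
  have h1 : |D.coefU j| ≤ 4 / (n + N) := by
    rw [CrossFit.coefU, abs_of_nonneg (by positivity), inv_eq_one_div, div_le_div_iff₀ hpos hs]
    linarith
  have h2 : |D.coefU j| ^ (2 + δ) ≤ (4 / (n + N)) ^ (2 + δ) := by gcongr
  have e : ∀ x : ℝ, 0 < x → (4 / x) ^ (2 + δ) = 4 / x * (4 / x) ^ (1 + δ) := fun x hx => by
    rw [show 2 + δ = 1 + (1 + δ) by ring, Real.rpow_add (by positivity), Real.rpow_one]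
  have h5 : (4 / ((n : ℝ) + N)) ^ (1 + δ) ≤ (4 / (n : ℝ)) ^ (1 + δ) := by
    gcongr
    linarith
  calc (N : ℝ) * |D.coefU j| ^ (2 + δ) ≤ N * (4 / (n + N) * (4 / (n : ℝ)) ^ (1 + δ)) := by
        gcongr
        refine h2.trans ?_
        rw [e _ hs]
        gcongr
    _ = n * (N / (n + N) * (4 / n) ^ (2 + δ)) := by
        rw [e _ hn0]
        field_simp

/-- The constant in the Lyapunov condition. -/
def lyapConst (B δ ψ : ℝ) : ℝ := 2 ^ (2 + δ) * (2 ^ (2 + δ) * (2 * B))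
  + (2 ^ (2 + δ) * 4 + 1) * (4 ^ (2 + δ) * |ψ / 2| ^ (2 + δ) * (2 * B) ^ (2 + δ))

lemma integrable_linL_rpow (hB : 1 ≤ B) (hδ : 0 < δ) (hA : Assumptions (1 / B) B δ M n P)
    (D : CrossFit n N p) (w : Fin p → ℝ) (i : Fin n) {Q Q' : ℝ} (hQ : l1 w * P.K ≤ Q)
    (hQ' : l1 (M.B *ᵥ w) * (2 * (P.K * B)) ≤ Q') :
    Integrable (fun z => |M.linL D ψ w i z| ^ (2 + δ)) M.PXY ∧
      ∫ z, |M.linL D ψ w i z| ^ (2 + δ) ∂M.PXY ≤ √n ^ (2 + δ) * (2 ^ (2 + δ)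
        * ((n : ℝ)⁻¹ ^ (2 + δ) * (Q ^ (2 + δ) * (2 ^ (2 + δ) * (2 * B)))
          + (|ψ / 2| ^ (2 + δ) * |D.coefL (D.foldL i)| ^ (2 + δ)) * Q' ^ (2 + δ))) := by
  obtain ⟨a1, a2⟩ := infA_rpow hB hδ hA w hQ
  obtain ⟨b1, b2⟩ := infB_rpow hδ hA w hQ'
  set c := D.coefL (D.foldL i) with hc
  have b1' := M.integrable_fst_PXY b1
  have b2' : ∫ z : Obs p, |M.infB w z.1| ^ (2 + δ) ∂M.PXY ≤ Q' ^ (2 + δ) := by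
    rwa [M.integral_fst_PXY (g := fun x => |M.infB w x| ^ (2 + δ))
      ((M.measurable_infB w).abs.pow_const _)]
  have hle : ∀ z, |M.linL D ψ w i z| ^ (2 + δ) ≤ √n ^ (2 + δ) * (2 ^ (2 + δ)
      * ((n : ℝ)⁻¹ ^ (2 + δ) * |M.infA w z| ^ (2 + δ)
        + (|ψ / 2| ^ (2 + δ) * |c| ^ (2 + δ)) * |M.infB w z.1| ^ (2 + δ))) := fun z => by
    rw [Model.linL, abs_mul, abs_of_nonneg (Real.sqrt_nonneg _),
      Real.mul_rpow (Real.sqrt_nonneg _) (abs_nonneg _), sub_eq_add_neg]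
    gcongr
    refine (abs_add_rpow_le _ _ (by linarith)).trans_eq ?_
    rw [abs_neg, abs_mul, abs_mul _ (M.infB w z.1), abs_mul (ψ / 2), abs_of_nonneg
      (by positivity : (0 : ℝ) ≤ (n : ℝ)⁻¹), Real.mul_rpow (by positivity) (by positivity),
      Real.mul_rpow (by positivity) (by positivity), Real.mul_rpow (by positivity) (by positivity)]
  have i1 := a1.const_mul ((n : ℝ)⁻¹ ^ (2 + δ))
  have i2 := b1'.const_mul (|ψ / 2| ^ (2 + δ) * |c| ^ (2 + δ))
  have i3 : Integrable (fun z => √n ^ (2 + δ) * (2 ^ (2 + δ)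
      * ((n : ℝ)⁻¹ ^ (2 + δ) * |M.infA w z| ^ (2 + δ)
        + (|ψ / 2| ^ (2 + δ) * |c| ^ (2 + δ)) * |M.infB w z.1| ^ (2 + δ)))) M.PXY :=
    ((i1.add i2).const_mul _).const_mul _
  have hi : Integrable (fun z => |M.linL D ψ w i z| ^ (2 + δ)) M.PXY :=
    integrable_of_abs_le_integrable i3 ((M.measurable_linL D w i).abs.pow_const _)
      (ae_of_all _ fun z => by rw [abs_of_nonneg (by positivity)]; exact hle z)
  refine ⟨hi, (integral_mono hi i3 hle).trans ?_⟩
  rw [integral_const_mul, integral_const_mul, integral_add i1 i2, integral_const_mul,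
    integral_const_mul]
  gcongr

lemma integrable_linU_rpow (hδ : 0 < δ) (hA : Assumptions (1 / B) B δ M n P)
    (D : CrossFit n N p) (w : Fin p → ℝ) (i : Fin N) {Q' : ℝ}
    (hQ' : l1 (M.B *ᵥ w) * (2 * (P.K * B)) ≤ Q') :
    Integrable (fun x => |M.linU D ψ w i x| ^ (2 + δ)) M.PX ∧
      ∫ x, |M.linU D ψ w i x| ^ (2 + δ) ∂M.PX ≤ √n ^ (2 + δ)
        * ((|ψ / 2| ^ (2 + δ) * |D.coefU (D.foldU i)| ^ (2 + δ)) * Q' ^ (2 + δ)) := by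
  obtain ⟨b1, b2⟩ := infB_rpow hδ hA w hQ'
  have e : ∀ x, |M.linU D ψ w i x| ^ (2 + δ) = √n ^ (2 + δ)
      * ((|ψ / 2| ^ (2 + δ) * |D.coefU (D.foldU i)| ^ (2 + δ)) * |M.infB w x| ^ (2 + δ)) :=
    fun x => by
      rw [Model.linU, abs_mul, abs_of_nonneg (Real.sqrt_nonneg _), abs_mul, abs_mul,
        Real.mul_rpow (by positivity) (by positivity), Real.mul_rpow (by positivity) (by positivity),
        Real.mul_rpow (by positivity) (by positivity)]
  simp only [e]
  refine ⟨(b1.const_mul _).const_mul _, ?_⟩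
  rw [integral_const_mul, integral_const_mul]
  gcongr

lemma lyapunov_lin (hB : 1 ≤ B) (hδ : 0 < δ) (hA : Assumptions (1 / B) B δ M n P) (hn : 4 ≤ n)
    (hp : 0 < p) (D : CrossFit n N p) (v : Fin p → ℝ) :
    ∑ i, ∫ ω, |M.lin D ψ (M.Omega *ᵥ v) i ω| ^ (2 + δ) ∂M.law n N
      ≤ lyapConst B δ ψ * ((l1 v * P.LΩ * P.K) ^ (2 + δ) * (1 / (n : ℝ) ^ (δ / 2))
        * (1 + P.LB ^ (2 + δ) * N / (n + N))) := by
  set w := M.Omega *ᵥ v with hw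
  set Q := l1 v * P.LΩ * P.K with hQdef
  have hn0 : (0 : ℝ) < n := by exact_mod_cast (by omega : 0 < n)
  have hK := hA.K_nonneg ⟨0, hp⟩
  have hLB := hA.LB_nonneg ⟨0, hp⟩
  have hLΩ : 0 ≤ P.LΩ := (l1_nonneg _).trans (hA.l1_Omega ⟨0, hp⟩)
  have hv := l1_nonneg v
  have hQ0 : 0 ≤ Q := by positivity
  have hw1 : l1 w ≤ l1 v * P.LΩ := l1_Omega_mulVec hA v
  have hQ : l1 w * P.K ≤ Q := mul_le_mul_of_nonneg_right hw1 hK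
  have hQ' : l1 (M.B *ᵥ w) * (2 * (P.K * B)) ≤ 2 * B * (P.LB * Q) := by
    calc _ ≤ l1 v * P.LΩ * P.LB * (2 * (P.K * B)) := by
          gcongr
          exact (l1_B_mulVec hA w).trans (by gcongr)
      _ = _ := by rw [hQdef]; ring
  rw [Fintype.sum_sum_type]
  simp only [Model.lin, Sum.elim_inl, Sum.elim_inr]
  have a1 : ∀ i : Fin n, ∫ ω : Sample n N p, |M.linL D ψ w i (ω.1 i)| ^ (2 + δ) ∂M.law n N
      = ∫ z, |M.linL D ψ w i z| ^ (2 + δ) ∂M.PXY := fun i =>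
    M.integral_labelled ((M.measurable_linL D w i).abs.pow_const _) i
  have a2 : ∀ i : Fin N, ∫ ω : Sample n N p, |M.linU D ψ w i (ω.2 i)| ^ (2 + δ) ∂M.law n N
      = ∫ z, |M.linU D ψ w i z| ^ (2 + δ) ∂M.PX := fun i =>
    M.integral_unlabelled ((M.measurable_linU D w i).abs.pow_const _) i
  simp only [a1, a2]
  have hq' : (2 * B * (P.LB * Q)) ^ (2 + δ)
      = (2 * B) ^ (2 + δ) * (P.LB ^ (2 + δ) * Q ^ (2 + δ)) := by
    rw [Real.mul_rpow (by positivity) (by positivity), Real.mul_rpow hLB hQ0]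
  have h4n : (4 / (n : ℝ)) ^ (2 + δ) = 4 ^ (2 + δ) * (n : ℝ)⁻¹ ^ (2 + δ) := by
    rw [div_eq_mul_inv, Real.mul_rpow (by positivity) (by positivity)]
  set ρ : ℝ := (N : ℝ) / (n + N) with hρ
  have hρ0 : 0 ≤ ρ := by positivity
  set X := Q ^ (2 + δ) with hX
  set Y := P.LB ^ (2 + δ) with hY
  set S := √(n : ℝ) ^ (2 + δ) with hS
  set I := (n : ℝ)⁻¹ ^ (2 + δ) with hI
  set R := |ψ / 2| ^ (2 + δ) with hR
  have hX0 : 0 ≤ X := by positivity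
  have hY0 : 0 ≤ Y := by positivity
  have hS0 : 0 ≤ S := by positivity
  have hI0 : 0 ≤ I := by positivity
  have hR0 : 0 ≤ R := by positivity
  have s1 : ∑ i : Fin n, ∫ z, |M.linL D ψ w i z| ^ (2 + δ) ∂M.PXY
      ≤ n * (S * (2 ^ (2 + δ) * (I * (X * (2 ^ (2 + δ) * (2 * B)))
        + (R * (4 * ρ * (4 ^ (2 + δ) * I))) * ((2 * B) ^ (2 + δ) * (Y * X))))) := by
    refine (Finset.sum_le_sum (g := fun _ => S * (2 ^ (2 + δ) * (I * (X * (2 ^ (2 + δ) * (2 * B)))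
        + (R * (4 * ρ * (4 ^ (2 + δ) * I))) * ((2 * B) ^ (2 + δ) * (Y * X)))))
        fun i _ => ?_).trans_eq (by simp)
    refine (integrable_linL_rpow hB hδ hA D w i hQ hQ').2.trans ?_
    have := coefL_rpow hn D hδ (D.foldL i)
    rw [h4n] at this
    rw [hq']
    gcongr
  have s2 : ∑ i : Fin N, ∫ x, |M.linU D ψ w i x| ^ (2 + δ) ∂M.PX
      ≤ n * (S * ((R * (ρ * (4 ^ (2 + δ) * I))) * ((2 * B) ^ (2 + δ) * (Y * X)))) := by
    rcases Nat.eq_zero_or_pos N with h0 | h0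
    · subst h0
      simp only [Finset.univ_eq_empty, Finset.sum_empty]
      positivity
    have hN0 : (0 : ℝ) < N := by exact_mod_cast h0
    refine (Finset.sum_le_sum (g := fun _ => (N : ℝ)⁻¹ * (n * (S * ((R * (ρ * (4 ^ (2 + δ) * I)))
      * ((2 * B) ^ (2 + δ) * (Y * X)))))) fun i _ => ?_).trans_eq (by
        rw [Finset.sum_const, Finset.card_univ, Fintype.card_fin, nsmul_eq_mul,
          mul_inv_cancel_left₀ hN0.ne'])
    refine (integrable_linU_rpow hδ hA D w i hQ').2.trans ?_
    have := coefU_rpow hn D hδ (D.foldU i)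
    rw [h4n] at this
    rw [hq', ← div_eq_inv_mul, le_div_iff₀ hN0]
    calc _ = S * (R * (N * |D.coefU (D.foldU i)| ^ (2 + δ)) * ((2 * B) ^ (2 + δ) * (Y * X))) := by
          ring
      _ ≤ S * (R * (n * (ρ * (4 ^ (2 + δ) * I))) * ((2 * B) ^ (2 + δ) * (Y * X))) := by gcongr
      _ = _ := by ring
  have hnS : n * (S * I) = 1 / (n : ℝ) ^ (δ / 2) := by
    rw [one_div, ← Real.rpow_neg hn0.le, hS, hI, Real.sqrt_eq_rpow, ← Real.rpow_mul hn0.le,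
      Real.inv_rpow hn0.le, ← Real.rpow_neg hn0.le, ← Real.rpow_add hn0]
    nth_rewrite 1 [← Real.rpow_one (n : ℝ)]
    rw [← Real.rpow_add hn0]
    congr 1
    ring
  refine (add_le_add s1 s2).trans ?_
  have e : P.LB ^ (2 + δ) * N / (n + N) = Y * ρ := by rw [hY, hρ, mul_div_assoc]
  rw [e, ← hnS]
  set G := 4 ^ (2 + δ) * R * (2 * B) ^ (2 + δ) with hG
  have hG0 : 0 ≤ G := by positivity
  have h22 : 0 ≤ (2 : ℝ) ^ (2 + δ) * (2 ^ (2 + δ) * (2 * B)) := by positivity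
  have h23 : 0 ≤ ((2 : ℝ) ^ (2 + δ) * 4 + 1) * G := by positivity
  calc _ = n * (S * I) * X * (2 ^ (2 + δ) * (2 ^ (2 + δ) * (2 * B)) * 1
        + (2 ^ (2 + δ) * 4 + 1) * G * (Y * ρ)) := by rw [hG]; ring
    _ ≤ n * (S * I) * X * (lyapConst B δ ψ * 1 + lyapConst B δ ψ * (Y * ρ)) := by
        have l1 : 2 ^ (2 + δ) * (2 ^ (2 + δ) * (2 * B)) ≤ lyapConst B δ ψ := by
          rw [lyapConst]; linarith
        have l2 : (2 ^ (2 + δ) * 4 + 1) * G ≤ lyapConst B δ ψ := by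
          rw [lyapConst]; linarith
        gcongr
    _ = _ := by ring

end Lyapunov

/-! ### Passage to the limit -/

lemma continuous_gaussian_Iic : Continuous fun t => (gaussianReal 0 1).real (Set.Iic t) := by
  refine continuous_iff_continuousAt.2 fun t => ?_
  have e : ∀ x, (gaussianReal 0 1).real (Set.Iic x)
      = ∫ y, (Set.Iic x).indicator (fun _ => (1 : ℝ)) y ∂gaussianReal 0 1 := fun x => by
    rw [integral_indicator measurableSet_Iic]
    simp
  simp only [ContinuousAt, e]
  refine tendsto_integral_filter_of_dominated_convergence (fun _ => 1) (Eventually.of_forall fun x =>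
    (measurable_const.indicator measurableSet_Iic).aestronglyMeasurable)
    (Eventually.of_forall fun x => ae_of_all _ fun y => ?_) (integrable_const _) ?_
  · refine (norm_indicator_le_norm_self _ _).trans (by simp)
  · have hne : ∀ᵐ y ∂gaussianReal 0 1, y ≠ t := by
      have := nullSingletonClass_gaussianReal (μ := 0) (v := 1) one_ne_zero
      rw [ae_iff]
      simp
    filter_upwards [hne] with y hy
    refine tendsto_const_nhds.congr' ?_
    rcases lt_or_gt_of_ne hy with h | h
    · filter_upwards [lt_mem_nhds h] with x hx
      simp [h.le, le_of_lt hx]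
    · filter_upwards [gt_mem_nhds h] with x hx
      simp [not_le.2 h, not_le.2 hx]

/-- A perturbation of a convergent sequence of variables, up to exceptional events. -/
lemma eventually_abs_sub_le_of_perturbation {Ω : ℕ → Type*} [∀ k, MeasurableSpace (Ω k)]
    (Q : ∀ k, Measure (Ω k)) [∀ k, IsProbabilityMeasure (Q k)] {T Z : ∀ k, Ω k → ℝ} {F : ℝ → ℝ}
    {good : ∀ k, Ω k → Prop} {t b ε : ℝ} (hbε : b < ε)
    (hZ : ∀ x, Tendsto (fun k => (Q k).real {ω | Z k ω ≤ x}) atTop (𝓝 (F x)))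
    (hF : ContinuousAt F t) {e : ℕ → ℝ} (he : Tendsto e atTop (𝓝 0))
    (hTZ : ∀ᶠ k in atTop, ∀ ω, good k ω →
      (T k ω ≤ t → Z k ω ≤ t + e k) ∧ (Z k ω ≤ t - e k → T k ω ≤ t))
    (hb : ∀ᶠ k in atTop, (Q k).real {ω | ¬ good k ω} ≤ b) :
    ∀ᶠ k in atTop, |(Q k).real {ω | T k ω ≤ t} - F t| ≤ ε := by
  have hγ : 0 < (ε - b) / 2 := by linarith
  obtain ⟨η, hη, hFη⟩ := Metric.continuousAt_iff.1 hF _ hγ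
  have h1 := hFη (x := t + η / 2) (by rw [Real.dist_eq, abs_lt]; constructor <;> linarith)
  have h2 := hFη (x := t - η / 2) (by rw [Real.dist_eq, abs_lt]; constructor <;> linarith)
  rw [Real.dist_eq, abs_lt] at h1 h2
  have e1 := (hZ (t + η / 2)).eventually (Metric.ball_mem_nhds _ hγ)
  have e2 := (hZ (t - η / 2)).eventually (Metric.ball_mem_nhds _ hγ)
  have e3 := he.eventually (gt_mem_nhds (half_pos hη))
  filter_upwards [e1, e2, e3, hTZ, hb] with k k1 k2 k3 k4 k5
  rw [Real.dist_eq, abs_lt] at k1 k2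
  have u1 : (Q k).real {ω | T k ω ≤ t}
      ≤ (Q k).real {ω | Z k ω ≤ t + η / 2} + (Q k).real {ω | ¬ good k ω} := by
    refine (measureReal_mono fun ω hω => ?_).trans (measureReal_union_le _ _)
    by_cases hg : good k ω
    · refine Or.inl ?_
      have := (k4 ω hg).1 hω
      simp only [Set.mem_ofPred_eq]
      linarith
    · exact Or.inr hg
  have u2 : (Q k).real {ω | Z k ω ≤ t - η / 2}
      ≤ (Q k).real {ω | T k ω ≤ t} + (Q k).real {ω | ¬ good k ω} := by
    refine (measureReal_mono fun ω hω => ?_).trans (measureReal_union_le _ _)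
    by_cases hg : good k ω
    · refine Or.inl ((k4 ω hg).2 ?_)
      have : Z k ω ≤ t - η / 2 := hω
      linarith
    · exact Or.inr hg
  rw [abs_le]
  constructor <;> linarith [k1.1, k1.2, k2.1, k2.2, h1.1, h1.2, h2.1, h2.2]

/-- Studentization: `x / √V'` against `y / √V`. -/
lemma studentize {x y V V' a b t : ℝ} (hV : 0 < V) (hxy : |x - y| ≤ a * √V)
    (hVV : |V' - V| ≤ b * V) (hb : b < 1) :
    (x / √V' ≤ t → y / √V ≤ t + (a + |t| * b)) ∧ (y / √V ≤ t - (a + |t| * b) → x / √V' ≤ t) := by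
  have hs : 0 < √V := Real.sqrt_pos.2 hV
  have hV' : 0 < V' := by
    have := (abs_le.1 hVV).1
    nlinarith
  have hs' : 0 < √V' := Real.sqrt_pos.2 hV'
  have hd : |√V' - √V| ≤ b * √V := by
    have e : (√V' - √V) * (√V' + √V) = V' - V := by
      linear_combination Real.sq_sqrt hV'.le - Real.sq_sqrt hV.le
    have h1 : |√V' - √V| * √V ≤ b * √V * √V := by
      calc _ ≤ |√V' - √V| * (√V' + √V) := by gcongr; linarith
        _ = |V' - V| := by rw [← e, abs_mul, abs_of_pos (add_pos hs' hs)]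
        _ ≤ b * V := hVV
        _ = _ := by rw [mul_assoc, Real.mul_self_sqrt hV.le]
    exact le_of_mul_le_mul_right h1 hs
  have ht : |t * √V' - t * √V| ≤ |t| * b * √V := by
    rw [← mul_sub, abs_mul, mul_assoc]
    gcongr
  rw [abs_le] at hxy ht
  rw [div_le_iff₀ hs, div_le_iff₀ hs', div_le_iff₀ hs]
  constructor <;> intro h <;> linarith [hxy.1, hxy.2, ht.1, ht.2]

section Limit

variable {B δ ψ : ℝ} {n N p : ℕ → ℕ} {M : ∀ k, Model (p k)} {P : ℕ → Params}
  {D : ∀ k, CrossFit (n k) (N k) (p k)} {v : ∀ k, Fin (p k) → ℝ}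

lemma pos_of_ne_zero {p : ℕ} {v : Fin p → ℝ} (h : v ≠ 0) : 0 < p :=
  Nat.pos_of_ne_zero fun h0 => h (by subst h0; exact Subsingleton.elim _ _)

/-- The central limit theorem for the linear part. -/
lemma clt_score (hB : 1 ≤ B) (hδ : 0 < δ) (hn : Tendsto n atTop atTop) (hv : ∀ k, v k ≠ 0)
    (hA : ∀ k, Assumptions (1 / B) B δ (M k) (n k) (P k)) {c₁ : ℝ} (hc₁ : 0 < c₁)
    (hV : ∀ k, c₁ * l2 (v k) ^ 2 ≤ (M k).asympVar ψ (n k) (N k) (v k))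
    (hlyap : Tendsto (fun k => lyap δ (n k) (N k) (P k) (v k)) atTop (𝓝 0)) (t : ℝ) :
    Tendsto (fun k => ((M k).law (n k) (N k)).real
      {ω | √(n k) * (v k ⬝ᵥ ((M k).Omega *ᵥ (M k).score (D k) ψ ω))
        / √((M k).asympVar ψ (n k) (N k) (v k)) ≤ t})
      atTop (𝓝 ((gaussianReal 0 1).real (Set.Iic t))) := by
  set V := fun k => (M k).asympVar ψ (n k) (N k) (v k) with hVdef
  set w := fun k => (M k).Omega *ᵥ v k with hw
  have hl : ∀ k, 0 < l2 (v k) := fun k => l2_pos (hv k)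
  have hVpos : ∀ k, 0 < V k := fun k => (hV k).trans_lt' (mul_pos hc₁ (pow_pos (hl k) 2))
  have hs : ∀ k, 0 < √(V k) := fun k => Real.sqrt_pos.2 (hVpos k)
  have hp : ∀ k, 0 < p k := fun k => pos_of_ne_zero (hv k)
  have hn4 : ∀ᶠ k in atTop, 4 ≤ n k := hn.eventually_ge_atTop 4
  have hQ := fun k => le_refl (l1 (w k) * (P k).K)
  have hQ' := fun k => le_refl (l1 ((M k).B *ᵥ w k) * (2 * ((P k).K * B)))
  have hmL : ∀ k i, Measurable ((M k).linL (D k) ψ (w k) i) := fun k i => (M k).measurable_linL _ _ i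
  have hmU : ∀ k i, Measurable ((M k).linU (D k) ψ (w k) i) := fun k i => (M k).measurable_linU _ _ i
  have hm : ∀ k i, Measurable ((M k).lin (D k) ψ (w k) i) := fun k i => by
    rcases i with i | i
    · exact (hmL k i).comp (Model.measurable_labelled _ _ i)
    · exact (hmU k i).comp (Model.measurable_unlabelled _ _ i)
  have hclt := lyapunov_clt (fun k => (M k).law (n k) (N k))
    (fun k i ω => (M k).lin (D k) ψ (w k) i ω / √(V k)) (fun k i => (hm k i).div_const _)
    (fun k => ?_) (fun k i => ?_) (fun k i => ?_) hδ (fun k i => ?_) ?_ ?_ t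
  · refine hclt.congr' ?_
    filter_upwards [hn4] with k hk
    simp only [← Finset.sum_div]
    simp only [hw, ← sqrt_mul_score_eq_sum hk (D k)]
    rfl
  · exact ((M k).iIndepFun_sample _ _ (hmL k) (hmU k)).comp (fun _ x => x / √(V k))
      fun _ => measurable_id.div_const _
  · simp only [div_eq_mul_inv]
    refine MemLp.mul_const ?_ _
    rcases i with i | i
    · have h := (hA k).memLp_linL hB (D k) (w k) i (ψ := ψ)
      rw [← (M k).map_labelled (n k) (N k) i] at h
      exact h.comp_of_map (Model.measurable_labelled _ _ i).aemeasurable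
    · have h := (hA k).memLp_linU (D k) (w k) i (ψ := ψ)
      rw [← (M k).map_unlabelled (n k) (N k) i] at h
      exact h.comp_of_map (Model.measurable_unlabelled _ _ i).aemeasurable
  · rw [integral_div]
    rcases i with i | i
    · have h := (M k).integral_labelled (N := N k) (hmL k i) i
      rw [(hA k).integral_linL hB] at h
      exact div_eq_zero_iff.2 (Or.inl h)
    · have h := (M k).integral_unlabelled (n := n k) (hmU k i) i
      rw [(hA k).integral_linU] at h
      exact div_eq_zero_iff.2 (Or.inl h)
  · simp only [abs_div, Real.div_rpow (abs_nonneg _) (abs_nonneg _)]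
    refine Integrable.div_const ?_ _
    rcases i with i | i
    · have h := (integrable_linL_rpow (ψ := ψ) hB hδ (hA k) (D k) (w k) i (hQ k) (hQ' k)).1
      rw [← (M k).map_labelled (n k) (N k) i] at h
      exact h.comp_measurable (Model.measurable_labelled _ _ i)
    · have h := (integrable_linU_rpow (ψ := ψ) hδ (hA k) (D k) (w k) i (hQ' k)).1
      rw [← (M k).map_unlabelled (n k) (N k) i] at h
      exact h.comp_measurable (Model.measurable_unlabelled _ _ i)
  · rw [tendsto_iff_norm_sub_tendsto_zero]
    have h0 : Tendsto (fun k => 48 * B ^ 5 * (|ψ| + ψ ^ 2) / c₁ / n k) atTop (𝓝 0) :=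
      (tendsto_natCast_atTop_atTop.comp hn).const_div_atTop _
    refine squeeze_zero' (Eventually.of_forall fun k => norm_nonneg _) ?_ h0
    filter_upwards [hn4] with k hk
    have hn0 : (0 : ℝ) < n k := by exact_mod_cast (by omega : 0 < n k)
    have h1 := (hA k).variance_lin (ψ := ψ) hB hk (D k) (v k)
    have e : ∑ i, ∫ ω, ((M k).lin (D k) ψ (w k) i ω / √(V k)) ^ 2 ∂(M k).law (n k) (N k) - 1
        = (∑ i, ∫ ω, (M k).lin (D k) ψ (w k) i ω ^ 2 ∂(M k).law (n k) (N k) - V k) / V k := by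
      simp only [div_pow, Real.sq_sqrt (hVpos k).le, integral_div, ← Finset.sum_div]
      rw [sub_div, div_self (hVpos k).ne']
    rw [e, Real.norm_eq_abs, abs_div, abs_of_pos (hVpos k), div_le_iff₀ (hVpos k)]
    refine h1.trans ?_
    calc _ = 48 * B ^ 5 * (|ψ| + ψ ^ 2) / c₁ / n k * (c₁ * l2 (v k) ^ 2) := by field_simp
      _ ≤ _ := by
        gcongr
        exact hV k
  · have h0 : Tendsto (fun k => lyapConst B δ ψ / √c₁ ^ (2 + δ) * lyap δ (n k) (N k) (P k) (v k))
        atTop (𝓝 0) := by simpa using hlyap.const_mul (lyapConst B δ ψ / √c₁ ^ (2 + δ))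
    refine squeeze_zero' (Eventually.of_forall fun k => Finset.sum_nonneg fun i _ =>
      integral_nonneg fun ω => by positivity) ?_ h0
    filter_upwards [hn4] with k hk
    have h1 := lyapunov_lin (ψ := ψ) hB hδ (hA k) hk (hp k) (D k) (v k)
    have hsc : 0 < √c₁ := Real.sqrt_pos.2 hc₁
    have h2 : √c₁ * l2 (v k) ≤ √(V k) := by
      rw [← Real.sqrt_sq (hl k).le, ← Real.sqrt_mul hc₁.le]
      exact Real.sqrt_le_sqrt (hV k)
    have h3 : √c₁ ^ (2 + δ) * l2 (v k) ^ (2 + δ) ≤ √(V k) ^ (2 + δ) := by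
      rw [← Real.mul_rpow hsc.le (hl k).le]
      exact Real.rpow_le_rpow (mul_pos hsc (hl k)).le h2 (by linarith)
    simp only [abs_div, abs_of_pos (hs k), Real.div_rpow (abs_nonneg _) (hs k).le, integral_div,
      ← Finset.sum_div]
    have hK := (hA k).K_nonneg ⟨0, hp k⟩
    have hLB := (hA k).LB_nonneg ⟨0, hp k⟩
    have hLΩ : 0 ≤ (P k).LΩ := (l1_nonneg _).trans ((hA k).l1_Omega ⟨0, hp k⟩)
    have hv1 := l1_nonneg (v k)
    have hc : 0 < √c₁ ^ (2 + δ) := Real.rpow_pos_of_pos hsc _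
    have hl' : 0 < l2 (v k) ^ (2 + δ) := Real.rpow_pos_of_pos (hl k) _
    have hL0 : 0 ≤ lyapConst B δ ψ := by
      have : 0 ≤ B := by linarith
      rw [lyapConst]; positivity
    rw [lyap, Real.div_rpow (by positivity) (hl k).le]
    refine (div_le_div₀ ?_ h1 (mul_pos hc hl') h3).trans_eq ?_
    · positivity
    · field_simp

end Limit

section Regimes

variable {n p : ℕ} {B δ : ℝ} {M : Model p} {P : Params}

lemma K_sq_rt_le (hA : Assumptions (1 / B) B δ M n P) :
    P.K ^ 2 * rt p n ≤ P.sB * P.K ^ 2 * (P.c + rt p n) := by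
  have hs : (1 : ℝ) ≤ P.sB := by exact_mod_cast hA.one_le_sB
  have hc := hA.c_nonneg
  have hr : 0 ≤ rt p n := Real.sqrt_nonneg _
  calc _ = 1 * P.K ^ 2 * (0 + rt p n) := by ring
    _ ≤ _ := by gcongr

lemma K_LB_rt_le_Rem (hp : 2 ≤ p) (hA : Assumptions (1 / B) B δ M n P) :
    P.K * P.LB * rt p n ≤ Rem p n P := by
  have hK := hA.K_nonneg ⟨0, by omega⟩
  have hLB := hA.LB_nonneg ⟨0, by omega⟩
  have hc := hA.c_nonneg
  have hr : 0 ≤ rt p n := Real.sqrt_nonneg _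
  have h1 : P.K * P.LB * rt p n ≤ P.K * P.LB * (√P.s * rt p n) := by
    gcongr
    exact le_mul_of_one_le_left hr (one_le_sqrt_s hA)
  have h2 : 0 ≤ P.K * (P.sB + √P.sB * P.LB) * (rt p n + P.c) := by positivity
  have h3 : 0 ≤ P.K ^ 2 * (√P.s * √P.sB * rt p n) := by positivity
  rw [Rem_eq]
  linarith

lemma s_rt_sq_le (hB : 1 ≤ B) (hp : 2 ≤ p) (hA : Assumptions (1 / B) B δ M n P) :
    P.s * rt p n ^ 2 ≤ B ^ 2 * Rem p n P ^ 2 := by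
  have hK := hA.K_nonneg ⟨0, by omega⟩
  have hLB := hA.LB_nonneg ⟨0, by omega⟩
  have hc := hA.c_nonneg
  have hr : 0 ≤ rt p n := Real.sqrt_nonneg _
  have hBK : 1 ≤ B * P.K ^ 2 := by
    have := hA.K_sq_ge ⟨0, by omega⟩
    rwa [div_le_iff₀' (by linarith)] at this
  have hsB := one_le_sqrt_sB hA
  have h1 : √P.s * rt p n ≤ B * (P.K ^ 2 * (√P.s * √P.sB * rt p n)) := by
    calc _ = 1 * (√P.s * 1 * rt p n) := by ring
      _ ≤ B * P.K ^ 2 * (√P.s * √P.sB * rt p n) := by gcongr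
      _ = _ := by ring
  have h2 : 0 ≤ P.K * (P.sB + √P.sB * P.LB) * (rt p n + P.c) := by positivity
  have h3 : 0 ≤ P.K * P.LB * (√P.s * rt p n) := by positivity
  have h4 : √P.s * rt p n ≤ B * Rem p n P := by
    refine h1.trans (mul_le_mul_of_nonneg_left ?_ (by linarith))
    rw [Rem_eq]
    linarith
  calc P.s * rt p n ^ 2 = (√P.s * rt p n) ^ 2 := by rw [mul_pow, Real.sq_sqrt (by positivity)]
    _ ≤ (B * Rem p n P) ^ 2 := by gcongr
    _ = _ := by ring

end Regimes

section Limit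

variable {B δ : ℝ} {n N p : ℕ → ℕ} {M : ∀ k, Model (p k)} {P : ℕ → Params}

lemma eventually_regime (hB : 1 ≤ B) (hn : Tendsto n atTop atTop) (hp : Tendsto p atTop atTop)
    (hA : ∀ k, Assumptions (1 / B) B δ (M k) (n k) (P k))
    (hx : Tendsto (fun k => ((P k).sB : ℝ) * (P k).K ^ 2 * ((P k).c + rt (p k) (n k)))
      atTop (𝓝 0))
    (hRem : Tendsto (fun k => Rem (p k) (n k) (P k)) atTop (𝓝 0)) :
    ∀ᶠ k in atTop, Regime B (p k) (n k) (P k) := by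
  have f1 := (hx.const_mul (240 * B ^ 5)).eventually_le_const (u := 1) (by simp)
  have f2 := (hRem.const_mul (240 * B)).eventually_le_const (u := 1) (by simp)
  have f3 := ((hRem.pow 2).const_mul (9216 * B ^ 8)).eventually_le_const (u := 1) (by simp)
  filter_upwards [f1, f2, f3, hn.eventually_ge_atTop 4, hp.eventually_ge_atTop 2]
    with k k1 k2 k3 k4 k5
  have hB0 : 0 ≤ B := by linarith
  refine ⟨hB, k5, k4, k1.trans' ?_, k2.trans' ?_, k3.trans' ?_⟩
  · exact mul_le_mul_of_nonneg_left (K_sq_rt_le (hA k)) (by positivity)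
  · exact mul_le_mul_of_nonneg_left (K_LB_rt_le_Rem k5 (hA k)) (by positivity)
  · calc _ = 9216 * B ^ 6 * ((P k).s * rt (p k) (n k) ^ 2) := by ring
      _ ≤ 9216 * B ^ 6 * (B ^ 2 * Rem (p k) (n k) (P k) ^ 2) :=
          mul_le_mul_of_nonneg_left (s_rt_sq_le hB k5 (hA k)) (by positivity)
      _ = _ := by ring

lemma eventually_badProb_le (hB : 1 ≤ B) (hn : Tendsto n atTop atTop)
    (hp : Tendsto p atTop atTop) (hA : ∀ k, Assumptions (1 / B) B δ (M k) (n k) (P k))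
    (hx : Tendsto (fun k => ((P k).sB : ℝ) * (P k).K ^ 2 * ((P k).c + rt (p k) (n k)))
      atTop (𝓝 0))
    (hRem : Tendsto (fun k => Rem (p k) (n k) (P k)) atTop (𝓝 0)) (H : ℝ) {γ : ℝ} (hγ : 0 < γ) :
    ∀ᶠ k in atTop, badProb B H (p k) (n k) (P k) ≤ 4 * B ^ 2 / H + γ := by
  have hB0 : 0 < B := by linarith
  set x := fun k => ((P k).sB : ℝ) * (P k).K ^ 2 * ((P k).c + rt (p k) (n k)) with hxdef
  have g1 : Tendsto (fun k => 40 / Real.log (p k)) atTop (𝓝 0) :=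
    (Real.tendsto_log_atTop.comp (tendsto_natCast_atTop_atTop.comp hp)).const_div_atTop _
  have g2 : Tendsto (fun k => Real.exp (-((n k : ℝ) / (256 * B ^ 4)))) atTop (𝓝 0) :=
    Real.tendsto_exp_neg_atTop_nhds_zero.comp
      ((tendsto_natCast_atTop_atTop.comp hn).atTop_div_const (by positivity))
  have g3 : Tendsto (fun k => 40 / Real.log (p k) + Real.exp (-((n k : ℝ) / (256 * B ^ 4)))
      + 4096 * x k ^ 2 + 2 * (5 * B ^ 2 * √(x k) + 2 * B ^ 3 * Rem (p k) (n k) (P k)))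
      atTop (𝓝 0) := by
    have := ((g1.add g2).add ((hx.pow 2).const_mul 4096)).add
      (((hx.sqrt.const_mul (5 * B ^ 2)).add (hRem.const_mul (2 * B ^ 3))).const_mul 2)
    simpa using this
  filter_upwards [g3.eventually_le_const hγ, hp.eventually_ge_atTop 2] with k k1 k2
  refine le_trans ?_ (add_le_add_right k1 _)
  have hK := (hA k).K_nonneg ⟨0, by omega⟩
  have hr : 0 ≤ rt (p k) (n k) := Real.sqrt_nonneg _
  have h1 := K_sq_rt_le (hA k)
  have h2 := K_LB_rt_le_Rem k2 (hA k)
  have h3 : (P k).K * √(rt (p k) (n k)) ≤ √(x k) := by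
    refine Real.le_sqrt_of_sq_le ?_
    rw [mul_pow, Real.sq_sqrt hr]
    exact h1
  have h4 : ((P k).K ^ 2 * rt (p k) (n k)) ^ 2 ≤ x k ^ 2 := by gcongr
  rw [badProb]
  have h5 := mul_le_mul_of_nonneg_left h3 (by positivity : 0 ≤ 5 * B ^ 2)
  have h6 := mul_le_mul_of_nonneg_left h2 (by positivity : 0 ≤ 2 * B ^ 3)
  linarith

end Limit

end SemiSup

end

open SemiSup

/-- All constants come first: `c₀` and `C` bound the population quantities from below and above,
and `Cm` is the constant in the rate of `m̂⁻ʲ`. The tuning constants have to exceed a threshold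
`C₀` that depends on these only. The number `ε₀` bounds the asymptotic probability that the rate
`Cm c` of `m̂⁻ʲ` is violated; the conclusions then hold up to probability `ε₀`. For `ε₀ = 0` they
are boundedness in probability and convergence in distribution. If `m̂⁻ʲ - m` is of order `c` in
probability, then every `ε₀ > 0` is admissible with a suitable `Cm`. -/
theorem proposition1 (c₀ C Cm δ : ℝ) (hc₀ : 0 < c₀) (hδ : 0 < δ) :
    ∃ C₀ : ℝ, 0 < C₀ ∧
    ∀ (A CB ψ ε₀ : ℝ), C₀ ≤ CB → 0 ≤ ε₀ →
    -- sample sizes, dimensions, models, parameters, cross-fitting schemes, directions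
    ∀ (n N p : ℕ → ℕ) (M : (k : ℕ) → SemiSup.Model (p k)) (P : ℕ → SemiSup.Params)
      (D : (k : ℕ) → SemiSup.CrossFit (n k) (N k) (p k)) (v : (k : ℕ) → Fin (p k) → ℝ)
    -- tuning parameters and solutions of the optimization problems
      (lamD lamB : ℕ → ℝ) (lamN : (k : ℕ) → Fin (p k) → ℝ)
      (F : (k : ℕ) → SemiSup.Sample (n k) (N k) (p k) → SemiSup.Fit (p k)),
    Tendsto n atTop atTop →
    Tendsto p atTop atTop →
    (∀ k, v k ≠ 0) →
    (∀ k, SemiSup.Assumptions c₀ C δ (M k) (n k) (P k)) →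
    Tendsto (fun k => ((P k).sB : ℝ) * (P k).K ^ 2 * ((P k).c + SemiSup.rt (p k) (n k)))
      atTop (𝓝 0) →
    Tendsto (fun k => ((P k).K * (P k).LΩ) ^ 2 * (P k).sΩ * SemiSup.rt (p k) (n k + N k))
      atTop (𝓝 0) →
    (∀ ε : ℝ, ε₀ < ε → ∀ᶠ k in atTop, ((M k).law (n k) (N k)).real
      {ω | ¬ ∀ j, eLpNorm (fun x => (D k).mAt ω j x - (M k).m x) 2 (M k).PX
        ≤ ENNReal.ofReal (Cm * (P k).c)} ≤ ε) →
    Tendsto (fun k => SemiSup.Rem (p k) (n k) (P k)) atTop (𝓝 0) →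
    (∀ k, C₀ * SemiSup.rateD (M k) (n k) (P k) ≤ lamD k ∧
      lamD k ≤ A * SemiSup.rateD (M k) (n k) (P k)) →
    (∀ k l, C₀ * SemiSup.rateN (p k) (n k) (N k) (P k) ≤ lamN k l ∧
      lamN k l ≤ A * SemiSup.rateN (p k) (n k) (N k) (P k)) →
    (∀ k, SemiSup.IsLamOpt CB (M k) (n k) (P k) (lamB k)) →
    (∀ k ω, SemiSup.IsFit (D k) ω (lamD k) (lamN k) (lamB k) (F k ω)) →
    -- rate of the plug-in variance
    (∀ ε : ℝ, ε₀ < ε → ∃ c : ℝ, ∀ᶠ k in atTop, ((M k).law (n k) (N k)).real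
      {ω | c * SemiSup.varRate (M k) ψ (n k) (N k) (P k) (v k)
        < |(F k ω).varHat (D k) ω ψ (v k) - (M k).asympVar ψ (n k) (N k) (v k)|} ≤ ε) ∧
    -- asymptotic normality of the studentized statistic
    ((∃ c₁ : ℝ, 0 < c₁ ∧ ∀ k,
        c₁ * SemiSup.l2 (v k) ^ 2 ≤ (M k).asympVar ψ (n k) (N k) (v k)) →
      Tendsto (fun k => √(n k : ℝ) *
        (SemiSup.expRate (M k) (n k) (N k) (P k) (v k) / SemiSup.l2 (v k))) atTop (𝓝 0) →
      Tendsto (fun k => SemiSup.lyap δ (n k) (N k) (P k) (v k)) atTop (𝓝 0) →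
      Tendsto (fun k => SemiSup.varRate (M k) ψ (n k) (N k) (P k) (v k) / SemiSup.l2 (v k) ^ 2)
        atTop (𝓝 0) →
      ∀ t ε : ℝ, ε₀ < ε → ∀ᶠ k in atTop,
        |((M k).law (n k) (N k)).real {ω | (F k ω).studentized (D k) ω ψ (M k).θ (v k) ≤ t}
          - (gaussianReal 0 1).real (Set.Iic t)| ≤ ε) := by
  set B := max (max 1 C) (max (1 / c₀) |Cm|) with hBdef
  have hB : 1 ≤ B := (le_max_left _ _).trans (le_max_left _ _)
  have hB0 : 0 < B := by linarith
  have hBC : C ≤ B := (le_max_right _ _).trans (le_max_left _ _)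
  have hBc : 1 / B ≤ c₀ := by
    have : 1 / c₀ ≤ B := (le_max_left _ _).trans (le_max_right _ _)
    rwa [one_div_le hB0 hc₀]
  have hBm : Cm ≤ B := (le_abs_self _).trans ((le_max_right _ _).trans (le_max_right _ _))
  have hB45 : B ^ 4 ≤ B ^ 5 := pow_le_pow_right₀ hB (by norm_num)
  have hB5 : 1 ≤ B ^ 5 := one_le_pow₀ hB
  refine ⟨248 * B ^ 5, by positivity, ?_⟩
  intro A CB ψ ε₀ hCB hε₀ n N p M P D v lamD lamB lamN F hn hp hv hA hx hy hm hRem hlamD hlamN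
    hlamB hF
  replace hCB : 248 * B ^ 4 ≤ CB := by linarith
  have hCB0 : 0 ≤ CB := hCB.trans' (by positivity)
  replace hA := fun k => (hA k).mono hBc hBC
  have hR := eventually_regime hB hn hp hA hx hRem
  have hrateN : ∀ k, Regime B (p k) (n k) (P k) → 0 < rateN (p k) (n k) (N k) (P k) :=
    fun k hk => RegimeΩ.rateN_pos hk (hA k) (N k)
  have hA1 : 1 ≤ A := by
    obtain ⟨k, hk⟩ := hR.exists
    have h := (hlamN k ⟨0, by have := hk.two_le_p; omega⟩).1.trans
      (hlamN k ⟨0, by have := hk.two_le_p; omega⟩).2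
    have := le_of_mul_le_mul_right h (hrateN k hk)
    linarith
  have hA0 : 0 ≤ A := by linarith
  -- with high probability the estimators are in the regime of the deterministic analysis
  have key : ∀ ε, ε₀ < ε → ∃ H, ∀ᶠ k in atTop, Regime B (p k) (n k) (P k) ∧
      RegimeΩ A B (p k) (n k) (N k) (P k) ∧ RegimeB B H (p k) (n k) (P k) ∧
      Rem (p k) (n k) (P k) ≤ 1 ∧ ((M k).law (n k) (N k)).real {ω |
        ¬ (Good B H (M k) (P k) (D k) ω ∧ FitBounds A B H CB (M k) (P k) ω (F k ω))} ≤ ε := by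
    intro ε hε
    set γ := (ε - ε₀) / 4 with hγdef
    have hγ : 0 < γ := by rw [hγdef]; linarith
    set H := max 1 (4 * B ^ 2 / γ) with hHdef
    have hH1 : 1 ≤ H := le_max_left _ _
    have hH2 : 4 * B ^ 2 / H ≤ γ := by
      rw [div_le_iff₀ (by linarith), ← div_le_iff₀' hγ]
      exact le_max_right _ _
    refine ⟨H, ?_⟩
    have f1 := (hx.const_mul (5472 * B ^ 7 * H)).eventually_le_const (u := 1) (by simp)
    have f2 := (hy.const_mul (1440 * A * B ^ 12)).eventually_le_const (u := 1) (by simp)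
    filter_upwards [hR, f1, f2, hRem.eventually_le_const one_pos,
      eventually_badProb_le hB hn hp hA hx hRem H hγ, hm (ε₀ + γ) (by linarith)]
      with k k1 k2 k3 k4 k5 k6
    have hΩ : RegimeΩ A B (p k) (n k) (N k) (P k) := ⟨k3, hA1⟩
    have hSB : RegimeB B H (p k) (n k) (P k) := ⟨k2, hH1⟩
    refine ⟨k1, hΩ, hSB, k4, ?_⟩
    have hgood := good_prob k1 (hA k) (D k) (H := H) (by linarith)
    have hrD := rateD_nonneg (M := M k) (n := n k) (k1.K_pos (hA k)).le
    have hrN := (hrateN k k1).le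
    have hsub : ((M k).law (n k) (N k)).real {ω |
        ¬ (Good B H (M k) (P k) (D k) ω ∧ FitBounds A B H CB (M k) (P k) ω (F k ω))}
        ≤ ((M k).law (n k) (N k)).real {ω | (∀ j, eLpNorm (fun x => (D k).mAt ω j x - (M k).m x) 2
          (M k).PX ≤ ENNReal.ofReal (B * (P k).c)) ∧ ¬ Good B H (M k) (P k) (D k) ω}
        + ((M k).law (n k) (N k)).real {ω | ¬ ∀ j, eLpNorm (fun x => (D k).mAt ω j x - (M k).m x) 2
          (M k).PX ≤ ENNReal.ofReal (Cm * (P k).c)} := by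
      refine (measureReal_mono fun ω hω => ?_).trans (measureReal_union_le _ _)
      by_cases hc : ∀ j, eLpNorm (fun x => (D k).mAt ω j x - (M k).m x) 2 (M k).PX
          ≤ ENNReal.ofReal (Cm * (P k).c)
      · refine Or.inl ⟨fun j => (hc j).trans (ENNReal.ofReal_le_ofReal
          (mul_le_mul_of_nonneg_right hBm (hA k).c_nonneg)), fun hG => hω ⟨hG, ?_⟩⟩
        refine fitBounds hG hΩ hSB k1 (hA k) hCB ((hlamD k).1.trans' ?_) (hlamD k).2
          (fun l => (hlamN k l).1.trans' ?_) (fun l => (hlamN k l).2) (hlamB k) (hF k ω)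
        · exact mul_le_mul_of_nonneg_right (by linarith) hrD
        · exact mul_le_mul_of_nonneg_right (by linarith) hrN
      · exact Or.inr hc
    linarith
  refine ⟨fun ε hε => ?_, ?_⟩
  · obtain ⟨H, hH⟩ := key ε hε
    refine ⟨varConst A B H CB ψ, ?_⟩
    filter_upwards [hH] with k ⟨k1, k2, k3, k4, k5⟩
    refine (measureReal_mono fun ω hω hgood => ?_).trans k5
    exact absurd (varHat_dev hgood.1 k3 k1 (hA k) hA0 hCB0 k4 hgood.2 (v k)) (not_le.2 hω)
  · rintro ⟨c₁, hc₁, hV⟩ hexp hlyap hvar t ε hε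
    obtain ⟨H, hH⟩ := key ((ε₀ + ε) / 2) (by linarith)
    have hsc : 0 < √c₁ := Real.sqrt_pos.2 hc₁
    set a := fun k => expConst A B H CB ψ / √c₁ * (√(n k : ℝ) *
      (expRate (M k) (n k) (N k) (P k) (v k) / l2 (v k))) with ha
    set b := fun k => varConst A B H CB ψ / c₁ *
      (varRate (M k) ψ (n k) (N k) (P k) (v k) / l2 (v k) ^ 2) with hb
    have ha0 : Tendsto a atTop (𝓝 0) := by simpa using hexp.const_mul (expConst A B H CB ψ / √c₁)
    have hb0 : Tendsto b atTop (𝓝 0) := by simpa using hvar.const_mul (varConst A B H CB ψ / c₁)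
    refine eventually_abs_sub_le_of_perturbation (fun k => (M k).law (n k) (N k))
      (good := fun k ω => Good B H (M k) (P k) (D k) ω ∧ FitBounds A B H CB (M k) (P k) ω (F k ω))
      (b := (ε₀ + ε) / 2) (e := fun k => a k + |t| * b k) (F := fun t =>
        (gaussianReal 0 1).real (Set.Iic t)) (by linarith)
      (fun x => clt_score (D := D) hB hδ hn hv hA hc₁ hV hlyap x)
      continuous_gaussian_Iic.continuousAt (by simpa using ha0.add (hb0.const_mul |t|)) ?_
      (hH.mono fun k hk => hk.2.2.2.2)
    filter_upwards [hH, hb0.eventually_lt_const one_pos] with k ⟨k1, k2, k3, k4, _⟩ k6 ω hgood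
    have hl := l2_pos (hv k)
    have hVpos : 0 < (M k).asympVar ψ (n k) (N k) (v k) := (hV k).trans_lt' (by positivity)
    have h1 := expansion (ψ := ψ) hgood.1 k2 k3 k1 (hA k) hCB0 hgood.2 (v k)
    have h2 := varHat_dev (ψ := ψ) hgood.1 k3 k1 (hA k) hA0 hCB0 k4 hgood.2 (v k)
    have e1 : 0 ≤ expConst A B H CB ψ * expRate (M k) (n k) (N k) (P k) (v k) :=
      (abs_nonneg _).trans h1
    have e2 : 0 ≤ varConst A B H CB ψ * varRate (M k) ψ (n k) (N k) (P k) (v k) :=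
      (abs_nonneg _).trans h2
    refine studentize hVpos ?_ ?_ k6
    · rw [← mul_sub, abs_mul, abs_of_nonneg (Real.sqrt_nonneg _)]
      have h3 : √c₁ * l2 (v k) ≤ √((M k).asympVar ψ (n k) (N k) (v k)) := by
        rw [← Real.sqrt_sq hl.le, ← Real.sqrt_mul hc₁.le]
        exact Real.sqrt_le_sqrt (hV k)
      have e : a k = √(n k : ℝ) * (expConst A B H CB ψ * expRate (M k) (n k) (N k) (P k) (v k))
          / (√c₁ * l2 (v k)) := by
        rw [ha]; field_simp
      rw [e, div_mul_eq_mul_div, le_div_iff₀ (by positivity)]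
      gcongr
    · have e : b k = varConst A B H CB ψ * varRate (M k) ψ (n k) (N k) (P k) (v k)
          / (c₁ * l2 (v k) ^ 2) := by
        rw [hb]; field_simp
      rw [e, div_mul_eq_mul_div, le_div_iff₀ (by positivity)]
      exact mul_le_mul h2 (hV k) (by positivity) e2
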